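/- **Setting.** Let $M$ be a closed, simply connected smooth manifold of dimension $2m$ with a smooth almost complex structure $J$, and fix a $J$-invariant Riemannian metric $g$ on $M$. Let $S^1=\mathbb R/\mathbb Z$, with base point $1\in S^1$ (the class of $0$), and let $LM$ be the space of piecewise smooth loops $\gamma:S^1\to M$ with the $W^{1,2}$ topology. For $\gamma\in LM$ let $T_\gamma LM$ be the complex Hilbert space of $L^2$ vector fields along $\gamma$. A piecewise smooth unitary frame of $\gamma^*TM$ identifies $T_\gamma LM$ with $L^2(S^1,\mathbb C^m)=H_+\oplus H_-$, where $H_+$ is the closed span of the functions $z^n v$, $n\ge 0$, $v\in\mathbb C^m$, $z=e^{2\pi i\theta}$, and $H_-=H_+^\perp$. Two such frames differ by a loop in $U(m)$, which preserves this polarization; thus $TLM\to LM$ is the Hilbert bundle with fibre $L^2(S^1,\mathbb C^m)$ associated to the $LU(m)$-bundle of framed loops. Let $Gr_{res}(T_\gamma LM)$ be the set of closed complex subspaces $W$ which in a unitary frame have Fredholm projection to $H_+$ and Hilbert–Schmidt projection to $H_-$, with the Hilbert–Schmidt topology. The *polarized loop space* is $$LM_\pm=\{(\gamma,W) : \gamma\in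 LM,\ W\in Gr_{res}(T_\gamma LM),\ zW\subset W\},$$ topologized as the bundle $p:LM_\pm\to LM$, $p(\gamma,W)=\gamma$, associated to the $LU(m)$-bundle of framed loops. The circle acts on $LM$, $TLM$, $LM_\pm$ and $p^*TLM$ by rotation: $(t\gamma)(\theta)=\gamma(\theta+t)$, $(t\sigma)(\theta)=\sigma(\theta+t)$, $t(\gamma,W)=(t\gamma,tW)$. Let $\tilde p:LM_\pm\to M$, $\tilde p(\gamma,W)=\gamma(1)$. For a finite dimensional $S^1$-equivariant complex subbundle $E$ of $p^*TLM$, the Thom spectrum $(LM_\pm)^{-E}$ of the virtual bundle $-E$ is the orthogonal $S^1$-spectrum whose value at $\mathbb R^n$ is the Thom space of the bundle with fibre $\varphi(E_x)^\perp\subset\mathbb R^n$ over the space of pairs $(x,\varphi)$, $x\in LM_\pm$, $\varphi:E_x\to\mathbb R^n$ a real linear isometric embedding (for the real $L^2$ inner product). An inclusion $E\subset E'$ induces a map $(LM_\pm)^{-E'}\to(LM_\pm)^{-E}$ through the inclusions $\varphi(E'_x)^\perp\subset\varphi(E_x)^\perp$. **Theorem.** There is a doubly graded collection of finite dimensional $S^1$-equivariant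 complex subbundles $$E_{i,j}\subset p^*(TLM)\to LM_\pm,\qquad i<j,\ i,j\in\mathbb Z,$$ with the following properties. 1. $E_{i,j}\subset E_{i-1,j}$ and $E_{i,j}\subset E_{i,j+1}$ for all $i<j$, and $\bigcup_{i,j}E_{i,j}$ is dense in $p^*(TLM)$ (it is dense in each fibre). 2. For all $i<j$, the quotients $E_{i-1,j}/E_{i,j}$ and $E_{i,j+1}/E_{i,j}$ are $m$-dimensional $S^1$-equivariant complex vector bundles which are isomorphic, nonequivariantly, to the complex vector bundle $\tilde p^*TM$. 3. The spectra $(LM_\pm)^{-E_{i,j}}$, with the maps induced by the inclusions between the bundles $E_{i,j}$, form an inverse system of orthogonal $S^1$-spectra, indexed by the pairs $i<j$ with $(i,j)\le(i',j')$ when $i'\le i$ and $j\le j'$. This pro-object is the polarized Atiyah dual $LM_\pm^{-TLM}$. -/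

import Mathlib

open MeasureTheory Filter Topology Set
open scoped Manifold ContDiff Bundle ENNReal

noncomputable section

namespace PolarizedLoop

universe u

/-! ### Hilbert–Schmidt operators and the restricted Grassmannian of `L²(S¹, ℂᵐ)` -/

/-- An operator between complex inner product spaces is Hilbert–Schmidt if `∑ ‖A bᵢ‖² < ∞` for an
orthonormal (Hilbert) basis `b` of the source. -/
def IsHilbertSchmidt {E F : Type} [NormedAddCommGroup E] [InnerProductSpace ℂ E]
    [NormedAddCommGroup F] [InnerProductSpace ℂ F] (A : E →L[ℂ] F) : Prop :=
  ∃ (ι : Type) (b : HilbertBasis ι ℂ E), Summable fun i => ‖A (b i)‖ ^ 2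

/-- The normalized invariant measure on the circle `S¹ = ℝ/ℤ`. -/
abbrev μS : Measure UnitAddCircle := AddCircle.haarAddCircle

/-- The Hilbert space `L²(S¹, ℂᵐ)`. -/
abbrev L2 (m : ℕ) : Type := Lp (EuclideanSpace ℂ (Fin m)) 2 μS

lemma memLp_mode {m : ℕ} (n : ℤ) (k : Fin m) :
    MemLp (fun θ : UnitAddCircle => fourier n θ • EuclideanSpace.single k (1 : ℂ)) 2 μS := by
  refine MemLp.of_bound (C := 1) ?_ ?_
  · exact (Continuous.aestronglyMeasurable (by fun_prop))
  · refine Eventually.of_forall fun θ => ?_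
    rw [norm_smul, fourier_apply, Circle.norm_coe]
    simp

/-- The Fourier mode `zⁿ eₖ`, where `z = exp (2πiθ)` and `eₖ` is a standard basis vector. -/
def mode {m : ℕ} (q : ℤ × Fin m) : L2 m := (memLp_mode q.1 q.2).toLp _

/-- `H₊ ⊂ L²(S¹, ℂᵐ)`: the closed span of the modes `zⁿ eₖ`, `n ≥ 0` (boundary values of
holomorphic functions on the disk). -/
def Hplus (m : ℕ) : Submodule ℂ (L2 m) :=
  (Submodule.span ℂ {f | ∃ (n : ℤ) (k : Fin m), 0 ≤ n ∧ f = mode (n, k)}).topologicalClosure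

/-- `H₋`, the orthogonal complement of `H₊`. -/
abbrev Hminus (m : ℕ) : Submodule ℂ (L2 m) := (Hplus m)ᗮ

instance (m : ℕ) : (Hplus m).HasOrthogonalProjection := by
  unfold Hplus; infer_instance

/-- The restricted Grassmannian of `L²(S¹, ℂᵐ) = H₊ ⊕ H₋`: closed subspaces `W` for which
`W → H₊` is Fredholm and `W → H₋` is Hilbert–Schmidt. -/
structure MemGrRes {m : ℕ} (W : Submodule ℂ (L2 m)) : Prop where
  isClosed : IsClosed (W : Set (L2 m))
  fredholm : ((Hplus m).orthogonalProjectionOnto ∘L W.subtypeL).IsFredholm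
  hilbertSchmidt : IsHilbertSchmidt ((Hminus m).orthogonalProjectionOnto ∘L W.subtypeL)

/-- The coordinates, with respect to the Fourier basis, of the operator `P_W - P_{H₊}`, as a point
of `ℓ²`, that is, of the Hilbert space of Hilbert–Schmidt operators. (The value `0` is used when
this operator is not Hilbert–Schmidt, which does not happen on the restricted Grassmannian.) -/
def projDiff {m : ℕ} (W : Submodule ℂ (L2 m)) : lp (fun _ : ℤ × Fin m => L2 m) 2 :=
  open Classical in
  if h : Memℓp (E := fun _ => L2 m) (fun q : ℤ × Fin m =>
      W.topologicalClosure.starProjection (mode q) - (Hplus m).starProjection (mode q)) 2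
  then ⟨_, h⟩ else 0

/-- The topology of the restricted Grassmannian: `W` and `W'` are close if `P_W - P_{W'}` is small
in Hilbert–Schmidt norm. -/
@[reducible]
def grTopology (m : ℕ) : TopologicalSpace (Submodule ℂ (L2 m)) :=
  TopologicalSpace.induced projDiff inferInstance

lemma mp_add (t : UnitAddCircle) :
    MeasurePreserving (fun θ : UnitAddCircle => θ + t) μS μS :=
  measurePreserving_add_right μS t

/-- Rotation `(R_t f)(θ) = f (θ + t)` of `L²(S¹, ℂᵐ)`. -/
def rotL2 {m : ℕ} (t : UnitAddCircle) : L2 m ≃ₗᵢ[ℂ] L2 m :=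
  LinearIsometryEquiv.ofSurjective
    (Lp.compMeasurePreservingₗᵢ ℂ (fun θ : UnitAddCircle => θ + t) (mp_add t)) (by
      intro f
      refine ⟨Lp.compMeasurePreservingₗᵢ ℂ (fun θ : UnitAddCircle => θ + -t) (mp_add (-t)) f, ?_⟩
      refine Lp.ext ?_
      refine (Lp.coeFn_compMeasurePreserving _ (mp_add t)).trans ?_
      have h := (mp_add t).quasiMeasurePreserving.ae_eq_comp
        (Lp.coeFn_compMeasurePreserving f (mp_add (-t)))
      refine h.trans (Eventually.of_forall fun θ => ?_)
      simp [Function.comp])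

lemma rotL2_coe {m : ℕ} (t : UnitAddCircle) (f : L2 m) :
    rotL2 t f =ᵐ[μS] fun θ => f (θ + t) :=
  Lp.coeFn_compMeasurePreserving f (mp_add t)

lemma fourier_apply_add (n : ℤ) (θ t : UnitAddCircle) :
    (fourier n (θ + t) : ℂ) = fourier n t * fourier n θ := by
  rw [fourier_apply, fourier_apply, fourier_apply, smul_add, AddCircle.toCircle_add,
    Circle.coe_mul, mul_comm]

lemma rotL2_mode {m : ℕ} (t : UnitAddCircle) (q : ℤ × Fin m) :
    rotL2 t (mode q) = (fourier q.1 t : ℂ) • mode q := by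
  refine Lp.ext ?_
  refine (rotL2_coe t _).trans ?_
  have h := (mp_add t).quasiMeasurePreserving.ae_eq_comp (memLp_mode q.1 q.2).coeFn_toLp
  refine h.trans ?_
  refine EventuallyEq.trans ?_ (Lp.coeFn_smul _ _).symm
  filter_upwards [(memLp_mode q.1 q.2).coeFn_toLp] with θ hθ
  simp only [Function.comp, Pi.smul_apply]
  rw [mode, hθ, smul_smul, fourier_apply_add]

lemma map_rotL2_Hplus {m : ℕ} (t : UnitAddCircle) :
    (Hplus m).map ((rotL2 (m := m) t).toLinearEquiv : L2 m →ₗ[ℂ] L2 m) = Hplus m := by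
  have key : ∀ t : UnitAddCircle, ∀ f ∈ Hplus m, rotL2 t f ∈ Hplus m := by
    intro t
    have hc : IsClosed (((Hplus m).comap ((rotL2 (m := m) t).toLinearEquiv : L2 m →ₗ[ℂ] L2 m) :
        Submodule ℂ (L2 m)) : Set (L2 m)) :=
      (Submodule.isClosed_topologicalClosure _).preimage (rotL2 t).continuous
    refine Submodule.topologicalClosure_minimal _ (Submodule.span_le.2 ?_) hc
    rintro _ ⟨n, k, hn, rfl⟩
    change rotL2 t (mode (n, k)) ∈ Hplus m
    rw [rotL2_mode]
    exact Submodule.smul_mem _ _ (Submodule.le_topologicalClosure _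
      (Submodule.subset_span ⟨n, k, hn, rfl⟩))
  refine le_antisymm ?_ ?_
  · rintro _ ⟨f, hf, rfl⟩
    exact key t f hf
  · intro f hf
    refine ⟨rotL2 (-t) f, key (-t) f hf, ?_⟩
    change rotL2 t (rotL2 (-t) f) = f
    refine Lp.ext ((rotL2_coe t _).trans ?_)
    refine ((mp_add t).quasiMeasurePreserving.ae_eq_comp (rotL2_coe (-t) f)).trans ?_
    exact Eventually.of_forall fun θ => by simp [Function.comp]

section Transport

variable {H : Type} [NormedAddCommGroup H] [InnerProductSpace ℂ H]

lemma starProjection_equiv (e : H ≃ₗᵢ[ℂ] H) (p : Submodule ℂ H) [p.HasOrthogonalProjection]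
    (hp : p.map (e.toLinearEquiv : H →ₗ[ℂ] H) = p) (f : H) :
    p.starProjection (e f) = e (p.starProjection f) := by
  refine (Submodule.eq_starProjection_of_mem_of_inner_eq_zero ?_ fun y hy => ?_)
  · have h : e (p.starProjection f) ∈ p.map (e.toLinearEquiv : H →ₗ[ℂ] H) :=
      ⟨_, Submodule.starProjection_apply_mem p f, rfl⟩
    rwa [hp] at h
  · rw [← hp] at hy
    obtain ⟨y, hy, rfl⟩ := hy
    change inner ℂ (e f - e (p.starProjection f)) (e y) = 0
    rw [← map_sub, LinearIsometryEquiv.inner_map_map]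
    exact Submodule.starProjection_inner_eq_zero f y hy

lemma fredholm_equiv (e : H ≃ₗᵢ[ℂ] H) (p : Submodule ℂ H) [p.HasOrthogonalProjection]
    (hp : p.map (e.toLinearEquiv : H →ₗ[ℂ] H) = p) (W W' : Submodule ℂ H)
    (hW : W.map (e.toLinearEquiv : H →ₗ[ℂ] H) = W')
    (h : (p.orthogonalProjectionOnto ∘L W.subtypeL).IsFredholm) :
    (p.orthogonalProjectionOnto ∘L W'.subtypeL).IsFredholm := by
  let eP : p ≃L[ℂ] p := e.toContinuousLinearEquiv.ofSubmodules _ _ hp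
  let eW : W ≃L[ℂ] W' := e.toContinuousLinearEquiv.ofSubmodules _ _ hW
  obtain ⟨v, hv⟩ := h.exists_isQuasiInverse
  refine ContinuousLinearMap.IsFredholm.of_isQuasiInverse
    (v := (eW : W →L[ℂ] W') ∘L v ∘L (eP.symm : p →L[ℂ] p)) ?_
  have h1 := hv.comp (LinearEquiv.isQuasiInverse eP.toLinearEquiv)
  have h2 := (LinearEquiv.isQuasiInverse eW.symm.toLinearEquiv).comp h1
  refine Eq.mp (congrArg (LinearMap.IsQuasiInverse _) ?_) h2
  refine LinearMap.ext fun (f : W') => ?_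
  obtain ⟨f, rfl⟩ := eW.surjective f
  have hl : (p.orthogonalProjectionOnto (e (f : H)) : H)
      = e (p.orthogonalProjectionOnto (f : H)) := starProjection_equiv e p hp _
  have e2 : (eW.symm.toLinearEquiv : W' →ₗ[ℂ] W) (eW f) = f := eW.symm_apply_apply f
  simp only [LinearMap.comp_apply]
  rw [e2]
  exact Subtype.ext hl.symm

lemma isHilbertSchmidt_equiv (e : H ≃ₗᵢ[ℂ] H) (p : Submodule ℂ H) [p.HasOrthogonalProjection]
    (hp : p.map (e.toLinearEquiv : H →ₗ[ℂ] H) = p) (W : Submodule ℂ H)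
    (h : IsHilbertSchmidt (p.orthogonalProjectionOnto ∘L W.subtypeL)) :
    IsHilbertSchmidt (p.orthogonalProjectionOnto ∘L
      (W.map (e.toLinearEquiv : H →ₗ[ℂ] H)).subtypeL) := by
  obtain ⟨ι, b, hb⟩ := h
  refine ⟨ι, ⟨(e.submoduleMap W).symm.trans b.repr⟩, ?_⟩
  convert hb using 2 with i
  congr 1
  have hl : (p.orthogonalProjectionOnto (e ((b i : W) : H)) : H)
      = e (p.orthogonalProjectionOnto ((b i : W) : H)) := starProjection_equiv e p hp _
  change ‖(p.orthogonalProjectionOnto (e ((b i : W) : H)) : H)‖ = _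
  rw [hl, LinearIsometryEquiv.norm_map]
  rfl

end Transport

/-- The rotation action preserves the restricted Grassmannian. -/
lemma MemGrRes.map_rotL2 {m : ℕ} {W : Submodule ℂ (L2 m)} (hW : MemGrRes W) (t : UnitAddCircle) :
    MemGrRes (W.map ((rotL2 (m := m) t).toLinearEquiv : L2 m →ₗ[ℂ] L2 m)) := by
  have hm : (Hminus m).map ((rotL2 (m := m) t).toLinearEquiv : L2 m →ₗ[ℂ] L2 m) = Hminus m := by
    rw [Submodule.map_orthogonal_equiv (Hplus m) (rotL2 t), map_rotL2_Hplus]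
  refine ⟨?_, ?_, ?_⟩
  · rw [Submodule.map_coe]
    exact (rotL2 t).toHomeomorph.isClosedMap _ hW.isClosed
  · exact fredholm_equiv _ _ (map_rotL2_Hplus t) _ _ rfl hW.fredholm
  · exact isHilbertSchmidt_equiv _ _ hm _ hW.hilbertSchmidt


/-! ### Piecewise smooth loops -/

section Loops

variable {E : Type*} [NormedAddCommGroup E] [NormedSpace ℝ E] {H : Type*} [TopologicalSpace H]
  (I : ModelWithCorners ℝ E H) {N : Type*} [TopologicalSpace N] [ChartedSpace H N]

/-- `f : S¹ = ℝ/ℤ → N` is piecewise smooth: it is continuous, and around each point it is smooth on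
a closed interval on the left and on a closed interval on the right of the point. (By compactness
there are then finitely many break points, and `f` is smooth on the closed arcs between them.) -/
def IsPSmooth (f : UnitAddCircle → N) : Prop :=
  Continuous f ∧ ∀ a : ℝ, ∃ ε > 0,
    ContMDiffOn 𝓘(ℝ, ℝ) I ∞ (fun s : ℝ => f (s : UnitAddCircle)) (Icc (a - ε) a) ∧
    ContMDiffOn 𝓘(ℝ, ℝ) I ∞ (fun s : ℝ => f (s : UnitAddCircle)) (Icc a (a + ε))

variable (N) in
/-- The space `LN` of piecewise smooth loops in `N`. -/
structure PSLoop where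
  toMap : C(UnitAddCircle, N)
  psmooth : IsPSmooth I toMap

instance : CoeFun (PSLoop I N) (fun _ => UnitAddCircle → N) := ⟨fun γ => γ.toMap⟩

/-- The class in `L²` of a square integrable function (`0` if it is not square integrable). -/
def toL2 (f : UnitAddCircle → ℝ) : Lp ℝ 2 μS :=
  open Classical in if h : MemLp f 2 μS then h.toLp f else 0

/-- The topology of `LN` is the Sobolev (`W^{1,2}`) topology: uniform convergence of loops together
with `L²`-convergence of the derivative of `f ∘ γ` for each smooth function `f` on `N`. -/
instance : TopologicalSpace (PSLoop I N) :=
  TopologicalSpace.induced PSLoop.toMap inferInstance ⊓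
  ⨅ f : C^∞⟮I, N; 𝓘(ℝ, ℝ), ℝ⟯, TopologicalSpace.induced
    (fun γ : PSLoop I N =>
      toL2 fun θ => deriv (fun s : ℝ => f (γ (θ + (s : UnitAddCircle)))) 0) inferInstance

variable {I} in
lemma IsPSmooth.rotate {f : UnitAddCircle → N} (hf : IsPSmooth I f) (t : UnitAddCircle) :
    IsPSmooth I (fun θ => f (θ + t)) := by
  obtain ⟨t, rfl⟩ := QuotientAddGroup.mk_surjective t
  refine ⟨hf.1.comp (continuous_add_const _), fun a => ?_⟩
  obtain ⟨ε, hε, h1, h2⟩ := hf.2 (a + t)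
  have hs : ContMDiff 𝓘(ℝ, ℝ) 𝓘(ℝ, ℝ) ∞ (fun s : ℝ => s + t) :=
    (contDiff_id.add contDiff_const).contMDiff
  refine ⟨ε, hε, ?_, ?_⟩
  · exact h1.comp (s := Icc (a - ε) a) hs.contMDiffOn
      (fun s hs => ⟨by linarith [hs.1], by linarith [hs.2]⟩)
  · exact h2.comp (s := Icc a (a + ε)) hs.contMDiffOn
      (fun s hs => ⟨by linarith [hs.1], by linarith [hs.2]⟩)

/-- The circle action on loops, `(t · γ)(θ) = γ (θ + t)`. -/
def rotLoop {I : ModelWithCorners ℝ E H} (t : UnitAddCircle) (γ : PSLoop I N) : PSLoop I N :=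
  ⟨γ.toMap.comp ⟨fun θ => θ + t, continuous_add_const t⟩, γ.psmooth.rotate t⟩

end Loops

/-! ### Almost complex manifolds -/

/-- The complex vector space structure `(a + ib) v = a v + b J v` defined by an endomorphism `J`
with `J² = -1`. -/
@[reducible]
def complexModule {V : Type*} [AddCommGroup V] [Module ℝ V] (J : V → V)
    (hadd : ∀ v w, J (v + w) = J v + J w) (hsmul : ∀ (c : ℝ) v, J (c • v) = c • J v)
    (hJ : ∀ v, J (J v) = -v) : Module ℂ V where
  smul c v := c.re • v + c.im • J v
  one_smul v := by
    change (1 : ℂ).re • v + (1 : ℂ).im • J v = v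
    simp
  mul_smul a b v := by
    change (a * b).re • v + (a * b).im • J v =
      a.re • (b.re • v + b.im • J v) + a.im • J (b.re • v + b.im • J v)
    simp only [hadd, hsmul, hJ, Complex.mul_re, Complex.mul_im]
    module
  smul_zero a := by
    change a.re • (0 : V) + a.im • J 0 = 0
    have h : J 0 = 0 := by simpa using hsmul 0 0
    simp [h]
  smul_add a v w := by
    change a.re • (v + w) + a.im • J (v + w) = (a.re • v + a.im • J v) + (a.re • w + a.im • J w)
    simp only [hadd]
    module
  add_smul a b v := by
    change (a + b).re • v + (a + b).im • J v = (a.re • v + a.im • J v) + (b.re • v + b.im • J v)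
    simp only [Complex.add_re, Complex.add_im]
    module
  zero_smul v := by
    change (0 : ℂ).re • v + (0 : ℂ).im • J v = 0
    simp

section Manifold

variable {m : ℕ} {M : Type u} [TopologicalSpace M]
  [ChartedSpace (EuclideanSpace ℝ (Fin (2 * m))) M] [IsManifold (𝓡 (2 * m)) ∞ M]

variable (m M) in
/-- A smooth almost complex structure `J` on the `2m`-dimensional manifold `M`, and a smooth
Riemannian metric `g` with respect to which `J` is isometric. -/
structure AlmostHermitian where
  g : Bundle.ContMDiffRiemannianMetric (𝓡 (2 * m)) ∞ (EuclideanSpace ℝ (Fin (2 * m)))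
    (fun x : M => TangentSpace (𝓡 (2 * m)) x)
  J : ∀ x : M, TangentSpace (𝓡 (2 * m)) x →L[ℝ] TangentSpace (𝓡 (2 * m)) x
  J_sq : ∀ (x : M) (v : TangentSpace (𝓡 (2 * m)) x), J x (J x v) = -v
  J_smooth : ContMDiff (𝓡 (2 * m)).tangent (𝓡 (2 * m)).tangent ∞
    (fun v : TangentBundle (𝓡 (2 * m)) M =>
      (⟨v.1, J v.1 v.2⟩ : TangentBundle (𝓡 (2 * m)) M))
  J_isometric : ∀ (x : M) (v w : TangentSpace (𝓡 (2 * m)) x),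
    g.inner x (J x v) (J x w) = g.inner x v w

variable (A : AlmostHermitian m M)

namespace AlmostHermitian

/-- The tangent space `T_x M`, viewed as a complex vector space through `J`. -/
def Fib (_A : AlmostHermitian m M) (x : M) : Type := TangentSpace (𝓡 (2 * m)) x

instance (x : M) : AddCommGroup (A.Fib x) :=
  inferInstanceAs (AddCommGroup (TangentSpace (𝓡 (2 * m)) x))

/-- `(a + ib) v = a v + b J v`. -/
instance (x : M) : Module ℂ (A.Fib x) :=
  complexModule (V := TangentSpace (𝓡 (2 * m)) x) (A.J x) (map_add _) (map_smul _) (A.J_sq x)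

/-- The Riemannian metric on `T_x M`. -/
def metric (x : M) (v w : A.Fib x) : ℝ := A.g.inner x v w

/-- A tangent vector, as a point of the tangent bundle. -/
def toTB {x : M} (v : A.Fib x) : TangentBundle (𝓡 (2 * m)) M := ⟨x, v⟩

/-- Smooth complex one-forms `η` on `M` of type `(1,0)`: `η (J v) = i η v`. -/
structure Form where
  toFun : ∀ x : M, A.Fib x →ₗ[ℂ] ℂ
  smooth : ContMDiff (𝓡 (2 * m)).tangent 𝓘(ℝ, ℂ) ∞
    (fun v : TangentBundle (𝓡 (2 * m)) M => toFun v.1 v.2)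

end AlmostHermitian

/-- The free loop space `LM`. -/
abbrev LM (m : ℕ) (M : Type u) [TopologicalSpace M]
    [ChartedSpace (EuclideanSpace ℝ (Fin (2 * m))) M] := PSLoop (𝓡 (2 * m)) M

/-! ### The tangent bundle `TLM` of the loop space, with fibres of `L²` vector fields -/

/-- The square integrable vector fields along `γ`. As `M` is compact, a vector field `s` along `γ`
is measurable with `∫ |s|² < ∞` if and only if `η (s)` is so for each smooth `(1,0)`-form `η`. -/
def sqInt (γ : LM m M) : Submodule ℂ (∀ θ, A.Fib (γ θ)) where
  carrier := {s | ∀ η : A.Form, MemLp (fun θ => η.toFun (γ θ) (s θ)) 2 μS}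
  zero_mem' η := by simp
  add_mem' {s s'} hs hs' η := by
    simpa only [Pi.add_apply, map_add] using! (hs η).add (hs' η)
  smul_mem' c s hs η := by
    simpa only [Pi.smul_apply, map_smul] using! (hs η).const_smul c

/-- The vector fields along `γ` which vanish almost everywhere. -/
def aeZero (γ : LM m M) : Submodule ℂ (∀ θ, A.Fib (γ θ)) where
  carrier := {s | ∀ᵐ θ ∂μS, s θ = 0}
  zero_mem' := by simp
  add_mem' {s s'} hs hs' := by
    change ∀ᵐ θ ∂μS, (s + s') θ = 0
    filter_upwards [hs, hs'] with θ h h'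
    simp [h, h']
  smul_mem' c s hs := by
    change ∀ᵐ θ ∂μS, (c • s) θ = 0
    filter_upwards [hs] with θ h
    simp [h]

/-- `T_γ LM`, the complex vector space of `L²` vector fields along `γ`, modulo equality almost
everywhere. -/
def TLMfib (γ : LM m M) : Type := sqInt A γ ⧸ (aeZero A γ).submoduleOf (sqInt A γ)

instance (γ : LM m M) : AddCommGroup (TLMfib A γ) :=
  inferInstanceAs (AddCommGroup (sqInt A γ ⧸ (aeZero A γ).submoduleOf (sqInt A γ)))

instance (γ : LM m M) : Module ℂ (TLMfib A γ) :=
  inferInstanceAs (Module ℂ (sqInt A γ ⧸ (aeZero A γ).submoduleOf (sqInt A γ)))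

variable {A}

/-- The class in `T_γ LM` of a square integrable vector field. -/
def toFib (γ : LM m M) : sqInt A γ →ₗ[ℂ] TLMfib A γ :=
  ((aeZero A γ).submoduleOf (sqInt A γ)).mkQ

lemma toFib_surjective (γ : LM m M) : Function.Surjective (toFib (A := A) γ) :=
  Submodule.mkQ_surjective _

lemma toFib_eq_iff {γ : LM m M} (s s' : sqInt A γ) :
    toFib γ s = toFib γ s' ↔ ∀ᵐ θ ∂μS, s.1 θ = s'.1 θ := by
  refine (Submodule.Quotient.eq _).trans ?_
  change (∀ᵐ θ ∂μS, s.1 θ - s'.1 θ = 0) ↔ _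
  simp only [sub_eq_zero]

/-- A representative of an element of `T_γ LM`. -/
def rep {γ : LM m M} (σ : TLMfib A γ) (θ : UnitAddCircle) : A.Fib (γ θ) :=
  (toFib_surjective γ σ).choose.1 θ

/-- The real `L²` inner product `∫ g (σ, τ) dθ` on `T_γ LM`. -/
def ip {γ : LM m M} (σ τ : TLMfib A γ) : ℝ :=
  ∫ θ, A.metric (γ θ) (rep σ θ) (rep τ θ) ∂μS

lemma rep_toFib {γ : LM m M} (s : sqInt A γ) : ∀ᵐ θ ∂μS, rep (toFib γ s) θ = s.1 θ :=
  (toFib_eq_iff _ _).1 (toFib_surjective γ (toFib γ s)).choose_spec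

lemma ip_toFib {γ : LM m M} (s s' : sqInt A γ) :
    ip (toFib γ s) (toFib γ s') = ∫ θ, A.metric (γ θ) (s.1 θ) (s'.1 θ) ∂μS := by
  refine integral_congr_ae ?_
  filter_upwards [rep_toFib s, rep_toFib s'] with θ h h'
  rw [h, h']

/-- Multiplication of vector fields along `γ` by the function `z = exp (2πiθ)`. -/
def mulZField (γ : LM m M) : (∀ θ, A.Fib (γ θ)) →ₗ[ℂ] (∀ θ, A.Fib (γ θ)) where
  toFun s θ := (fourier 1 θ : ℂ) • s θ
  map_add' s s' := by
    funext θ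
    exact smul_add _ _ _
  map_smul' c s := by
    funext θ
    exact smul_comm (fourier 1 θ : ℂ) c (s θ)

lemma mulZField_mem (γ : LM m M) : ∀ s ∈ sqInt A γ, mulZField γ s ∈ sqInt A γ := by
  intro s hs η
  have h1 : AEStronglyMeasurable (fun θ : UnitAddCircle => (fourier 1 θ : ℂ)) μS :=
    Continuous.aestronglyMeasurable (by fun_prop)
  refine MemLp.of_le (hs η) ?_ (Eventually.of_forall fun θ => ?_)
  · refine (h1.smul (hs η).1).congr (Eventually.of_forall fun θ => ?_)
    exact (map_smul (η.toFun (γ θ)) _ _).symm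
  · change ‖η.toFun (γ θ) ((fourier 1 θ : ℂ) • s θ)‖ ≤ _
    rw [map_smul, norm_smul, fourier_apply, Circle.norm_coe, one_mul]

/-- Multiplication by `z = exp (2πiθ)` on `T_γ LM`. -/
def mulZ (γ : LM m M) : TLMfib A γ →ₗ[ℂ] TLMfib A γ :=
  Submodule.mapQ ((aeZero A γ).submoduleOf (sqInt A γ)) ((aeZero A γ).submoduleOf (sqInt A γ))
    ((mulZField γ).restrict (mulZField_mem γ)) (by
    intro s hs
    have hs' : ∀ᵐ θ ∂μS, s.1 θ = 0 := hs
    change ∀ᵐ θ ∂μS, (fourier 1 θ : ℂ) • s.1 θ = 0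
    filter_upwards [hs'] with θ h
    rw [h, smul_zero])

/-- Translation of vector fields, from fields along `γ` to fields along `t · γ`. -/
def shift (t : UnitAddCircle) (γ : LM m M) :
    (∀ θ, A.Fib (γ θ)) ≃ₗ[ℂ] (∀ θ, A.Fib (rotLoop t γ θ)) :=
  (LinearEquiv.piCongrLeft ℂ (fun θ => A.Fib (γ θ)) (Equiv.addRight t)).symm

lemma shift_apply (t : UnitAddCircle) (γ : LM m M) (s : ∀ θ, A.Fib (γ θ)) (θ : UnitAddCircle) :
    shift t γ s θ = s (θ + t) := rfl

lemma ae_shift_iff (t : UnitAddCircle) (p : UnitAddCircle → Prop) :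
    (∀ᵐ θ ∂μS, p (θ + t)) ↔ ∀ᵐ θ ∂μS, p θ := by
  have h : ∀ (t : UnitAddCircle) (p : UnitAddCircle → Prop),
      (∀ᵐ θ ∂μS, p θ) → ∀ᵐ θ ∂μS, p (θ + t) := fun t p hp =>
    (mp_add t).quasiMeasurePreserving.ae hp
  refine ⟨fun hp => ?_, h t p⟩
  simpa using h (-t) _ hp

lemma map_shift_sqInt (t : UnitAddCircle) (γ : LM m M) :
    (sqInt A γ).map (shift (A := A) t γ : _ →ₗ[ℂ] _) = sqInt A (rotLoop t γ) := by
  refine Submodule.ext fun s => ?_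
  obtain ⟨s, rfl⟩ := (shift (A := A) t γ).surjective s
  constructor
  · rintro ⟨s', hs', h⟩
    obtain rfl := (shift t γ).injective h
    intro η
    exact (hs' η).comp_measurePreserving (mp_add t)
  · intro hs
    refine ⟨s, fun η => ?_, rfl⟩
    have h := (hs η).comp_measurePreserving (mp_add (-t))
    refine (memLp_congr_ae (Eventually.of_forall fun θ => ?_)).1 h
    change η.toFun (γ (θ + -t + t)) (s (θ + -t + t)) = η.toFun (γ θ) (s θ)
    rw [neg_add_cancel_right]

/-- The circle action `(t · σ)(θ) = σ (θ + t)` on `TLM`, from `T_γ LM` to `T_{t·γ} LM`. -/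
def rot (t : UnitAddCircle) (γ : LM m M) : TLMfib A γ ≃ₗ[ℂ] TLMfib A (rotLoop t γ) :=
  Submodule.Quotient.equiv ((aeZero A γ).submoduleOf (sqInt A γ))
    ((aeZero A (rotLoop t γ)).submoduleOf (sqInt A (rotLoop t γ)))
    ((shift (A := A) t γ).ofSubmodules (sqInt A γ) (sqInt A (rotLoop t γ)) (map_shift_sqInt t γ)) (by
      refine Submodule.ext fun s => ?_
      obtain ⟨s, rfl⟩ := ((shift (A := A) t γ).ofSubmodules (sqInt A γ) (sqInt A (rotLoop t γ))
        (map_shift_sqInt t γ)).surjective s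
      have key : ∀ s : sqInt A γ, (shift t γ).ofSubmodules (sqInt A γ) (sqInt A (rotLoop t γ))
          (map_shift_sqInt t γ) s ∈ (aeZero A (rotLoop t γ)).submoduleOf _ ↔
          s ∈ (aeZero A γ).submoduleOf _ := fun s =>
        ae_shift_iff t (fun θ => s.1 θ = 0)
      constructor
      · rintro ⟨s', hs', h⟩
        rw [← h]
        exact (key s').2 hs'
      · intro h
        exact ⟨s, (key s).1 h, rfl⟩)

lemma rot_toFib (t : UnitAddCircle) (γ : LM m M) (s : sqInt A γ) :
    rot t γ (toFib γ s) = toFib (rotLoop t γ)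
      ((shift t γ).ofSubmodules (sqInt A γ) (sqInt A (rotLoop t γ)) (map_shift_sqInt t γ) s) := rfl

lemma ip_rot (t : UnitAddCircle) (γ : LM m M) (σ τ : TLMfib A γ) :
    ip (rot t γ σ) (rot t γ τ) = ip σ τ := by
  obtain ⟨s, rfl⟩ := toFib_surjective γ σ
  obtain ⟨s', rfl⟩ := toFib_surjective γ τ
  rw [rot_toFib, rot_toFib, ip_toFib, ip_toFib]
  exact integral_add_right_eq_self (μ := μS)
    (fun θ => A.metric (γ θ) (s.1 θ) (s'.1 θ)) t

lemma rot_mulZ (t : UnitAddCircle) (γ : LM m M) (σ : TLMfib A γ) :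
    rot t γ (mulZ γ σ) = (fourier 1 t : ℂ) • mulZ (rotLoop t γ) (rot t γ σ) := by
  obtain ⟨s, rfl⟩ := toFib_surjective γ σ
  refine congrArg (toFib (rotLoop t γ)) (Subtype.ext (funext fun θ => ?_))
  change (fourier 1 (θ + t) : ℂ) • s.1 (θ + t) = (fourier 1 t : ℂ) • (fourier 1 θ : ℂ) • s.1 (θ + t)
  rw [smul_smul, fourier_apply_add]

end Manifold

/-! ### Unitary frames along loops, and the topology of `TLM` -/

section Frames

variable {m : ℕ} {M : Type u} [TopologicalSpace M]
  [ChartedSpace (EuclideanSpace ℝ (Fin (2 * m))) M] [IsManifold (𝓡 (2 * m)) ∞ M]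
  {A : AlmostHermitian m M}

variable (A) in
/-- A (piecewise smooth) unitary frame of `γ*TM`: `m` piecewise smooth vector fields along `γ` which
are Hermitian-orthonormal at each point. -/
structure Frame (γ : LM m M) where
  e : Fin m → ∀ θ, A.Fib (γ θ)
  psmooth : ∀ k, IsPSmooth (𝓡 (2 * m)).tangent (fun θ => A.toTB (e k θ))
  unitary : ∀ k l θ, A.metric (γ θ) (e k θ) (e l θ) = if k = l then 1 else 0
  unitary_J : ∀ k l θ, A.metric (γ θ) (Complex.I • e k θ) (e l θ) = 0

lemma frameMap_mem {γ : LM m M} (Φ : Frame A γ) (f : L2 m) :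
    (fun θ => ∑ k, (f θ k : ℂ) • Φ.e k θ) ∈ sqInt A γ := by
  intro η
  have h : ∀ k, MemLp (fun θ => (f θ k : ℂ) * η.toFun (γ θ) (Φ.e k θ)) 2 μS := by
    intro k
    have hc : Continuous (fun θ => η.toFun (γ θ) (Φ.e k θ)) :=
      η.smooth.continuous.comp (Φ.psmooth k).1
    obtain ⟨C, hC⟩ := (isCompact_range hc).isBounded.exists_norm_le
    have hm : AEStronglyMeasurable (fun θ => (f θ k : ℂ)) μS :=
      (EuclideanSpace.proj (𝕜 := ℂ) k).continuous.comp_aestronglyMeasurable (Lp.memLp f).1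
    refine MemLp.of_le_mul (c := C) (Lp.memLp f) (hm.mul hc.aestronglyMeasurable)
      (Eventually.of_forall fun θ => ?_)
    rw [norm_mul, mul_comm C]
    exact mul_le_mul (PiLp.norm_apply_le (f θ) k) (hC _ ⟨θ, rfl⟩) (norm_nonneg _) (norm_nonneg _)
  have h2 := memLp_finsetSum Finset.univ (fun k _ => h k)
  simpa only [map_sum, map_smul, smul_eq_mul] using h2

/-- The isomorphism `L²(S¹, ℂᵐ) → T_γ LM`, `f ↦ ∑ₖ fₖ eₖ`, defined by a unitary frame `e` along
`γ`. -/
def frameMap {γ : LM m M} (Φ : Frame A γ) : L2 m →ₗ[ℂ] TLMfib A γ where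
  toFun f := toFib γ ⟨_, frameMap_mem Φ f⟩
  map_add' f f' := by
    rw [← map_add]
    refine (toFib_eq_iff _ _).2 ?_
    change ∀ᵐ θ ∂μS, (∑ k, ((f + f' : L2 m) θ k : ℂ) • Φ.e k θ) =
      (∑ k, (f θ k : ℂ) • Φ.e k θ) + ∑ k, (f' θ k : ℂ) • Φ.e k θ
    filter_upwards [Lp.coeFn_add f f'] with θ h
    rw [h, ← Finset.sum_add_distrib]
    exact Finset.sum_congr rfl fun k _ => add_smul _ _ _
  map_smul' c f := by
    rw [← map_smul]
    refine (toFib_eq_iff _ _).2 ?_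
    change ∀ᵐ θ ∂μS, (∑ k, ((c • f : L2 m) θ k : ℂ) • Φ.e k θ) =
      c • ∑ k, (f θ k : ℂ) • Φ.e k θ
    filter_upwards [Lp.coeFn_smul c f] with θ h
    rw [h, Finset.smul_sum]
    exact Finset.sum_congr rfl fun k _ => mul_smul _ _ _

/-- The frame `t · Φ` along `t · γ`. -/
def rotFrame (t : UnitAddCircle) {γ : LM m M} (Φ : Frame A γ) : Frame A (rotLoop t γ) where
  e k θ := Φ.e k (θ + t)
  psmooth k := (Φ.psmooth k).rotate t
  unitary k l θ := Φ.unitary k l (θ + t)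
  unitary_J k l θ := Φ.unitary_J k l (θ + t)

lemma frameMap_rot (t : UnitAddCircle) {γ : LM m M} (Φ : Frame A γ) (f : L2 m) :
    frameMap (rotFrame t Φ) (rotL2 t f) = rot t γ (frameMap Φ f) := by
  refine (toFib_eq_iff _ _).2 ?_
  change ∀ᵐ θ ∂μS, (∑ k, (rotL2 t f θ k : ℂ) • Φ.e k (θ + t)) =
    (∑ k, (f (θ + t) k : ℂ) • Φ.e k (θ + t))
  filter_upwards [rotL2_coe t f] with θ h
  rw [h]

variable (A) in
/-- The principal bundle over `LM` of loops with a unitary frame; its structure group is the loop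
group `LU(m)`. -/
structure FramedLoop where
  loop : LM m M
  frame : Frame A loop

/-- The topology on framed loops is induced by that of the loop space of `M` and of the loop space
of `TM`, in which the members of the frame are loops. -/
instance : TopologicalSpace (FramedLoop A) :=
  TopologicalSpace.induced (fun p => (p.loop, fun k : Fin m =>
    (⟨⟨_, (p.frame.psmooth k).1⟩, p.frame.psmooth k⟩ :
      PSLoop (𝓡 (2 * m)).tangent (TangentBundle (𝓡 (2 * m)) M)))) inferInstance

variable (A) in
/-- The total space of `TLM → LM`. -/
structure TLM where
  loop : LM m M
  vec : TLMfib A loop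

/-- `TLM` is the bundle with fibre `L²(S¹, ℂᵐ)` associated to the principal bundle of framed loops:
it has the quotient topology from `FramedLoop × L²(S¹, ℂᵐ)`. -/
instance : TopologicalSpace (TLM A) :=
  TopologicalSpace.coinduced (fun p : FramedLoop A × L2 m => ⟨p.1.loop, frameMap p.1.frame p.2⟩)
    inferInstance

/-! ### The polarized loop space -/

/-- `W ∈ Gr_res (T_γ LM)`: in terms of a unitary frame along `γ`, which identifies `T_γ LM` with
`L²(S¹, ℂᵐ) = H₊ ⊕ H₋`, the subspace `W` belongs to the restricted Grassmannian. (Unitary frames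
exist along each loop, and the condition does not depend on their choice, as two frames differ by
an element of the loop group of `U(m)`, which preserves the polarization.) -/
def MemGrResTLM {γ : LM m M} (W : Submodule ℂ (TLMfib A γ)) : Prop :=
  ∃ Φ : Frame A γ, MemGrRes (W.comap (frameMap Φ))

variable (A) in
/-- The polarized loop space `LM_±`: pairs `(γ, W)` with `γ ∈ LM` and `W ∈ Gr_res (T_γ LM)` such
that `z W ⊆ W`. -/
structure PolLoop where
  loop : LM m M
  W : Submodule ℂ (TLMfib A loop)
  mem_grRes : MemGrResTLM W
  z_stable : W.map (mulZ loop) ≤ W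

variable (A) in
/-- A point `(γ, W)` of `LM_±` with a unitary frame along `γ`. -/
structure FramedPolLoop where
  pt : PolLoop A
  frame : Frame A pt.loop

/-- A framed point of `LM_±` amounts to a framed loop together with a point of the Grassmannian
of `L²(S¹, ℂᵐ)`. -/
instance : TopologicalSpace (FramedPolLoop A) :=
  TopologicalSpace.induced
    (fun p => ((⟨p.pt.loop, p.frame⟩ : FramedLoop A), p.pt.W.comap (frameMap p.frame)))
    (@instTopologicalSpaceProd _ _ _ (grTopology m))

/-- `LM_± → LM` is the associated bundle with fibre `Gr⁰_res (L²(S¹, ℂᵐ))`: it has the quotient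
topology by the change of frames. -/
instance : TopologicalSpace (PolLoop A) :=
  TopologicalSpace.coinduced (FramedPolLoop.pt (A := A)) inferInstance

/-- The circle action `t · (γ, W) = (t · γ, t W)` on `LM_±`. -/
def rotPol (t : UnitAddCircle) (x : PolLoop A) : PolLoop A where
  loop := rotLoop t x.loop
  W := x.W.map (rot (A := A) t x.loop : TLMfib A x.loop →ₗ[ℂ] _)
  mem_grRes := by
    obtain ⟨Φ, hΦ⟩ := x.mem_grRes
    refine ⟨rotFrame t Φ, ?_⟩
    convert hΦ.map_rotL2 t using 1
    refine Submodule.ext fun f => ?_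
    obtain ⟨f, rfl⟩ := (rotL2 t).surjective f
    have h1 : (∃ σ ∈ x.W, rot t x.loop σ = frameMap (rotFrame t Φ) (rotL2 t f)) ↔
        frameMap Φ f ∈ x.W := by
      rw [frameMap_rot]
      exact ⟨fun ⟨σ, hσ, h⟩ => (rot t x.loop).injective h ▸ hσ, fun h => ⟨_, h, rfl⟩⟩
    have h2 : (∃ f' ∈ x.W.comap (frameMap Φ), rotL2 t f' = rotL2 t f) ↔ frameMap Φ f ∈ x.W :=
      ⟨fun ⟨f', hf', h⟩ => (rotL2 t).injective h ▸ hf', fun h => ⟨_, h, rfl⟩⟩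
    exact h1.trans h2.symm
  z_stable := by
    rintro _ ⟨_, ⟨σ, hσ, rfl⟩, rfl⟩
    have h := rot_mulZ t x.loop σ
    have hne : (fourier 1 t : ℂ) ≠ 0 := by
      rw [fourier_apply]
      exact Circle.coe_ne_zero _
    refine ⟨(fourier 1 t : ℂ)⁻¹ • mulZ x.loop σ,
      x.W.smul_mem _ (x.z_stable ⟨σ, hσ, rfl⟩), ?_⟩
    change rot t x.loop ((fourier 1 t : ℂ)⁻¹ • mulZ x.loop σ) = mulZ _ (rot t x.loop σ)
    rw [map_smul, h, smul_smul, inv_mul_cancel₀ hne, one_smul]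

/-- The map `t : T_γ LM → T_{t·γ} LM` between the fibres of `p*TLM` over `x = (γ, W)` and `t · x`. -/
def rotFib (t : UnitAddCircle) (x : PolLoop A) :
    TLMfib A x.loop ≃ₗ[ℂ] TLMfib A (rotPol t x).loop := rot t x.loop

variable (A) in
/-- The total space of `p*TLM → LM_±`, the pullback of `TLM` by the projection `p : LM_± → LM`. -/
structure PullTLM where
  pt : PolLoop A
  vec : TLMfib A pt.loop

instance : TopologicalSpace (PullTLM A) :=
  TopologicalSpace.induced (fun v => (v.pt, (⟨v.pt.loop, v.vec⟩ : TLM A))) inferInstance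

/-! ### Equivariant complex vector bundles over `LM_±` -/

section VB

variable {B : Type u} [TopologicalSpace B] (F : B → Type) [∀ b, AddCommGroup (F b)]
  [∀ b, Module ℂ (F b)]

/-- The family of complex vector spaces `F`, with a topology `τ` on its total space, is trivial of
rank `r` near `b`: there is a fibrewise linear homeomorphism of `U × ℂʳ` with the restriction of
the family to some open neighbourhood `U` of `b`. -/
def TrivialNear (τ : TopologicalSpace (Σ b, F b)) (b : B) (r : ℕ) : Prop :=
  ∃ U : Set B, IsOpen U ∧ b ∈ U ∧ ∃ e : ∀ x : U, (Fin r → ℂ) ≃ₗ[ℂ] F x,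
    @IsEmbedding (U × (Fin r → ℂ)) (Σ b, F b) _ τ (fun p => ⟨p.1, e p.1 p.2⟩)

/-- A finite dimensional complex vector bundle. -/
def IsVectorBundle (τ : TopologicalSpace (Σ b, F b)) : Prop :=
  @Continuous _ _ τ _ (Sigma.fst : (Σ b, F b) → B) ∧ ∀ b, ∃ r, TrivialNear F τ b r

/-- A complex vector bundle of dimension `r`. -/
def IsVectorBundleOfRank (τ : TopologicalSpace (Σ b, F b)) (r : ℕ) : Prop :=
  @Continuous _ _ τ _ (Sigma.fst : (Σ b, F b) → B) ∧ ∀ b, TrivialNear F τ b r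

end VB

/-- The subspace topology on the total space of a family of subspaces of the fibres of `p*TLM`. -/
@[reducible]
def subTopology (E : ∀ x : PolLoop A, Submodule ℂ (TLMfib A x.loop)) :
    TopologicalSpace (Σ x, E x) :=
  TopologicalSpace.induced (fun v => (⟨v.1, v.2.1⟩ : PullTLM A)) inferInstance

/-- The map `t : E_x → E_{t·x}` for a family of subspaces invariant under the circle action. -/
def rotSub {E : ∀ x : PolLoop A, Submodule ℂ (TLMfib A x.loop)}
    (hE : ∀ t x, (E x).map (rotFib t x).toLinearMap = E (rotPol t x))
    (t : UnitAddCircle) (x : PolLoop A) : E x ≃ₗ[ℂ] E (rotPol t x) :=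
  (rotFib t x).ofSubmodules (E x) (E (rotPol t x)) (hE t x)

variable (A) in
/-- A finite dimensional `S¹`-equivariant complex subbundle of `p*TLM → LM_±`. -/
structure EqSubbundle where
  fib : ∀ x : PolLoop A, Submodule ℂ (TLMfib A x.loop)
  invariant : ∀ t x, (fib x).map (rotFib t x).toLinearMap = fib (rotPol t x)
  isVectorBundle : IsVectorBundle (fun x => fib x) (subTopology fib)
  continuous_act : @Continuous _ _
    (@instTopologicalSpaceProd _ _ _ (subTopology fib)) (subTopology fib)
    (fun p : UnitAddCircle × (Σ x, fib x) =>
      (⟨rotPol p.1 p.2.1, rotSub invariant p.1 p.2.1 p.2.2⟩ : Σ x, fib x))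

/-- Inclusion of subbundles. -/
instance : LE (EqSubbundle A) := ⟨fun E E' => ∀ x, E.fib x ≤ E'.fib x⟩

namespace EqSubbundle

/-- The fibres of the quotient `E' / E`, for subbundles `E ⊆ E'`. -/
abbrev Quo (E E' : EqSubbundle A) (x : PolLoop A) : Type :=
  E'.fib x ⧸ (E.fib x).submoduleOf (E'.fib x)

/-- The total space of `E' / E` has the quotient topology. -/
@[reducible]
def quoTopology (E E' : EqSubbundle A) : TopologicalSpace (Σ x, Quo E E' x) :=
  @TopologicalSpace.coinduced (Σ x, E'.fib x) _
    (fun v => ⟨v.1, Submodule.Quotient.mk v.2⟩) (subTopology E'.fib)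

/-- The action of the circle on `E' / E`. -/
def rotQuo (E E' : EqSubbundle A) (t : UnitAddCircle) (x : PolLoop A) :
    Quo E E' x →ₗ[ℂ] Quo E E' (rotPol t x) :=
  Submodule.mapQ _ _ (rotSub E'.invariant t x : E'.fib x →ₗ[ℂ] E'.fib (rotPol t x)) (by
    intro v hv
    have hv' : v.1 ∈ E.fib x := hv
    change rotFib t x v.1 ∈ E.fib (rotPol t x)
    rw [← E.invariant t x]
    exact ⟨_, hv', rfl⟩)

variable (A) in
/-- The total space of `p̃*TM → LM_±`, for `p̃ (γ, W) = γ(1)`, the value of `γ` at the base point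
`1 ∈ S¹` (which is `0 ∈ ℝ/ℤ`). -/
@[reducible]
def evTopology : TopologicalSpace (Σ x : PolLoop A, A.Fib (x.loop 0)) :=
  TopologicalSpace.induced (fun v => (v.1, A.toTB v.2)) inferInstance

/-- The quotient `E' / E` is an `m`-dimensional `S¹`-equivariant complex vector bundle over `LM_±`,
isomorphic, as a complex vector bundle, to the pullback of `TM` under evaluation at `1`. -/
structure QuotientIsPullbackTM (E E' : EqSubbundle A) : Prop where
  isVectorBundle : IsVectorBundleOfRank (Quo E E') (quoTopology E E') m
  continuous_act : @Continuous _ _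
    (@instTopologicalSpaceProd _ _ _ (quoTopology E E')) (quoTopology E E')
    (fun p : UnitAddCircle × (Σ x, Quo E E' x) =>
      (⟨rotPol p.1 p.2.1, rotQuo E E' p.1 p.2.1 p.2.2⟩ : Σ x, Quo E E' x))
  iso : ∃ e : ∀ x : PolLoop A, Quo E E' x ≃ₗ[ℂ] A.Fib (x.loop 0),
    @IsHomeomorph _ _ (quoTopology E E') (evTopology A)
      (fun v : Σ x, Quo E E' x => ⟨v.1, e v.1 v.2⟩)

end EqSubbundle

/-- The topology of the fibre of `p*TLM` over `x`. -/
@[reducible]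
def fibTopology (x : PolLoop A) : TopologicalSpace (TLMfib A x.loop) :=
  TopologicalSpace.induced (fun σ => (⟨x, σ⟩ : PullTLM A)) inferInstance

end Frames

/-! ### Orthogonal spectra with an action of the circle -/

/-- The Euclidean space `ℝⁿ`. -/
abbrev V (n : ℕ) : Type := EuclideanSpace ℝ (Fin n)

/-- The morphisms from `ℝⁿ` to `ℝᵏ` of the indexing category of orthogonal spectra: linear isometric
embeddings `ℝⁿ → ℝᵏ` together with a point of the one-point compactification of the orthogonal
complement of the image. (Morphisms with second component `∞` are all identified with the base
point: see `S1Spectrum`.) -/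
structure JMor (n k : ℕ) where
  iso : V n →ₗᵢ[ℝ] V k
  pt : OnePoint (V k)
  orth : ∀ w : V k, pt = ↑w → ∀ v, inner ℝ (iso v) w = 0

instance (n k : ℕ) : TopologicalSpace (JMor n k) :=
  TopologicalSpace.induced (fun f => (f.iso.toContinuousLinearMap, f.pt)) inferInstance

namespace JMor

/-- The identity of `ℝⁿ`. -/
def id (n : ℕ) : JMor n n where
  iso := LinearIsometry.id
  pt := ((0 : V n) : OnePoint (V n))
  orth w hw v := by
    rw [← OnePoint.coe_injective hw, inner_zero_right]

/-- The composition `(b, u') ∘ (a, u) = (b a, b u + u')`. -/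
def comp {n k l : ℕ} (g : JMor k l) (f : JMor n k) : JMor n l where
  iso := g.iso.comp f.iso
  pt := Option.map₂ (fun u' u => g.iso u + u') g.pt f.pt
  orth w hw v := by
    obtain ⟨u', u, hu', hu, rfl⟩ := Option.map₂_eq_some_iff.1 hw
    change inner ℝ (g.iso (f.iso v)) (g.iso u + u') = 0
    rw [inner_add_right, LinearIsometry.inner_map_map,
      f.orth u hu, g.orth u' hu', add_zero]

end JMor

/-- An orthogonal spectrum with an action of `S¹`, that is, an orthogonal `S¹`-spectrum: a continuous
functor with values in pointed spaces with a base point preserving action of `S¹`, on the category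
with objects `ℝⁿ` and the one-point compactifications above (with the points at infinity collapsed)
as pointed spaces of morphisms. This encodes the actions of the orthogonal groups `O(n)` on `X n` as
well as the structure maps `Xₙ ∧ Sᵏ → Xₙ₊ₖ`. -/
structure S1Spectrum where
  X : ℕ → Type u
  top : ∀ n, TopologicalSpace (X n)
  base : ∀ n, X n
  act : ∀ n, UnitAddCircle → X n → X n
  str : ∀ {n k}, JMor n k → X n → X k
  continuous_act : ∀ n, Continuous fun p : UnitAddCircle × X n => act n p.1 p.2
  act_zero : ∀ n x, act n 0 x = x
  act_add : ∀ n s t x, act n (s + t) x = act n s (act n t x)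
  act_base : ∀ n t, act n t (base n) = base n
  continuous_str : ∀ n k, Continuous fun p : JMor n k × X n => str p.1 p.2
  str_base : ∀ {n k} (f : JMor n k), str f (base n) = base k
  str_infty : ∀ {n k} (f : JMor n k) x, f.pt = OnePoint.infty → str f x = base k
  str_id : ∀ n x, str (JMor.id n) x = x
  str_comp : ∀ {n k l} (g : JMor k l) (f : JMor n k) x, str (g.comp f) x = str g (str f x)
  str_act : ∀ {n k} (f : JMor n k) t x, str f (act n t x) = act k t (str f x)

namespace S1Spectrum

instance (X : S1Spectrum.{u}) (n : ℕ) : TopologicalSpace (X.X n) := X.top n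

/-- Maps of orthogonal `S¹`-spectra. -/
@[ext]
structure Hom (X Y : S1Spectrum.{u}) where
  toFun : ∀ n, X.X n → Y.X n
  continuous : ∀ n, Continuous (toFun n)
  map_base : ∀ n, toFun n (X.base n) = Y.base n
  map_act : ∀ n t x, toFun n (X.act n t x) = Y.act n t (toFun n x)
  map_str : ∀ {n k} (f : JMor n k) x, toFun k (X.str f x) = Y.str f (toFun n x)

instance : CategoryTheory.Category S1Spectrum.{u} where
  Hom := Hom
  id X :=
    { toFun := fun _ x => x
      continuous := fun _ => continuous_id
      map_base := fun _ => rfl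
      map_act := fun _ _ _ => rfl
      map_str := fun _ _ => rfl }
  comp f g :=
    { toFun := fun n x => g.toFun n (f.toFun n x)
      continuous := fun n => (g.continuous n).comp (f.continuous n)
      map_base := fun n => by rw [f.map_base, g.map_base]
      map_act := fun n t x => by rw [f.map_act, g.map_act]
      map_str := fun a x => by rw [f.map_str, g.map_str] }

end S1Spectrum

/-! ### The Thom spectrum of `-E` -/

section Thom

variable {m : ℕ} {M : Type u} [TopologicalSpace M]
  [ChartedSpace (EuclideanSpace ℝ (Fin (2 * m))) M] [IsManifold (𝓡 (2 * m)) ∞ M]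
  {A : AlmostHermitian m M}

/-- A point `x` of `LM_±` with a real linear isometric embedding of `E_x` into `ℝⁿ`. -/
structure EmbPt (E : EqSubbundle A) (n : ℕ) where
  x : PolLoop A
  φ : E.fib x →ₗ[ℝ] V n
  isometric : ∀ v : E.fib x, ‖φ v‖ ^ 2 = ip v.1 v.1

/-- The adjoint `ℝⁿ → E_x` of an embedding `φ : E_x → ℝⁿ`. -/
def EmbPt.adj {E : EqSubbundle A} {n : ℕ} (s : EmbPt E n) (v : V n) : E.fib s.x :=
  Classical.epsilon fun e => ∀ e' : E.fib s.x, ip e.1 e'.1 = inner ℝ v (s.φ e')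

/-- The bundle of embeddings is topologized through the adjoints, `n`-tuples of vectors in `E`. -/
instance (E : EqSubbundle A) (n : ℕ) : TopologicalSpace (EmbPt E n) :=
  TopologicalSpace.induced (fun s (v : V n) => (⟨s.x, s.adj v⟩ : PullTLM A)) inferInstance

/-- A point of the bundle, over the space of pairs `(x, φ)`, of orthogonal complements
`φ(E_x)^⊥ ⊆ ℝⁿ`. -/
structure ComplPt (E : EqSubbundle A) (n : ℕ) extends EmbPt E n where
  w : V n
  orth : ∀ v, inner ℝ w (φ v) = 0

/-- A point of the bundle of one-point compactifications of the orthogonal complements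
`φ(E_x)^⊥ ⊆ ℝⁿ`. -/
structure SpherePt (E : EqSubbundle A) (n : ℕ) extends EmbPt E n where
  w : OnePoint (V n)
  orth : ∀ w' : V n, w = ↑w' → ∀ v, inner ℝ w' (φ v) = 0

instance (E : EqSubbundle A) (n : ℕ) : TopologicalSpace (SpherePt E n) :=
  TopologicalSpace.induced (fun s => (s.toEmbPt, s.w)) inferInstance

/-- The Thom space of the bundle of orthogonal complements: the points of the bundle together with
a base point `none`. -/
def Thom (E : EqSubbundle A) (n : ℕ) : Type u := Option (ComplPt E n)

/-- The map collapsing the section at infinity of the bundle of one-point compactifications. -/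
def collapse {E : EqSubbundle A} {n : ℕ} (s : SpherePt E n) : Thom E n :=
  open Classical in
  if h : ∃ w' : V n, s.w = ↑w' then some ⟨s.toEmbPt, h.choose, s.orth _ h.choose_spec⟩ else none

instance (E : EqSubbundle A) (n : ℕ) : TopologicalSpace (Thom E n) :=
  TopologicalSpace.coinduced collapse inferInstance

/-- The circle action on the Thom space, `t · (x, φ, w) = (t x, φ t⁻¹, w)`. -/
def Thom.act {E : EqSubbundle A} {n : ℕ} (t : UnitAddCircle) : Thom E n → Thom E n :=
  Option.map fun p =>
    { x := rotPol t p.x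
      φ := p.φ ∘ₗ ((rotSub E.invariant t p.x).symm.toLinearMap.restrictScalars ℝ)
      isometric := fun v => by
        obtain ⟨v, rfl⟩ := (rotSub E.invariant t p.x).surjective v
        have h : ((rotSub E.invariant t p.x v : E.fib (rotPol t p.x)) :
          TLMfib A (rotPol t p.x).loop) = rot t p.x.loop v.1 := rfl
        rw [h]
        refine Eq.trans ?_ ((p.isometric v).trans (ip_rot t p.x.loop v.1 v.1).symm)
        exact congrArg (fun e => ‖p.φ e‖ ^ 2) ((rotSub E.invariant t p.x).symm_apply_apply v)
      w := p.w
      orth := fun v => p.orth _ }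

/-- The structure maps of the Thom spectrum, `(a, u) · (x, φ, w) = (x, a φ, a w + u)`. -/
def Thom.str {E : EqSubbundle A} {n k : ℕ} (f : JMor n k) : Thom E n → Thom E k :=
  fun p => Option.bind p fun p => Option.pmap
    (fun (u : V k) (hu : f.pt = ↑u) =>
      { x := p.x
        φ := f.iso.toLinearMap ∘ₗ p.φ
        isometric := fun v => by
          rw [← p.isometric v]
          exact congrArg (· ^ 2) (f.iso.norm_map (p.φ v))
        w := f.iso p.w + u
        orth := fun v => by
          change inner ℝ (f.iso p.w + u) (f.iso (p.φ v)) = 0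
          rw [inner_add_left, LinearIsometry.inner_map_map, p.orth, real_inner_comm,
            f.orth u hu, add_zero] : ComplPt E k })
    f.pt (fun _ h => h)

/-- For `E ⊆ E'`, the map of Thom spaces induced by the inclusions `φ(E'_x)^⊥ ⊆ φ(E_x)^⊥` of
orthogonal complements. -/
def Thom.restrict {E E' : EqSubbundle A} (h : E ≤ E') (n : ℕ) : Thom E' n → Thom E n :=
  Option.map fun p =>
    { x := p.x
      φ := p.φ ∘ₗ ((Submodule.inclusion (h p.x)).restrictScalars ℝ)
      isometric := fun v => p.isometric (Submodule.inclusion (h p.x) v)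
      w := p.w
      orth := fun _ => p.orth _ }

/-- The Thom spectrum `LM_±^{-E}` of the `S¹`-equivariant virtual bundle `-E`: the orthogonal
`S¹`-spectrum `X` is (isomorphic to) the one whose value at `ℝⁿ` is the Thom space of the bundle,
over the space of points `x ∈ LM_±` with an isometric embedding `φ : E_x → ℝⁿ`, with fibre the
orthogonal complement of `φ(E_x)`. -/
structure ThomIso (E : EqSubbundle A) (X : S1Spectrum.{u}) where
  homeo : ∀ n, X.X n ≃ₜ Thom E n
  map_base : ∀ n, homeo n (X.base n) = none
  map_act : ∀ n t x, homeo n (X.act n t x) = Thom.act t (homeo n x)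
  map_str : ∀ {n k} (f : JMor n k) x, homeo k (X.str f x) = Thom.str f (homeo n x)

/-- The pairs `(i, j)` of integers with `i < j`, ordered so that `(i, j) ≤ (i', j')` if `i' ≤ i`
and `j ≤ j'`. -/
structure Idx where
  i : ℤ
  j : ℤ
  lt : i < j

instance : Preorder Idx where
  le a b := b.i ≤ a.i ∧ a.j ≤ b.j
  le_refl a := ⟨le_refl _, le_refl _⟩
  le_trans a b c h h' := ⟨h'.1.trans h.1, h.2.trans h'.2⟩

instance : IsDirectedOrder Idx :=
  ⟨fun a b => ⟨⟨min a.i b.i, max a.j b.j, (min_le_left _ _).trans_lt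
    (a.lt.trans_le (le_max_left _ _))⟩, ⟨min_le_left _ _, le_max_left _ _⟩,
    ⟨min_le_right _ _, le_max_right _ _⟩⟩⟩

/-- The inverse system (pro-object) `P` of orthogonal `S¹`-spectra is the system of Thom spectra
`LM_±^{-E_{i,j}}`, with the maps induced by the inclusions between the bundles `E_{i,j}`. -/
def IsPolarizedAtiyahDual (E : Idx → EqSubbundle A)
    (P : CategoryTheory.Functor Idxᵒᵖ S1Spectrum.{u}) : Prop :=
  ∃ iso : ∀ a : Idx, ThomIso (E a) (P.obj (Opposite.op a)),
    ∀ (a b : Idx) (hab : a ≤ b), ∃ h : E a ≤ E b, ∀ n x,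
      (iso a).homeo n (S1Spectrum.Hom.toFun (P.map (CategoryTheory.homOfLE hab).op) n x) =
        Thom.restrict h n ((iso b).homeo n x)

end Thom

end PolarizedLoop

end

/-!
The bundles are `E_{i,j} = zⁱ W ⊖ zʲ W` over the points `(γ, W)` of the polarized loop space.

A Parseval frame of the tangent bundle (`nonempty_parsevalFrame`) embeds it isometrically, and
complex linearly, into a trivial bundle with fibre `ℂᴺ`. All the Hilbert spaces `T_γ LM` are thereby
embedded into the single space `L²(S¹, ℂᴺ)`, compatibly with multiplication by `z` and with rotation
of loops, and the topologies of `LM_±` and `p*TLM` may be described there (`PullTLM.continuous_iff`,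
which needs local continuous families of unitary frames, `exists_local_section`). A point
`x = (γ, W)` gives the orthogonal projection `Π_x` onto the image of `W`. It depends continuously on
`x` in the operator norm (`continuous_polProj`), since the Hilbert–Schmidt topology is finer, and so
does the projection `zⁱ Π_x z⁻ⁱ - zʲ Π_x z⁻ʲ` onto `zⁱ W ⊖ zʲ W`. The latter has finite rank:
multiplication by powers of `z` makes an orthonormal system of `W ⊖ z W` into one of
`L²(S¹, ℂᵐ)`, and comparison with the Fourier modes shows `dim (W ⊖ z W) ≤ m`
(`IsShiftProj.finrank_le`). The ranges of a norm continuous family of projections of finite rank form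
a vector bundle (`trivialNear_of_projection`). The union of the `E_{i,j}` is dense, because
`Π_x - P_{H₊}` is a Hilbert–Schmidt operator in each unitary frame, so that `zⁿ Π_x z⁻ⁿ` tends
strongly to `0` or to the identity as `n → ± ∞` (`tendsto_conjZ_atTop`, `tendsto_conjZ_atBot`).

Multiplication by a power of `z` identifies each of the quotients with `W ⊖ z W`, which has to be
compared with `T_{γ(1)} M`. Elements of `W ⊖ z W` are only square integrable and cannot be evaluated
at the base point. Instead, let `k_r = √(1 - r²) / (1 - r z)` be the normalized Szegő kernel,
`b_r = (z - r) / (1 - r z)` the Blaschke factor, and `Λ = Π - z Π z⁻¹` the projection onto `W ⊖ z W`.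
Then `k_r Λ k_r* = Π - b_r Π b_r*` (`szego_conj`). As `r → 1` the vectors `k_r v` concentrate at
`z = 1` and converge weakly to zero, so that Hilbert–Schmidt operators map them to null families;
since `P_{H₊} - b_r P_{H₊} b_r*` fixes `k_r v`, the operator `Π - b_r Π b_r*` nearly fixes `k_r v`
for `v` in `T_{γ(1)} M` (`tendsto_projW_blaschke`, `tendsto_defect_polProj`). Hence `v ↦ Λ |k_r|² v`
is injective on `T_{γ(1)} M` for `r` close to `1`, and it is an isomorphism onto `W ⊖ z W`, as this
has dimension at most `m`. The required closeness of `r` to `1` depends on `x`, but a suitable radius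
may be chosen as a continuous function of `x` (`exists_continuous_radius`), which gives the
isomorphism of bundles (`exists_comparison`, `quotientIsPullbackTM`).

The spaces of isometric embeddings are topologized by the adjoints of the embeddings, and these are
described by vectors in `L²(S¹, ℂᴺ)`: rotation acts on them by rotation, and restriction to
a subbundle is the projection onto the subbundle (`EmbPt.vec_act`, `EmbPt.vec_restrict`). The actions
and structure maps of the Thom spectra are therefore continuous on bundles of spheres, where
one-point compactifications are handled by stereographic coordinates (`JMor.continuous_apply`). They
descend to the Thom spaces, since the parameters range in the locally compact spaces `S¹` and
`JMor n k` (`continuous_thom`).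
-/

noncomputable section

namespace PolarizedLoop

universe u
/-! ### Fourier modes and multiplication operators on `L²(S¹, ℂᵐ)` -/

/-- Linear maps `ℂᵐ → ℂⁿ`. -/
abbrev EHom (m n : ℕ) : Type := EuclideanSpace ℂ (Fin m) →L[ℂ] EuclideanSpace ℂ (Fin n)

lemma mode_coe {m : ℕ} (q : ℤ × Fin m) :
    (mode q : L2 m) =ᵐ[μS] fun θ => fourier q.1 θ • EuclideanSpace.single q.2 (1 : ℂ) :=
  (memLp_mode q.1 q.2).coeFn_toLp

/-- The `k`-th coordinate of an element of `L²(S¹, ℂᵐ)`. -/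
def coordL2 {m : ℕ} (k : Fin m) : L2 m →L[ℂ] Lp ℂ 2 μS :=
  (EuclideanSpace.proj (𝕜 := ℂ) k).compLpL 2 μS

lemma coordL2_coe {m : ℕ} (k : Fin m) (f : L2 m) : coordL2 k f =ᵐ[μS] fun θ => f θ k :=
  ContinuousLinearMap.coeFn_compLp _ f

lemma inner_mode {m : ℕ} (q : ℤ × Fin m) (f : L2 m) :
    inner ℂ (mode q) f = fourierBasis.repr (coordL2 q.2 f) q.1 := by
  rw [fourierBasis_repr, L2.inner_def, fourierCoeff]
  refine integral_congr_ae ?_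
  filter_upwards [mode_coe q, coordL2_coe q.2 f] with θ h1 h2
  rw [h1, h2, inner_smul_left, EuclideanSpace.inner_single_left, fourier_neg]
  simp

lemma mode_orthonormal (m : ℕ) : Orthonormal ℂ (mode : ℤ × Fin m → L2 m) := by
  classical
  rw [orthonormal_iff_ite]
  rintro ⟨n, k⟩ ⟨p, l⟩
  have h : coordL2 k (mode (p, l) : L2 m) = if l = k then fourierLp 2 p else 0 := by
    refine Lp.ext ?_
    filter_upwards [coordL2_coe k (mode (p, l)), mode_coe (p, l),
      coeFn_fourierLp (T := 1) 2 p, Lp.coeFn_zero ℂ 2 (μS)] with θ h1 h2 h3 h4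
    rw [h1, h2]
    split_ifs with h
    · rw [h3, h]
      simp
    · rw [h4]
      simp [Ne.symm h]
  rw [inner_mode, h]
  by_cases hk : l = k
  · subst hk
    have := (orthonormal_iff_ite.1 (orthonormal_fourier (T := 1))) n p
    rw [if_pos rfl, HilbertBasis.repr_apply_apply, coe_fourierBasis, this]
    simp
  · simp [hk, Ne.symm hk]

lemma mode_orthogonal_eq_bot (m : ℕ) :
    (Submodule.span ℂ (Set.range (mode : ℤ × Fin m → L2 m)))ᗮ = ⊥ := by
  rw [eq_bot_iff]
  intro f hf
  have h : ∀ k, coordL2 k f = 0 := by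
    intro k
    apply fourierBasis.repr.injective
    rw [map_zero]
    ext n
    rw [← inner_mode (n, k) f]
    exact hf _ (Submodule.subset_span ⟨_, rfl⟩)
  refine Lp.ext ?_
  have h2 : ∀ᵐ θ ∂μS, ∀ k, f θ k = 0 := by
    rw [ae_all_iff]
    intro k
    filter_upwards [coordL2_coe k f, Lp.coeFn_zero ℂ 2 (μS)] with θ h1 h2
    rw [← h1, h, h2]
    rfl
  filter_upwards [h2, Lp.coeFn_zero (EuclideanSpace ℂ (Fin m)) 2 (μS)] with θ h1 h3
  rw [h3]
  ext k
  simpa using h1 k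

/-- The Hilbert basis of `L²(S¹, ℂᵐ)` formed by the Fourier modes. -/
def modeBasis (m : ℕ) : HilbertBasis (ℤ × Fin m) ℂ (L2 m) :=
  HilbertBasis.mkOfOrthogonalEqBot (mode_orthonormal m) (mode_orthogonal_eq_bot m)

@[simp]
lemma modeBasis_apply {m : ℕ} (q : ℤ × Fin m) : modeBasis m q = mode q := by
  simp [modeBasis]

/-- Multiplication by a continuous function on the circle with values in `Hom (ℂᵐ, ℂⁿ)`; this
depends linearly and continuously on the function. -/
def mulOp {m n : ℕ} : C(UnitAddCircle, EHom m n) →L[ℂ] (L2 m →L[ℂ] L2 n) :=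
  ((ContinuousLinearMap.id ℂ (EHom m n)).holderL μS ∞ 2 2) ∘L
    (ContinuousMap.toLp ∞ μS ℂ)

lemma mulOp_coe {m n : ℕ} (G : C(UnitAddCircle, EHom m n)) (f : L2 m) :
    mulOp G f =ᵐ[μS] fun θ => G θ (f θ) := by
  refine (ContinuousLinearMap.coeFn_holder (r := 2) _ _ _).trans ?_
  have h := ContinuousMap.coeFn_toLp (p := ∞) (𝕜 := ℂ) μS G
  filter_upwards [h] with θ h
  exact congrArg (fun c : EHom m n => c (f θ)) h

lemma mulOp_ext {m n : ℕ} {G : C(UnitAddCircle, EHom m n)} {A : L2 m →L[ℂ] L2 n}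
    (h : ∀ f : L2 m, A f =ᵐ[μS] fun θ => G θ (f θ)) : mulOp G = A :=
  ContinuousLinearMap.ext fun f => Lp.ext ((mulOp_coe G f).trans (h f).symm)

/-- Pointwise composition of functions with values in `Hom (ℂᵐ, ℂⁿ)`. -/
def compC {m n p : ℕ} (G : C(UnitAddCircle, EHom n p)) (H : C(UnitAddCircle, EHom m n)) :
    C(UnitAddCircle, EHom m p) := ⟨fun θ => G θ ∘L H θ, by fun_prop⟩

/-- Pointwise adjoint of a function with values in `Hom (ℂᵐ, ℂⁿ)`. -/
def adjC {m n : ℕ} (G : C(UnitAddCircle, EHom m n)) : C(UnitAddCircle, EHom n m) :=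
  ⟨fun θ => ContinuousLinearMap.adjoint (G θ),
    ContinuousLinearMap.adjoint.continuous.comp G.continuous⟩

/-- A scalar function, as a function with values in `Hom (ℂᵐ, ℂᵐ)`. -/
def scC (m : ℕ) (g : C(UnitAddCircle, ℂ)) : C(UnitAddCircle, EHom m m) :=
  ⟨fun θ => g θ • ContinuousLinearMap.id ℂ _, by fun_prop⟩

lemma mulOp_comp {m n p : ℕ} (G : C(UnitAddCircle, EHom n p)) (H : C(UnitAddCircle, EHom m n)) :
    mulOp G ∘L mulOp H = mulOp (compC G H) := by
  refine (mulOp_ext fun f => ?_).symm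
  filter_upwards [mulOp_coe G (mulOp H f), mulOp_coe H f] with θ h1 h2
  change (mulOp G (mulOp H f) : L2 p) θ = _
  rw [h1, h2]
  rfl

lemma mulOp_adjoint {m n : ℕ} (G : C(UnitAddCircle, EHom m n)) :
    ContinuousLinearMap.adjoint (mulOp G) = mulOp (adjC G) := by
  symm
  rw [ContinuousLinearMap.eq_adjoint_iff]
  intro f g
  rw [L2.inner_def, L2.inner_def]
  refine integral_congr_ae ?_
  filter_upwards [mulOp_coe (adjC G) f, mulOp_coe G g] with θ h1 h2
  rw [h1, h2]
  exact ContinuousLinearMap.adjoint_inner_left _ _ _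

/-- Multiplication by a continuous scalar function. -/
def mulS {m : ℕ} : C(UnitAddCircle, ℂ) →L[ℂ] (L2 m →L[ℂ] L2 m) :=
  ((ContinuousLinearMap.lsmul ℂ ℂ : ℂ →L[ℂ] EHom m m).holderL μS ∞ 2 2) ∘L
    (ContinuousMap.toLp ∞ μS ℂ)

lemma mulS_coe {m : ℕ} (g : C(UnitAddCircle, ℂ)) (f : L2 m) :
    mulS g f =ᵐ[μS] fun θ => g θ • f θ := by
  refine (ContinuousLinearMap.coeFn_holder (r := 2) _ _ _).trans ?_
  have h := ContinuousMap.coeFn_toLp (p := ∞) (𝕜 := ℂ) μS g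
  filter_upwards [h] with θ h
  exact congrArg (fun c : ℂ => c • f θ) h

lemma mulS_eq {m : ℕ} (g : C(UnitAddCircle, ℂ)) :
    (mulS g : L2 m →L[ℂ] L2 m) = mulOp (scC m g) := by
  symm
  refine mulOp_ext fun f => ?_
  filter_upwards [mulS_coe g f] with θ h
  rw [h]
  rfl

lemma mulS_mul {m : ℕ} (g h : C(UnitAddCircle, ℂ)) :
    (mulS (g * h) : L2 m →L[ℂ] L2 m) = mulS g ∘L mulS h := by
  rw [mulS_eq, mulS_eq, mulS_eq, mulOp_comp]
  congr 1
  ext1 θ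
  ext1 v
  exact mul_smul (g θ) (h θ) v

lemma mulS_one {m : ℕ} : (mulS 1 : L2 m →L[ℂ] L2 m) = 1 := by
  refine ContinuousLinearMap.ext fun f => Lp.ext ?_
  filter_upwards [mulS_coe 1 f] with θ h
  rw [h]
  exact one_smul ℂ (f θ)

lemma mulS_adjoint {m : ℕ} (g : C(UnitAddCircle, ℂ)) :
    ContinuousLinearMap.adjoint (mulS g : L2 m →L[ℂ] L2 m) = mulS (star g) := by
  symm
  rw [ContinuousLinearMap.eq_adjoint_iff]
  intro f f'
  rw [L2.inner_def, L2.inner_def]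
  refine integral_congr_ae ?_
  filter_upwards [mulS_coe (star g) f, mulS_coe g f'] with θ h1 h2
  rw [h1, h2, inner_smul_left, inner_smul_right]
  simp

lemma mulS_comm {m n : ℕ} (g : C(UnitAddCircle, ℂ)) (G : C(UnitAddCircle, EHom m n)) :
    mulS g ∘L mulOp G = mulOp G ∘L mulS g := by
  rw [mulS_eq, mulOp_comp, mulS_eq, mulOp_comp]
  congr 1
  ext1 θ
  ext1 v
  exact (map_smul (G θ) (g θ) v).symm

/-- Multiplication by `zⁿ`. -/
def Zp {m : ℕ} (n : ℤ) : L2 m →L[ℂ] L2 m := mulS (fourier n)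

lemma Zp_coe {m : ℕ} (n : ℤ) (f : L2 m) : Zp n f =ᵐ[μS] fun θ => (fourier n θ : ℂ) • f θ :=
  mulS_coe _ f

lemma Zp_add {m : ℕ} (n p : ℤ) : (Zp (n + p) : L2 m →L[ℂ] L2 m) = Zp n ∘L Zp p := by
  rw [Zp, Zp, Zp, ← mulS_mul]
  congr 1
  ext1 θ
  exact fourier_add

lemma Zp_zero {m : ℕ} : (Zp 0 : L2 m →L[ℂ] L2 m) = 1 := by
  rw [Zp, ← mulS_one]
  congr 1
  ext1 θ
  exact fourier_zero

lemma Zp_adjoint {m : ℕ} (n : ℤ) :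
    ContinuousLinearMap.adjoint (Zp n : L2 m →L[ℂ] L2 m) = Zp (-n) := by
  rw [Zp, mulS_adjoint, Zp]
  congr 1
  ext1 θ
  exact fourier_neg.symm

lemma Zp_apply_apply {m : ℕ} (n p : ℤ) (f : L2 m) : Zp n (Zp p f) = Zp (n + p) f := by
  rw [Zp_add]; rfl

lemma Zp_neg_apply {m : ℕ} (n : ℤ) (f : L2 m) : Zp (-n) (Zp n f) = f := by
  rw [Zp_apply_apply, neg_add_cancel, Zp_zero]; rfl

lemma inner_Zp {m : ℕ} (n : ℤ) (f g : L2 m) : inner ℂ (Zp n f) g = inner ℂ f (Zp (-n) g) := by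
  rw [← Zp_adjoint, ContinuousLinearMap.adjoint_inner_right]

lemma norm_Zp {m : ℕ} (n : ℤ) (f : L2 m) : ‖Zp n f‖ = ‖f‖ := by
  rw [@norm_eq_sqrt_re_inner ℂ, inner_Zp, Zp_neg_apply, ← @norm_eq_sqrt_re_inner ℂ]

lemma Zp_mode {m : ℕ} (n : ℤ) (q : ℤ × Fin m) : Zp n (mode q) = mode (n + q.1, q.2) := by
  refine Lp.ext ?_
  filter_upwards [Zp_coe n (mode q), mode_coe q, mode_coe (n + q.1, q.2)] with θ h1 h2 h3
  rw [h1, h2, h3, smul_smul, fourier_add]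

/-- The isometric embedding of the constant functions `ℂᵐ` in `L²(S¹, ℂᵐ)`. -/
def constL (m : ℕ) : EuclideanSpace ℂ (Fin m) →L[ℂ] L2 m := Lp.constL 2 μS ℂ

lemma constL_coe {m : ℕ} (v : EuclideanSpace ℂ (Fin m)) : constL m v =ᵐ[μS] fun _ => v :=
  Lp.coeFn_const (p := 2) μS v

lemma norm_mulS_constL_sq {m : ℕ} (g : C(UnitAddCircle, ℂ)) (v : EuclideanSpace ℂ (Fin m)) :
    ‖mulS g (constL m v)‖ ^ 2 = (∫ θ, ‖g θ‖ ^ 2 ∂μS) * ‖v‖ ^ 2 := by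
  rw [@norm_sq_eq_re_inner ℂ, L2.inner_def, ← integral_re (L2.integrable_inner _ _),
    ← integral_mul_const]
  refine integral_congr_ae ?_
  filter_upwards [mulS_coe g (constL m v), constL_coe v] with θ h1 h2
  rw [h1, h2, ← @norm_sq_eq_re_inner ℂ, norm_smul, mul_pow]

lemma norm_mulS_le {m : ℕ} (g : C(UnitAddCircle, ℂ)) {C : ℝ} (hC : 0 ≤ C) (h : ∀ θ, ‖g θ‖ ≤ C) :
    ‖(mulS g : L2 m →L[ℂ] L2 m)‖ ≤ C := by
  refine ContinuousLinearMap.opNorm_le_bound _ hC fun f => ?_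
  refine Lp.norm_le_mul_norm_of_ae_le_mul ?_
  filter_upwards [mulS_coe g f] with θ h1
  rw [h1, norm_smul]
  exact mul_le_mul_of_nonneg_right (h θ) (norm_nonneg _)


/-! ### Hilbert–Schmidt sums -/

lemma summable_norm_add_sq {F : Type} [NormedAddCommGroup F] {ι : Type*} {f g : ι → F}
    (hf : Summable fun i => ‖f i‖ ^ 2) (hg : Summable fun i => ‖g i‖ ^ 2) : Summable fun i => ‖f i + g i‖ ^ 2 := by
  refine Summable.of_nonneg_of_le (fun i => sq_nonneg _) (fun i => ?_) ((hf.add hg).mul_left 2)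
  exact (pow_le_pow_left₀ (norm_nonneg _) (norm_add_le _ _) 2).trans add_sq_le

section HS

variable {E F G : Type} [NormedAddCommGroup E] [InnerProductSpace ℂ E]
  [NormedAddCommGroup F] [InnerProductSpace ℂ F] [NormedAddCommGroup G] [InnerProductSpace ℂ G]
  {ι κ ν : Type*}

lemma hasSum_norm_inner_sq (b : HilbertBasis ι ℂ E) (x : E) :
    HasSum (fun i => ‖inner ℂ (b i) x‖ ^ 2) (‖x‖ ^ 2) := by
  have h := b.hasSum_inner_mul_inner x x
  have h2 := Complex.hasSum_re h
  convert h2 using 1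
  · funext i
    rw [← inner_conj_symm x (b i), mul_comm, Complex.mul_conj, Complex.normSq_eq_norm_sq]
    exact (Complex.ofReal_re _).symm
  · exact norm_sq_eq_re_inner (𝕜 := ℂ) x

/-- The Hilbert–Schmidt norm of an operator is that of its adjoint; in particular it does not depend
on the basis used to compute it. -/
lemma summable_adjoint [CompleteSpace E] [CompleteSpace F] (b : HilbertBasis ι ℂ E)
    (c : HilbertBasis κ ℂ F) (A : E →L[ℂ] F) (h : Summable fun i => ‖A (b i)‖ ^ 2) :
    Summable fun j => ‖ContinuousLinearMap.adjoint A (c j)‖ ^ 2 := by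
  have h1 : Summable fun p : ι × κ => ‖inner ℂ (c p.2) (A (b p.1))‖ ^ 2 := by
    refine (summable_prod_of_nonneg
      (f := fun p : ι × κ => ‖inner ℂ (c p.2) (A (b p.1))‖ ^ 2) fun p => by positivity).2 ?_
    have e : ∀ i, ∑' y, ‖inner ℂ (c y) (A (b i))‖ ^ 2 = ‖A (b i)‖ ^ 2 := fun i =>
      (hasSum_norm_inner_sq c (A (b i))).tsum_eq
    refine ⟨fun i => (hasSum_norm_inner_sq c (A (b i))).summable, ?_⟩
    simp only [e]
    exact h
  have h2 : Summable fun p : κ × ι => ‖inner ℂ (c p.1) (A (b p.2))‖ ^ 2 :=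
    (Equiv.prodComm κ ι).summable_iff.2 h1
  replace h2 := (summable_prod_of_nonneg
    (f := fun p : κ × ι => ‖inner ℂ (c p.1) (A (b p.2))‖ ^ 2) fun p => by positivity).1 h2
  convert h2.2 using 2 with j
  rw [← (hasSum_norm_inner_sq b (ContinuousLinearMap.adjoint A (c j))).tsum_eq]
  refine tsum_congr fun i => ?_
  rw [ContinuousLinearMap.adjoint_inner_right, norm_inner_symm]

lemma summable_comp_left {f : ι → F} (S : F →L[ℂ] G)
    (h : Summable fun i => ‖f i‖ ^ 2) : Summable fun i => ‖S (f i)‖ ^ 2 := by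
  refine Summable.of_nonneg_of_le (fun i => by positivity) (fun i => ?_) (h.mul_left (‖S‖ ^ 2))
  rw [← mul_pow]
  exact pow_le_pow_left₀ (norm_nonneg _) (S.le_opNorm _) 2

lemma summable_comp_right [CompleteSpace E] [CompleteSpace F] [CompleteSpace G]
    {b : HilbertBasis ι ℂ E} {A : E →L[ℂ] F} (c : HilbertBasis κ ℂ F)
    (d : HilbertBasis ν ℂ G) (S : G →L[ℂ] E)
    (h : Summable fun i => ‖A (b i)‖ ^ 2) : Summable fun i => ‖A (S (d i))‖ ^ 2 := by
  have h1 := summable_comp_left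
    (ContinuousLinearMap.adjoint S) (summable_adjoint b c A h)
  have h2 := summable_adjoint c d
    (ContinuousLinearMap.adjoint S ∘L ContinuousLinearMap.adjoint A) h1
  rw [← ContinuousLinearMap.adjoint_comp, ContinuousLinearMap.adjoint_adjoint] at h2
  exact h2

lemma summable_of_finiteDimensional_range [CompleteSpace E] [CompleteSpace F]
    (b : HilbertBasis ι ℂ E) (A : E →L[ℂ] F)
    (K : Submodule ℂ F) [FiniteDimensional ℂ K] (hA : ∀ x, A x ∈ K) :
    Summable fun i => ‖A (b i)‖ ^ 2 := by
  let e := stdOrthonormalBasis ℂ K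
  have h : ∀ x, ‖A x‖ ^ 2 = ∑ k, ‖inner ℂ x (ContinuousLinearMap.adjoint A (e k))‖ ^ 2 := by
    intro x
    have := e.sum_sq_norm_inner_right ⟨A x, hA x⟩
    change _ = ‖A x‖ ^ 2 at this
    rw [← this]
    refine Finset.sum_congr rfl fun k _ => ?_
    rw [ContinuousLinearMap.adjoint_inner_right, norm_inner_symm]
    rfl
  simp only [h]
  exact summable_sum fun k _ => (hasSum_norm_inner_sq b _).summable

/-- The operator norm is bounded by the Hilbert–Schmidt norm. -/
lemma norm_apply_sq_le_tsum (b : HilbertBasis ι ℂ E) (A : E →L[ℂ] F)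
    (h : Summable fun i => ‖A (b i)‖ ^ 2) (x : E) :
    ‖A x‖ ^ 2 ≤ ‖x‖ ^ 2 * ∑' i, ‖A (b i)‖ ^ 2 := by
  have h1 : HasSum (fun i => b.repr x i • A (b i)) (A x) := by
    simpa using (b.hasSum_repr x).mapL A
  have h2 : Tendsto (fun s : Finset ι => ‖∑ i ∈ s, b.repr x i • A (b i)‖ ^ 2) atTop
      (𝓝 (‖A x‖ ^ 2)) := (h1.norm).pow 2
  refine le_of_tendsto h2 (Eventually.of_forall fun s => ?_)
  have h3 : ‖∑ i ∈ s, b.repr x i • A (b i)‖ ≤ ∑ i ∈ s, ‖b.repr x i‖ * ‖A (b i)‖ :=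
    (norm_sum_le _ _).trans (Finset.sum_le_sum fun i _ => (norm_smul _ _).le)
  refine (pow_le_pow_left₀ (norm_nonneg _) h3 2).trans ?_
  refine (Finset.sum_mul_sq_le_sq_mul_sq _ _ _).trans ?_
  refine mul_le_mul ?_ (h.sum_le_tsum s fun i _ => by positivity) (by positivity) (by positivity)
  have h4 := hasSum_norm_inner_sq b x
  rw [← h4.tsum_eq]
  refine le_trans (le_of_eq ?_) (h4.summable.sum_le_tsum s fun i _ => by positivity)
  exact Finset.sum_congr rfl fun i _ => by rw [b.repr_apply_apply]

/-- A Hilbert–Schmidt operator maps bounded, weakly null families to null families. -/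
lemma tendsto_apply_zero_of_weak (b : HilbertBasis ι ℂ E) (A : E →L[ℂ] F)
    (h : Summable fun i => ‖A (b i)‖ ^ 2) {α : Type*} {l : Filter α} {x : α → E} {C : ℝ}
    (hx : ∀ a, ‖x a‖ ≤ C) (hw : ∀ i, Tendsto (fun a => inner ℂ (b i) (x a)) l (𝓝 0)) :
    Tendsto (fun a => A (x a)) l (𝓝 0) := by
  classical
  rw [Metric.tendsto_nhds]
  intro ε hε
  obtain ⟨s, hs⟩ : ∃ s : Finset ι, C ^ 2 * ∑' i : {i // i ∉ s}, ‖A (b i)‖ ^ 2 < (ε / 2) ^ 2 := by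
    have h1 := (tendsto_tsum_compl_atTop_zero fun i => ‖A (b i)‖ ^ 2).const_mul (C ^ 2)
    rw [mul_zero] at h1
    exact (h1.eventually_lt_const (by positivity)).exists
  let A' : E →L[ℂ] F := ∑ i ∈ s, (innerSL ℂ (b i)).smulRight (A (b i))
  have hA' : ∀ x, A' x = ∑ i ∈ s, inner ℂ (b i) x • A (b i) := by
    intro x
    simp [A']
  have hb : ∀ j, (A - A') (b j) = if j ∈ s then 0 else A (b j) := by
    intro j
    have ho := fun i => orthonormal_iff_ite.1 b.orthonormal i j
    rw [sub_apply, hA']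
    simp only [ho, ite_smul, one_smul, zero_smul, Finset.sum_ite_eq']
    split_ifs <;> simp
  have hsq : ∀ j, ‖(A - A') (b j)‖ ^ 2 = {i | i ∉ s}.indicator (fun i => ‖A (b i)‖ ^ 2) j := by
    intro j
    rw [hb, Set.indicator_apply]
    by_cases hj : j ∈ s <;> simp [hj]
  have hle : ∀ a, ‖(A - A') (x a)‖ < ε / 2 := by
    intro a
    have h1 := norm_apply_sq_le_tsum b (A - A') (by
      simp only [hsq]
      exact h.indicator _) (x a)
    simp only [hsq] at h1
    rw [← tsum_subtype {i | i ∉ s} fun i => ‖A (b i)‖ ^ 2] at h1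
    refine lt_of_pow_lt_pow_left₀ 2 (by positivity) (lt_of_le_of_lt (h1.trans ?_) hs)
    refine mul_le_mul_of_nonneg_right (pow_le_pow_left₀ (norm_nonneg _) (hx a) 2) ?_
    exact tsum_nonneg fun i => by positivity
  have hlim : Tendsto (fun a => A' (x a)) l (𝓝 0) := by
    simp only [hA']
    have : Tendsto (fun a => ∑ i ∈ s, inner ℂ (b i) (x a) • A (b i)) l
        (𝓝 (∑ i ∈ s, (0 : ℂ) • A (b i))) :=
      tendsto_finsetSum _ fun i _ => (hw i).smul_const _
    simpa using this
  filter_upwards [Metric.tendsto_nhds.1 hlim (ε / 2) (by positivity)] with a ha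
  rw [dist_zero_right] at ha ⊢
  have h1 : A (x a) = (A - A') (x a) + A' (x a) := by simp
  rw [h1]
  linarith [norm_add_le ((A - A') (x a)) (A' (x a)), hle a]

end HS

/-! ### The restricted Grassmannian -/

/-- The orthogonal projection onto (the closure of) `W`. -/
def projW {m : ℕ} (W : Submodule ℂ (L2 m)) : L2 m →L[ℂ] L2 m := W.topologicalClosure.starProjection

/-- The orthogonal projection onto `H₊`. -/
abbrev projH (m : ℕ) : L2 m →L[ℂ] L2 m := (Hplus m).starProjection

/-- `P_W - P_{H₊}` is a Hilbert–Schmidt operator, so that `projDiff W` is not a default value. -/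
def IsHSDiff {m : ℕ} (W : Submodule ℂ (L2 m)) : Prop :=
  Summable fun q => ‖(projW W - projH m) (mode q)‖ ^ 2

lemma isHSDiff_iff_memℓp {m : ℕ} {W : Submodule ℂ (L2 m)} :
    IsHSDiff W ↔ Memℓp (E := fun _ => L2 m) (fun q : ℤ × Fin m =>
      W.topologicalClosure.starProjection (mode q) - (Hplus m).starProjection (mode q)) 2 := by
  rw [memℓp_gen_iff (by norm_num)]
  simp only [ENNReal.toReal_ofNat, Real.rpow_ofNat]
  rfl

lemma projDiff_apply {m : ℕ} {W : Submodule ℂ (L2 m)} (h : IsHSDiff W) (q : ℤ × Fin m) :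
    projDiff W q = (projW W - projH m) (mode q) := by
  rw [projDiff, dif_pos (isHSDiff_iff_memℓp.1 h)]
  rfl

/-- The projection onto a point of the restricted Grassmannian depends continuously on the point,
in operator norm. -/
lemma norm_projW_sub_le {m : ℕ} {W W' : Submodule ℂ (L2 m)} (h : IsHSDiff W) (h' : IsHSDiff W') :
    ‖projW W - projW W'‖ ≤ ‖projDiff W - projDiff W'‖ := by
  have e : ∀ q, (projW W - projW W') (mode q) = (projDiff W - projDiff W') q := by
    intro q
    have h1 := projDiff_apply h q
    have h2 := projDiff_apply h' q
    simp only [sub_apply] at h1 h2 ⊢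
    rw [lp.coeFn_sub, Pi.sub_apply, h1, h2]
    abel
  have hs := lp.hasSum_norm (p := 2) (by norm_num) (projDiff W - projDiff W')
  simp only [ENNReal.toReal_ofNat, Real.rpow_ofNat, ← e] at hs
  refine ContinuousLinearMap.opNorm_le_bound _ (norm_nonneg _) fun x => ?_
  refine le_of_sq_le_sq ?_ (by positivity)
  have h1 := norm_apply_sq_le_tsum (modeBasis m) (projW W - projW W')
    (by simpa using hs.summable) x
  simp only [modeBasis_apply, hs.tsum_eq] at h1
  rw [mul_pow, mul_comm]
  exact h1

lemma projH_apply_mem {m : ℕ} {f : L2 m} (hf : f ∈ Hplus m) : projH m f = f :=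
  Submodule.starProjection_eq_self_iff.2 hf

/-- For a point `W` of the restricted Grassmannian, `P_W - P_{H₊} = P_- P_W - P_+ P_W^⊥` is a
Hilbert–Schmidt operator. For the second term, whose adjoint is `P_W^⊥ P_+`, let `v` be an inverse of
`W → H₊` up to operators of finite rank: then `P_+` agrees with `v P_+ - P_- v P_+` up to finite rank,
and `v P_+` takes values in `W`. -/
lemma MemGrRes.isHSDiff {m : ℕ} {W : Submodule ℂ (L2 m)} (hW : MemGrRes W) : IsHSDiff W := by
  have : CompleteSpace W := hW.isClosed.completeSpace_coe
  have hP : projW W = W.starProjection := by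
    have h : W.topologicalClosure = W := hW.isClosed.submodule_topologicalClosure_eq
    unfold projW
    congr 1
  let Pm : L2 m →L[ℂ] L2 m := (Hminus m).starProjection
  have hPm : ∀ f, Pm f = f - projH m f := fun f =>
    congrArg (fun A : L2 m →L[ℂ] L2 m => A f) (Submodule.starProjection_orthogonal (Hplus m))
  let P := W.starProjection
  let B : W →L[ℂ] L2 m := Pm ∘L W.subtypeL
  obtain ⟨ι, b, hb⟩ := hW.hilbertSchmidt
  have hB : Summable fun i => ‖B (b i)‖ ^ 2 := hb
  -- the first half, `P_- P_W`
  have h1 : Summable fun q => ‖Pm (P (mode q))‖ ^ 2 := by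
    have := summable_comp_right (modeBasis m) (modeBasis m) W.orthogonalProjectionOnto hB
    simp only [modeBasis_apply] at this
    exact this
  -- the second half, the adjoint of `P_W^⊥ P_+`
  obtain ⟨v, hv⟩ := hW.fredholm.exists_isQuasiInverse
  set w : W →L[ℂ] Hplus m := (Hplus m).orthogonalProjectionOnto ∘L W.subtypeL with hw
  let D : Hplus m →L[ℂ] Hplus m := w ∘L v - ContinuousLinearMap.id ℂ _
  have hD : (D : Hplus m →ₗ[ℂ] Hplus m).HasFiniteRange := by
    have h2 := hv.2
    exact LinearMap.FiniteRangeSetoid.equiv_iff_hasFiniteRange.1 h2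
  let Dx : L2 m →L[ℂ] L2 m := (Hplus m).subtypeL ∘L D ∘L (Hplus m).orthogonalProjectionOnto
  have hDx : Summable fun q => ‖Dx (modeBasis m q)‖ ^ 2 := by
    have hfg : ((LinearMap.range (D : Hplus m →ₗ[ℂ] Hplus m)).map (Hplus m).subtype).FG :=
      (LinearMap.hasFiniteRange_iff_range.1 hD).map _
    have : FiniteDimensional ℂ
        ((LinearMap.range (D : Hplus m →ₗ[ℂ] Hplus m)).map (Hplus m).subtype) :=
      Module.Finite.iff_fg.2 hfg
    exact summable_of_finiteDimensional_range (modeBasis m) Dx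
      ((LinearMap.range (D : Hplus m →ₗ[ℂ] Hplus m)).map (Hplus m).subtype)
      (fun x => ⟨_, ⟨_, rfl⟩, rfl⟩)
  let Q : L2 m →L[ℂ] L2 m := ContinuousLinearMap.id ℂ _ - P
  let R : L2 m →L[ℂ] L2 m := Q ∘L projH m
  have hR : ∀ f, R f = -(Q (B (v ((Hplus m).orthogonalProjectionOnto f))) + Q (Dx f)) := by
    intro f
    set g := (Hplus m).orthogonalProjectionOnto f with hg
    have e1 : Dx f = projH m (v g : L2 m) - projH m f := rfl
    have e2 : B (v g) = (v g : L2 m) - projH m (v g : L2 m) := hPm _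
    have e3 : Q (v g : L2 m) = 0 := by
      change (v g : L2 m) - P (v g : L2 m) = 0
      rw [sub_eq_zero]
      exact (Submodule.starProjection_eq_self_iff.2 (v g).2).symm
    rw [← map_add, e1, e2, ← map_neg]
    have e4 : -((v g : L2 m) - projH m (v g : L2 m) + (projH m (v g : L2 m) - projH m f))
      = projH m f - (v g : L2 m) := by abel
    rw [e4, map_sub, e3, sub_zero]
    rfl
  have h2 : Summable fun q => ‖R (modeBasis m q)‖ ^ 2 := by
    have s1 : Summable fun q => ‖Q (Dx (modeBasis m q))‖ ^ 2 := summable_comp_left Q hDx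
    obtain ⟨S, hS⟩ : ∃ S : L2 m →L[ℂ] W, ∀ f, S f = v ((Hplus m).orthogonalProjectionOnto f) :=
      ⟨v ∘L (Hplus m).orthogonalProjectionOnto, fun _ => rfl⟩
    have s2 := summable_comp_left Q (summable_comp_right (modeBasis m) (modeBasis m) S hB)
    simp only [hS] at s2
    refine (summable_norm_add_sq s2 s1).congr fun q => ?_
    rw [hR, norm_neg]
  have h3 := summable_adjoint (modeBasis m) (modeBasis m) R h2
  have hsa : ∀ f, ContinuousLinearMap.adjoint R f = projH m (f - P f) := by
    intro f
    refine ext_inner_right ℂ fun g => ?_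
    rw [ContinuousLinearMap.adjoint_inner_left, Submodule.inner_starProjection_left_eq_right]
    change inner ℂ f (projH m g - P (projH m g)) = inner ℂ (f - P f) (projH m g)
    rw [inner_sub_left, inner_sub_right, Submodule.inner_starProjection_left_eq_right]
  have e : ∀ q, (projW W - projH m) (mode q) =
      Pm (P (mode q)) + -ContinuousLinearMap.adjoint R (modeBasis m q) := by
    intro q
    rw [hPm, hsa, map_sub, hP, modeBasis_apply, sub_apply]
    abel
  unfold IsHSDiff
  simp only [e]
  refine summable_norm_add_sq h1 ?_
  simpa only [norm_neg] using h3


/-! ### Shifts and the Hardy space -/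

lemma ext_mode {m : ℕ} {F : Type*} [NormedAddCommGroup F] [NormedSpace ℂ F] {A B : L2 m →L[ℂ] F}
    (h : ∀ q, A (mode q) = B (mode q)) : A = B := by
  refine ContinuousLinearMap.ext_on (s := Set.range (modeBasis m)) ?_ ?_
  · have := (modeBasis m).dense_span
    rw [Submodule.dense_iff_topologicalClosure_eq_top]
    exact this
  · rintro _ ⟨q, rfl⟩
    simpa using h q

lemma projH_mode {m : ℕ} (q : ℤ × Fin m) :
    projH m (mode q) = if 0 ≤ q.1 then mode q else 0 := by
  split_ifs with h
  · exact projH_apply_mem (Submodule.le_topologicalClosure _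
      (Submodule.subset_span ⟨q.1, q.2, h, rfl⟩))
  · refine (Submodule.starProjection_apply_eq_zero_iff _).2 ?_
    unfold Hplus
    rw [Submodule.orthogonal_closure, Submodule.mem_orthogonal]
    intro f hf
    induction hf using Submodule.span_induction with
    | mem f hf =>
      obtain ⟨n, k, hn, rfl⟩ := hf
      refine (mode_orthonormal m).2 ?_
      rintro rfl
      exact h hn
    | zero => exact inner_zero_left _
    | add f g _ _ hf hg => rw [inner_add_left, hf, hg, add_zero]
    | smul c f _ hf => rw [inner_smul_left, hf, mul_zero]

lemma projH_Zp_one {m : ℕ} (f : L2 m) (hf : projH m f = f) : projH m (Zp 1 f) = Zp 1 f := by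
  have h : projH m ∘L Zp 1 ∘L projH m = Zp 1 ∘L projH m := by
    refine ext_mode fun q => ?_
    simp only [ContinuousLinearMap.comp_apply, projH_mode]
    split_ifs with h
    · rw [Zp_mode, projH_mode, if_pos (by change 0 ≤ 1 + q.1; omega)]
    · simp
  have := congrArg (fun A : L2 m →L[ℂ] L2 m => A f) h
  simpa only [ContinuousLinearMap.comp_apply, hf] using this

lemma projH_Zp_neg_one {m : ℕ} (f : L2 m) (hf : projH m f = 0) : projH m (Zp (-1) f) = 0 := by
  have h : projH m ∘L Zp (-1) = projH m ∘L Zp (-1) ∘L projH m := by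
    refine ext_mode fun q => ?_
    simp only [ContinuousLinearMap.comp_apply, projH_mode]
    split_ifs with h
    · rfl
    · rw [Zp_mode, projH_mode, if_neg (by change ¬ 0 ≤ -1 + q.1; omega)]
      simp
  have := congrArg (fun A : L2 m →L[ℂ] L2 m => A f) h
  simpa only [ContinuousLinearMap.comp_apply, hf, map_zero] using this

lemma constL_eq_sum {m : ℕ} (v : EuclideanSpace ℂ (Fin m)) :
    constL m v = ∑ k, v k • mode (0, k) := by
  have h : ∀ k, constL m (EuclideanSpace.single k 1) = mode (0, k) := by
    intro k
    refine Lp.ext ?_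
    filter_upwards [constL_coe (EuclideanSpace.single k (1 : ℂ)), mode_coe (0, k)] with θ h1 h2
    rw [h1, h2]
    simp
  have hv : v = ∑ k, v k • EuclideanSpace.single k (1 : ℂ) := by
    ext j
    simp [Finset.sum_apply, Pi.single_apply]
  conv_lhs => rw [hv]
  simp only [map_sum, map_smul, h]

lemma projH_constL {m : ℕ} (v : EuclideanSpace ℂ (Fin m)) :
    projH m (constL m v) = constL m v := by
  rw [constL_eq_sum]
  simp [projH_mode]

lemma projH_Zp_neg_one_constL {m : ℕ} (v : EuclideanSpace ℂ (Fin m)) :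
    projH m (Zp (-1) (constL m v)) = 0 := by
  rw [constL_eq_sum]
  simp [Zp_mode, projH_mode]

lemma norm_constL {m : ℕ} (v : EuclideanSpace ℂ (Fin m)) : ‖constL m v‖ = ‖v‖ := by
  have h := norm_mulS_constL_sq 1 v
  rw [mulS_one] at h
  simp only [ContinuousMap.one_apply, norm_one, one_pow, integral_const, smul_eq_mul, mul_one,
    probReal_univ, one_mul] at h
  exact (sq_eq_sq₀ (norm_nonneg _) (norm_nonneg _)).1 h

lemma norm_projH_le {m : ℕ} (f : L2 m) : ‖projH m f‖ ≤ ‖f‖ :=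
  Submodule.norm_starProjection_apply_le _ _

/-! ### The Szegő kernel and the Blaschke factor -/

/-- The coordinate function `z` on the circle. -/
def zC : C(UnitAddCircle, ℂ) := fourier 1

lemma norm_smul_zC_lt {r : ℝ} (hr : |r| < 1) : ‖(r : ℂ) • zC‖ < 1 := by
  rw [norm_smul, zC, fourier_norm, mul_one]
  simpa using hr

/-- The function `(1 - r z)⁻¹` on the circle. -/
def resC (r : ℝ) : C(UnitAddCircle, ℂ) := Ring.inverse (1 - (r : ℂ) • zC)

lemma isUnit_one_sub {r : ℝ} (hr : |r| < 1) : IsUnit (1 - (r : ℂ) • zC) :=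
  isUnit_one_sub_of_norm_lt_one (norm_smul_zC_lt hr)

lemma one_sub_mul_resC {r : ℝ} (hr : |r| < 1) : (1 - (r : ℂ) • zC) * resC r = 1 :=
  Ring.mul_inverse_cancel _ (isUnit_one_sub hr)

/-- The normalized Szegő kernel `k_r = √(1 - r²) / (1 - r z)`: a unit vector of `H²` concentrated
near `z = 1` as `r → 1`. -/
def szego (r : ℝ) : C(UnitAddCircle, ℂ) := (Real.sqrt (1 - r ^ 2) : ℂ) • resC r

/-- The Blaschke factor `b_r = (z - r) / (1 - r z)`. -/
def blaschke (r : ℝ) : C(UnitAddCircle, ℂ) := (zC - (r : ℂ) • 1) * resC r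

lemma continuousAt_resC {r : ℝ} (hr : |r| < 1) : ContinuousAt resC r := by
  obtain ⟨x, hx⟩ := isUnit_one_sub hr
  have h := NormedRing.inverse_continuousAt x
  rw [hx] at h
  refine ContinuousAt.comp (f := fun r : ℝ => 1 - (r : ℂ) • zC) h ?_
  exact Continuous.continuousAt (by fun_prop)

lemma continuousAt_szego {r : ℝ} (hr : |r| < 1) : ContinuousAt szego r := by
  refine ContinuousAt.smul (f := fun r : ℝ => (Real.sqrt (1 - r ^ 2) : ℂ)) ?_
    (continuousAt_resC hr)
  exact Continuous.continuousAt (by fun_prop)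

lemma continuousAt_blaschke {r : ℝ} (hr : |r| < 1) : ContinuousAt blaschke r := by
  refine ContinuousAt.mul (f := fun r : ℝ => zC - (r : ℂ) • (1 : C(UnitAddCircle, ℂ))) ?_
    (continuousAt_resC hr)
  exact Continuous.continuousAt (by fun_prop)

lemma star_zC_mul : star zC * zC = 1 := by
  ext θ
  simp only [zC, ContinuousMap.mul_apply, ContinuousMap.star_apply, ContinuousMap.one_apply]
  rw [mul_comm, ← starRingEnd_apply, Complex.mul_conj, Complex.normSq_eq_norm_sq, fourier_apply,
    Circle.norm_coe]
  simp

lemma star_resC {r : ℝ} (hr : |r| < 1) : (1 - (r : ℂ) • star zC) * star (resC r) = 1 := by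
  have h := congrArg star (one_sub_mul_resC hr)
  rw [star_mul, mul_comm, star_sub, star_smul, star_one] at h
  simpa using h

/-- On the circle, `conj b_r · k_r = conj (z k_r)`. -/
lemma star_blaschke_mul_szego {r : ℝ} (hr : |r| < 1) :
    star (blaschke r) * szego r = star zC * star (szego r) := by
  have h1 := one_sub_mul_resC hr
  have e1 : star (blaschke r) = (star zC - (r : ℂ) • 1) * star (resC r) := by
    rw [blaschke, star_mul, mul_comm, star_sub, star_smul, star_one]
    simp
  have e2 : star (szego r) = (Real.sqrt (1 - r ^ 2) : ℂ) • star (resC r) := by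
    rw [szego, star_smul]
    simp
  have e3 : star zC - (r : ℂ) • (1 : C(UnitAddCircle, ℂ)) = star zC * (1 - (r : ℂ) • zC) := by
    rw [mul_sub, mul_one, mul_smul_comm, star_zC_mul]
  rw [e1, e2, e3, szego, mul_smul_comm, mul_smul_comm]
  congr 1
  calc star zC * (1 - (r : ℂ) • zC) * star (resC r) * resC r
      = star zC * star (resC r) * ((1 - (r : ℂ) • zC) * resC r) := by ring
    _ = _ := by rw [h1, mul_one]

/-- `b_r` has modulus one on the circle. -/
lemma star_blaschke_mul_blaschke {r : ℝ} (hr : |r| < 1) : star (blaschke r) * blaschke r = 1 := by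
  have h1 := one_sub_mul_resC hr
  have h2 := star_resC hr
  have e1 : star (blaschke r) = (star zC - (r : ℂ) • 1) * star (resC r) := by
    rw [blaschke, star_mul, mul_comm, star_sub, star_smul, star_one]
    simp
  have e3 : star zC - (r : ℂ) • (1 : C(UnitAddCircle, ℂ)) = star zC * (1 - (r : ℂ) • zC) := by
    rw [mul_sub, mul_one, mul_smul_comm, star_zC_mul]
  have e4 : zC - (r : ℂ) • (1 : C(UnitAddCircle, ℂ)) = zC * (1 - (r : ℂ) • star zC) := by
    rw [mul_sub, mul_one, mul_smul_comm, mul_comm zC (star zC), star_zC_mul]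
  rw [e1, e3, blaschke, e4]
  calc star zC * (1 - (r : ℂ) • zC) * star (resC r) * (zC * (1 - (r : ℂ) • star zC) * resC r)
      = (star zC * zC) * ((1 - (r : ℂ) • zC) * resC r)
        * ((1 - (r : ℂ) • star zC) * star (resC r)) := by ring
    _ = 1 := by rw [h1, h2, star_zC_mul]; simp

lemma mulS_szego_relation {m : ℕ} {r : ℝ} (hr : |r| < 1) (v : EuclideanSpace ℂ (Fin m)) :
    mulS (szego r) (constL m v) = (Real.sqrt (1 - r ^ 2) : ℂ) • constL m v
      + (r : ℂ) • Zp 1 (mulS (szego r) (constL m v)) := by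
  have h : szego r = (Real.sqrt (1 - r ^ 2) : ℂ) • 1 + (r : ℂ) • (zC * szego r) := by
    have h1 : resC r = 1 + (r : ℂ) • (zC * resC r) := by
      have := one_sub_mul_resC hr
      rw [sub_mul, one_mul, smul_mul_assoc, sub_eq_iff_eq_add] at this
      exact this
    conv_lhs => rw [szego, h1]
    rw [szego]
    ext θ
    simp only [ContinuousMap.smul_apply, ContinuousMap.add_apply, ContinuousMap.mul_apply,
      smul_eq_mul]
    ring
  conv_lhs => rw [h]
  rw [map_add, map_smul, map_smul, mulS_mul, mulS_one]
  rfl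

/-- `k_r v` belongs to `H₊`. -/
lemma projH_szego {m : ℕ} {r : ℝ} (hr : |r| < 1) (v : EuclideanSpace ℂ (Fin m)) :
    projH m (mulS (szego r) (constL m v)) = mulS (szego r) (constL m v) := by
  set f := mulS (szego r) (constL m v) with hf
  have h1 := mulS_szego_relation hr v
  rw [← hf] at h1
  set g := f - projH m f with hg
  have hpg : projH m g = 0 := by
    rw [hg, map_sub, projH_apply_mem (Submodule.starProjection_apply_mem _ f), sub_self]
  -- `(1 - P₊) f = r (1 - P₊) z (1 - P₊) f`, and the right side is a strict contraction
  have h2 : g = (r : ℂ) • (Zp 1 g - projH m (Zp 1 g)) := by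
    have e : f = g + projH m f := by rw [hg]; abel
    have e2 := projH_Zp_one (projH m f) (projH_apply_mem (Submodule.starProjection_apply_mem _ f))
    have e3 : Zp 1 f - projH m (Zp 1 f) = Zp 1 g - projH m (Zp 1 g) := by
      conv_lhs => rw [e]
      rw [map_add, map_add, e2]
      abel
    rw [← e3]
    conv_lhs => rw [hg, h1]
    rw [map_add, map_smul, map_smul, projH_constL, smul_sub]
    abel
  have h3 : ‖g‖ ≤ |r| * ‖g‖ := by
    conv_lhs => rw [h2]
    rw [norm_smul, Complex.norm_real, Real.norm_eq_abs]
    refine mul_le_mul_of_nonneg_left ?_ (abs_nonneg _)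
    have h4 : Zp 1 g - projH m (Zp 1 g) = (Hplus m)ᗮ.starProjection (Zp 1 g) :=
      (congrArg (fun A : L2 m →L[ℂ] L2 m => A (Zp 1 g))
        (Submodule.starProjection_orthogonal (Hplus m))).symm
    rw [h4]
    exact (Submodule.norm_starProjection_apply_le _ _).trans (norm_Zp 1 g).le
  have h4 : g = 0 := by
    rw [← norm_eq_zero]
    nlinarith [norm_nonneg g]
  rw [hg, sub_eq_zero] at h4
  exact h4.symm

/-- `conj (z k_r) v` belongs to `H₋`. -/
lemma projH_star_szego {m : ℕ} {r : ℝ} (hr : |r| < 1) (v : EuclideanSpace ℂ (Fin m)) :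
    projH m (mulS (star zC * star (szego r)) (constL m v)) = 0 := by
  have h : star zC * star (szego r) = (Real.sqrt (1 - r ^ 2) : ℂ) • star zC
      + (r : ℂ) • (star zC * (star zC * star (szego r))) := by
    have e2 : star (szego r) = (Real.sqrt (1 - r ^ 2) : ℂ) • star (resC r) := by
      rw [szego, star_smul]
      simp
    have h1 : star (resC r) = 1 + (r : ℂ) • (star zC * star (resC r)) := by
      have := star_resC hr
      rw [sub_mul, one_mul, smul_mul_assoc, sub_eq_iff_eq_add] at this
      exact this
    conv_lhs => rw [e2, h1]
    rw [e2]
    ext θ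
    simp only [ContinuousMap.smul_apply, ContinuousMap.add_apply, ContinuousMap.mul_apply,
      ContinuousMap.one_apply, smul_eq_mul]
    ring
  have hz : (mulS (star zC) : L2 m →L[ℂ] L2 m) = Zp (-1) := by
    rw [Zp]
    congr 1
    ext θ
    exact fourier_neg.symm
  set f := mulS (star zC * star (szego r)) (constL m v) with hf
  have h1 : f = (Real.sqrt (1 - r ^ 2) : ℂ) • Zp (-1) (constL m v) + (r : ℂ) • Zp (-1) f := by
    conv_lhs => rw [hf, h]
    rw [map_add, map_smul, map_smul, mulS_mul, hz]
    rfl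
  set g := projH m f with hg
  have h2 : g = (r : ℂ) • projH m (Zp (-1) g) := by
    have e : f = (f - g) + g := by abel
    have hpg : projH m (f - g) = 0 := by
      rw [hg, map_sub, projH_apply_mem (Submodule.starProjection_apply_mem _ f), sub_self]
    have e2 := projH_Zp_neg_one (f - g) hpg
    have e3 : projH m (Zp (-1) f) = projH m (Zp (-1) g) := by
      conv_lhs => rw [e]
      rw [map_add, map_add, e2, zero_add]
    rw [← e3]
    conv_lhs => rw [hg, h1]
    rw [map_add, map_smul, map_smul, projH_Zp_neg_one_constL, smul_zero, zero_add]
  have h3 : ‖g‖ ≤ |r| * ‖g‖ := by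
    conv_lhs => rw [h2]
    rw [norm_smul, Complex.norm_real, Real.norm_eq_abs]
    exact mul_le_mul_of_nonneg_left ((norm_projH_le _).trans (norm_Zp (-1) g).le) (abs_nonneg _)
  rw [← norm_eq_zero]
  nlinarith [norm_nonneg g]

/-- The vectors `k_r v` have norm `‖v‖`, by the orthogonal decomposition
`k_r v = √(1 - r²) v + r z k_r v`. -/
lemma norm_mulS_szego {m : ℕ} {r : ℝ} (hr : |r| < 1) (v : EuclideanSpace ℂ (Fin m)) :
    ‖mulS (szego r) (constL m v)‖ = ‖v‖ := by
  set f := mulS (szego r) (constL m v) with hf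
  have hr2 : 0 < 1 - r ^ 2 := by
    have := sq_lt_one_iff_abs_lt_one r
    nlinarith [this.2 hr]
  have h1 := mulS_szego_relation hr v
  rw [← hf] at h1
  have ho : inner ℂ (constL m v) (Zp 1 f) = 0 := by
    have e : inner ℂ (constL m v) (Zp 1 f) = inner ℂ (Zp (-1) (constL m v)) f := by
      rw [inner_Zp, neg_neg]
    rw [e, hf, ← projH_szego hr v, ← Submodule.inner_starProjection_left_eq_right,
      projH_Zp_neg_one_constL, inner_zero_left]
  have h2 : ‖f‖ * ‖f‖ = (1 - r ^ 2) * (‖v‖ * ‖v‖) + r ^ 2 * (‖f‖ * ‖f‖) := by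
    have h3 := norm_add_sq_eq_norm_sq_add_norm_sq_of_inner_eq_zero
      ((Real.sqrt (1 - r ^ 2) : ℂ) • constL m v) ((r : ℂ) • Zp 1 f) (by
        rw [inner_smul_left, inner_smul_right, ho]
        simp)
    rw [← h1, norm_smul, norm_smul, norm_constL, norm_Zp, Complex.norm_real, Complex.norm_real,
      Real.norm_eq_abs, Real.norm_eq_abs, abs_of_nonneg (Real.sqrt_nonneg _)] at h3
    rw [h3]
    have h4 := Real.mul_self_sqrt hr2.le
    have h5 := abs_mul_abs_self r
    nlinarith
  have h3 : ‖f‖ * ‖f‖ = ‖v‖ * ‖v‖ := by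
    have : (1 - r ^ 2) * (‖f‖ * ‖f‖) = (1 - r ^ 2) * (‖v‖ * ‖v‖) := by linarith
    exact mul_left_cancel₀ hr2.ne' this
  exact (mul_self_inj (norm_nonneg _) (norm_nonneg _)).1 h3

/-- Away from `z = 1` the kernel `k_r` is small. -/
lemma norm_one_sub_mul_szego_le {r : ℝ} (hr0 : 0 ≤ r) (hr : r < 1) (θ : UnitAddCircle) :
    ‖(1 - zC θ) * szego r θ‖ ≤ 2 * Real.sqrt (1 - r ^ 2) := by
  have hz : ‖zC θ‖ = 1 := by rw [zC, fourier_apply, Circle.norm_coe]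
  have h1 : (1 - (r : ℂ) * zC θ) * resC r θ = 1 := by
    have := congrArg (fun f : C(UnitAddCircle, ℂ) => f θ)
      (one_sub_mul_resC (r := r) (by rwa [abs_of_nonneg hr0]))
    simpa using this
  have h2 : 1 - r ≤ ‖1 - (r : ℂ) * zC θ‖ := by
    have := norm_sub_norm_le (1 : ℂ) ((r : ℂ) * zC θ)
    rw [norm_mul, hz, Complex.norm_real, Real.norm_eq_abs, abs_of_nonneg hr0] at this
    simpa using this
  have h3 : ‖1 - zC θ‖ ≤ 2 * ‖1 - (r : ℂ) * zC θ‖ := by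
    have e : 1 - zC θ = (1 - (r : ℂ) * zC θ) - ((1 - r : ℝ) : ℂ) * zC θ := by push_cast; ring
    have := norm_sub_le (1 - (r : ℂ) * zC θ) (((1 - r : ℝ) : ℂ) * zC θ)
    rw [← e, norm_mul, hz, Complex.norm_real, Real.norm_eq_abs,
      abs_of_nonneg (by linarith : 0 ≤ 1 - r)] at this
    linarith
  have h4 : ‖1 - (r : ℂ) * zC θ‖ * ‖resC r θ‖ = 1 := by rw [← norm_mul, h1, norm_one]
  change ‖(1 - zC θ) * ((Real.sqrt (1 - r ^ 2) : ℂ) * resC r θ)‖ ≤ _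
  rw [norm_mul, norm_mul, Complex.norm_real, Real.norm_eq_abs, abs_of_nonneg (Real.sqrt_nonneg _)]
  calc ‖1 - zC θ‖ * (Real.sqrt (1 - r ^ 2) * ‖resC r θ‖)
      ≤ (2 * ‖1 - (r : ℂ) * zC θ‖) * (Real.sqrt (1 - r ^ 2) * ‖resC r θ‖) := by gcongr
    _ = 2 * Real.sqrt (1 - r ^ 2) * (‖1 - (r : ℂ) * zC θ‖ * ‖resC r θ‖) := by ring
    _ = _ := by rw [h4, mul_one]


/-! ### Concentration at `z = 1` -/

/-- A bounded family `x` in `L²(S¹, ℂᵐ)` such that `x - z x → 0` converges weakly to zero: the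
Fourier coefficients of `x` are asymptotically constant over longer and longer ranges. -/
lemma tendsto_inner_mode_of_shift {m : ℕ} {α : Type*} {l : Filter α} {x : α → L2 m} {C : ℝ}
    (hx : ∀ a, ‖x a‖ ≤ C) (h : Tendsto (fun a => ‖x a - Zp 1 (x a)‖) l (𝓝 0)) (q : ℤ × Fin m) :
    Tendsto (fun a => inner ℂ (mode q) (x a)) l (𝓝 0) := by
  have key : ∀ (P : ℕ) (a : α), (P : ℝ) * ‖inner ℂ (mode q) (x a)‖ ^ 2 ≤
      2 * C ^ 2 + 2 * (P : ℝ) ^ 3 * ‖x a - Zp 1 (x a)‖ ^ 2 := by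
    intro P a
    set δ := ‖x a - Zp 1 (x a)‖ with hδ
    let y : ℕ → ℂ := fun p => inner ℂ (mode (q.1 + p, q.2) : L2 m) (x a)
    have hstep : ∀ p, ‖y (p + 1) - y p‖ ≤ δ := by
      intro p
      have e : y p = inner ℂ (mode (q.1 + (p + 1 : ℕ), q.2) : L2 m) (Zp 1 (x a)) := by
        have h1 := inner_Zp (-1) (mode (q.1 + (p + 1 : ℕ), q.2) : L2 m) (x a)
        rw [neg_neg, Zp_mode] at h1
        rw [← h1]
        change inner ℂ (mode (q.1 + p, q.2) : L2 m) (x a) = _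
        congr 3
        push_cast
        ring
      rw [e, ← inner_sub_right]
      refine (norm_inner_le_norm _ _).trans ?_
      rw [(mode_orthonormal m).1, one_mul]
    have hy : ∀ p : ℕ, ‖y 0‖ ≤ ‖y p‖ + p * δ := by
      intro p
      induction p with
      | zero => simp
      | succ p ih =>
        have h1 := hstep p
        have h2 := norm_sub_norm_le (y p) (y (p + 1))
        rw [norm_sub_rev] at h2
        push_cast
        linarith
    have hsum : ∑ p ∈ Finset.range P, ‖y p‖ ^ 2 ≤ C ^ 2 := by
      have hinj : Function.Injective fun p : ℕ => ((q.1 + p, q.2) : ℤ × Fin m) := by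
        intro p p' hp
        simpa using congrArg Prod.fst hp
      have ho := (mode_orthonormal m).comp _ hinj
      exact (ho.sum_inner_products_le (x a)).trans (pow_le_pow_left₀ (norm_nonneg _) (hx a) 2)
    have h1 : ∀ p ∈ Finset.range P, ‖y 0‖ ^ 2 ≤ 2 * ‖y p‖ ^ 2 + 2 * (P : ℝ) ^ 2 * δ ^ 2 := by
      intro p hp
      have hpP : (p : ℝ) ≤ P := by exact_mod_cast (Finset.mem_range.1 hp).le
      have hδ0 : 0 ≤ δ := norm_nonneg _
      have h2 : ‖y 0‖ ≤ ‖y p‖ + P * δ :=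
        (hy p).trans (by nlinarith)
      refine (pow_le_pow_left₀ (norm_nonneg _) h2 2).trans ((add_sq_le).trans (le_of_eq ?_))
      ring
    have h2 := Finset.sum_le_sum h1
    simp only [Finset.sum_const, Finset.card_range, nsmul_eq_mul, Finset.sum_add_distrib,
      ← Finset.mul_sum] at h2
    have h3 : y 0 = inner ℂ (mode q) (x a) := by simp [y]
    rw [h3] at h2
    nlinarith
  rw [Metric.tendsto_nhds]
  intro ε hε
  obtain ⟨P, hP⟩ := exists_nat_gt (4 * C ^ 2 / ε ^ 2 + 1)
  have hP0 : (0 : ℝ) < P := lt_of_lt_of_le (by positivity) hP.le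
  have h1 : Tendsto (fun a => 2 * (P : ℝ) ^ 3 * ‖x a - Zp 1 (x a)‖ ^ 2) l (𝓝 0) := by
    simpa using (h.pow 2).const_mul (2 * (P : ℝ) ^ 3)
  filter_upwards [h1.eventually_lt_const (show 0 < (P : ℝ) * ε ^ 2 / 2 by positivity)] with a ha
  rw [dist_zero_right]
  have h2 := key P a
  have h3 : 4 * C ^ 2 < P * ε ^ 2 := by
    have : 4 * C ^ 2 / ε ^ 2 < P := by linarith
    rwa [div_lt_iff₀ (by positivity)] at this
  refine lt_of_pow_lt_pow_left₀ 2 hε.le ?_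
  refine lt_of_mul_lt_mul_left ?_ hP0.le
  linarith

lemma tendsto_sqrt_one_sub_sq :
    Tendsto (fun r : ℝ => 2 * Real.sqrt (1 - r ^ 2)) (𝓝[<] 1) (𝓝 0) := by
  have h : Continuous fun r : ℝ => 2 * Real.sqrt (1 - r ^ 2) := by fun_prop
  have h2 := (h.tendsto 1).mono_left (nhdsWithin_le_nhds (s := Iio 1))
  simpa using h2

lemma eventually_mem_Ico_zero_one : ∀ᶠ r : ℝ in 𝓝[<] 1, 0 ≤ r ∧ r < 1 := by
  filter_upwards [self_mem_nhdsWithin, mem_nhdsWithin_of_mem_nhds (Ioi_mem_nhds zero_lt_one)]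
    with r h1 h2
  exact ⟨le_of_lt h2, h1⟩

lemma abs_lt_one_of_mem {r : ℝ} (h : 0 ≤ r ∧ r < 1) : |r| < 1 := by
  rw [abs_of_nonneg h.1]
  exact h.2

lemma mulS_apply_mul {m : ℕ} (g h : C(UnitAddCircle, ℂ)) (f : L2 m) :
    mulS (g * h) f = mulS g (mulS h f) := by
  rw [mulS_mul]
  rfl

lemma star_zC_eq : star zC = (fourier (-1) : C(UnitAddCircle, ℂ)) := by
  ext θ
  exact fourier_neg.symm

lemma norm_zC (θ : UnitAddCircle) : ‖zC θ‖ = 1 := by rw [zC, fourier_apply, Circle.norm_coe]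

lemma norm_mulS_apply_of_norm_one {m : ℕ} {g : C(UnitAddCircle, ℂ)} (h : ∀ θ, ‖g θ‖ = 1)
    (f : L2 m) : ‖mulS g f‖ ≤ ‖f‖ := by
  have := (mulS g).le_of_opNorm_le (norm_mulS_le (m := m) g zero_le_one fun θ => (h θ).le) f
  rwa [one_mul] at this

lemma norm_blaschke {r : ℝ} (hr : |r| < 1) (θ : UnitAddCircle) : ‖blaschke r θ‖ = 1 := by
  have h := congrArg (fun f : C(UnitAddCircle, ℂ) => f θ) (star_blaschke_mul_blaschke hr)
  simp only [ContinuousMap.mul_apply, ContinuousMap.star_apply, ContinuousMap.one_apply] at h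
  have h2 := congrArg norm h
  rw [norm_mul, norm_star, norm_one] at h2
  nlinarith [norm_nonneg (blaschke r θ)]

/-- If `|g| = |k_r|` pointwise, `g v` is asymptotically invariant under the shift. -/
lemma norm_sub_shift_le {m : ℕ} {r : ℝ} (h0 : 0 ≤ r) (hr : r < 1) {g : C(UnitAddCircle, ℂ)}
    (hg : ∀ θ, ‖g θ‖ = ‖szego r θ‖) (v : EuclideanSpace ℂ (Fin m)) :
    ‖mulS g (constL m v) - Zp 1 (mulS g (constL m v))‖ ≤ 2 * Real.sqrt (1 - r ^ 2) * ‖v‖ := by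
  have e : mulS g (constL m v) - Zp 1 (mulS g (constL m v)) =
      mulS ((1 - zC) * g) (constL m v) := by
    rw [sub_mul, one_mul, map_sub, sub_apply, mulS_apply_mul]
    rfl
  rw [e, ← norm_constL v]
  refine ContinuousLinearMap.le_of_opNorm_le _ (norm_mulS_le _ (by positivity) fun θ => ?_) _
  have := norm_one_sub_mul_szego_le h0 hr θ
  rw [norm_mul, ← hg, ← norm_mul] at this
  exact this

/-- If `|g_r| = |k_r|` pointwise, then the vectors `g_r v` are bounded and, as `r → 1`,
asymptotically invariant under the shift. Hence they converge weakly to zero, and a Hilbert–Schmidt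
operator maps them to a null family. -/
lemma tendsto_hs_szego {m : ℕ} {T : L2 m →L[ℂ] L2 m} (hT : Summable fun q => ‖T (mode q)‖ ^ 2)
    (v : EuclideanSpace ℂ (Fin m)) {g : ℝ → C(UnitAddCircle, ℂ)}
    (hg : ∀ r, 0 ≤ r → r < 1 → ∀ θ, ‖g r θ‖ = ‖szego r θ‖) :
    Tendsto (fun r => T (mulS (g r) (constL m v))) (𝓝[<] 1) (𝓝 0) := by
  classical
  let x : ℝ → L2 m := fun r => if 0 ≤ r ∧ r < 1 then mulS (g r) (constL m v) else 0
  have hx : ∀ r, ‖x r‖ ≤ ‖v‖ := by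
    intro r
    simp only [x]
    split_ifs with h
    · have h1 := norm_mulS_constL_sq (g r) v
      have h2 := norm_mulS_constL_sq (szego r) v
      simp only [hg r h.1 h.2] at h1
      rw [← h2, norm_mulS_szego (abs_lt_one_of_mem h)] at h1
      exact ((sq_eq_sq₀ (norm_nonneg _) (norm_nonneg _)).1 h1).le
    · simp
  have hshift : Tendsto (fun r => ‖x r - Zp 1 (x r)‖) (𝓝[<] 1) (𝓝 0) := by
    have h1 := tendsto_sqrt_one_sub_sq.mul_const ‖v‖
    rw [zero_mul] at h1
    refine squeeze_zero' (Eventually.of_forall fun _ => norm_nonneg _) ?_ h1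
    filter_upwards [eventually_mem_Ico_zero_one] with r h
    simp only [x, if_pos h]
    exact norm_sub_shift_le h.1 h.2 (hg r h.1 h.2) v
  have h := tendsto_apply_zero_of_weak (modeBasis m) T (by simpa using hT) hx
    (l := 𝓝[<] 1) (fun q => by simpa using tendsto_inner_mode_of_shift hx hshift q)
  refine h.congr' ?_
  filter_upwards [eventually_mem_Ico_zero_one] with r h
  simp only [x, if_pos h]

/-- As `r → 1`, the vector `k_r v` gets close to the range of `P_W - b_r P_W b_r⁻¹`, for each point
`W` of the restricted Grassmannian. -/
lemma tendsto_projW_blaschke {m : ℕ} {W : Submodule ℂ (L2 m)} (hW : IsHSDiff W)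
    (v : EuclideanSpace ℂ (Fin m)) :
    Tendsto (fun r => projW W (mulS (szego r) (constL m v))
      - mulS (blaschke r) (projW W (mulS (star (blaschke r)) (mulS (szego r) (constL m v))))
      - mulS (szego r) (constL m v)) (𝓝[<] 1) (𝓝 0) := by
  have h1 := tendsto_hs_szego hW v (g := szego) (fun _ _ _ _ => rfl)
  have h2 := tendsto_hs_szego hW v (g := fun r => star zC * star (szego r)) (fun r _ _ θ => by
    rw [ContinuousMap.mul_apply, norm_mul, ContinuousMap.star_apply, norm_star, norm_zC, one_mul,
      ContinuousMap.star_apply, norm_star])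
  have h3 := h1.norm.add h2.norm
  rw [norm_zero, add_zero] at h3
  refine squeeze_zero_norm' ?_ h3
  filter_upwards [eventually_mem_Ico_zero_one] with r hr
  have hr' := abs_lt_one_of_mem hr
  rw [← mulS_apply_mul, star_blaschke_mul_szego hr']
  set f := mulS (szego r) (constL m v) with hf
  set g := mulS (star zC * star (szego r)) (constL m v) with hg
  have e : projW W f - mulS (blaschke r) (projW W g) - f =
      (projW W - projH m) f - mulS (blaschke r) ((projW W - projH m) g) := by
    rw [sub_apply, sub_apply, projH_szego hr', projH_star_szego hr', sub_zero]
    abel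
  rw [e]
  refine (norm_sub_le _ _).trans (add_le_add le_rfl ?_)
  exact norm_mulS_apply_of_norm_one (norm_blaschke hr') _

lemma zC_eq_one_iff (θ : UnitAddCircle) : zC θ = 1 ↔ θ = 0 := by
  rw [zC, fourier_one]
  constructor
  · intro h
    have h1 : AddCircle.toCircle θ = AddCircle.toCircle (0 : UnitAddCircle) := by
      rw [AddCircle.toCircle_zero]
      exact Subtype.ext h
    exact AddCircle.injective_toCircle one_ne_zero h1
  · rintro rfl
    simp

/-- The functions `|k_r|²` form an approximate identity at `z = 1`. -/
lemma tendsto_szego_mulOp {m n : ℕ} (G : C(UnitAddCircle, EHom m n))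
    (v : EuclideanSpace ℂ (Fin m)) (h0 : G 0 v = 0) :
    Tendsto (fun r => mulS (szego r) (mulOp G (constL m v))) (𝓝[<] 1) (𝓝 0) := by
  -- away from `0`, `G v` is dominated by a multiple of `1 - z`
  have hC : ∀ ε > 0, ∃ C ≥ 0, ∀ θ, ‖G θ v‖ ≤ ε + C * ‖1 - zC θ‖ := by
    intro ε hε
    let K : Set UnitAddCircle := {θ | ε ≤ ‖G θ v‖}
    have hK : IsCompact K := (isClosed_le continuous_const (by fun_prop)).isCompact
    have hne : ∀ θ ∈ K, ‖1 - zC θ‖ ≠ 0 := by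
      intro θ hθ h
      rw [norm_eq_zero, sub_eq_zero, eq_comm, zC_eq_one_iff] at h
      subst h
      have : ε ≤ ‖G 0 v‖ := hθ
      rw [h0, norm_zero] at this
      linarith
    have hcont : ContinuousOn (fun θ => ‖G θ v‖ / ‖1 - zC θ‖) K :=
      ContinuousOn.div (by fun_prop) (by fun_prop) hne
    obtain ⟨C, hC⟩ := hK.bddAbove_image hcont
    refine ⟨max C 0, le_max_right _ _, fun θ => ?_⟩
    by_cases hθ : θ ∈ K
    · have h1 : ‖G θ v‖ / ‖1 - zC θ‖ ≤ max C 0 := (hC ⟨θ, hθ, rfl⟩).trans (le_max_left _ _)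
      rw [div_le_iff₀ (lt_of_le_of_ne (norm_nonneg _) (hne θ hθ).symm)] at h1
      linarith
    · have h1 : ‖G θ v‖ < ε := not_le.1 hθ
      have : 0 ≤ max C 0 * ‖1 - zC θ‖ := by positivity
      linarith
  rw [Metric.tendsto_nhds]
  intro ε hε
  obtain ⟨C, hC0, hC⟩ := hC (ε / 2) (by positivity)
  have h1 := tendsto_sqrt_one_sub_sq.const_mul C
  rw [mul_zero] at h1
  filter_upwards [eventually_mem_Ico_zero_one,
    h1.eventually_lt_const (show 0 < ε / 2 by positivity)] with r hr hlt
  rw [dist_zero_right]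
  -- the scalar majorant, as a function in `L²(S¹, ℂ¹)`
  let e1 : EuclideanSpace ℂ (Fin 1) := EuclideanSpace.single 0 1
  have he1 : ‖e1‖ = 1 := by simp [e1]
  let w : C(UnitAddCircle, ℂ) := ⟨fun θ => ((C * ‖(1 - zC θ) * szego r θ‖ : ℝ) : ℂ), by fun_prop⟩
  have hle : ‖mulS (szego r) (mulOp G (constL m v))‖ ≤
      ‖(ε / 2 : ℂ) • mulS (⟨fun θ => ((‖szego r θ‖ : ℝ) : ℂ), by fun_prop⟩) (constL 1 e1)
        + mulS w (constL 1 e1)‖ := by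
    refine Lp.norm_le_norm_of_ae_le ?_
    filter_upwards [mulS_coe (szego r) (mulOp G (constL m v)), mulOp_coe G (constL m v),
      constL_coe v, constL_coe e1, mulS_coe w (constL 1 e1),
      mulS_coe (⟨fun θ => ((‖szego r θ‖ : ℝ) : ℂ), by fun_prop⟩) (constL 1 e1),
      Lp.coeFn_add ((ε / 2 : ℂ) • mulS (⟨fun θ => ((‖szego r θ‖ : ℝ) : ℂ), by fun_prop⟩)
        (constL 1 e1)) (mulS w (constL 1 e1)),
      Lp.coeFn_smul (ε / 2 : ℂ) (mulS (⟨fun θ => ((‖szego r θ‖ : ℝ) : ℂ), by fun_prop⟩)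
        (constL 1 e1))] with θ a1 a2 a3 a4 a5 a6 a7 a8
    rw [a7, Pi.add_apply, a8, Pi.smul_apply, a6, a5, a4, a1, a2, a3, smul_smul, ← add_smul,
      norm_smul, norm_smul, he1, mul_one]
    have e : ((ε / 2 : ℂ) * ((‖szego r θ‖ : ℝ) : ℂ) + ((C * ‖(1 - zC θ) * szego r θ‖ : ℝ) : ℂ)) =
        ((ε / 2 * ‖szego r θ‖ + C * ‖(1 - zC θ) * szego r θ‖ : ℝ) : ℂ) := by push_cast; rfl
    change _ ≤ ‖((ε / 2 : ℂ) * ((‖szego r θ‖ : ℝ) : ℂ)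
      + ((C * ‖(1 - zC θ) * szego r θ‖ : ℝ) : ℂ))‖
    rw [e, Complex.norm_real, Real.norm_eq_abs, abs_of_nonneg (by positivity), norm_mul]
    have := mul_le_mul_of_nonneg_left (hC θ) (norm_nonneg (szego r θ))
    linarith
  refine lt_of_le_of_lt (hle.trans (norm_add_le _ _)) ?_
  have b1 : ‖(ε / 2 : ℂ) • (mulS (⟨fun θ => ((‖szego r θ‖ : ℝ) : ℂ), by fun_prop⟩)
      (constL 1 e1))‖ = ε / 2 := by
    have h2 := norm_mulS_constL_sq (⟨fun θ => ((‖szego r θ‖ : ℝ) : ℂ), by fun_prop⟩) e1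
    have h3 := norm_mulS_constL_sq (szego r) e1
    rw [norm_mulS_szego (abs_lt_one_of_mem hr), he1] at h3
    simp only [ContinuousMap.coe_mk, Complex.norm_real, norm_norm] at h2
    rw [he1, ← h3] at h2
    have h4 := (sq_eq_sq₀ (norm_nonneg _) zero_le_one).1 h2
    rw [norm_smul, h4, mul_one]
    have : (ε / 2 : ℂ) = ((ε / 2 : ℝ) : ℂ) := by push_cast; rfl
    rw [this, Complex.norm_real, Real.norm_eq_abs, abs_of_pos (by positivity)]
  have b2 : ‖mulS w (constL 1 e1)‖ ≤ C * (2 * Real.sqrt (1 - r ^ 2)) := by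
    have h2 := (mulS w).le_of_opNorm_le (norm_mulS_le (m := 1) w
      (C := C * (2 * Real.sqrt (1 - r ^ 2))) (by positivity) fun θ => ?_) (constL 1 e1)
    · rwa [norm_constL, he1, mul_one] at h2
    · change ‖((C * ‖(1 - zC θ) * szego r θ‖ : ℝ) : ℂ)‖ ≤ _
      rw [Complex.norm_real, Real.norm_eq_abs, abs_of_nonneg (by positivity)]
      exact mul_le_mul_of_nonneg_left (norm_one_sub_mul_szego_le hr.1 hr.2 θ) hC0
  rw [b1]
  linarith

/-- The operator of multiplication by `k_r` conjugates `P - z P z⁻¹` to `P - b_r P b_r⁻¹`. -/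
lemma szego_conj {m : ℕ} {r : ℝ} (hr : |r| < 1) (P : L2 m →L[ℂ] L2 m) (f : L2 m) :
    mulS (szego r) ((P - Zp 1 ∘L P ∘L Zp (-1)) (mulS (star (szego r)) f)) =
      P f - mulS (blaschke r) (P (mulS (star (blaschke r)) f)) := by
  let U : L2 m →L[ℂ] L2 m := mulS zC
  let U' : L2 m →L[ℂ] L2 m := mulS (star zC)
  let R : L2 m →L[ℂ] L2 m := mulS (resC r)
  let R' : L2 m →L[ℂ] L2 m := mulS (star (resC r))
  have hmul : ∀ g h : C(UnitAddCircle, ℂ), (mulS (g * h) : L2 m →L[ℂ] L2 m) = mulS g * mulS h :=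
    mulS_mul
  have h1 : R * (1 - (r : ℂ) • U) = 1 := by
    have := congrArg (mulS (m := m)) (one_sub_mul_resC hr)
    rwa [mul_comm, hmul, map_sub, map_smul, mulS_one] at this
  have h2 : (1 - (r : ℂ) • U') * R' = 1 := by
    have := congrArg (mulS (m := m)) (star_resC hr)
    rwa [hmul, map_sub, map_smul, mulS_one] at this
  have hB : (mulS (blaschke r) : L2 m →L[ℂ] L2 m) = R * (U - (r : ℂ) • 1) := by
    rw [blaschke, mul_comm, hmul, map_sub, map_smul, mulS_one]
  have hB' : (mulS (star (blaschke r)) : L2 m →L[ℂ] L2 m) = (U' - (r : ℂ) • 1) * R' := by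
    have e1 : star (blaschke r) = (star zC - (r : ℂ) • 1) * star (resC r) := by
      rw [blaschke, star_mul, mul_comm, star_sub, star_smul, star_one]
      simp
    rw [e1, hmul, map_sub, map_smul, mulS_one]
  have hK : (mulS (szego r) : L2 m →L[ℂ] L2 m) = (Real.sqrt (1 - r ^ 2) : ℂ) • R := by
    rw [szego, map_smul]
  have hK' : (mulS (star (szego r)) : L2 m →L[ℂ] L2 m) = (Real.sqrt (1 - r ^ 2) : ℂ) • R' := by
    have e2 : star (szego r) = (Real.sqrt (1 - r ^ 2) : ℂ) • star (resC r) := by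
      rw [szego, star_smul]
      simp
    rw [e2, map_smul]
  have hc : (Real.sqrt (1 - r ^ 2) : ℂ) * (Real.sqrt (1 - r ^ 2) : ℂ) = 1 - (r : ℂ) * r := by
    rw [← Complex.ofReal_mul, Real.mul_self_sqrt]
    · push_cast; ring
    · nlinarith [(sq_lt_one_iff_abs_lt_one r).2 hr]
  have hU' : (Zp (-1) : L2 m →L[ℂ] L2 m) = U' := by
    rw [Zp, ← star_zC_eq]
  have main : ((Real.sqrt (1 - r ^ 2) : ℂ) • R) * (P - U * (P * U')) *
      ((Real.sqrt (1 - r ^ 2) : ℂ) • R') =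
      P - (R * (U - (r : ℂ) • 1)) * (P * ((U' - (r : ℂ) • 1) * R')) := by
    have e1 : P = R * ((1 - (r : ℂ) • U) * P * (1 - (r : ℂ) • U')) * R' := by
      calc P = (R * (1 - (r : ℂ) • U)) * P * ((1 - (r : ℂ) • U') * R') := by
            rw [h1, h2, one_mul, mul_one]
        _ = _ := by noncomm_ring
    have e2 : (1 - (r : ℂ) • U) * P * (1 - (r : ℂ) • U') -
        (U - (r : ℂ) • 1) * P * (U' - (r : ℂ) • 1) =
        (1 - (r : ℂ) * r) • (P - U * (P * U')) := by
      simp only [sub_mul, mul_sub, smul_mul_assoc, mul_smul_comm, one_mul, mul_one, smul_sub,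
        sub_smul, one_smul, mul_smul, mul_assoc]
      abel
    calc ((Real.sqrt (1 - r ^ 2) : ℂ) • R) * (P - U * (P * U')) *
          ((Real.sqrt (1 - r ^ 2) : ℂ) • R')
        = R * ((1 - (r : ℂ) * r) • (P - U * (P * U'))) * R' := by
          rw [smul_mul_assoc, smul_mul_assoc, mul_smul_comm, smul_smul, hc, mul_smul_comm,
            smul_mul_assoc]
      _ = R * ((1 - (r : ℂ) • U) * P * (1 - (r : ℂ) • U')) * R' -
          R * ((U - (r : ℂ) • 1) * P * (U' - (r : ℂ) • 1)) * R' := by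
          rw [← e2, mul_sub, sub_mul]
      _ = _ := by
          rw [← e1]
          simp only [mul_assoc]
  have := congrArg (fun A : L2 m →L[ℂ] L2 m => A f) main
  rw [hK, hK', hB, hB', hU']
  exact this


/-! ### Shift-stable points of the Grassmannian -/

/-- Strong convergence of a bounded sequence of operators may be checked on the Fourier modes. -/
lemma tendsto_of_tendsto_mode {m : ℕ} {α : Type*} {l : Filter α} {A : α → L2 m →L[ℂ] L2 m}
    {B : L2 m →L[ℂ] L2 m} (hA : ∀ a f, ‖A a f‖ ≤ ‖f‖)
    (h : ∀ q, Tendsto (fun a => A a (mode q)) l (𝓝 (B (mode q)))) (f : L2 m) :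
    Tendsto (fun a => A a f) l (𝓝 (B f)) := by
  have hspan : ∀ g ∈ Submodule.span ℂ (Set.range (modeBasis m)),
      Tendsto (fun a => A a g) l (𝓝 (B g)) := by
    intro g hg
    induction hg using Submodule.span_induction with
    | mem g hg =>
      obtain ⟨q, rfl⟩ := hg
      simpa using h q
    | zero => simpa using tendsto_const_nhds
    | add g g' _ _ hg hg' => simpa using hg.add hg'
    | smul c g _ hg => simpa using hg.const_smul c
  have hd : f ∈ closure ((Submodule.span ℂ (Set.range (modeBasis m)) : Submodule ℂ (L2 m)) :
      Set (L2 m)) := by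
    have := (modeBasis m).dense_span
    have h2 := Submodule.dense_iff_topologicalClosure_eq_top.2 this
    exact h2 f
  rw [Metric.tendsto_nhds]
  intro ε hε
  obtain ⟨g, hg, hfg⟩ := Metric.mem_closure_iff.1 hd (ε / (2 * (2 + ‖B‖))) (by positivity)
  have h1 := Metric.tendsto_nhds.1 (hspan g hg) (ε / 2) (by positivity)
  filter_upwards [h1] with a ha
  rw [dist_eq_norm] at ha hfg ⊢
  have e : A a f - B f = A a (f - g) + (A a g - B g) - B (f - g) := by
    rw [map_sub, map_sub]
    abel
  rw [e]
  have h2 := norm_sub_le (A a (f - g) + (A a g - B g)) (B (f - g))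
  have h3 := norm_add_le (A a (f - g)) (A a g - B g)
  have h4 := hA a (f - g)
  have h5 := B.le_opNorm (f - g)
  have h6 : ‖f - g‖ * (2 * (2 + ‖B‖)) < ε := by
    rwa [lt_div_iff₀ (by positivity)] at hfg
  nlinarith [norm_nonneg (f - g), norm_nonneg B]

/-- The conjugate `zⁿ A z⁻ⁿ` of an operator. -/
def conjZ {m : ℕ} (n : ℤ) (A : L2 m →L[ℂ] L2 m) : L2 m →L[ℂ] L2 m := Zp n ∘L A ∘L Zp (-n)

lemma conjZ_apply {m : ℕ} (n : ℤ) (A : L2 m →L[ℂ] L2 m) (f : L2 m) :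
    conjZ n A f = Zp n (A (Zp (-n) f)) := rfl

lemma conjZ_projH_mode {m : ℕ} (n : ℤ) (q : ℤ × Fin m) :
    conjZ n (projH m) (mode q) = if n ≤ q.1 then mode q else 0 := by
  rw [conjZ_apply, Zp_mode, projH_mode]
  by_cases h : n ≤ q.1
  · rw [if_pos h, if_pos (by change 0 ≤ -n + q.1; omega), Zp_mode]
    simp
  · rw [if_neg h, if_neg (by change ¬ 0 ≤ -n + q.1; omega), map_zero]

lemma tendsto_inner_mode_Zp {m : ℕ} (g : L2 m) (q : ℤ × Fin m) :
    Tendsto (fun n : ℤ => inner ℂ (mode q) (Zp (-n) g)) cofinite (𝓝 0) := by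
  have h1 : ∀ n : ℤ, inner ℂ (mode q) (Zp (-n) g) = inner ℂ (mode (n + q.1, q.2)) g := by
    intro n
    rw [← Zp_mode, inner_Zp]
  simp only [h1]
  have h2 := (hasSum_norm_inner_sq (modeBasis m) g).summable.tendsto_cofinite_zero
  have hinj : Function.Injective fun n : ℤ => ((n + q.1, q.2) : ℤ × Fin m) := by
    intro n n' h
    simpa using congrArg Prod.fst h
  have h3 := h2.comp hinj.tendsto_cofinite
  rw [tendsto_zero_iff_norm_tendsto_zero]
  have h4 := h3.sqrt
  simpa [Function.comp_def, Real.sqrt_sq] using h4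

lemma norm_conjZ_projH_le {m : ℕ} (n : ℤ) (f : L2 m) : ‖conjZ n (projH m) f‖ ≤ ‖f‖ := by
  rw [conjZ_apply, norm_Zp]
  exact (norm_projH_le _).trans (norm_Zp _ _).le

lemma tendsto_conjZ_sub {m : ℕ} {W : Submodule ℂ (L2 m)} (hW : IsHSDiff W) (g : L2 m) :
    Tendsto (fun n => conjZ n (projW W) g - conjZ n (projH m) g) cofinite (𝓝 0) := by
  have h := tendsto_apply_zero_of_weak (modeBasis m) (projW W - projH m)
    (by simpa [IsHSDiff] using hW)
    (x := fun n : ℤ => Zp (-n) g) (C := ‖g‖) (fun n => (norm_Zp _ _).le)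
    (l := cofinite) (fun q => by simpa using tendsto_inner_mode_Zp g q)
  rw [tendsto_zero_iff_norm_tendsto_zero] at h ⊢
  refine h.congr fun n => ?_
  rw [conjZ_apply, conjZ_apply, ← map_sub, norm_Zp]
  rfl

/-- `⋂ zⁿ W = 0`. -/
lemma tendsto_conjZ_atTop {m : ℕ} {W : Submodule ℂ (L2 m)} (hW : IsHSDiff W) (g : L2 m) :
    Tendsto (fun n => conjZ n (projW W) g) atTop (𝓝 0) := by
  have h1 := (tendsto_conjZ_sub hW g).mono_left
    (show (atTop : Filter ℤ) ≤ cofinite from Int.cofinite_eq ▸ le_sup_right)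
  have h2 : Tendsto (fun n => conjZ n (projH m) g) atTop (𝓝 ((0 : L2 m →L[ℂ] L2 m) g)) := by
    refine tendsto_of_tendsto_mode norm_conjZ_projH_le (fun q => ?_) g
    refine tendsto_const_nhds.congr' ?_
    filter_upwards [eventually_gt_atTop q.1] with n hn
    rw [conjZ_projH_mode, if_neg (by omega)]
    rfl
  simpa using h1.add h2

/-- `⋃ z⁻ⁿ W` is dense. -/
lemma tendsto_conjZ_atBot {m : ℕ} {W : Submodule ℂ (L2 m)} (hW : IsHSDiff W) (g : L2 m) :
    Tendsto (fun n => conjZ n (projW W) g) atBot (𝓝 g) := by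
  have h1 := (tendsto_conjZ_sub hW g).mono_left
    (show (atBot : Filter ℤ) ≤ cofinite from Int.cofinite_eq ▸ le_sup_left)
  have h2 : Tendsto (fun n => conjZ n (projH m) g) atBot
      (𝓝 ((ContinuousLinearMap.id ℂ (L2 m)) g)) := by
    refine tendsto_of_tendsto_mode norm_conjZ_projH_le (fun q => ?_) g
    refine tendsto_const_nhds.congr' ?_
    filter_upwards [eventually_le_atBot q.1] with n hn
    rw [conjZ_projH_mode, if_pos hn]
    rfl
  simpa using h1.add h2

/-- A family of vectors all of whose shifts are orthonormal has at most `m` members: by Parseval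
and Bessel, `n = ∑ᵢ ∑ₚ ∑ⱼ |⟨zᵖ eⱼ, vᵢ⟩|² = ∑ⱼ ∑ᵢ ∑ₚ |⟨eⱼ, z⁻ᵖ vᵢ⟩|² ≤ m`. -/
lemma card_le_of_orthonormal_shifts {m n : ℕ} (v : Fin n → L2 m)
    (hv : Orthonormal ℂ fun p : Fin n × ℤ => Zp p.2 (v p.1)) : n ≤ m := by
  have h1 : ∀ i, HasSum (fun q : ℤ × Fin m => ‖inner ℂ (mode q) (v i)‖ ^ 2) 1 := by
    intro i
    have h := hasSum_norm_inner_sq (modeBasis m) (v i)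
    have hn := hv.1 (i, 0)
    simp only [norm_Zp] at hn
    simpa [hn] using h
  have h2 : ∀ i j, Summable fun p : ℤ => ‖inner ℂ (mode (p, j)) (v i)‖ ^ 2 := fun i j =>
    (h1 i).summable.comp_injective (i := fun p : ℤ => (p, j)) fun p p' h => congrArg Prod.fst h
  have h3 : ∀ i, ∑ j, ∑' p : ℤ, ‖inner ℂ (mode (p, j)) (v i)‖ ^ 2 = 1 := by
    intro i
    have h4 : HasSum (fun q : Fin m × ℤ => ‖inner ℂ (mode (q.2, q.1)) (v i)‖ ^ 2) 1 :=
      (Equiv.prodComm (Fin m) ℤ).hasSum_iff.2 (h1 i)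
    have h5 := h4.prod_fiberwise fun j => (h2 i j).hasSum
    exact (hasSum_fintype _).unique h5
  have h4 : ∀ j, ∑ i, ∑' p : ℤ, ‖inner ℂ (mode (p, j)) (v i)‖ ^ 2 ≤ 1 := by
    intro j
    have e : ∀ (i : Fin n) (p : ℤ), ‖inner ℂ (mode (p, j)) (v i)‖ ^ 2 =
        ‖inner ℂ (Zp (-p) (v i)) (mode (0, j))‖ ^ 2 := by
      intro i p
      rw [norm_inner_symm, inner_Zp, neg_neg, Zp_mode, add_zero]
    have hs : HasSum (fun ip : Fin n × ℤ => ‖inner ℂ (Zp ip.2 (v ip.1)) (mode (0, j))‖ ^ 2)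
        (∑' ip : Fin n × ℤ, ‖inner ℂ (Zp ip.2 (v ip.1)) (mode (0, j))‖ ^ 2) :=
      (hv.inner_products_summable (mode (0, j))).hasSum
    have hs2 : ∀ i, HasSum (fun p : ℤ => ‖inner ℂ (Zp p (v i)) (mode (0, j))‖ ^ 2)
        (∑' p : ℤ, ‖inner ℂ (mode (p, j)) (v i)‖ ^ 2) := by
      intro i
      have h5 := (h2 i j).hasSum
      simp only [e] at h5 ⊢
      exact (Equiv.neg ℤ).hasSum_iff.1 h5
    have h5 := (hasSum_fintype _).unique (hs.prod_fiberwise hs2)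
    rw [h5]
    refine (hv.tsum_inner_products_le (mode (0, j))).trans ?_
    rw [(mode_orthonormal m).1]
    norm_num
  have h5 : (n : ℝ) ≤ m := by
    calc (n : ℝ) = ∑ _i : Fin n, (1 : ℝ) := by simp
      _ = ∑ i, ∑ j, ∑' p : ℤ, ‖inner ℂ (mode (p, j)) (v i)‖ ^ 2 := by simp only [h3]
      _ = ∑ j, ∑ i, ∑' p : ℤ, ‖inner ℂ (mode (p, j)) (v i)‖ ^ 2 := Finset.sum_comm
      _ ≤ ∑ _j : Fin m, (1 : ℝ) := Finset.sum_le_sum fun j _ => h4 j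
      _ = m := by simp
  exact_mod_cast h5

/-- Orthogonal projections with range stable under multiplication by `z`. -/
structure IsShiftProj {m : ℕ} (P : L2 m →L[ℂ] L2 m) : Prop where
  idem : ∀ f, P (P f) = P f
  symm : ∀ f g, inner ℂ (P f) g = inner ℂ f (P g)
  stable : ∀ f, P (Zp 1 (P f)) = Zp 1 (P f)

namespace IsShiftProj

variable {m : ℕ} {P : L2 m →L[ℂ] L2 m} (hP : IsShiftProj P)

include hP

lemma apply_Zp_one {f : L2 m} (hf : P f = f) : P (Zp 1 f) = Zp 1 f := by
  have := hP.stable f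
  rwa [hf] at this

lemma apply_Zp_nat {f : L2 m} (hf : P f = f) (n : ℕ) : P (Zp n f) = Zp n f := by
  induction n with
  | zero => simpa [Zp_zero] using hf
  | succ n ih =>
    have := hP.apply_Zp_one ih
    rw [Zp_apply_apply] at this
    rw [Nat.cast_succ, add_comm]
    exact this

lemma conj_idem (n : ℤ) (f : L2 m) : conjZ n P (conjZ n P f) = conjZ n P f := by
  rw [conjZ_apply, conjZ_apply, Zp_neg_apply, hP.idem]

lemma conj_symm (n : ℤ) (f g : L2 m) : inner ℂ (conjZ n P f) g = inner ℂ f (conjZ n P g) := by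
  rw [conjZ_apply, conjZ_apply, inner_Zp, hP.symm, inner_Zp, neg_neg]

/-- `zⁿ' W ⊆ zⁿ W` for `n ≤ n'`. -/
lemma conj_le {n n' : ℤ} (h : n ≤ n') (f : L2 m) :
    conjZ n P (conjZ n' P f) = conjZ n' P f := by
  rw [conjZ_apply, conjZ_apply, Zp_apply_apply]
  obtain ⟨k, hk⟩ := Int.eq_ofNat_of_zero_le (show 0 ≤ -n + n' by omega)
  rw [hk, hP.apply_Zp_nat (hP.idem _), Zp_apply_apply]
  congr 2
  omega

lemma conj_le' {n n' : ℤ} (h : n ≤ n') (f : L2 m) :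
    conjZ n' P (conjZ n P f) = conjZ n' P f := by
  refine ext_inner_right ℂ fun g => ?_
  rw [hP.conj_symm, hP.conj_symm, hP.conj_le h, ← hP.conj_symm]

/-- The projection `zⁱ P z⁻ⁱ - zʲ P z⁻ʲ`, for `i ≤ j`, onto `zⁱ W ⊖ zʲ W`. -/
lemma sub_idem {i j : ℤ} (h : i ≤ j) (f : L2 m) :
    (conjZ i P - conjZ j P) ((conjZ i P - conjZ j P) f) = (conjZ i P - conjZ j P) f := by
  simp only [sub_apply, map_sub, hP.conj_idem, hP.conj_le h, hP.conj_le' h]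
  abel

lemma sub_symm (i j : ℤ) (f g : L2 m) :
    inner ℂ ((conjZ i P - conjZ j P) f) g = inner ℂ f ((conjZ i P - conjZ j P) g) := by
  simp only [sub_apply, inner_sub_left, inner_sub_right, hP.conj_symm]

lemma norm_apply_le (f : L2 m) : ‖P f‖ ≤ ‖f‖ := by
  have h1 : ‖P f‖ * ‖P f‖ ≤ ‖f‖ * ‖P f‖ := by
    rw [← sq, norm_sq_eq_re_inner (𝕜 := ℂ), hP.symm, hP.idem]
    exact (RCLike.re_le_norm _).trans (norm_inner_le_norm _ _)
  by_contra h
  push Not at h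
  nlinarith [norm_nonneg (P f), norm_nonneg f]

end IsShiftProj

/-- The orthonormality of the shifts of an orthonormal system in `W ⊖ z W`. -/
lemma IsShiftProj.orthonormal_shifts {m n : ℕ} {P : L2 m →L[ℂ] L2 m} (hP : IsShiftProj P)
    {v : Fin n → L2 m} (hv : Orthonormal ℂ v) (h1 : ∀ i, (conjZ 0 P - conjZ 1 P) (v i) = v i) :
    Orthonormal ℂ fun p : Fin n × ℤ => Zp p.2 (v p.1) := by
  classical
  have h2 : ∀ i, conjZ 1 P (v i) = 0 := by
    intro i
    rw [← h1 i, sub_apply, map_sub, hP.conj_le' (by norm_num), hP.conj_idem, sub_self]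
  have h3 : ∀ i, P (v i) = v i := by
    intro i
    have := h1 i
    rw [sub_apply, h2, sub_zero, conjZ_apply, neg_zero, Zp_zero] at this
    exact this
  have h4 : ∀ i j (k : ℕ), inner ℂ (v i) (Zp (k + 1 : ℕ) (v j)) = 0 := by
    intro i j k
    have e : Zp (k + 1 : ℕ) (v j) = conjZ 1 P (Zp (k + 1 : ℕ) (v j)) := by
      rw [conjZ_apply, Zp_apply_apply]
      have : (-1 + ((k + 1 : ℕ) : ℤ)) = k := by push_cast; ring
      rw [this, hP.apply_Zp_nat (h3 j), Zp_apply_apply]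
      congr 2
      push_cast; ring
    rw [e, ← hP.conj_symm, h2, inner_zero_left]
  rw [orthonormal_iff_ite]
  rintro ⟨i, p⟩ ⟨j, p'⟩
  rw [inner_Zp, Zp_apply_apply]
  rcases lt_trichotomy p p' with h | h | h
  · obtain ⟨k, hk⟩ := Int.eq_ofNat_of_zero_le (show 0 ≤ -p + p' - 1 by omega)
    have e : -p + p' = (k + 1 : ℕ) := by push_cast; omega
    rw [e, h4, if_neg (by simp [h.ne])]
  · subst h
    rw [neg_add_cancel, Zp_zero]
    simpa using orthonormal_iff_ite.1 hv i j
  · obtain ⟨k, hk⟩ := Int.eq_ofNat_of_zero_le (show 0 ≤ -p' + p - 1 by omega)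
    have e : -p + p' = -((k + 1 : ℕ) : ℤ) := by push_cast; omega
    rw [e, ← inner_Zp, ← inner_conj_symm, h4, if_neg (by simp [h.ne'])]
    simp

/-- `W ⊖ z W` has dimension at most `m`. -/
lemma IsShiftProj.finrank_le {m : ℕ} {P : L2 m →L[ℂ] L2 m} (hP : IsShiftProj P) :
    FiniteDimensional ℂ (LinearMap.range (conjZ 0 P - conjZ 1 P : L2 m →L[ℂ] L2 m).toLinearMap) ∧
    Module.finrank ℂ
      (LinearMap.range (conjZ 0 P - conjZ 1 P : L2 m →L[ℂ] L2 m).toLinearMap) ≤ m := by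
  set K := LinearMap.range (conjZ 0 P - conjZ 1 P : L2 m →L[ℂ] L2 m).toLinearMap with hK
  have hr : Module.rank ℂ K ≤ m := by
    refine rank_le fun s hs => ?_
    let S := Submodule.span ℂ (s : Set K)
    have : FiniteDimensional ℂ S := FiniteDimensional.span_finset ℂ s
    have hcard : Module.finrank ℂ S = s.card := by
      rw [finrank_span_set_eq_card hs]
      simp
    let e := stdOrthonormalBasis ℂ S
    have ho : Orthonormal ℂ fun i => ((e i : S) : K) :=
      e.orthonormal.comp_linearIsometry S.subtypeₗᵢ
    have ho2 : Orthonormal ℂ fun i => (((e i : S) : K) : L2 m) :=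
      ho.comp_linearIsometry K.subtypeₗᵢ
    rw [← hcard]
    refine card_le_of_orthonormal_shifts _ (hP.orthonormal_shifts ho2 fun i => ?_)
    obtain ⟨f, hf⟩ := (e i : K).2
    rw [← hf]
    exact hP.sub_idem (by norm_num) f
  refine ⟨Module.rank_lt_aleph0_iff.1 (hr.trans_lt Cardinal.natCast_lt_aleph0), ?_⟩
  exact Module.finrank_le_of_rank_le hr


/-! ### Piecewise smooth loops and their derivatives -/

section PSmooth

variable {E : Type*} [NormedAddCommGroup E] [NormedSpace ℝ E] {H : Type*} [TopologicalSpace H]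
  {I : ModelWithCorners ℝ E H} {N : Type*} [TopologicalSpace N] [ChartedSpace H N]
  {E' : Type*} [NormedAddCommGroup E'] [NormedSpace ℝ E'] {H' : Type*} [TopologicalSpace H']
  {I' : ModelWithCorners ℝ E' H'} {N' : Type*} [TopologicalSpace N'] [ChartedSpace H' N']
  {V : Type*} [NormedAddCommGroup V] [NormedSpace ℝ V]
  {V' : Type*} [NormedAddCommGroup V'] [NormedSpace ℝ V']

lemma IsPSmooth.comp {f : UnitAddCircle → N} (hf : IsPSmooth I f) {g : N → N'}
    (hg : ContMDiff I I' ∞ g) : IsPSmooth I' fun θ => g (f θ) := by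
  refine ⟨hg.continuous.comp hf.1, fun a => ?_⟩
  obtain ⟨ε, hε, h1, h2⟩ := hf.2 a
  exact ⟨ε, hε, hg.comp_contMDiffOn h1, hg.comp_contMDiffOn h2⟩

lemma IsPSmooth.prodMk {f : UnitAddCircle → N} (hf : IsPSmooth I f) {g : UnitAddCircle → N'}
    (hg : IsPSmooth I' g) : IsPSmooth (I.prod I') fun θ => (f θ, g θ) := by
  refine ⟨hf.1.prodMk hg.1, fun a => ?_⟩
  obtain ⟨ε, hε, h1, h2⟩ := hf.2 a
  obtain ⟨δ, hδ, h3, h4⟩ := hg.2 a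
  refine ⟨min ε δ, lt_min hε hδ, ?_, ?_⟩
  · refine (h1.mono ?_).prodMk (h3.mono ?_)
    · exact Icc_subset_Icc_left (by linarith [min_le_left ε δ])
    · exact Icc_subset_Icc_left (by linarith [min_le_right ε δ])
  · refine (h2.mono ?_).prodMk (h4.mono ?_)
    · exact Icc_subset_Icc_right (by linarith [min_le_left ε δ])
    · exact Icc_subset_Icc_right (by linarith [min_le_right ε δ])

lemma IsPSmooth.prodMk_space {f : UnitAddCircle → V} (hf : IsPSmooth 𝓘(ℝ, V) f)
    {g : UnitAddCircle → V'} (hg : IsPSmooth 𝓘(ℝ, V') g) :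
    IsPSmooth 𝓘(ℝ, V × V') fun θ => (f θ, g θ) := by
  have := hf.prodMk hg
  rwa [modelWithCornersSelf_prod, ← chartedSpaceSelf_prod]

/-- A piecewise smooth loop in a normed space is Lipschitz. -/
lemma IsPSmooth.exists_norm_sub_le {f : UnitAddCircle → V} (hf : IsPSmooth 𝓘(ℝ, V) f) :
    ∃ K : ℝ, 0 ≤ K ∧ ∀ (θ : UnitAddCircle) (s : ℝ), |s| ≤ 1 →
      ‖f (θ + (s : UnitAddCircle)) - f θ‖ ≤ K * |s| := by
  have hl : LocallyLipschitz fun s : ℝ => f (s : UnitAddCircle) := by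
    intro a
    obtain ⟨ε, hε, h1, h2⟩ := hf.2 a
    obtain ⟨K1, hK1⟩ := (contMDiffOn_iff_contDiffOn.1 h1).exists_lipschitzOnWith (by simp)
      (convex_Icc _ _) isCompact_Icc
    obtain ⟨K2, hK2⟩ := (contMDiffOn_iff_contDiffOn.1 h2).exists_lipschitzOnWith (by simp)
      (convex_Icc _ _) isCompact_Icc
    refine ⟨max K1 K2, Icc (a - ε) (a + ε), Icc_mem_nhds (by linarith) (by linarith), ?_⟩
    have hK1' := (hK1.weaken (le_max_left K1 K2)).dist_le_mul
    have hK2' := (hK2.weaken (le_max_right K1 K2)).dist_le_mul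
    have key : ∀ x ∈ Icc (a - ε) (a + ε), ∀ y ∈ Icc (a - ε) (a + ε), x ≤ y →
        dist (f (x : UnitAddCircle)) (f (y : UnitAddCircle)) ≤ (max K1 K2 : NNReal) * dist x y := by
      intro x hx y hy hxy
      rcases le_total y a with h | h
      · exact hK1' x ⟨hx.1, hxy.trans h⟩ y ⟨hy.1, h⟩
      rcases le_total a x with h' | h'
      · exact hK2' x ⟨h', hx.2⟩ y ⟨h, hy.2⟩
      have e1 := hK1' x ⟨hx.1, h'⟩ a ⟨by linarith, le_rfl⟩
      have e2 := hK2' a ⟨le_rfl, by linarith⟩ y ⟨h, hy.2⟩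
      refine (dist_triangle _ (f (a : UnitAddCircle)) _).trans ((add_le_add e1 e2).trans ?_)
      rw [← mul_add]
      refine mul_le_mul_of_nonneg_left ?_ (NNReal.coe_nonneg _)
      rw [Real.dist_eq, Real.dist_eq, Real.dist_eq, abs_of_nonpos, abs_of_nonpos, abs_of_nonpos]
      all_goals linarith
    refine LipschitzOnWith.of_dist_le_mul fun x hx y hy => ?_
    rcases le_total x y with h | h
    · exact key x hx y hy h
    · rw [dist_comm, dist_comm x]
      exact key y hy x hx h
  obtain ⟨K, hK⟩ := (hl.locallyLipschitzOn (s := Icc (-1 : ℝ) 2)).exists_lipschitzOnWith_of_compact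
    isCompact_Icc
  refine ⟨K, NNReal.coe_nonneg _, fun θ s hs => ?_⟩
  obtain ⟨x, hx, rfl⟩ : ∃ x ∈ Ico (0 : ℝ) (0 + 1), (x : UnitAddCircle) = θ :=
    by
    have h := mem_univ θ
    rwa [← AddCircle.coe_image_Ico_eq (1 : ℝ) 0] at h
  have := hK.dist_le_mul (x + s) ⟨by linarith [hx.1, (abs_le.1 hs).1],
    by linarith [hx.2, (abs_le.1 hs).2]⟩ x ⟨by linarith [hx.1], by linarith [hx.2]⟩
  rw [dist_eq_norm, dist_eq_norm, add_sub_cancel_left] at this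
  simpa using this

/-- The derivative of a function on the circle. -/
def cderiv (f : UnitAddCircle → V) (θ : UnitAddCircle) : V :=
  deriv (fun s : ℝ => f (θ + (s : UnitAddCircle))) 0

lemma IsPSmooth.exists_norm_cderiv_le {f : UnitAddCircle → V} (hf : IsPSmooth 𝓘(ℝ, V) f) :
    ∃ K : ℝ, 0 ≤ K ∧ ∀ θ, ‖cderiv f θ‖ ≤ K := by
  obtain ⟨K, hK, h⟩ := hf.exists_norm_sub_le
  refine ⟨K, hK, fun θ => norm_deriv_le_of_lip' hK ?_⟩
  filter_upwards [Icc_mem_nhds (show (-1 : ℝ) < 0 by norm_num) (show (0 : ℝ) < 1 by norm_num)]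
    with s hs
  simpa using h θ s (abs_le.2 hs)

/-- Around each point, a piecewise smooth loop is differentiable except possibly at that point. -/
lemma IsPSmooth.ae_differentiableAt {f : UnitAddCircle → V} (hf : IsPSmooth 𝓘(ℝ, V) f) :
    ∀ᵐ θ ∂μS, DifferentiableAt ℝ (fun s : ℝ => f (θ + (s : UnitAddCircle))) 0 := by
  have hnt : Nontrivial UnitAddCircle := by
    refine ⟨0, ((1 / 2 : ℝ) : UnitAddCircle), fun h => ?_⟩
    obtain ⟨n, hn⟩ := (AddCircle.coe_eq_zero_iff 1).1 h.symm
    have h2 : (2 * n : ℤ) = 1 := by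
      have : (2 : ℝ) * n = 1 := by
        rw [zsmul_one] at hn
        linarith
      exact_mod_cast this
    omega
  refine measure_null_of_locally_null _ fun θ _ => ?_
  obtain ⟨a, rfl⟩ := QuotientAddGroup.mk_surjective θ
  obtain ⟨ε, hε, h1, h2⟩ := hf.2 a
  have h1 := contMDiffOn_iff_contDiffOn.1 h1
  have h2 := contMDiffOn_iff_contDiffOn.1 h2
  have hop : IsOpen ((fun s : ℝ => (s : UnitAddCircle)) '' Ioo (a - ε) (a + ε)) :=
    QuotientAddGroup.isOpenMap_coe _ isOpen_Ioo
  refine ⟨_, inter_mem_nhdsWithin _ (hop.mem_nhds ⟨a, ⟨by linarith, by linarith⟩, rfl⟩), ?_⟩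
  refine measure_mono_null (t := {(a : UnitAddCircle)}) ?_ (measure_singleton _)
  rintro _ ⟨hn, s, hs, rfl⟩
  by_contra hsa
  have hne : s ≠ a := fun h => hsa (h ▸ rfl)
  refine hn ?_
  have hd : DifferentiableAt ℝ (fun s : ℝ => f (s : UnitAddCircle)) s := by
    rcases lt_or_gt_of_ne hne with h | h
    · exact (h1.differentiableOn (by simp)).differentiableAt (Icc_mem_nhds hs.1 h)
    · exact (h2.differentiableOn (by simp)).differentiableAt (Icc_mem_nhds h hs.2)
  have hd2 : DifferentiableAt ℝ (fun t : ℝ => s + t) 0 := by fun_prop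
  have hd3 : DifferentiableAt ℝ (fun s : ℝ => f (s : UnitAddCircle)) (s + 0) := by simpa using hd
  have := hd3.comp (f := fun t : ℝ => s + t) 0 hd2
  simpa [Function.comp_def] using this

lemma aestronglyMeasurable_cderiv {f : UnitAddCircle → V} [SecondCountableTopology V]
    [CompleteSpace V] (hf : Continuous f) : AEStronglyMeasurable (cderiv f) μS := by
  have h := stronglyMeasurable_deriv_with_param
    (f := fun (θ : UnitAddCircle) (s : ℝ) => f (θ + (s : UnitAddCircle))) (by fun_prop)
  exact (h.comp_measurable (measurable_id.prodMk measurable_const)).aestronglyMeasurable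

lemma IsPSmooth.memLp_cderiv {f : UnitAddCircle → V} [SecondCountableTopology V]
    [CompleteSpace V] (hf : IsPSmooth 𝓘(ℝ, V) f) : MemLp (cderiv f) 2 μS := by
  obtain ⟨K, hK, h⟩ := hf.exists_norm_cderiv_le
  exact MemLp.of_bound (aestronglyMeasurable_cderiv hf.1) K (Eventually.of_forall h)

lemma toL2_eq {f : UnitAddCircle → ℝ} (hf : MemLp f 2 μS) : toL2 f = hf.toLp f := dif_pos hf

lemma toL2_coe {f : UnitAddCircle → ℝ} (hf : MemLp f 2 μS) : toL2 f =ᵐ[μS] f := by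
  rw [toL2_eq hf]
  exact hf.coeFn_toLp

/-- Multiplication of real `L²` functions by continuous functions. -/
def mulR : C(UnitAddCircle, ℝ) →L[ℝ] (Lp ℝ 2 μS →L[ℝ] Lp ℝ 2 μS) :=
  ((ContinuousLinearMap.mul ℝ ℝ).holderL μS ∞ 2 2) ∘L (ContinuousMap.toLp ∞ μS ℝ)

lemma mulR_coe (g : C(UnitAddCircle, ℝ)) (f : Lp ℝ 2 μS) :
    mulR g f =ᵐ[μS] fun θ => g θ * f θ := by
  refine (ContinuousLinearMap.coeFn_holder (r := 2) _ _ _).trans ?_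
  have h := ContinuousMap.coeFn_toLp (p := ∞) (𝕜 := ℝ) μS g
  filter_upwards [h] with θ h
  exact congrArg (fun c : ℝ => c * f θ) h

/-- Post-composition with a smooth function is continuous for the Sobolev topology: the chain
rule. -/
lemma continuous_toL2_cderiv_comp [FiniteDimensional ℝ V] {X : Type*} [TopologicalSpace X]
    {p : X → C(UnitAddCircle, V)} (hp : Continuous p) (hps : ∀ x, IsPSmooth 𝓘(ℝ, V) (p x))
    (hd : ∀ l : V →L[ℝ] ℝ, Continuous fun x => toL2 (cderiv fun θ => l (p x θ)))
    {Ψ : V → ℝ} (hΨ : ContDiff ℝ ∞ Ψ) :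
    Continuous fun x => toL2 (cderiv fun θ => Ψ (p x θ)) := by
  let b := Module.finBasis ℝ V
  let l : Fin (Module.finrank ℝ V) → V →L[ℝ] ℝ :=
    fun a => LinearMap.toContinuousLinearMap (b.coord a)
  have hc : Continuous fun v => fderiv ℝ Ψ v := hΨ.continuous_fderiv (by simp)
  let D : Fin (Module.finrank ℝ V) → C(V, ℝ) := fun a =>
    ⟨fun v => fderiv ℝ Ψ v (b a), hc.clm_apply continuous_const⟩
  have key : ∀ x, toL2 (cderiv fun θ => Ψ (p x θ)) =
      ∑ a, mulR ((D a).comp (p x)) (toL2 (cderiv fun θ => l a (p x θ))) := by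
    intro x
    have hm : MemLp (cderiv fun θ => Ψ (p x θ)) 2 μS :=
      ((hps x).comp hΨ.contMDiff).memLp_cderiv
    have hma : ∀ a, MemLp (cderiv fun θ => l a (p x θ)) 2 μS := fun a =>
      ((hps x).comp (l a).contDiff.contMDiff).memLp_cderiv
    refine Lp.ext ((toL2_coe hm).trans ?_)
    have h1 : ∀ᵐ θ ∂μS, ∀ a, mulR ((D a).comp (p x)) (toL2 (cderiv fun θ => l a (p x θ))) θ =
        D a (p x θ) * cderiv (fun θ => l a (p x θ)) θ := by
      refine ae_all_iff.2 fun a => ?_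
      filter_upwards [mulR_coe ((D a).comp (p x)) (toL2 (cderiv fun θ => l a (p x θ))),
        toL2_coe (hma a)] with θ h h'
      rw [h, h']
      rfl
    have h2 := Lp.coeFn_finsetSum Finset.univ
      (fun a => mulR ((D a).comp (p x)) (toL2 (cderiv fun θ => l a (p x θ))))
    filter_upwards [h1, h2, (hps x).ae_differentiableAt] with θ h1 h2 h3
    rw [h2, Finset.sum_apply]
    simp only [h1]
    have h4 : HasDerivAt (fun s : ℝ => p x (θ + (s : UnitAddCircle))) (cderiv (p x) θ) 0 :=
      h3.hasDerivAt
    have h5 : ∀ a, cderiv (fun θ => l a (p x θ)) θ = l a (cderiv (p x) θ) := fun a =>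
      ((l a).hasFDerivAt.comp_hasDerivAt (f := fun s : ℝ => p x (θ + (s : UnitAddCircle))) 0
        h4).deriv
    have h6 : HasFDerivAt Ψ (fderiv ℝ Ψ (p x θ)) (p x (θ + ((0 : ℝ) : UnitAddCircle))) := by
      have e : θ + ((0 : ℝ) : UnitAddCircle) = θ := by simp
      rw [e]
      exact (hΨ.differentiable (by simp) _).hasFDerivAt
    have h7 : cderiv (fun θ => Ψ (p x θ)) θ = fderiv ℝ Ψ (p x θ) (cderiv (p x) θ) :=
      (h6.comp_hasDerivAt (f := fun s : ℝ => p x (θ + (s : UnitAddCircle))) 0 h4).deriv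
    rw [h7]
    conv_lhs => rw [← b.sum_repr (cderiv (p x) θ)]
    rw [map_sum]
    refine Finset.sum_congr rfl fun a _ => ?_
    rw [h5, map_smul, smul_eq_mul, mul_comm]
    rfl
  simp only [key]
  refine continuous_finsetSum _ fun a _ => ?_
  exact (mulR.continuous.comp ((ContinuousMap.continuous_postcomp (D a)).comp hp)).clm_apply
    (hd (l a))

end PSmooth

/-! ### Commutators of piecewise smooth loops of matrices with the projection onto `H₊` -/

/-- A function with `‖R_t f - f‖ = O(t)` has Fourier coefficients with `∑ n² |f̂ₙ|² < ∞`. -/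
lemma summable_sq_mul_inner_mode {n : ℕ} (f : L2 n) {C : ℝ}
    (h : ∀ t : ℝ, |t| ≤ 1 → ‖rotL2 (t : UnitAddCircle) f - f‖ ≤ C * |t|) :
    Summable fun q : ℤ × Fin n => (q.1 : ℝ) ^ 2 * ‖inner ℂ (mode q) f‖ ^ 2 := by
  have hin : ∀ (t : UnitAddCircle) (q : ℤ × Fin n), inner ℂ (mode q) (rotL2 t f - f) =
      (fourier q.1 t - 1) * inner ℂ (mode q) f := by
    intro t q
    have h1 : inner ℂ (mode q) (rotL2 t f) = fourier q.1 t * inner ℂ (mode q) f := by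
      rw [← (rotL2 t).inner_map_map (mode q) f, rotL2_mode, inner_smul_left, ← mul_assoc,
        fourier_apply, Complex.mul_conj, Complex.normSq_eq_norm_sq, Circle.norm_coe]
      simp
    rw [inner_sub_right, h1]
    ring
  have hq : ∀ q : ℤ × Fin n, Tendsto (fun t : ℝ => ‖((fourier q.1 (t : UnitAddCircle) : ℂ) - 1)‖ ^ 2
      / t ^ 2) (𝓝[≠] 0) (𝓝 ((2 * Real.pi * q.1) ^ 2)) := by
    intro q
    have h1 : HasDerivAt (fun t : ℝ => (fourier q.1 (t : UnitAddCircle) : ℂ))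
        (2 * Real.pi * Complex.I * q.1 / (1 : ℝ) * fourier q.1 ((0 : ℝ) : UnitAddCircle)) 0 :=
      hasDerivAt_fourier 1 q.1 0
    have h2 := hasDerivAt_iff_tendsto_slope_zero.1 h1
    have h3 := (h2.norm).pow 2
    refine (h3.congr fun t => ?_).trans (le_of_eq ?_)
    · simp [div_eq_inv_mul, mul_pow]
    · congr 1
      simp [mul_pow]
  refine summable_of_sum_le (c := C ^ 2) (fun q => by positivity) fun S => ?_
  have h1 : ∀ᶠ t : ℝ in 𝓝[≠] 0, ∑ q ∈ S, ‖((fourier q.1 (t : UnitAddCircle) : ℂ) - 1)‖ ^ 2 / t ^ 2 *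
      ‖inner ℂ (mode q) f‖ ^ 2 ≤ C ^ 2 := by
    have h0 : ∀ᶠ t : ℝ in 𝓝[≠] 0, t ∈ Icc (-1 : ℝ) 1 :=
      nhdsWithin_le_nhds (Icc_mem_nhds (by norm_num) (by norm_num))
    filter_upwards [h0, self_mem_nhdsWithin] with t ht ht0
    have ht0 : t ≠ 0 := ht0
    have h2 := (mode_orthonormal n).sum_inner_products_le (s := S) (rotL2 (t : UnitAddCircle) f - f)
    have h3 := pow_le_pow_left₀ (norm_nonneg _) (h t (abs_le.2 ht)) 2
    rw [mul_pow, sq_abs] at h3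
    have h4 : ∑ q ∈ S, ‖((fourier q.1 (t : UnitAddCircle) : ℂ) - 1)‖ ^ 2 / t ^ 2 *
        ‖inner ℂ (mode q) f‖ ^ 2 =
        (∑ q ∈ S, ‖inner ℂ (mode q) (rotL2 (t : UnitAddCircle) f - f)‖ ^ 2) / t ^ 2 := by
      rw [Finset.sum_div]
      refine Finset.sum_congr rfl fun q _ => ?_
      rw [hin, norm_mul]
      ring
    rw [h4, div_le_iff₀ (by positivity)]
    exact h2.trans h3
  have h2 : Tendsto (fun t : ℝ => ∑ q ∈ S, ‖((fourier q.1 (t : UnitAddCircle) : ℂ) - 1)‖ ^ 2 /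
      t ^ 2 * ‖inner ℂ (mode q) f‖ ^ 2) (𝓝[≠] 0)
      (𝓝 (∑ q ∈ S, (2 * Real.pi * q.1) ^ 2 * ‖inner ℂ (mode q) f‖ ^ 2)) :=
    tendsto_finsetSum _ fun q _ => (hq q).mul_const _
  refine (Finset.sum_le_sum fun q _ => ?_).trans (le_of_tendsto h2 h1)
  refine mul_le_mul_of_nonneg_right ?_ (by positivity)
  rw [mul_pow]
  have : (1 : ℝ) ≤ (2 * Real.pi) ^ 2 := by nlinarith [Real.pi_gt_three]
  nlinarith [sq_nonneg (q.1 : ℝ)]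

/-- If `S = ∑ n² |f̂ₙ|²`, then the part of `zⁿ f` of the wrong frequencies has squared norm at most
`S / n²`. -/
lemma norm_commutator_mode_le {n : ℕ} (f : L2 n)
    (h : Summable fun q : ℤ × Fin n => (q.1 : ℝ) ^ 2 * ‖inner ℂ (mode q) f‖ ^ 2) (k : ℤ)
    (hk : k ≠ 0) (g : L2 n)
    (hg : ∀ q : ℤ × Fin n, inner ℂ (mode q) g = 0 ∨
      (inner ℂ (mode q) g = inner ℂ (mode q) (Zp k f) ∧ |k| ≤ |q.1 - k|)) :
    ‖g‖ ^ 2 ≤ (∑' q : ℤ × Fin n, (q.1 : ℝ) ^ 2 * ‖inner ℂ (mode q) f‖ ^ 2) / (k : ℝ) ^ 2 := by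
  have h1 := hasSum_norm_inner_sq (modeBasis n) g
  have e : ∀ q : ℤ × Fin n, inner ℂ (mode q) (Zp k f) = inner ℂ (mode (q.1 - k, q.2)) f := by
    intro q
    rw [← neg_neg k, ← inner_Zp, Zp_mode, neg_neg, neg_add_eq_sub]
  let φ : ℤ × Fin n ≃ ℤ × Fin n := (Equiv.subRight k).prodCongr (Equiv.refl _)
  have h2 : HasSum (fun q : ℤ × Fin n => ((q.1 - k : ℤ) : ℝ) ^ 2 *
      ‖inner ℂ (mode (q.1 - k, q.2)) f‖ ^ 2 / (k : ℝ) ^ 2)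
      ((∑' q : ℤ × Fin n, (q.1 : ℝ) ^ 2 * ‖inner ℂ (mode q) f‖ ^ 2) / (k : ℝ) ^ 2) :=
    (φ.hasSum_iff.2 h.hasSum).div_const _
  refine hasSum_le (fun q => ?_) h1 h2
  rw [modeBasis_apply]
  rcases hg q with h0 | ⟨h0, h3⟩
  · rw [h0, norm_zero, zero_pow two_ne_zero]
    exact div_nonneg (mul_nonneg (sq_nonneg _) (sq_nonneg _)) (sq_nonneg _)
  · have hk' : (0 : ℝ) < (k : ℝ) ^ 2 := by positivity
    rw [h0, e, le_div_iff₀ hk', mul_comm]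
    refine mul_le_mul_of_nonneg_right ?_ (by positivity)
    exact_mod_cast sq_le_sq.2 h3


lemma inner_mode_projH {n : ℕ} (q : ℤ × Fin n) (f : L2 n) :
    inner ℂ (mode q) (projH n f) = if 0 ≤ q.1 then inner ℂ (mode q) f else 0 := by
  rw [← Submodule.inner_starProjection_left_eq_right, projH_mode]
  split_ifs
  · rfl
  · exact inner_zero_left _

/-- The commutator of a piecewise smooth loop of matrices with the projection onto `H₊` is
Hilbert–Schmidt. -/
lemma summable_commutator {m n : ℕ} (G : C(UnitAddCircle, EHom m n))
    (hG : IsPSmooth 𝓘(ℝ, EHom m n) G) :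
    Summable fun q : ℤ × Fin m =>
      ‖mulOp G (projH m (mode q)) - projH n (mulOp G (mode q))‖ ^ 2 := by
  obtain ⟨K, hK, hlip⟩ := hG.exists_norm_sub_le
  let f : Fin m → L2 n := fun k => mulOp G (mode (0, k))
  have hf : ∀ k, f k =ᵐ[μS] fun θ => G θ (EuclideanSpace.single k 1) := by
    intro k
    filter_upwards [mulOp_coe G (mode (0, k)), mode_coe ((0, k) : ℤ × Fin m)] with θ h h'
    rw [h, h']
    simp
  have hrot : ∀ k (t : ℝ), |t| ≤ 1 → ‖rotL2 (t : UnitAddCircle) (f k) - f k‖ ≤ K * |t| := by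
    intro k t ht
    have h0 : (0 : ℝ) ≤ K * |t| := by positivity
    have h1 : ∀ᵐ θ ∂μS, ‖(rotL2 (t : UnitAddCircle) (f k) - f k : L2 n) θ‖ ≤ K * |t| := by
      filter_upwards [Lp.coeFn_sub (rotL2 (t : UnitAddCircle) (f k)) (f k), hf k,
        rotL2_coe (t : UnitAddCircle) (f k),
        (mp_add (t : UnitAddCircle)).quasiMeasurePreserving.ae_eq_comp (hf k)] with θ h1 h2 h3 h4
      have h4 : f k (θ + (t : UnitAddCircle)) =
        G (θ + (t : UnitAddCircle)) (EuclideanSpace.single k 1) := h4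
      rw [h1, Pi.sub_apply, h2, h3, h4, ← sub_apply]
      refine (ContinuousLinearMap.le_opNorm _ _).trans ?_
      simpa using hlip θ t ht
    simpa [measureUnivNNReal] using Lp.norm_le_of_ae_bound h0 h1
  have hsum := fun k => summable_sq_mul_inner_mode (f k) (hrot k)
  have hmode : ∀ q : ℤ × Fin m, mulOp G (mode q) = Zp q.1 (f q.2) := by
    intro q
    have h1 : mode q = Zp q.1 (mode ((0, q.2) : ℤ × Fin m)) := by
      rw [Zp_mode, add_zero]
    rw [h1]
    exact (congrArg (fun A : L2 m →L[ℂ] L2 n => A (mode ((0, q.2) : ℤ × Fin m)))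
      (mulS_comm (fourier q.1) G)).symm
  let S : Fin m → ℝ := fun k => ∑' q : ℤ × Fin n, (q.1 : ℝ) ^ 2 * ‖inner ℂ (mode q) (f k)‖ ^ 2
  have hb : Summable fun q : ℤ × Fin m => (1 / (q.1 : ℝ) ^ 2) * S q.2 :=
    Summable.mul_of_nonneg (Real.summable_one_div_int_pow.2 one_lt_two)
      (Summable.of_finite) (fun _ => by positivity)
      (fun k => tsum_nonneg fun q => by positivity)
  refine hb.of_norm_bounded_eventually ?_
  have hfin : {q : ℤ × Fin m | q.1 = 0}.Finite := by
    refine (Set.finite_range fun k : Fin m => ((0, k) : ℤ × Fin m)).subset ?_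
    rintro ⟨j, k⟩ h
    exact ⟨k, by simpa using (show j = 0 from h).symm⟩
  filter_upwards [hfin.compl_mem_cofinite] with q hq
  have hq : q.1 ≠ 0 := hq
  rw [Real.norm_of_nonneg (by positivity), hmode, one_div_mul_eq_div]
  by_cases h : 0 ≤ q.1
  · refine norm_commutator_mode_le (f q.2) (hsum q.2) q.1 hq _ fun p => ?_
    rw [projH_mode, if_pos h, hmode, inner_sub_right, inner_mode_projH]
    split_ifs with hp
    · exact Or.inl (sub_self _)
    · refine Or.inr ⟨sub_zero _, ?_⟩
      rw [abs_of_nonneg h, abs_of_nonpos (by omega)]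
      omega
  · rw [projH_mode, if_neg h, map_zero, zero_sub, norm_neg]
    refine norm_commutator_mode_le (f q.2) (hsum q.2) q.1 hq _ fun p => ?_
    rw [inner_mode_projH]
    split_ifs with hp
    · refine Or.inr ⟨rfl, ?_⟩
      rw [abs_of_nonpos (by omega), abs_of_nonneg (by omega)]
      omega
    · exact Or.inl rfl

/-- Membership in the restricted Grassmannian is invariant under piecewise smooth unitary loops. -/
lemma IsHSDiff.conj {m : ℕ} {W W' : Submodule ℂ (L2 m)} (hW : IsHSDiff W)
    {G : C(UnitAddCircle, EHom m m)} (hG : IsPSmooth 𝓘(ℝ, EHom m m) G)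
    (h1 : mulOp G ∘L ContinuousLinearMap.adjoint (mulOp G) = 1)
    (hW' : projW W' = mulOp G ∘L projW W ∘L ContinuousLinearMap.adjoint (mulOp G)) :
    IsHSDiff W' := by
  let g : L2 m →L[ℂ] L2 m := mulOp G
  let g' : L2 m →L[ℂ] L2 m := ContinuousLinearMap.adjoint (mulOp G)
  have hgg : ∀ f, g (g' f) = f := fun f => congrArg (fun A : L2 m →L[ℂ] L2 m => A f) h1
  have h2 : Summable fun q => ‖(g ∘L (projW W - projH m)) (modeBasis m q)‖ ^ 2 := by
    have := summable_comp_left g hW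
    simpa using this
  have h3 : Summable fun q => ‖(g ∘L projH m - projH m ∘L g) (modeBasis m q)‖ ^ 2 := by
    have := summable_commutator G hG
    simpa using this
  have h4 := summable_comp_right (modeBasis m) (modeBasis m) g' h2
  have h5 := summable_comp_right (modeBasis m) (modeBasis m) g' h3
  refine (summable_norm_add_sq h4 h5).congr fun q => ?_
  rw [modeBasis_apply, hW']
  congr 2
  change g (projW W (g' (mode q)) - projH m (g' (mode q))) +
    (g (projH m (g' (mode q))) - projH m (g (g' (mode q)))) =
    g (projW W (g' (mode q))) - projH m (mode q)
  rw [hgg, map_sub]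
  abel

/-! ### The Sobolev topology on piecewise smooth loops -/

section Rotation

variable {E : Type*} [NormedAddCommGroup E] [NormedSpace ℝ E] {H : Type*} [TopologicalSpace H]
  {I : ModelWithCorners ℝ E H} {N : Type*} [TopologicalSpace N] [ChartedSpace H N]

lemma PSLoop.continuous_toMap : Continuous (PSLoop.toMap (I := I) (N := N)) :=
  continuous_iff_le_induced.2 inf_le_left

lemma PSLoop.continuous_toL2 (f : C^∞⟮I, N; 𝓘(ℝ, ℝ), ℝ⟯) :
    Continuous fun γ : PSLoop I N => toL2 (cderiv fun θ => f (γ θ)) :=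
  continuous_iff_le_induced.2 (inf_le_right.trans (iInf_le _ f))

lemma PSLoop.continuous_iff {X : Type*} [TopologicalSpace X] {F : X → PSLoop I N} :
    Continuous F ↔ (Continuous fun x => (F x).toMap) ∧ ∀ f : C^∞⟮I, N; 𝓘(ℝ, ℝ), ℝ⟯,
      Continuous fun x => toL2 (cderiv fun θ => f (F x θ)) := by
  refine ⟨fun h => ⟨PSLoop.continuous_toMap.comp h, fun f => (PSLoop.continuous_toL2 f).comp h⟩,
    fun h => ?_⟩
  have h1 : @Continuous X (PSLoop I N) _ (TopologicalSpace.induced PSLoop.toMap inferInstance) F :=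
    continuous_induced_rng.2 h.1
  have h2 : ∀ f : C^∞⟮I, N; 𝓘(ℝ, ℝ), ℝ⟯, @Continuous X (PSLoop I N) _ (TopologicalSpace.induced
      (fun γ : PSLoop I N => toL2 (cderiv fun θ => f (γ θ))) inferInstance) F := fun f =>
    continuous_induced_rng.2 (h.2 f)
  exact continuous_inf_rng.2 ⟨h1, continuous_iInf_rng.2 h2⟩

/-- Translation by `t`, as a continuous map of the circle. -/
def transC (t : UnitAddCircle) : C(UnitAddCircle, UnitAddCircle) :=
  ⟨fun θ => θ + t, continuous_add_const t⟩

lemma continuous_transC : Continuous transC :=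
  ContinuousMap.continuous_of_continuous_uncurry _ (by
    change Continuous fun p : UnitAddCircle × UnitAddCircle => p.2 + p.1
    fun_prop)

lemma continuous_rotL2 {m : ℕ} : Continuous fun p : UnitAddCircle × L2 m => rotL2 p.1 p.2 := by
  have h : Continuous fun p : UnitAddCircle × L2 m =>
      Lp.compMeasurePreserving (transC p.1) (mp_add p.1) p.2 :=
    Continuous.compMeasurePreservingLp (f := fun p : UnitAddCircle × L2 m => p.2)
      continuous_snd (continuous_transC.comp continuous_fst) (fun p => mp_add p.1)
        ENNReal.ofNat_ne_top
  exact h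

/-- Circle rotation of loops is jointly continuous. -/
lemma continuous_rotLoop :
    Continuous fun p : UnitAddCircle × PSLoop I N => rotLoop p.1 p.2 := by
  refine PSLoop.continuous_iff.2 ⟨?_, fun f => ?_⟩
  · exact (PSLoop.continuous_toMap.comp continuous_snd).compCM
      (continuous_transC.comp continuous_fst)
  · have h : Continuous fun p : UnitAddCircle × PSLoop I N =>
        Lp.compMeasurePreserving (transC p.1) (mp_add p.1) (toL2 (cderiv fun θ => f (p.2 θ))) :=
      Continuous.compMeasurePreservingLp ((PSLoop.continuous_toL2 f).comp continuous_snd)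
        (continuous_transC.comp continuous_fst) (fun p => mp_add p.1)
        ENNReal.ofNat_ne_top
    refine h.congr fun p => ?_
    have hm : MemLp (cderiv fun θ => f (p.2 θ)) 2 μS := (p.2.psmooth.comp f.contMDiff).memLp_cderiv
    have hm' : MemLp (cderiv fun θ => f (rotLoop p.1 p.2 θ)) 2 μS :=
      ((rotLoop p.1 p.2).psmooth.comp f.contMDiff).memLp_cderiv
    refine Lp.ext ((Lp.coeFn_compMeasurePreserving _ (mp_add p.1)).trans
      (EventuallyEq.trans ?_ (toL2_coe hm').symm))
    refine ((mp_add p.1).quasiMeasurePreserving.ae_eq_comp (toL2_coe hm)).trans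
      (Eventually.of_forall fun θ => ?_)
    change deriv (fun s : ℝ => f (p.2 (θ + p.1 + (s : UnitAddCircle)))) 0 =
      deriv (fun s : ℝ => f (p.2 (θ + (s : UnitAddCircle) + p.1))) 0
    simp only [add_right_comm]

end Rotation

section Factor

variable {E : Type*} [NormedAddCommGroup E] [NormedSpace ℝ E] [FiniteDimensional ℝ E]
  {N : Type u} [TopologicalSpace N] [ChartedSpace E N] [IsManifold 𝓘(ℝ, E) ∞ N] [T2Space N]
  {V : Type*} [NormedAddCommGroup V] [NormedSpace ℝ V]

variable (V) in
/-- Near a point, smooth functions, also with parameters, factor through a globally defined smooth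
map to the model space, namely a chart multiplied by a bump function. -/
lemma exists_local_factor (c : N) : ∃ U : Set N, IsOpen U ∧ c ∈ U ∧ ∃ h : N → E,
    ContMDiff 𝓘(ℝ, E) 𝓘(ℝ, E) ∞ h ∧ ∀ F : V × N → ℝ,
      ContMDiff (𝓘(ℝ, V).prod 𝓘(ℝ, E)) 𝓘(ℝ, ℝ) ∞ F →
      ∃ G : V × E → ℝ, ContDiff ℝ ∞ G ∧ ∀ v, ∀ y ∈ U, F (v, y) = G (v, h y) := by
  obtain ⟨f, -⟩ := (SmoothBumpFunction.nhds_basis_tsupport (I := 𝓘(ℝ, E)) c).ex_mem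
  let B := f.toContDiffBump
  let φ := extChartAt 𝓘(ℝ, E) c
  refine ⟨interior {y | f y = 1} ∩ (chartAt E c).source,
    isOpen_interior.inter (chartAt E c).open_source,
    ⟨mem_interior_iff_mem_nhds.2 f.eventuallyEq_one, mem_chart_source E c⟩,
    fun y => f y • φ y, f.contMDiff_smul contMDiffOn_extChartAt, fun F hF => ?_⟩
  refine ⟨fun p => B p.2 • F (p.1, φ.symm p.2), ?_, ?_⟩
  · refine contDiff_iff_contDiffAt.2 fun p => ?_
    by_cases hp : p.2 ∈ φ.target
    · have h1 : ContMDiffAt 𝓘(ℝ, E) 𝓘(ℝ, E) ∞ φ.symm p.2 :=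
        (contMDiffOn_extChartAt_symm c).contMDiffAt
          ((isOpen_extChartAt_target c).mem_nhds hp)
      have h2 : ContMDiffAt 𝓘(ℝ, V × E) 𝓘(ℝ, ℝ) ∞ (fun p : V × E => F (p.1, φ.symm p.2)) p := by
        refine hF.contMDiffAt.comp p (ContMDiffAt.prodMk contDiff_fst.contMDiff.contMDiffAt ?_)
        exact ContMDiffAt.comp (g := φ.symm) (f := fun p : V × E => p.2) p h1
          contDiff_snd.contMDiff.contMDiffAt
      exact ContDiffAt.smul (B.contDiff.comp contDiff_snd).contDiffAt h2.contDiffAt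
    · have h1 : p.2 ∉ tsupport B := fun h => hp (f.closedBall_subset
        ⟨by rwa [B.tsupport_eq] at h, by simp⟩)
      have h2 : ∀ᶠ p' in 𝓝 p, B p'.2 • F (p'.1, φ.symm p'.2) = 0 := by
        have := (notMem_tsupport_iff_eventuallyEq.1 h1)
        filter_upwards [continuous_snd.continuousAt.eventually this] with p' hp'
        rw [hp']
        exact zero_smul _ _
      exact contDiffAt_const.congr_of_eventuallyEq h2
  · rintro v y ⟨hy, hys⟩
    have hy1 : y ∈ {y | f y = 1} := interior_subset hy
    have hy1 : f y = 1 := hy1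
    have hB : B (φ y) = 1 := by
      rw [← hy1]
      exact (f.eqOn_source hys).symm
    have hy2 : φ.symm (φ y) = y := φ.left_inv (by rwa [extChartAt_source])
    simp only [hy1, one_smul, hB, hy2]

variable (N) in
/-- There is a smooth map `h` of a compact manifold to a finite dimensional space through which
all smooth functions, also with parameters, factor. -/
lemma exists_factor [CompactSpace N] : ∃ (ι : Type u) (_ : Fintype ι) (h : N → (ι → E × ℝ)),
    ContMDiff 𝓘(ℝ, E) 𝓘(ℝ, ι → E × ℝ) ∞ h ∧ ∀ F : V × N → ℝ,
      ContMDiff (𝓘(ℝ, V).prod 𝓘(ℝ, E)) 𝓘(ℝ, ℝ) ∞ F →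
      ∃ Ψ : V × (ι → E × ℝ) → ℝ, ContDiff ℝ ∞ Ψ ∧ ∀ v y, F (v, y) = Ψ (v, h y) := by
  choose U hU hcU h hh hF using fun c : N => exists_local_factor (E := E) V c
  obtain ⟨ρ, hρ⟩ := SmoothPartitionOfUnity.exists_isSubordinate 𝓘(ℝ, E) isClosed_univ U hU
    (fun c _ => mem_iUnion.2 ⟨c, hcU c⟩)
  have hfin := ρ.locallyFinite.finite_nonempty_of_compact
  refine ⟨hfin.toFinset, inferInstance, fun y c => (h c y, ρ c y), ?_, fun F hFs => ?_⟩
  · refine contMDiff_pi_space.2 fun c => ?_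
    exact (hh c).prodMk_space (ρ c).contMDiff
  · choose G hG hFG using fun c => hF c F hFs
    refine ⟨fun p => ∑ c, (p.2 c).2 * G c (p.1, (p.2 c).1), ?_, fun v y => ?_⟩
    · refine ContDiff.sum fun c _ => ContDiff.mul (by fun_prop) ((hG (c : N)).comp (by fun_prop))
    · have h1 : ∑ c ∈ hfin.toFinset, ρ c y = 1 := by
        rw [← ρ.sum_eq_one (mem_univ y)]
        refine (finsum_eq_sum_of_support_subset _ fun c hc => ?_).symm
        rw [Finite.coe_toFinset]
        exact ⟨y, hc⟩
      calc F (v, y) = ∑ c ∈ hfin.toFinset, ρ c y * F (v, y) := by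
            rw [← Finset.sum_mul, h1, one_mul]
        _ = ∑ c ∈ hfin.toFinset, ρ c y * G c (v, h c y) := by
            refine Finset.sum_congr rfl fun c _ => ?_
            by_cases hc : ρ c y = 0
            · rw [hc, zero_mul, zero_mul]
            · rw [hFG c v y (hρ c (subset_tsupport _ hc))]
        _ = _ := (Finset.sum_coe_sort hfin.toFinset fun c => ρ c y * G c (v, h c y)).symm

/-- For a fixed piecewise smooth loop `c`, the operation `γ ↦ F (c, γ)` is continuous in the
Sobolev topology. -/
lemma continuous_toL2_cderiv_param [CompactSpace N] [FiniteDimensional ℝ V] {c : UnitAddCircle → V}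
    (hc : IsPSmooth 𝓘(ℝ, V) c) {F : V × N → ℝ}
    (hF : ContMDiff (𝓘(ℝ, V).prod 𝓘(ℝ, E)) 𝓘(ℝ, ℝ) ∞ F) :
    Continuous fun γ : PSLoop 𝓘(ℝ, E) N => toL2 (cderiv fun θ => F (c θ, γ θ)) := by
  obtain ⟨ι, _, h, hh, hfac⟩ := exists_factor (E := E) (V := V) N
  obtain ⟨Ψ, hΨ, hFΨ⟩ := hfac F hF
  simp only [hFΨ]
  let hC : C(N, ι → E × ℝ) := ⟨h, hh.continuous⟩
  let p : PSLoop 𝓘(ℝ, E) N → C(UnitAddCircle, V × (ι → E × ℝ)) := fun γ =>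
    ContinuousMap.prodMk ⟨c, hc.1⟩ (hC.comp γ.toMap)
  have hps : ∀ γ, IsPSmooth 𝓘(ℝ, V × (ι → E × ℝ)) (p γ) := fun γ =>
    hc.prodMk_space (γ.psmooth.comp hh)
  refine continuous_toL2_cderiv_comp (p := p) ?_ hps (fun l => ?_) hΨ
  · have h1 := (ContinuousMap.continuous_postcomp hC).comp
      (PSLoop.continuous_toMap (I := 𝓘(ℝ, E)) (N := N))
    exact ContinuousMap.continuous_of_continuous_uncurry _
      ((hc.1.comp continuous_snd).prodMk
        (ContinuousEval.continuous_eval.comp (h1.prodMap continuous_id)))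
  · let f : C^∞⟮𝓘(ℝ, E), N; 𝓘(ℝ, ℝ), ℝ⟯ := ⟨fun y => l (0, h y),
      l.contDiff.contMDiff.comp (contMDiff_const.prodMk_space hh)⟩
    have hcl : IsPSmooth 𝓘(ℝ, ℝ) fun θ => l (c θ, 0) :=
      hc.comp (l.contDiff.comp (contDiff_id.prodMk contDiff_const)).contMDiff
    refine (continuous_const.add (PSLoop.continuous_toL2 f) :
      Continuous fun γ => toL2 (cderiv fun θ => l (c θ, 0)) + _).congr fun γ => ?_
    have hf : IsPSmooth 𝓘(ℝ, ℝ) fun θ => f (γ θ) := γ.psmooth.comp f.contMDiff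
    have hs : IsPSmooth 𝓘(ℝ, ℝ) fun θ => l (p γ θ) := (hps γ).comp l.contDiff.contMDiff
    refine Lp.ext ((Lp.coeFn_add _ _).trans (EventuallyEq.trans ?_ (toL2_coe hs.memLp_cderiv).symm))
    filter_upwards [toL2_coe hcl.memLp_cderiv, toL2_coe hf.memLp_cderiv,
      hcl.ae_differentiableAt, hf.ae_differentiableAt] with θ h1 h2 h3 h4
    rw [Pi.add_apply, h1, h2]
    refine (deriv_add h3 h4).symm.trans ?_
    refine congrArg (fun g : ℝ → ℝ => deriv g 0) (funext fun s => ?_)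
    change l (c _, 0) + l (0, h _) = l (c _, h _)
    rw [← map_add]
    simp

end Factor


/-! ### Smooth orthonormalization -/

/-- A smooth map `ψ` with `ψ(G)* G ψ(G) = 1` for self-adjoint `G` near `1`, namely
`ψ(G) = G^(-1/2)`, where the square root is a local inverse of `S ↦ S²`. -/
lemma exists_orthonormalization (𝒜 : Type*) [NormedRing 𝒜] [NormedAlgebra ℝ 𝒜]
    [FiniteDimensional ℝ 𝒜] [StarRing 𝒜] [NormedStarGroup 𝒜] : ∃ ψ : 𝒜 → 𝒜, ContDiff ℝ ∞ ψ ∧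
    ∀ᶠ G in 𝓝 (1 : 𝒜), star G = G → star (ψ G) * G * ψ G = 1 := by
  have : CompleteSpace 𝒜 := FiniteDimensional.complete ℝ 𝒜
  let f : 𝒜 → 𝒜 := fun S => S * S
  have hfs : ContDiff ℝ ω f := contDiff_id.mul contDiff_id
  let f' : 𝒜 ≃L[ℝ] 𝒜 :=
    ContinuousLinearEquiv.smulLeft (Units.mk0 (2 : ℝ) two_ne_zero)
  have hf' : HasFDerivAt f (f' : 𝒜 →L[ℝ] 𝒜) 1 := by
    have h := (hasFDerivAt_id (𝕜 := ℝ) (1 : 𝒜)).mul' (hasFDerivAt_id (𝕜 := ℝ) (1 : 𝒜))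
    refine h.congr_fderiv (ContinuousLinearMap.ext fun S => ?_)
    change (1 : 𝒜) * S + S * 1 = (2 : ℝ) • S
    rw [one_mul, mul_one, two_smul ℝ S]
  have hst : HasStrictFDerivAt f (f' : 𝒜 →L[ℝ] 𝒜) 1 :=
    hfs.contDiffAt.hasStrictFDerivAt' hf' (by simp)
  let r := hst.localInverse f f' 1
  have hr : ContDiffAt ℝ ω r (f 1) := hfs.contDiffAt.to_localInverse (n := ω) hf' (by simp)
  have h1 : r 1 = 1 := by
    have := hst.localInverse_apply_image
    simpa [f] using this
  have hf1 : f 1 = 1 := mul_one 1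
  rw [hf1] at hr
  have hright : ∀ᶠ G in 𝓝 (1 : 𝒜), r G * r G = G := by
    have := hst.eventually_right_inverse
    rwa [hf1] at this
  have hleft : ∀ᶠ S in 𝓝 (1 : 𝒜), r (S * S) = S := hst.eventually_left_inverse
  have hrt : Tendsto r (𝓝 1) (𝓝 1) := by
    have := hr.continuousAt.tendsto
    rwa [h1] at this
  have hstar : Tendsto (fun G => star (r G)) (𝓝 (1 : 𝒜)) (𝓝 1) := by
    have := hrt.star
    rwa [star_one] at this
  have hunit : ∀ᶠ G in 𝓝 (1 : 𝒜), IsUnit (r G) :=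
    hrt.eventually (Units.isOpen.mem_nhds isUnit_one)
  let ψ₀ : 𝒜 → 𝒜 := fun G => Ring.inverse (r G)
  have hψ₀ : ∀ᶠ G in 𝓝 (1 : 𝒜), ContDiffAt ℝ ω ψ₀ G := by
    have h2 : ContDiffAt ℝ ω (Ring.inverse : 𝒜 → 𝒜) (r 1) := by
      rw [h1]
      exact contDiffAt_ringInverse ℝ (1 : (𝒜)ˣ)
    exact (h2.comp 1 hr).eventually (by simp)
  obtain ⟨δ, hδ, hball⟩ := Metric.eventually_nhds_iff_ball.1 hψ₀
  let B : ContDiffBump (1 : 𝒜) := ⟨δ / 3, δ / 2, by positivity, by linarith⟩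
  refine ⟨fun G => B G • ψ₀ G, ?_, ?_⟩
  · refine contDiff_iff_contDiffAt.2 fun G => ?_
    by_cases hG : G ∈ Metric.ball (1 : 𝒜) δ
    · exact B.contDiff.contDiffAt.smul ((hball G hG).of_le le_top)
    · have h2 : G ∉ tsupport B := by
        rw [B.tsupport_eq]
        intro h
        exact hG (Metric.closedBall_subset_ball (show δ / 2 < δ by linarith) h)
      refine (contDiffAt_const (c := (0 : 𝒜))).congr_of_eventuallyEq ?_
      filter_upwards [notMem_tsupport_iff_eventuallyEq.1 h2] with G' hG'
      rw [hG']
      exact zero_smul _ _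
  · filter_upwards [B.eventuallyEq_one, hright, hstar.eventually hleft, hunit]
      with G hB hG hS hU hsa
    have hrs : star (r G) = r G := by
      rw [← hS, ← star_mul, hG, hsa]
    have hB : B G = 1 := hB
    rw [hB, one_smul]
    have e1 : star (ψ₀ G) = ψ₀ G := by
      change star (Ring.inverse (r G)) = Ring.inverse (r G)
      rw [← Ring.inverse_star, hrs]
    rw [e1]
    change Ring.inverse (r G) * G * Ring.inverse (r G) = 1
    have e2 : Ring.inverse (r G) * G = Ring.inverse (r G) * (r G * r G) := by rw [hG]
    rw [e2, ← mul_assoc, Ring.inverse_mul_cancel _ hU, one_mul, Ring.mul_inverse_cancel _ hU]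

/-! ### The Hermitian metric and Parseval frames of the tangent bundle -/

namespace AlmostHermitian

variable {m : ℕ} {M : Type u} [TopologicalSpace M]
  [ChartedSpace (EuclideanSpace ℝ (Fin (2 * m))) M] [IsManifold (𝓡 (2 * m)) ∞ M]
  (A : AlmostHermitian m M)

/-- A vector of `A.Fib x`, as an element of the real vector space `T_x M`. -/
abbrev toTan {x : M} (v : A.Fib x) : TangentSpace (𝓡 (2 * m)) x := v

/-- A tangent vector, as an element of the complex vector space `A.Fib x`. -/
abbrev ofTan {x : M} (v : TangentSpace (𝓡 (2 * m)) x) : A.Fib x := v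

/-- The Hermitian metric `h(v, w) = g(v, w) - i g(v, J w)`, which is complex linear in `w`. -/
def herm (x : M) (v w : A.Fib x) : ℂ := ⟨A.metric x v w, -A.metric x v (Complex.I • w)⟩

lemma metric_symm (x : M) (v w : A.Fib x) : A.metric x v w = A.metric x w v := A.g.symm x v w

lemma metric_add_right (x : M) (v w w' : A.Fib x) :
    A.metric x v (w + w') = A.metric x v w + A.metric x v w' :=
  map_add (A.g.inner x v) w w'

lemma smul_eq {x : M} (c : ℂ) (v : A.Fib x) :
    c • v = A.ofTan (c.re • A.toTan v + c.im • A.J x v) := rfl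

lemma I_smul {x : M} (v : A.Fib x) : (Complex.I • v : A.Fib x) = A.J x v := by
  rw [smul_eq, Complex.I_re, Complex.I_im, zero_smul, one_smul, zero_add]

lemma metric_smul_right (x : M) (v w : A.Fib x) (c : ℂ) :
    A.metric x v (c • w) = c.re * A.metric x v w + c.im * A.metric x v (Complex.I • w) := by
  have h := map_add (A.g.inner x v) (c.re • A.toTan w) (c.im • A.J x w)
  have h1 := map_smul (A.g.inner x v) c.re (A.toTan w)
  have h2 := map_smul (A.g.inner x v) c.im (A.J x w)
  rw [I_smul]
  exact h.trans (congrArg₂ (· + ·) h1 h2)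

lemma metric_I_I (x : M) (v w : A.Fib x) :
    A.metric x (Complex.I • v) (Complex.I • w) = A.metric x v w := by
  rw [I_smul, I_smul]
  exact A.J_isometric x v w

lemma metric_I_left (x : M) (v w : A.Fib x) :
    A.metric x (Complex.I • v) w = -A.metric x v (Complex.I • w) := by
  have h := A.metric_I_I x v (Complex.I • w)
  rw [smul_smul, Complex.I_mul_I, metric_smul_right] at h
  simp at h
  linarith

lemma herm_re (x : M) (v w : A.Fib x) : (A.herm x v w).re = A.metric x v w := rfl

lemma herm_conj (x : M) (v w : A.Fib x) : (starRingEnd ℂ) (A.herm x v w) = A.herm x w v := by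
  refine Complex.ext ?_ ?_
  · exact A.metric_symm x v w
  · change - -A.metric x v (Complex.I • w) = -A.metric x w (Complex.I • v)
    rw [neg_neg, ← metric_I_left, metric_symm]

lemma herm_add_right (x : M) (v w w' : A.Fib x) :
    A.herm x v (w + w') = A.herm x v w + A.herm x v w' := by
  refine Complex.ext (A.metric_add_right x v w w') ?_
  change -A.metric x v (Complex.I • (w + w')) = -A.metric x v (Complex.I • w) +
    -A.metric x v (Complex.I • w')
  rw [smul_add, metric_add_right]
  ring

lemma herm_smul_right (x : M) (v w : A.Fib x) (c : ℂ) :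
    A.herm x v (c • w) = c * A.herm x v w := by
  refine Complex.ext ?_ ?_
  · change A.metric x v (c • w) = c.re * A.metric x v w - c.im * -A.metric x v (Complex.I • w)
    rw [metric_smul_right]
    ring
  · change -A.metric x v (Complex.I • c • w) =
      c.re * -A.metric x v (Complex.I • w) + c.im * A.metric x v w
    rw [smul_smul, metric_smul_right]
    simp

/-- The Hermitian metric as a linear form in the second variable. -/
def hermL (x : M) (v : A.Fib x) : A.Fib x →ₗ[ℂ] ℂ where
  toFun w := A.herm x v w
  map_add' := A.herm_add_right x v
  map_smul' c w := A.herm_smul_right x v w c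

lemma herm_sum_right {ι : Type*} (s : Finset ι) (x : M) (v : A.Fib x) (w : ι → A.Fib x) :
    A.herm x v (∑ a ∈ s, w a) = ∑ a ∈ s, A.herm x v (w a) := map_sum (A.hermL x v) w s

lemma herm_smul_left (x : M) (v w : A.Fib x) (c : ℂ) :
    A.herm x (c • v) w = (starRingEnd ℂ) c * A.herm x v w := by
  rw [← herm_conj, herm_smul_right, map_mul, herm_conj]

lemma herm_sum_left {ι : Type*} (s : Finset ι) (x : M) (v : ι → A.Fib x) (w : A.Fib x) :
    A.herm x (∑ a ∈ s, v a) w = ∑ a ∈ s, A.herm x (v a) w := by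
  rw [← herm_conj, herm_sum_right, map_sum]
  simp only [herm_conj]

/-- The Hermitian inner product on a tangent space. -/
@[reducible]
def core (x : M) : InnerProductSpace.Core ℂ (A.Fib x) where
  inner v w := A.herm x v w
  conj_inner_symm v w := A.herm_conj x w v
  re_inner_nonneg v := by
    by_cases hv : v = 0
    · subst hv
      have h := A.metric_add_right x 0 0 0
      rw [add_zero] at h
      change 0 ≤ A.metric x 0 0
      linarith
    · exact (A.g.pos x v hv).le
  add_left v w z := by
    change A.herm x (v + w) z = A.herm x v z + A.herm x w z
    rw [← herm_conj, herm_add_right, map_add, herm_conj, herm_conj]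
  smul_left v w c := A.herm_smul_left x v w c
  definite v hv := by
    by_contra h
    exact (A.g.pos x v h).ne' (congrArg Complex.re hv)

lemma finrank_fib (x : M) : FiniteDimensional ℂ (A.Fib x) ∧ Module.finrank ℂ (A.Fib x) = m := by
  let e : A.Fib x ≃ₗ[ℝ] EuclideanSpace ℝ (Fin (2 * m)) :=
    { toFun := fun v => v
      invFun := fun v => v
      left_inv := fun _ => rfl
      right_inv := fun _ => rfl
      map_add' := fun _ _ => rfl
      map_smul' := fun c v => by
        change (c : ℂ).re • A.toTan v + (c : ℂ).im • A.J x v = c • A.toTan v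
        rw [Complex.ofReal_re, Complex.ofReal_im, zero_smul, add_zero] }
  have h1 : FiniteDimensional ℝ (A.Fib x) := e.symm.finiteDimensional
  have h2 : FiniteDimensional ℂ (A.Fib x) := FiniteDimensional.right ℝ ℂ (A.Fib x)
  refine ⟨h2, ?_⟩
  have h3 := finrank_real_of_complex (A.Fib x)
  rw [e.finrank_eq, finrank_euclideanSpace_fin] at h3
  omega

/-- Each tangent space has a unitary basis with `m` members, as its complex dimension is `m`. -/
lemma exists_unitary_basis (x : M) : ∃ e : Fin m → A.Fib x,
    ∀ k l, A.herm x (e k) (e l) = if k = l then 1 else 0 := by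
  let : NormedAddCommGroup (A.Fib x) := (A.core x).toNormedAddCommGroup
  let : InnerProductSpace ℂ (A.Fib x) := InnerProductSpace.ofCore (A.core x).toCore
  have := (A.finrank_fib x).1
  let b := (stdOrthonormalBasis ℂ (A.Fib x)).reindex (finCongr (A.finrank_fib x).2)
  exact ⟨b, fun k l => orthonormal_iff_ite.1 b.orthonormal k l⟩

lemma sum_herm_smul {x : M} {e : Fin m → A.Fib x}
    (he : ∀ k l, A.herm x (e k) (e l) = if k = l then 1 else 0) (v : A.Fib x) :
    ∑ k, A.herm x (e k) v • e k = v := by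
  let : NormedAddCommGroup (A.Fib x) := (A.core x).toNormedAddCommGroup
  let : InnerProductSpace ℂ (A.Fib x) := InnerProductSpace.ofCore (A.core x).toCore
  have := (A.finrank_fib x).1
  have ho : Orthonormal ℂ e := orthonormal_iff_ite.2 he
  let b := basisOfLinearIndependentOfCardEqFinrank' e ho.linearIndependent
    (by rw [(A.finrank_fib x).2, Fintype.card_fin])
  have hb : (b : Fin m → A.Fib x) = e := coe_basisOfLinearIndependentOfCardEqFinrank' _ _ _
  let ob := b.toOrthonormalBasis (by rwa [hb])
  have hob : (ob : Fin m → A.Fib x) = e := by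
    rw [Module.Basis.coe_toOrthonormalBasis, hb]
  have h := ob.sum_repr' v
  simp only [hob] at h
  exact h

section Smooth

variable {A}
variable {E' : Type*} [NormedAddCommGroup E'] [NormedSpace ℝ E'] {H' : Type*} [TopologicalSpace H']
  {I' : ModelWithCorners ℝ E' H'} {X : Type*} [TopologicalSpace X] [ChartedSpace H' X] {b : X → M}

lemma contMDiff_base {v : ∀ x, A.Fib (b x)}
    (hv : ContMDiff I' (𝓡 (2 * m)).tangent ∞ fun x => A.toTB (v x)) :
    ContMDiff I' (𝓡 (2 * m)) ∞ b :=
  (Bundle.contMDiff_proj (TangentSpace (𝓡 (2 * m)) (M := M))).comp hv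

lemma contMDiff_metric {v w : ∀ x, A.Fib (b x)}
    (hv : ContMDiff I' (𝓡 (2 * m)).tangent ∞ fun x => A.toTB (v x))
    (hw : ContMDiff I' (𝓡 (2 * m)).tangent ∞ fun x => A.toTB (w x)) :
    ContMDiff I' 𝓘(ℝ, ℝ) ∞ fun x => A.metric (b x) (v x) (w x) := by
  have h : ContMDiff I' ((𝓡 (2 * m)).prod 𝓘(ℝ, ℝ)) ∞
      (fun x => Bundle.TotalSpace.mk' ℝ (E := Bundle.Trivial M ℝ) (b x)
        (A.g.inner (b x) (v x) (w x))) := by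
    refine ContMDiff.clm_bundle_apply₂ (F₁ := EuclideanSpace ℝ (Fin (2 * m)))
      (F₂ := EuclideanSpace ℝ (Fin (2 * m))) ?_ hv hw
    exact A.g.contMDiff.comp (contMDiff_base hv)
  intro x
  have := h x
  rw [Bundle.contMDiffAt_totalSpace] at this
  exact this.2

lemma contMDiff_I_smul {v : ∀ x, A.Fib (b x)}
    (hv : ContMDiff I' (𝓡 (2 * m)).tangent ∞ fun x => A.toTB (v x)) :
    ContMDiff I' (𝓡 (2 * m)).tangent ∞ fun x => A.toTB (Complex.I • v x) := by
  simp only [I_smul]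
  exact A.J_smooth.comp hv

lemma contMDiff_herm {v w : ∀ x, A.Fib (b x)}
    (hv : ContMDiff I' (𝓡 (2 * m)).tangent ∞ fun x => A.toTB (v x))
    (hw : ContMDiff I' (𝓡 (2 * m)).tangent ∞ fun x => A.toTB (w x)) :
    ContMDiff I' 𝓘(ℝ, ℂ) ∞ fun x => A.herm (b x) (v x) (w x) := by
  have h1 := contMDiff_metric hv hw
  have h2 := contMDiff_metric hv (contMDiff_I_smul hw)
  have h3 : ContDiff ℝ ∞ fun p : ℝ × ℝ => (Complex.equivRealProdCLM.symm p : ℂ) :=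
    Complex.equivRealProdCLM.symm.contDiff
  refine (h3.contMDiff.comp (h1.prodMk_space h2.neg)).congr fun x => ?_
  exact Complex.ext (by simp [herm]) (by simp [herm])

/-- Smoothness of linear combinations of vector fields along `b` is checked in a trivialization of
the tangent bundle. -/
lemma contMDiff_sum_smul_real {ι : Type*} [Fintype ι] {v : ι → ∀ x, A.Fib (b x)} {f : ι → X → ℝ}
    (hb : ContMDiff I' (𝓡 (2 * m)) ∞ b)
    (hv : ∀ a, ContMDiff I' (𝓡 (2 * m)).tangent ∞ fun x => A.toTB (v a x))
    (hf : ∀ a, ContMDiff I' 𝓘(ℝ, ℝ) ∞ (f a)) :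
    ContMDiff I' (𝓡 (2 * m)).tangent ∞
      fun x => A.toTB (A.ofTan (∑ a, f a x • A.toTan (v a x))) := by
  intro x₀
  rw [Bundle.contMDiffAt_totalSpace]
  refine ⟨hb x₀, ?_⟩
  let e := trivializationAt (EuclideanSpace ℝ (Fin (2 * m))) (TangentSpace (𝓡 (2 * m)) (M := M))
    (b x₀)
  have h1 : ∀ a, ContMDiffAt I' 𝓘(ℝ, EuclideanSpace ℝ (Fin (2 * m))) ∞
      (fun x => (e (A.toTB (v a x))).2) x₀ := by
    intro a
    have := hv a x₀
    rw [Bundle.contMDiffAt_totalSpace] at this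
    exact this.2
  have h2 : ContMDiffAt I' 𝓘(ℝ, EuclideanSpace ℝ (Fin (2 * m))) ∞
      (fun x => ∑ a, f a x • (e (A.toTB (v a x))).2) x₀ :=
    ContMDiffAt.sum fun a _ => (hf a x₀).smul (h1 a)
  refine h2.congr_of_eventuallyEq ?_
  have h3 : ∀ᶠ x in 𝓝 x₀, b x ∈ e.baseSet :=
    (hb x₀).continuousAt.eventually (e.open_baseSet.mem_nhds
      (FiberBundle.mem_baseSet_trivializationAt' (b x₀)))
  filter_upwards [h3] with x hx
  have h4 := map_sum (e.linearMapAt ℝ (b x))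
    (fun a => f a x • A.toTan (v a x)) Finset.univ
  simp only [e.linearMapAt_apply, if_pos hx] at h4
  exact h4.trans (Finset.sum_congr rfl fun a _ =>
    (e.linear ℝ hx).map_smul (f a x) (A.toTan (v a x)))

lemma contMDiff_sum_smul {ι : Type*} [Fintype ι] {v : ι → ∀ x, A.Fib (b x)} {f : ι → X → ℂ}
    (hb : ContMDiff I' (𝓡 (2 * m)) ∞ b)
    (hv : ∀ a, ContMDiff I' (𝓡 (2 * m)).tangent ∞ fun x => A.toTB (v a x))
    (hf : ∀ a, ContMDiff I' 𝓘(ℝ, ℂ) ∞ (f a)) :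
    ContMDiff I' (𝓡 (2 * m)).tangent ∞ fun x => A.toTB (∑ a, f a x • v a x) := by
  have h := contMDiff_sum_smul_real (A := A) (ι := ι ⊕ ι) (b := b)
    (v := Sum.elim v fun a x => Complex.I • v a x)
    (f := Sum.elim (fun a x => (f a x).re) fun a x => (f a x).im) hb
    (by rintro (a | a); exacts [hv a, contMDiff_I_smul (hv a)])
    (by
      rintro (a | a)
      · exact Complex.reCLM.contDiff.contMDiff.comp (hf a)
      · exact Complex.imCLM.contDiff.contMDiff.comp (hf a))
  refine h.congr fun x => ?_
  refine congrArg A.toTB ?_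
  rw [Fintype.sum_sum_type]
  refine Eq.trans ?_ (Finset.sum_add_distrib (f := fun a => (f a x).re • A.toTan (v a x))
    (g := fun a => (f a x).im • A.toTan (Complex.I • v a x)))
  refine Finset.sum_congr rfl fun a _ => ?_
  rw [I_smul]
  rfl

end Smooth


/-- A global smooth vector field with a given value at a point. -/
lemma exists_smooth_field [T2Space M] {x₀ : M} (v₀ : A.Fib x₀) : ∃ Z : ∀ x, A.Fib x, Z x₀ = v₀ ∧
    ContMDiff (𝓡 (2 * m)) (𝓡 (2 * m)).tangent ∞ fun x => A.toTB (Z x) := by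
  obtain ⟨s, hs, hZ⟩ := FiberBundle.exists_contMDiffOn_extend (k := ∞) (𝓡 (2 * m))
    (EuclideanSpace ℝ (Fin (2 * m))) (A.toTan v₀)
  obtain ⟨f, -, hf⟩ := (SmoothBumpFunction.nhds_basis_tsupport (I := 𝓡 (2 * m)) x₀).mem_iff.1
    (interior_mem_nhds.2 hs)
  let W : ∀ x, TangentSpace (𝓡 (2 * m)) x :=
    FiberBundle.extend (EuclideanSpace ℝ (Fin (2 * m))) (A.toTan v₀)
  refine ⟨fun x => A.ofTan (f x • W x), ?_, fun x => ?_⟩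
  · change f x₀ • W x₀ = A.toTan v₀
    rw [f.eq_one, one_smul]
    exact FiberBundle.extend_apply_self _ _
  · by_cases hx : x ∈ tsupport f
    · have h1 : ContMDiffAt (𝓡 (2 * m)) (𝓡 (2 * m)).tangent ∞
          (fun x => (⟨x, W x⟩ : TangentBundle (𝓡 (2 * m)) M)) x :=
        hZ.contMDiffAt (mem_interior_iff_mem_nhds.1 (hf hx))
      exact ContMDiffAt.smul_section f.contMDiff.contMDiffAt h1
    · refine ((Bundle.contMDiff_zeroSection ℝ (TangentSpace (𝓡 (2 * m)) (M := M))).contMDiffAt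
        (x := x)).congr_of_eventuallyEq ?_
      filter_upwards [notMem_tsupport_iff_eventuallyEq.1 hx] with y hy
      have hy : f y = 0 := hy
      change (⟨y, f y • W y⟩ : TangentBundle (𝓡 (2 * m)) M) = ⟨y, 0⟩
      rw [hy, zero_smul]

/-- The Gram operator of `m` tangent vectors. -/
def gram {x : M} (z : Fin m → A.Fib x) : EHom m m :=
  ∑ k, ∑ l, A.herm x (z k) (z l) • (EuclideanSpace.proj l :
    EuclideanSpace ℂ (Fin m) →L[ℂ] ℂ).smulRight (EuclideanSpace.single k (1 : ℂ))

lemma inner_gram {x : M} (z : Fin m → A.Fib x) (c d : EuclideanSpace ℂ (Fin m)) :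
    inner ℂ c (A.gram z d) = A.herm x (∑ k, c k • z k) (∑ k, d k • z k) := by
  rw [herm_sum_left]
  simp only [gram, sum_apply, inner_sum, smul_apply,
    ContinuousLinearMap.smulRight_apply, inner_smul_right,
    EuclideanSpace.inner_single_right, herm_smul_left, herm_sum_right, herm_smul_right]
  refine Finset.sum_congr rfl fun k _ => Finset.sum_congr rfl fun l _ => ?_
  have h : (EuclideanSpace.proj l : EuclideanSpace ℂ (Fin m) →L[ℂ] ℂ) d = d l := rfl
  rw [h]
  ring

lemma star_gram {x : M} (z : Fin m → A.Fib x) : star (A.gram z) = A.gram z := by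
  rw [ContinuousLinearMap.star_eq_adjoint]
  refine ((ContinuousLinearMap.eq_adjoint_iff _ _).2 fun c d => ?_).symm
  rw [← inner_conj_symm, inner_gram, inner_gram, herm_conj]

/-- Smooth local unitary frames. -/
lemma exists_local_frame [T2Space M] (x₀ : M) : ∃ U : Set M, IsOpen U ∧ x₀ ∈ U ∧
    ∃ e : Fin m → ∀ x, A.Fib x,
      (∀ k, ContMDiff (𝓡 (2 * m)) (𝓡 (2 * m)).tangent ∞ fun x => A.toTB (e k x)) ∧
      ∀ x ∈ U, ∀ k l, A.herm x (e k x) (e l x) = if k = l then 1 else 0 := by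
  obtain ⟨e₀, he₀⟩ := A.exists_unitary_basis x₀
  choose Z hZ0 hZ using fun k => A.exists_smooth_field (e₀ k)
  obtain ⟨ψ, hψ, hψ1⟩ := exists_orthonormalization (EHom m m)
  let G : M → EHom m m := fun x => A.gram fun k => Z k x
  have hG : ContMDiff (𝓡 (2 * m)) 𝓘(ℝ, EHom m m) ∞ G := by
    refine contMDiff_finsetSum fun k _ => contMDiff_finsetSum fun l _ => ?_
    have hc : ContDiff ℝ ∞ fun c : ℂ => c • (EuclideanSpace.proj l :
      EuclideanSpace ℂ (Fin m) →L[ℂ] ℂ).smulRight (EuclideanSpace.single k (1 : ℂ)) := by fun_prop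
    exact hc.contMDiff.comp (contMDiff_herm (hZ k) (hZ l))
  have hG0 : G x₀ = 1 := by
    refine ContinuousLinearMap.ext fun d => ext_inner_left ℂ fun c => ?_
    refine (A.inner_gram _ c d).trans ?_
    simp only [hZ0, herm_sum_left, herm_sum_right, herm_smul_left, herm_smul_right, he₀]
    simp [PiLp.inner_apply, mul_comm]
  have hU : ∀ᶠ x in 𝓝 x₀, star (ψ (G x)) * G x * ψ (G x) = 1 := by
    have h1 : Tendsto G (𝓝 x₀) (𝓝 1) := by
      rw [← hG0]
      exact hG.continuous.tendsto x₀
    filter_upwards [h1.eventually hψ1] with x hx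
    exact hx (A.star_gram _)
  refine ⟨interior {x | star (ψ (G x)) * G x * ψ (G x) = 1}, isOpen_interior,
    mem_interior_iff_mem_nhds.2 hU,
    fun l x => ∑ k, ψ (G x) (EuclideanSpace.single l 1) k • Z k x, fun l => ?_, fun x hx k l => ?_⟩
  · refine contMDiff_sum_smul contMDiff_id hZ fun k => ?_
    let L : EHom m m →L[ℝ] ℂ := ((EuclideanSpace.proj k : EuclideanSpace ℂ (Fin m) →L[ℂ] ℂ) ∘L
      ContinuousLinearMap.apply ℂ (EuclideanSpace ℂ (Fin m))
        (EuclideanSpace.single l (1 : ℂ))).restrictScalars ℝ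
    exact (L.contDiff.comp hψ).contMDiff.comp hG
  · have hx : x ∈ {x | star (ψ (G x)) * G x * ψ (G x) = 1} := interior_subset hx
    have hx : star (ψ (G x)) * G x * ψ (G x) = 1 := hx
    rw [← inner_gram]
    change inner ℂ (ψ (G x) (EuclideanSpace.single k 1))
      (G x (ψ (G x) (EuclideanSpace.single l 1))) = _
    rw [← ContinuousLinearMap.adjoint_inner_right, ← ContinuousLinearMap.star_eq_adjoint]
    have h2 := congrArg (fun T : EHom m m => T (EuclideanSpace.single l 1)) hx
    have h2 : star (ψ (G x)) (G x (ψ (G x) (EuclideanSpace.single l 1))) =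
      EuclideanSpace.single l 1 := h2
    rw [h2]
    simp [EuclideanSpace.inner_single_left, PiLp.single_apply]

/-- A Parseval frame of the tangent bundle: finitely many smooth vector fields `Yₐ` with
`∑ₐ h(Yₐ, v) Yₐ = v` for all tangent vectors `v`. It embeds the tangent bundle, isometrically,
into a trivial bundle. -/
structure ParsevalFrame where
  N : ℕ
  Y : Fin N → ∀ x, A.Fib x
  smooth : ∀ a, ContMDiff (𝓡 (2 * m)) (𝓡 (2 * m)).tangent ∞ fun x => A.toTB (Y a x)
  sum_eq : ∀ x (v : A.Fib x), ∑ a, A.herm x (Y a x) v • Y a x = v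

/-- A Parseval frame is obtained from local unitary frames, multiplied by functions `w_c` which
are supported where the frames are defined and satisfy `∑ w_c² = 1`. -/
lemma nonempty_parsevalFrame [T2Space M] [CompactSpace M] : Nonempty A.ParsevalFrame := by
  choose U hU hxU e he hon using A.exists_local_frame
  obtain ⟨ρ, hρ⟩ := SmoothPartitionOfUnity.exists_isSubordinate (𝓡 (2 * m)) isClosed_univ U hU
    (fun c _ => mem_iUnion.2 ⟨c, hxU c⟩)
  have hfin := ρ.locallyFinite.finite_nonempty_of_compact
  let s := hfin.toFinset
  let Q : M → ℝ := fun x => ∑ c ∈ s, ρ c x ^ 2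
  have hQ : ∀ x, 0 < Q x := by
    intro x
    obtain ⟨c, hc⟩ := ρ.exists_pos_of_mem (mem_univ x)
    refine Finset.sum_pos' (fun c _ => sq_nonneg _) ⟨c, ?_, pow_pos hc 2⟩
    exact hfin.mem_toFinset.2 ⟨x, hc.ne'⟩
  have hQs : ContMDiff (𝓡 (2 * m)) 𝓘(ℝ, ℝ) ∞ Q :=
    contMDiff_finsetSum fun c _ => (ρ c).contMDiff.pow 2
  let w : M → M → ℝ := fun c x => ρ c x * (Real.sqrt (Q x))⁻¹
  have hw : ∀ c, ContMDiff (𝓡 (2 * m)) 𝓘(ℝ, ℝ) ∞ (w c) := by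
    intro c x
    have h1 : ContDiffAt ℝ ∞ (fun t : ℝ => (Real.sqrt t)⁻¹) (Q x) :=
      (Real.contDiffAt_sqrt (hQ x).ne').inv (Real.sqrt_pos.2 (hQ x)).ne'
    exact (ρ c).contMDiff.contMDiffAt.mul (h1.contMDiffAt.comp x (hQs x))
  have hw1 : ∀ x, ∑ c ∈ s, w c x ^ 2 = 1 := by
    intro x
    simp only [w, mul_pow, inv_pow, Real.sq_sqrt (hQ x).le]
    rw [← Finset.sum_mul]
    exact mul_inv_cancel₀ (hQ x).ne'
  let Y' : s × Fin m → ∀ x, A.Fib x := fun p x => (w p.1 x : ℂ) • e p.1 p.2 x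
  have hY' : ∀ p, ContMDiff (𝓡 (2 * m)) (𝓡 (2 * m)).tangent ∞ fun x => A.toTB (Y' p x) := by
    intro p
    have := contMDiff_sum_smul (A := A) (ι := Unit) (b := fun x : M => x)
      (v := fun _ => e p.1 p.2) (f := fun _ x => (w p.1 x : ℂ)) contMDiff_id (fun _ => he _ _)
      (fun _ => Complex.ofRealCLM.contDiff.contMDiff.comp (hw p.1))
    exact this.congr fun x => congrArg A.toTB (by rw [Finset.univ_unique, Finset.sum_singleton])
  have hsum : ∀ x (v : A.Fib x), ∑ p, A.herm x (Y' p x) v • Y' p x = v := by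
    intro x v
    have h1 : ∀ c : s, ∑ l, A.herm x (Y' (c, l) x) v • Y' (c, l) x = ((w c x ^ 2 : ℝ) : ℂ) • v := by
      intro c
      have h2 : ∀ l, A.herm x (Y' (c, l) x) v • Y' (c, l) x =
          ((w c x ^ 2 : ℝ) : ℂ) • A.herm x (e c l x) v • e c l x := by
        intro l
        simp only [Y', herm_smul_left, smul_smul, Complex.conj_ofReal]
        congr 1
        push_cast
        ring
      simp only [h2]
      rw [← Finset.smul_sum]
      by_cases hc : ρ c x = 0
      · have : w c x = 0 := by simp only [w, hc, zero_mul]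
        simp [this]
      · rw [A.sum_herm_smul (hon c x (hρ c (subset_tsupport _ hc)))]
    rw [Fintype.sum_prod_type]
    simp only [h1]
    rw [← Finset.sum_smul, ← Complex.ofReal_sum, Finset.sum_coe_sort s fun c => w c x ^ 2, hw1]
    simp
  let φ := Fintype.equivFin (s × Fin m)
  refine ⟨⟨_, fun a => Y' (φ.symm a), fun a => hY' _, fun x v => ?_⟩⟩
  rw [← hsum x v, φ.symm.sum_comp fun p =>
    A.herm x (Y' p x) (∑ p, A.herm x (Y' p x) v • Y' p x) • Y' p x]
  simp only [hsum]

end AlmostHermitian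


/-! ### The embedding of `T_γ LM` into `L²(S¹, ℂᴺ)` -/

section Embedding

variable {m : ℕ} {M : Type u} [TopologicalSpace M]
  [ChartedSpace (EuclideanSpace ℝ (Fin (2 * m))) M] [IsManifold (𝓡 (2 * m)) ∞ M]
  {A : AlmostHermitian m M}

namespace AlmostHermitian.ParsevalFrame

variable (T : A.ParsevalFrame)

/-- The isometric embedding `ι v = (h(Yₐ, v))ₐ` of tangent spaces into `ℂᴺ`. -/
def iota (x : M) : A.Fib x →ₗ[ℂ] EuclideanSpace ℂ (Fin T.N) where
  toFun v := WithLp.toLp 2 fun a => A.herm x (T.Y a x) v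
  map_add' v w := by
    ext a
    exact A.herm_add_right x _ v w
  map_smul' c v := by
    ext a
    exact A.herm_smul_right x _ v c

/-- The adjoint `κ c = ∑ₐ cₐ Yₐ` of `ι`. -/
def kappa (x : M) : EuclideanSpace ℂ (Fin T.N) →ₗ[ℂ] A.Fib x where
  toFun c := ∑ a, c a • T.Y a x
  map_add' c d := by
    rw [← Finset.sum_add_distrib]
    exact Finset.sum_congr rfl fun a _ => add_smul _ _ _
  map_smul' c d := by
    rw [Finset.smul_sum]
    exact Finset.sum_congr rfl fun a _ => mul_smul _ _ _

lemma iota_apply (x : M) (v : A.Fib x) (a : Fin T.N) : T.iota x v a = A.herm x (T.Y a x) v := rfl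

lemma kappa_apply (x : M) (c : EuclideanSpace ℂ (Fin T.N)) :
    T.kappa x c = ∑ a, c a • T.Y a x := rfl

lemma kappa_iota (x : M) (v : A.Fib x) : T.kappa x (T.iota x v) = v := T.sum_eq x v

lemma inner_iota_right (x : M) (v : A.Fib x) (c : EuclideanSpace ℂ (Fin T.N)) :
    inner ℂ c (T.iota x v) = A.herm x (T.kappa x c) v := by
  rw [kappa_apply, A.herm_sum_left, PiLp.inner_apply]
  refine Finset.sum_congr rfl fun a _ => ?_
  rw [A.herm_smul_left, iota_apply, RCLike.inner_apply, mul_comm]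

lemma inner_iota_iota (x : M) (v w : A.Fib x) :
    inner ℂ (T.iota x v) (T.iota x w) = A.herm x v w := by
  rw [inner_iota_right, kappa_iota]

lemma iota_injective (x : M) : Function.Injective (T.iota x) :=
  Function.LeftInverse.injective (T.kappa_iota x)

/-- The coordinates of `ι`, as one-forms. -/
def form (a : Fin T.N) : A.Form where
  toFun x := A.hermL x (T.Y a x)
  smooth := by
    refine AlmostHermitian.contMDiff_herm (A := A)
      (b := fun v : TangentBundle (𝓡 (2 * m)) M => v.1)
      (v := fun v => T.Y a v.1) (w := fun v => v.2) ?_ contMDiff_id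
    exact (T.smooth a).comp (Bundle.contMDiff_proj (TangentSpace (𝓡 (2 * m)) (M := M)))

/-- The map `ι` on the tangent bundle. -/
def iotaTB (v : TangentBundle (𝓡 (2 * m)) M) : EuclideanSpace ℂ (Fin T.N) := T.iota v.1 v.2

lemma contMDiff_iotaTB :
    ContMDiff (𝓡 (2 * m)).tangent 𝓘(ℝ, EuclideanSpace ℂ (Fin T.N)) ∞ T.iotaTB := by
  have h : ContMDiff (𝓡 (2 * m)).tangent 𝓘(ℝ, Fin T.N → ℂ) ∞
      fun v : TangentBundle (𝓡 (2 * m)) M => fun a => (T.form a).toFun v.1 v.2 :=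
    contMDiff_pi_space.2 fun a => (T.form a).smooth
  exact (((EuclideanSpace.equiv (Fin T.N) ℂ).symm.toContinuousLinearMap.restrictScalars ℝ).contDiff
    (n := ∞)).contMDiff.comp h

/-- The map `κ`, as a map to the tangent bundle. -/
def kappaTB (p : EuclideanSpace ℂ (Fin T.N) × M) : TangentBundle (𝓡 (2 * m)) M :=
  A.toTB (T.kappa p.2 p.1)

lemma contMDiff_kappaTB :
    ContMDiff (𝓘(ℝ, EuclideanSpace ℂ (Fin T.N)).prod (𝓡 (2 * m))) (𝓡 (2 * m)).tangent ∞
      T.kappaTB := by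
  refine AlmostHermitian.contMDiff_sum_smul contMDiff_snd
    (fun a => (T.smooth a).comp contMDiff_snd) fun a => ?_
  have hc : ContDiff ℝ ∞ fun c : EuclideanSpace ℂ (Fin T.N) => c a :=
    ((EuclideanSpace.proj a : EuclideanSpace ℂ (Fin T.N) →L[ℂ] ℂ).restrictScalars ℝ).contDiff
  exact hc.contMDiff.comp contMDiff_fst

/-- The projection `ι κ` of `ℂᴺ` onto the image of a tangent space. -/
def proj (x : M) : EHom T.N T.N := LinearMap.toContinuousLinearMap (T.iota x ∘ₗ T.kappa x)

lemma proj_apply (x : M) (c : EuclideanSpace ℂ (Fin T.N)) : T.proj x c = T.iota x (T.kappa x c) :=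
  rfl

lemma inner_proj (x : M) (c d : EuclideanSpace ℂ (Fin T.N)) :
    inner ℂ c (T.proj x d) = A.herm x (T.kappa x c) (T.kappa x d) := by
  rw [proj_apply, inner_iota_right]

lemma contMDiff_proj : ContMDiff (𝓡 (2 * m)) 𝓘(ℝ, EHom T.N T.N) ∞ T.proj := by
  have h : ∀ x, T.proj x = ∑ k, ∑ l, A.herm x (T.Y k x) (T.Y l x) • (EuclideanSpace.proj l :
      EuclideanSpace ℂ (Fin T.N) →L[ℂ] ℂ).smulRight (EuclideanSpace.single k (1 : ℂ)) := by
    intro x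
    refine ContinuousLinearMap.ext fun d => ext_inner_left ℂ fun c => ?_
    rw [inner_proj, kappa_apply, kappa_apply, A.herm_sum_left]
    simp only [sum_apply, inner_sum, smul_apply,
      ContinuousLinearMap.smulRight_apply, inner_smul_right,
      EuclideanSpace.inner_single_right, A.herm_smul_left, A.herm_sum_right, A.herm_smul_right]
    refine Finset.sum_congr rfl fun k _ => ?_
    rw [Finset.mul_sum]
    refine Finset.sum_congr rfl fun l _ => ?_
    have h : (EuclideanSpace.proj l : EuclideanSpace ℂ (Fin T.N) →L[ℂ] ℂ) d = d l := rfl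
    rw [h]
    ring
  refine ContMDiff.congr (contMDiff_finsetSum fun k _ => contMDiff_finsetSum fun l _ => ?_) h
  have hc : ContDiff ℝ ∞ fun c : ℂ => c • (EuclideanSpace.proj l :
    EuclideanSpace ℂ (Fin T.N) →L[ℂ] ℂ).smulRight (EuclideanSpace.single k (1 : ℂ)) := by fun_prop
  exact hc.contMDiff.comp (AlmostHermitian.contMDiff_herm (T.smooth k) (T.smooth l))

lemma memLp_iota {γ : LM m M} (s : sqInt A γ) : MemLp (fun θ => T.iota (γ θ) (s.1 θ)) 2 μS := by
  have h : ∀ θ, T.iota (γ θ) (s.1 θ) = ∑ a, ContinuousLinearMap.smulRight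
      (1 : ℂ →L[ℂ] ℂ) (EuclideanSpace.single a (1 : ℂ)) ((T.form a).toFun (γ θ) (s.1 θ)) := by
    intro θ
    ext b
    simp [iota_apply, form, hermL, Pi.single_apply]
  simp only [h]
  exact memLp_finsetSum _ fun a _ => ContinuousLinearMap.comp_memLp' _ (s.2 (T.form a))

/-- The isometric embedding of `T_γ LM` into `L²(S¹, ℂᴺ)`, by `ι` at each point. -/
def toL2N (γ : LM m M) : TLMfib A γ →ₗ[ℂ] L2 T.N :=
  Submodule.liftQ ((aeZero A γ).submoduleOf (sqInt A γ))
    { toFun := fun s => (T.memLp_iota s).toLp _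
      map_add' := fun s s' => by
        rw [← MemLp.toLp_add]
        exact (MemLp.toLp_eq_toLp_iff _ _).2 (Eventually.of_forall fun θ => map_add _ _ _)
      map_smul' := fun c s => by
        rw [RingHom.id_apply, ← MemLp.toLp_const_smul]
        exact (MemLp.toLp_eq_toLp_iff _ _).2 (Eventually.of_forall fun θ =>
          map_smul (T.iota (γ θ)) c (s.1 θ)) } (by
      intro s hs
      have hs : ∀ᵐ θ ∂μS, s.1 θ = 0 := hs
      refine Lp.ext ((T.memLp_iota s).coeFn_toLp.trans
        (EventuallyEq.trans ?_ (Lp.coeFn_zero _ _ _).symm))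
      filter_upwards [hs] with θ h
      rw [h, map_zero]
      rfl)

lemma toL2N_toFib {γ : LM m M} (s : sqInt A γ) :
    T.toL2N γ (toFib γ s) =ᵐ[μS] fun θ => T.iota (γ θ) (s.1 θ) :=
  (T.memLp_iota s).coeFn_toLp

lemma toL2N_coe {γ : LM m M} (σ : TLMfib A γ) :
    T.toL2N γ σ =ᵐ[μS] fun θ => T.iota (γ θ) (rep σ θ) := by
  obtain ⟨s, rfl⟩ := toFib_surjective γ σ
  filter_upwards [T.toL2N_toFib s, rep_toFib s] with θ h h'
  rw [h, h']

lemma toL2N_injective (γ : LM m M) : Function.Injective (T.toL2N γ) := by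
  refine (injective_iff_map_eq_zero _).2 fun σ hσ => ?_
  obtain ⟨s, rfl⟩ := toFib_surjective γ σ
  rw [← map_zero (toFib γ)]
  refine (toFib_eq_iff _ _).2 ?_
  have h2 := T.toL2N_toFib s
  rw [hσ] at h2
  filter_upwards [h2, Lp.coeFn_zero (EuclideanSpace ℂ (Fin T.N)) 2 μS] with θ h h'
  refine T.iota_injective (γ θ) ?_
  rw [← h, h']
  exact (map_zero _).symm

/-- The real `L²` inner product on `T_γ LM` is induced from `L²(S¹, ℂᴺ)`. -/
lemma ip_eq {γ : LM m M} (σ τ : TLMfib A γ) :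
    ip σ τ = (inner ℂ (T.toL2N γ σ) (T.toL2N γ τ)).re := by
  have h1 : (inner ℂ (T.toL2N γ σ) (T.toL2N γ τ)).re =
      ∫ θ, (inner ℂ (T.toL2N γ σ θ) (T.toL2N γ τ θ) : ℂ).re ∂μS := by
    rw [L2.inner_def]
    exact (Complex.reCLM.integral_comp_comm (L2.integrable_inner _ _)).symm
  rw [h1]
  refine integral_congr_ae ?_
  filter_upwards [T.toL2N_coe σ, T.toL2N_coe τ] with θ h h'
  rw [h, h', inner_iota_iota]
  rfl

lemma toL2N_rot (t : UnitAddCircle) (γ : LM m M) (σ : TLMfib A γ) :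
    T.toL2N (rotLoop t γ) (rot t γ σ) = rotL2 t (T.toL2N γ σ) := by
  obtain ⟨s, rfl⟩ := toFib_surjective γ σ
  rw [rot_toFib]
  refine Lp.ext ((T.toL2N_toFib _).trans (EventuallyEq.trans ?_ (rotL2_coe t _).symm))
  filter_upwards [(mp_add t).quasiMeasurePreserving.ae_eq_comp (T.toL2N_toFib s)] with θ h
  exact h.symm

lemma toL2N_mulZ (γ : LM m M) (σ : TLMfib A γ) :
    T.toL2N γ (mulZ γ σ) = Zp 1 (T.toL2N γ σ) := by
  obtain ⟨s, rfl⟩ := toFib_surjective γ σ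
  have e : mulZ γ (toFib γ s) = toFib γ ((mulZField γ).restrict (mulZField_mem γ) s) := rfl
  rw [e]
  refine Lp.ext ((T.toL2N_toFib _).trans (EventuallyEq.trans ?_ (Zp_coe 1 _).symm))
  filter_upwards [T.toL2N_toFib s] with θ h
  rw [h]
  exact map_smul (T.iota (γ θ)) _ _

end AlmostHermitian.ParsevalFrame

namespace Frame

variable {γ : LM m M} (Φ : Frame A γ)

lemma herm_eq (k l : Fin m) (θ : UnitAddCircle) :
    A.herm (γ θ) (Φ.e k θ) (Φ.e l θ) = if k = l then 1 else 0 := by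
  refine Complex.ext ?_ ?_
  · rw [A.herm_re, Φ.unitary k l θ]
    split_ifs <;> simp
  · have h := Φ.unitary_J k l θ
    rw [A.metric_I_left] at h
    change -A.metric (γ θ) (Φ.e k θ) (Complex.I • Φ.e l θ) = _
    rw [h]
    split_ifs <;> simp

/-- The members of a frame, as loops in the tangent bundle. -/
def loopTB (k : Fin m) : PSLoop (𝓡 (2 * m)).tangent (TangentBundle (𝓡 (2 * m)) M) :=
  ⟨⟨_, (Φ.psmooth k).1⟩, Φ.psmooth k⟩

variable (T : A.ParsevalFrame)

/-- For a tangent vector `v`, the operator `c ↦ cₖ ι v`. -/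
def column (k : Fin m) : C(TangentBundle (𝓡 (2 * m)) M, EHom m T.N) :=
  ⟨fun v => (EuclideanSpace.proj k : EuclideanSpace ℂ (Fin m) →L[ℂ] ℂ).smulRight (T.iotaTB v), by
    have h := T.contMDiff_iotaTB.continuous
    fun_prop⟩

lemma contMDiff_column (k : Fin m) :
    ContMDiff (𝓡 (2 * m)).tangent 𝓘(ℝ, EHom m T.N) ∞ (column T k) := by
  have h : ContDiff ℝ ∞ fun v : EuclideanSpace ℂ (Fin T.N) =>
      (EuclideanSpace.proj k : EuclideanSpace ℂ (Fin m) →L[ℂ] ℂ).smulRight v :=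
    ((ContinuousLinearMap.smulRightL ℂ (EuclideanSpace ℂ (Fin m)) (EuclideanSpace ℂ (Fin T.N))
      (EuclideanSpace.proj k)).restrictScalars ℝ).contDiff
  exact h.contMDiff.comp T.contMDiff_iotaTB

/-- A unitary frame, as a loop of isometric embeddings `ℂᵐ → ℂᴺ`. -/
def toC : C(UnitAddCircle, EHom m T.N) := ∑ k, (column T k).comp (Φ.loopTB k).toMap

lemma toC_apply (θ : UnitAddCircle) (c : EuclideanSpace ℂ (Fin m)) :
    Φ.toC T θ c = T.iota (γ θ) (∑ k, c k • Φ.e k θ) := by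
  rw [map_sum, toC, ContinuousMap.sum_apply, sum_apply]
  exact Finset.sum_congr rfl fun k _ => (map_smul (T.iota (γ θ)) (c k) (Φ.e k θ)).symm

lemma psmooth_toC : IsPSmooth 𝓘(ℝ, EHom m T.N) (Φ.toC T) := by
  have h : ∀ s : Finset (Fin m), IsPSmooth 𝓘(ℝ, EHom m T.N)
      fun θ => ∑ k ∈ s, column T k (A.toTB (Φ.e k θ)) := by
    intro s
    classical
    induction s using Finset.induction_on with
    | empty =>
      simp only [Finset.sum_empty]
      exact ⟨continuous_const, fun a => ⟨1, one_pos, contMDiffOn_const, contMDiffOn_const⟩⟩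
    | insert k s hk ih =>
      simp only [Finset.sum_insert hk]
      exact (((Φ.psmooth k).comp (contMDiff_column T k)).prodMk_space ih).comp
        (g := fun p : EHom m T.N × EHom m T.N => p.1 + p.2) contDiff_add.contMDiff
  have h1 : (Φ.toC T : UnitAddCircle → EHom m T.N) =
      fun θ => ∑ k, column T k (A.toTB (Φ.e k θ)) := by
    funext θ
    rw [toC, ContinuousMap.sum_apply]
    rfl
  rw [h1]
  exact h _

/-- The isometry `L²(S¹, ℂᵐ) → L²(S¹, ℂᴺ)` defined by a unitary frame. -/
def op : L2 m →L[ℂ] L2 T.N := mulOp (Φ.toC T)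

lemma toL2N_frameMap (f : L2 m) : T.toL2N γ (frameMap Φ f) = Φ.op T f := by
  refine Lp.ext ((T.toL2N_toFib _).trans (EventuallyEq.trans ?_ (mulOp_coe _ f).symm))
  exact Eventually.of_forall fun θ => (Φ.toC_apply T θ (f θ)).symm

lemma adjoint_toC_apply (θ : UnitAddCircle) (v : A.Fib (γ θ)) (k : Fin m) :
    (ContinuousLinearMap.adjoint (Φ.toC T θ) (T.iota (γ θ) v)) k = A.herm (γ θ) (Φ.e k θ) v := by
  have h : (ContinuousLinearMap.adjoint (Φ.toC T θ) (T.iota (γ θ) v)) k =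
      inner ℂ (EuclideanSpace.single k (1 : ℂ))
        (ContinuousLinearMap.adjoint (Φ.toC T θ) (T.iota (γ θ) v)) := by
    simp [EuclideanSpace.inner_single_left]
  rw [h, ContinuousLinearMap.adjoint_inner_right, toC_apply, T.inner_iota_iota, A.herm_sum_left,
    Finset.sum_eq_single k]
  · simp
  · intro l _ hl
    rw [A.herm_smul_left]
    simp [hl]
  · simp

lemma adjoint_op : ContinuousLinearMap.adjoint (Φ.op T) = mulOp (adjC (Φ.toC T)) :=
  mulOp_adjoint _

lemma adjoint_op_op (f : L2 m) : ContinuousLinearMap.adjoint (Φ.op T) (Φ.op T f) = f := by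
  rw [adjoint_op]
  refine Lp.ext ((mulOp_coe _ _).trans ?_)
  filter_upwards [mulOp_coe (Φ.toC T) f] with θ h
  have h : Φ.op T f θ = Φ.toC T θ (f θ) := h
  rw [h, toC_apply]
  ext k
  refine (Φ.adjoint_toC_apply T θ _ k).trans ?_
  simp [A.herm_sum_right, A.herm_smul_right, Φ.herm_eq]

lemma op_adjoint_toL2N (σ : TLMfib A γ) :
    Φ.op T (ContinuousLinearMap.adjoint (Φ.op T) (T.toL2N γ σ)) = T.toL2N γ σ := by
  rw [adjoint_op]
  refine Lp.ext ((mulOp_coe _ _).trans ?_)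
  filter_upwards [mulOp_coe (adjC (Φ.toC T)) (T.toL2N γ σ), T.toL2N_coe σ] with θ h h'
  rw [h, h', toC_apply]
  congr 1
  have h2 : ∀ k, (adjC (Φ.toC T) θ (T.iota (γ θ) (rep σ θ))) k =
    A.herm (γ θ) (Φ.e k θ) (rep σ θ) := Φ.adjoint_toC_apply T θ (rep σ θ)
  simp only [h2]
  exact A.sum_herm_smul (fun k l => Φ.herm_eq k l θ) _

lemma frameMap_adjoint (σ : TLMfib A γ) :
    frameMap Φ (ContinuousLinearMap.adjoint (Φ.op T) (T.toL2N γ σ)) = σ := by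
  refine T.toL2N_injective γ ?_
  rw [toL2N_frameMap, op_adjoint_toL2N]

end Frame

/-- The operator of a framed loop. -/
def FramedLoop.op (T : A.ParsevalFrame) (p : FramedLoop A) : L2 m →L[ℂ] L2 T.N := p.frame.op T

lemma FramedLoop.continuous_loop : Continuous (FramedLoop.loop (A := A)) :=
  have h : Continuous fun p : FramedLoop A => (p.loop, fun k : Fin m => p.frame.loopTB k) :=
    continuous_induced_dom
  continuous_fst.comp h

lemma FramedLoop.continuous_loopTB (k : Fin m) :
    Continuous fun p : FramedLoop A => p.frame.loopTB k :=
  have h : Continuous fun p : FramedLoop A => (p.loop, fun k : Fin m => p.frame.loopTB k) :=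
    continuous_induced_dom
  (continuous_apply k).comp (continuous_snd.comp h)

lemma FramedLoop.continuous_iff {X : Type*} [TopologicalSpace X] {F : X → FramedLoop A} :
    Continuous F ↔ (Continuous fun x => (F x).loop) ∧
      ∀ k, Continuous fun x => (F x).frame.loopTB k := by
  refine ⟨fun h => ⟨FramedLoop.continuous_loop.comp h,
    fun k => (FramedLoop.continuous_loopTB k).comp h⟩, fun h => ?_⟩
  exact continuous_induced_rng.2 (h.1.prodMk (continuous_pi h.2))

lemma FramedLoop.continuous_op (T : A.ParsevalFrame) : Continuous (FramedLoop.op (A := A) T) := by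
  refine mulOp.continuous.comp (continuous_finsetSum _ fun k _ => ?_)
  exact (ContinuousMap.continuous_postcomp _).comp
    (PSLoop.continuous_toMap.comp (FramedLoop.continuous_loopTB k))

lemma contDiff_comp_complex (m n p : ℕ) :
    ContDiff ℝ ∞ fun q : EHom n p × EHom m n => q.1 ∘L q.2 := by
  have h : IsBoundedBilinearMap ℝ fun q : EHom n p × EHom m n => q.1 ∘L q.2 :=
    { add_left := fun C C' D => ContinuousLinearMap.add_comp C C' D
      smul_left := fun c C D => ContinuousLinearMap.ext fun v => rfl
      add_right := fun C D D' => ContinuousLinearMap.comp_add C D D'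
      smul_right := fun c C D => ContinuousLinearMap.ext fun v => by
        change C (c • D v) = c • C (D v)
        rw [RCLike.real_smul_eq_coe_smul (K := ℂ) c (D v), map_smul,
          ← RCLike.real_smul_eq_coe_smul (K := ℂ) c]
      bound := ⟨1, one_pos, fun C D => by
        rw [one_mul]
        exact ContinuousLinearMap.opNorm_comp_le C D⟩ }
  exact h.contDiff

lemma contDiff_adjoint_real (m n : ℕ) :
    ContDiff ℝ ∞ fun C : EHom m n => ContinuousLinearMap.adjoint C := by
  have h : IsBoundedLinearMap ℝ fun C : EHom m n => ContinuousLinearMap.adjoint C :=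
    { map_add := fun C D => map_add _ C D
      map_smul := fun c C => by
        rw [RCLike.real_smul_eq_coe_smul (K := ℂ) c C, map_smulₛₗ]
        simp
      bound := ⟨1, one_pos, fun C => by rw [LinearIsometryEquiv.norm_map, one_mul]⟩ }
  exact h.contDiff

lemma contDiff_conj_apply (m n : ℕ) : ContDiff ℝ ∞ fun q : EHom m n × EHom n n =>
    ContinuousLinearMap.adjoint q.1 ∘L q.2 ∘L q.1 := by
  have h1 : ContDiff ℝ ∞ fun q : EHom m n × EHom n n => q.2 ∘L q.1 :=
    (contDiff_comp_complex m n n).comp (f := fun q : EHom m n × EHom n n => (q.2, q.1))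
      (contDiff_snd.prodMk contDiff_fst)
  have h2 : ContDiff ℝ ∞ fun q : EHom m n × EHom n n => ContinuousLinearMap.adjoint q.1 :=
    (contDiff_adjoint_real m n).comp (f := fun q : EHom m n × EHom n n => q.1) contDiff_fst
  exact (contDiff_comp_complex m n m).comp
    (f := fun q : EHom m n × EHom n n => (ContinuousLinearMap.adjoint q.1, q.2 ∘L q.1))
    (h2.prodMk h1)

lemma contDiff_comp_apply (m n : ℕ) (v : EuclideanSpace ℂ (Fin m)) :
    ContDiff ℝ ∞ fun q : EHom m n × EHom m m => (q.1 ∘L q.2) v := by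
  have h : IsBoundedLinearMap ℝ fun C : EHom m n => C v :=
    { map_add := fun C D => rfl
      map_smul := fun c C => rfl
      bound := ⟨‖v‖ + 1, by positivity, fun C => (C.le_opNorm v).trans (by
        rw [mul_comm]
        exact mul_le_mul_of_nonneg_right (by linarith) (norm_nonneg C))⟩ }
  exact h.contDiff.comp (f := fun q : EHom m n × EHom m m => q.1 ∘L q.2)
    (contDiff_comp_complex m m n)

/-- Over a neighbourhood of a loop with a unitary frame, there is a continuous family of unitary
frames: a frame is moved to nearby loops by means of `κ`, and orthonormalized. -/
lemma exists_local_section [T2Space M] [CompactSpace M] (T : A.ParsevalFrame) {γ₀ : LM m M}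
    (Φ₀ : Frame A γ₀) : ∃ U : Set (LM m M), IsOpen U ∧ γ₀ ∈ U ∧ ∃ s : ∀ γ : U, Frame A γ.1,
      Continuous fun γ : U => (⟨γ.1, s γ⟩ : FramedLoop A) := by
  obtain ⟨ψ, hψ, hψ1⟩ := exists_orthonormalization (EHom m m)
  obtain ⟨O, hOψ, hO, hO1⟩ := _root_.eventually_nhds_iff.1 hψ1
  let V := EHom m T.N
  -- the Gram operator of the vectors `κ (C eₖ)` at `y`
  let Gr : V × M → EHom m m := fun p => ContinuousLinearMap.adjoint p.1 ∘L T.proj p.2 ∘L p.1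
  have hGr : ContMDiff (𝓘(ℝ, V).prod (𝓡 (2 * m))) 𝓘(ℝ, EHom m m) ∞ Gr := by
    exact (contDiff_conj_apply m T.N).contMDiff.comp
      (f := fun p : V × M => (p.1, T.proj p.2))
      (contMDiff_fst.prodMk_space (T.contMDiff_proj.comp contMDiff_snd))
  -- the orthonormalized vector fields
  let S : Fin m → V × M → EuclideanSpace ℂ (Fin T.N) × M := fun l p =>
    (p.1 (ψ (Gr p) (EuclideanSpace.single l 1)), p.2)
  have hS : ∀ l, ContMDiff (𝓘(ℝ, V).prod (𝓡 (2 * m)))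
      (𝓘(ℝ, EuclideanSpace ℂ (Fin T.N)).prod (𝓡 (2 * m))) ∞ (S l) := by
    intro l
    exact ((contDiff_comp_apply m T.N (EuclideanSpace.single l 1)).contMDiff.comp
      (f := fun p : V × M => (p.1, ψ (Gr p)))
      (contMDiff_fst.prodMk_space (hψ.contMDiff.comp hGr))).prodMk contMDiff_snd
  have hF : ∀ l, ContMDiff (𝓘(ℝ, V).prod (𝓡 (2 * m))) (𝓡 (2 * m)).tangent ∞
      fun p => T.kappaTB (S l p) := fun l => T.contMDiff_kappaTB.comp (hS l)
  have hStar : ∀ p, star (Gr p) = Gr p := by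
    intro p
    rw [ContinuousLinearMap.star_eq_adjoint]
    refine ((ContinuousLinearMap.eq_adjoint_iff _ _).2 fun c d => ?_).symm
    change inner ℂ (ContinuousLinearMap.adjoint p.1 (T.proj p.2 (p.1 c))) d =
      inner ℂ c (ContinuousLinearMap.adjoint p.1 (T.proj p.2 (p.1 d)))
    rw [ContinuousLinearMap.adjoint_inner_left, ContinuousLinearMap.adjoint_inner_right,
      T.inner_proj, ← inner_conj_symm, T.inner_proj, A.herm_conj]
  have hon : ∀ p, Gr p ∈ O → ∀ k l, A.herm p.2 (T.kappa p.2 (S k p).1) (T.kappa p.2 (S l p).1) =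
      if k = l then 1 else 0 := by
    intro p hp k l
    have h1 := congrArg (fun B : EHom m m => B (EuclideanSpace.single l 1))
      (hOψ _ hp (hStar p))
    have h1 : star (ψ (Gr p)) (ContinuousLinearMap.adjoint p.1 (T.proj p.2 (p.1
      (ψ (Gr p) (EuclideanSpace.single l 1))))) = EuclideanSpace.single l 1 := h1
    rw [← T.inner_proj]
    change inner ℂ (p.1 (ψ (Gr p) (EuclideanSpace.single k 1)))
      (T.proj p.2 (p.1 (ψ (Gr p) (EuclideanSpace.single l 1)))) = _
    rw [← ContinuousLinearMap.adjoint_inner_right, ← ContinuousLinearMap.adjoint_inner_right,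
      ← ContinuousLinearMap.star_eq_adjoint (ψ (Gr p)), h1]
    simp [EuclideanSpace.inner_single_left, PiLp.single_apply]
  let c : C(UnitAddCircle, V) := Φ₀.toC T
  let D : LM m M → C(UnitAddCircle, EHom m m) := fun γ =>
    ContinuousMap.comp ⟨Gr, hGr.continuous⟩ (ContinuousMap.prodMk c γ.toMap)
  have heval : Continuous fun p : LM m M × UnitAddCircle => (c p.2, p.1 p.2) :=
    (c.continuous.comp continuous_snd).prodMk (ContinuousEval.continuous_eval.comp
      (PSLoop.continuous_toMap.prodMap continuous_id))
  have hD : Continuous D := ContinuousMap.continuous_of_continuous_uncurry _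
    (hGr.continuous.comp heval)
  have hDon : ∀ γ, MapsTo (D γ) univ O → ∀ θ, Gr (c θ, γ θ) ∈ O := fun γ h θ => h (mem_univ θ)
  refine ⟨D ⁻¹' {f | MapsTo f univ O},
    (ContinuousMap.isOpen_setOfPred_mapsTo isCompact_univ hO).preimage hD, ?_, ?_⟩
  · intro θ _
    have : D γ₀ θ = 1 := by
      refine ContinuousLinearMap.ext fun d => ?_
      change ContinuousLinearMap.adjoint (Φ₀.toC T θ) (T.proj (γ₀ θ) (Φ₀.toC T θ d)) = d
      rw [Frame.toC_apply, T.proj_apply, T.kappa_iota]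
      ext k
      rw [Frame.adjoint_toC_apply]
      simp [A.herm_sum_right, A.herm_smul_right, Φ₀.herm_eq]
    rw [this]
    exact hO1
  · refine ⟨fun γ =>
      { e := fun l θ => T.kappa (γ.1 θ) (S l (c θ, γ.1 θ)).1
        psmooth := fun l => ((Φ₀.psmooth_toC T).prodMk γ.1.psmooth).comp (hF l)
        unitary := fun k l θ => by
          rw [← A.herm_re, hon _ (hDon γ.1 γ.2 θ)]
          split_ifs <;> simp
        unitary_J := fun k l θ => by
          have h := congrArg Complex.im (hon _ (hDon γ.1 γ.2 θ) k l)
          rw [A.metric_I_left]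
          refine Eq.trans h ?_
          split_ifs <;> simp }, ?_⟩
    refine FramedLoop.continuous_iff.2 ⟨continuous_subtype_val, fun l => ?_⟩
    refine PSLoop.continuous_iff.2 ⟨?_, fun f => ?_⟩
    · refine ContinuousMap.continuous_of_continuous_uncurry _ ?_
      exact (hF l).continuous.comp (heval.comp (continuous_subtype_val.prodMap continuous_id))
    · exact (continuous_toL2_cderiv_param (Φ₀.psmooth_toC T)
        (F := fun p : V × M => f (T.kappaTB (S l p)))
        (f.contMDiff.comp (hF l))).comp continuous_subtype_val

end Embedding


/-! ### The projections onto polarizing subspaces -/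

lemma projW_eq_self_iff {m : ℕ} {W : Submodule ℂ (L2 m)} {f : L2 m} :
    projW W f = f ↔ f ∈ W.topologicalClosure :=
  Submodule.starProjection_eq_self_iff

lemma projW_mem {m : ℕ} (W : Submodule ℂ (L2 m)) (f : L2 m) :
    projW W f ∈ W.topologicalClosure :=
  Submodule.starProjection_apply_mem _ f

lemma projW_idem {m : ℕ} (W : Submodule ℂ (L2 m)) (f : L2 m) :
    projW W (projW W f) = projW W f :=
  projW_eq_self_iff.2 (projW_mem W f)

lemma isShiftProj_projW {m : ℕ} {W : Submodule ℂ (L2 m)} (h : ∀ f ∈ W, Zp 1 f ∈ W) :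
    IsShiftProj (projW W) where
  idem := projW_idem W
  symm f g := Submodule.inner_starProjection_left_eq_right _ f g
  stable f := projW_eq_self_iff.2 (by
    have h1 : MapsTo (Zp 1 : L2 m →L[ℂ] L2 m) W W := h
    have h2 := h1.closure (Zp 1 : L2 m →L[ℂ] L2 m).continuous
    exact h2 (projW_mem W f))

/-- The projection onto the image of `W` under an isometric embedding `F`. -/
lemma projW_map_isometry {m n : ℕ} {F : L2 m →L[ℂ] L2 n}
    (hF : ∀ f, ContinuousLinearMap.adjoint F (F f) = f) (W : Submodule ℂ (L2 m)) :
    projW (W.map (F : L2 m →ₗ[ℂ] L2 n)) = F ∘L projW W ∘L ContinuousLinearMap.adjoint F := by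
  refine ContinuousLinearMap.ext fun f => ?_
  refine Submodule.eq_starProjection_of_mem_orthogonal ?_ ?_
  · have h1 : MapsTo F W (W.map (F : L2 m →ₗ[ℂ] L2 n)) := fun w hw => ⟨w, hw, rfl⟩
    exact (h1.closure F.continuous) (projW_mem W _)
  · rw [Submodule.orthogonal_closure]
    rintro _ ⟨w, hw, rfl⟩
    change inner ℂ (F w) (f - F (projW W (ContinuousLinearMap.adjoint F f))) = 0
    rw [← ContinuousLinearMap.adjoint_inner_right, map_sub, hF]
    have h2 : ContinuousLinearMap.adjoint F f - projW W (ContinuousLinearMap.adjoint F f) ∈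
        W.topologicalClosureᗮ := Submodule.sub_starProjection_mem_orthogonal _
    exact h2 w (W.le_topologicalClosure hw)

section PolLoop

variable {m : ℕ} {M : Type u} [TopologicalSpace M]
  [ChartedSpace (EuclideanSpace ℝ (Fin (2 * m))) M] [IsManifold (𝓡 (2 * m)) ∞ M]
  {A : AlmostHermitian m M}

/-- The condition of polarization includes that there is a unitary frame along the loop. -/
lemma PolLoop.nonempty_frame (x : PolLoop A) : Nonempty (Frame A x.loop) :=
  let ⟨Φ, _⟩ := x.mem_grRes
  ⟨Φ⟩

variable (T : A.ParsevalFrame)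

/-- For a point `x = (γ, W)` of `LM_±`, the orthogonal projection of `L²(S¹, ℂᴺ)` onto (the closure
of) the image of `W ⊂ T_γ LM`. -/
def polProj (x : PolLoop A) : L2 T.N →L[ℂ] L2 T.N := projW (x.W.map (T.toL2N x.loop))

lemma map_toL2N_eq {γ : LM m M} (Φ : Frame A γ) (W : Submodule ℂ (TLMfib A γ)) :
    W.map (T.toL2N γ) = (W.comap (frameMap Φ)).map (Φ.op T : L2 m →ₗ[ℂ] L2 T.N) := by
  refine le_antisymm ?_ ?_
  · rintro _ ⟨σ, hσ, rfl⟩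
    refine ⟨ContinuousLinearMap.adjoint (Φ.op T) (T.toL2N γ σ), ?_, Φ.op_adjoint_toL2N T σ⟩
    change frameMap Φ _ ∈ W
    rw [Φ.frameMap_adjoint T]
    exact hσ
  · rintro _ ⟨f, hf, rfl⟩
    exact ⟨frameMap Φ f, hf, Φ.toL2N_frameMap T f⟩

/-- The projection onto the image of `W` in terms of a unitary frame. -/
lemma polProj_eq {x : PolLoop A} (Φ : Frame A x.loop) :
    polProj T x = Φ.op T ∘L projW (x.W.comap (frameMap Φ)) ∘L
      ContinuousLinearMap.adjoint (Φ.op T) := by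
  rw [polProj, map_toL2N_eq T Φ, projW_map_isometry (Φ.adjoint_op_op T)]

lemma op_Zp {γ : LM m M} (Φ : Frame A γ) (n : ℤ) (f : L2 m) :
    Φ.op T (Zp n f) = Zp n (Φ.op T f) :=
  (congrArg (fun B : L2 m →L[ℂ] L2 T.N => B f) (mulS_comm (fourier n) (Φ.toC T))).symm

lemma adjoint_op_Zp {γ : LM m M} (Φ : Frame A γ) (n : ℤ) (f : L2 T.N) :
    ContinuousLinearMap.adjoint (Φ.op T) (Zp n f) =
      Zp n (ContinuousLinearMap.adjoint (Φ.op T) f) := by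
  rw [Φ.adjoint_op]
  exact (congrArg (fun B : L2 T.N →L[ℂ] L2 m => B f) (mulS_comm (fourier n) (adjC (Φ.toC T)))).symm

include T in
lemma frameMap_Zp {γ : LM m M} (Φ : Frame A γ) (f : L2 m) :
    frameMap Φ (Zp 1 f) = mulZ γ (frameMap Φ f) := by
  refine T.toL2N_injective γ ?_
  rw [T.toL2N_mulZ, Φ.toL2N_frameMap, Φ.toL2N_frameMap, op_Zp]

include T in
lemma isShiftProj_comap {x : PolLoop A} (Φ : Frame A x.loop) :
    IsShiftProj (projW (x.W.comap (frameMap Φ))) := by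
  refine isShiftProj_projW fun f hf => ?_
  change frameMap Φ (Zp 1 f) ∈ x.W
  rw [frameMap_Zp T]
  exact x.z_stable ⟨_, hf, rfl⟩

lemma isShiftProj_polProj (x : PolLoop A) : IsShiftProj (polProj T x) := by
  refine isShiftProj_projW ?_
  rintro _ ⟨σ, hσ, rfl⟩
  exact ⟨mulZ x.loop σ, x.z_stable ⟨σ, hσ, rfl⟩, T.toL2N_mulZ _ _⟩

lemma conjZ_polProj {x : PolLoop A} (Φ : Frame A x.loop) (n : ℤ) (f : L2 T.N) :
    conjZ n (polProj T x) f = Φ.op T (conjZ n (projW (x.W.comap (frameMap Φ)))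
      (ContinuousLinearMap.adjoint (Φ.op T) f)) := by
  rw [conjZ_apply, conjZ_apply, polProj_eq T Φ, ← adjoint_op_Zp, op_Zp]
  rfl

/-- `W ⊖ z W` has dimension at most `m`, not only at most `N`. -/
lemma finrank_polProj_le (x : PolLoop A) :
    FiniteDimensional ℂ
      (LinearMap.range (conjZ 0 (polProj T x) - conjZ 1 (polProj T x)).toLinearMap) ∧
    Module.finrank ℂ
      (LinearMap.range (conjZ 0 (polProj T x) - conjZ 1 (polProj T x)).toLinearMap) ≤ m := by
  obtain ⟨Φ⟩ := x.nonempty_frame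
  obtain ⟨h1, h2⟩ := (isShiftProj_comap T Φ).finrank_le
  set P := projW (x.W.comap (frameMap Φ))
  have hle : LinearMap.range (conjZ 0 (polProj T x) - conjZ 1 (polProj T x)).toLinearMap ≤
      (LinearMap.range (conjZ 0 P - conjZ 1 P).toLinearMap).map
        (Φ.op T : L2 m →ₗ[ℂ] L2 T.N) := by
    rintro _ ⟨f, rfl⟩
    refine ⟨_, ⟨ContinuousLinearMap.adjoint (Φ.op T) f, rfl⟩, ?_⟩
    change Φ.op T ((conjZ 0 P - conjZ 1 P) (ContinuousLinearMap.adjoint (Φ.op T) f)) =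
      (conjZ 0 (polProj T x) - conjZ 1 (polProj T x)) f
    rw [sub_apply, sub_apply, conjZ_polProj T Φ, conjZ_polProj T Φ, map_sub]
  refine ⟨Submodule.finiteDimensional_of_le hle, ?_⟩
  exact ((Submodule.finrank_mono hle).trans (Submodule.finrank_map_le _ _)).trans h2

lemma adjoint_op_comp {γ : LM m M} (Φ Φ' : Frame A γ) :
    ContinuousLinearMap.adjoint (Φ.op T) ∘L Φ'.op T =
      mulOp (compC (adjC (Φ.toC T)) (Φ'.toC T)) := by
  rw [Φ.adjoint_op, ← mulOp_comp]
  rfl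

lemma psmooth_transition {γ : LM m M} (Φ Φ' : Frame A γ) :
    IsPSmooth 𝓘(ℝ, EHom m m) (compC (adjC (Φ.toC T)) (Φ'.toC T)) := by
  have h1 : ContDiff ℝ ∞ fun q : EHom m T.N × EHom m T.N =>
      ContinuousLinearMap.adjoint q.1 ∘L q.2 :=
    (contDiff_comp_complex m T.N m).comp
      (f := fun q : EHom m T.N × EHom m T.N => (ContinuousLinearMap.adjoint q.1, q.2))
      (((contDiff_adjoint_real m T.N).comp
        (f := fun q : EHom m T.N × EHom m T.N => q.1) contDiff_fst).prodMk contDiff_snd)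
  exact ((Φ.psmooth_toC T).prodMk_space (Φ'.psmooth_toC T)).comp h1.contMDiff

lemma op_adjoint_op {γ : LM m M} (Φ Φ' : Frame A γ) (f : L2 m) :
    Φ'.op T (ContinuousLinearMap.adjoint (Φ'.op T) (Φ.op T f)) = Φ.op T f := by
  rw [← Φ.toL2N_frameMap, Φ'.op_adjoint_toL2N]

include T in
/-- The change of frames preserves the condition defining the restricted Grassmannian: if it holds
in one unitary frame, then `P_W - P_{H₊}` is Hilbert–Schmidt in every frame. -/
lemma isHSDiff_comap {x : PolLoop A} (Φ : Frame A x.loop) :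
    IsHSDiff (x.W.comap (frameMap Φ)) := by
  obtain ⟨Φ₀, h₀⟩ := x.mem_grRes
  have e := adjoint_op_comp T Φ Φ₀
  have e2 : ContinuousLinearMap.adjoint (mulOp (compC (adjC (Φ.toC T)) (Φ₀.toC T))) =
      ContinuousLinearMap.adjoint (Φ₀.op T) ∘L Φ.op T := by
    rw [← e, ContinuousLinearMap.adjoint_comp, ContinuousLinearMap.adjoint_adjoint]
  refine h₀.isHSDiff.conj (psmooth_transition T Φ Φ₀) ?_ ?_
  · rw [e2, ← e]
    refine ContinuousLinearMap.ext fun f => ?_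
    change ContinuousLinearMap.adjoint (Φ.op T) (Φ₀.op T
      (ContinuousLinearMap.adjoint (Φ₀.op T) (Φ.op T f))) = f
    rw [op_adjoint_op, Φ.adjoint_op_op]
  · rw [e2, ← e]
    have h := (polProj_eq T Φ).symm.trans (polProj_eq T Φ₀)
    refine ContinuousLinearMap.ext fun f => ?_
    have h1 := congrArg (fun B : L2 T.N →L[ℂ] L2 T.N =>
      ContinuousLinearMap.adjoint (Φ.op T) (B (Φ.op T f))) h
    refine Eq.trans ?_ h1
    change _ = ContinuousLinearMap.adjoint (Φ.op T) (Φ.op T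
      (projW (x.W.comap (frameMap Φ)) (ContinuousLinearMap.adjoint (Φ.op T) (Φ.op T f))))
    rw [Φ.adjoint_op_op, Φ.adjoint_op_op]

lemma FramedPolLoop.continuous_frame :
    Continuous fun p : FramedPolLoop A => (⟨p.pt.loop, p.frame⟩ : FramedLoop A) := by
  have h : @Continuous _ _ _ (@instTopologicalSpaceProd _ _ _ (grTopology m))
    (fun p : FramedPolLoop A => ((⟨p.pt.loop, p.frame⟩ : FramedLoop A),
      p.pt.W.comap (frameMap p.frame))) := continuous_induced_dom
  exact @Continuous.comp _ _ _ _ (@instTopologicalSpaceProd _ _ _ (grTopology m)) _ _ _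
    (@continuous_fst _ _ _ (grTopology m)) h

lemma FramedPolLoop.continuous_projDiff :
    Continuous fun p : FramedPolLoop A => projDiff (p.pt.W.comap (frameMap p.frame)) := by
  have h : @Continuous _ _ _ (@instTopologicalSpaceProd _ _ _ (grTopology m))
    (fun p : FramedPolLoop A => ((⟨p.pt.loop, p.frame⟩ : FramedLoop A),
      p.pt.W.comap (frameMap p.frame))) := continuous_induced_dom
  have h2 : @Continuous _ _ (grTopology m) _ (projDiff (m := m)) := continuous_induced_dom
  exact @Continuous.comp _ _ _ _ (grTopology m) _ _ _ h2
    (@Continuous.comp _ _ _ _ (@instTopologicalSpaceProd _ _ _ (grTopology m)) (grTopology m) _ _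
      (@continuous_snd _ _ _ (grTopology m)) h)

lemma PolLoop.continuous_loop : Continuous (PolLoop.loop (A := A)) :=
  continuous_coinduced_dom.2 (FramedLoop.continuous_loop.comp FramedPolLoop.continuous_frame)

lemma FramedPolLoop.continuous_iff {X : Type*} [TopologicalSpace X] {F : X → FramedPolLoop A} :
    Continuous F ↔ (Continuous fun x => (⟨(F x).pt.loop, (F x).frame⟩ : FramedLoop A)) ∧
      Continuous fun x => projDiff ((F x).pt.W.comap (frameMap (F x).frame)) := by
  refine ⟨fun h => ⟨FramedPolLoop.continuous_frame.comp h,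
    FramedPolLoop.continuous_projDiff.comp h⟩, fun h => continuous_induced_rng.2 ?_⟩
  have h2 : @Continuous _ _ _ (grTopology m)
      fun x => (F x).pt.W.comap (frameMap (F x).frame) := continuous_induced_rng.2 h.2
  exact @Continuous.prodMk _ _ _ _ (grTopology m) _ _ _ h.1 h2

/-- The projection `Π_x` depends continuously, in operator norm, on `x ∈ LM_±`. -/
lemma continuous_polProj : Continuous (polProj (A := A) T) := by
  refine continuous_coinduced_dom.2 ?_
  have h1 : Continuous fun p : FramedPolLoop A => FramedLoop.op T ⟨p.pt.loop, p.frame⟩ :=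
    Continuous.comp (g := FramedLoop.op T) (FramedLoop.continuous_op T)
      FramedPolLoop.continuous_frame
  have h2 : Continuous fun p : FramedPolLoop A => projW (p.pt.W.comap (frameMap p.frame)) := by
    refine continuous_iff_continuousAt.2 fun p => ?_
    refine tendsto_iff_norm_sub_tendsto_zero.2 ?_
    refine squeeze_zero (fun _ => norm_nonneg _)
      (fun q => norm_projW_sub_le (isHSDiff_comap T q.frame) (isHSDiff_comap T p.frame)) ?_
    exact tendsto_iff_norm_sub_tendsto_zero.1 FramedPolLoop.continuous_projDiff.continuousAt
  have h3 : polProj T ∘ FramedPolLoop.pt = fun p : FramedPolLoop A =>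
      FramedLoop.op T ⟨p.pt.loop, p.frame⟩ ∘L projW (p.pt.W.comap (frameMap p.frame)) ∘L
      ContinuousLinearMap.adjoint (FramedLoop.op T ⟨p.pt.loop, p.frame⟩) :=
    funext fun p => polProj_eq T p.frame
  have h4 : Continuous fun p : FramedPolLoop A =>
      ContinuousLinearMap.adjoint (FramedLoop.op T ⟨p.pt.loop, p.frame⟩) :=
    (ContinuousLinearMap.adjoint (𝕜 := ℂ) (E := L2 m) (F := L2 T.N)).continuous.comp h1
  rw [h3]
  exact h1.clm_comp (h2.clm_comp h4)

/-! ### The topology of `p*TLM` and the circle action -/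

lemma TLM.continuous_toL2N : Continuous fun v : TLM A => T.toL2N v.loop v.vec := by
  refine continuous_coinduced_dom.2 ?_
  have h : Continuous fun p : FramedLoop A × L2 m => FramedLoop.op T p.1 p.2 :=
    ((FramedLoop.continuous_op T).comp continuous_fst).clm_apply continuous_snd
  refine h.congr fun p => ?_
  exact (p.1.frame.toL2N_frameMap T p.2).symm

lemma PullTLM.continuous_pt : Continuous (PullTLM.pt (A := A)) := by
  have h1 : Continuous fun v : PullTLM A => (v.pt, (⟨v.pt.loop, v.vec⟩ : TLM A)) :=
    continuous_induced_dom
  exact h1.fst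

lemma PullTLM.continuous_toL2N :
    Continuous fun v : PullTLM A => T.toL2N v.pt.loop v.vec := by
  have h1 : Continuous fun v : PullTLM A => (v.pt, (⟨v.pt.loop, v.vec⟩ : TLM A)) :=
    continuous_induced_dom
  exact (TLM.continuous_toL2N T).comp
    (f := fun v : PullTLM A => (⟨v.pt.loop, v.vec⟩ : TLM A)) h1.snd

/-- A map to `p*TLM` is continuous if and only if it is so after the embedding of the fibres into
`L²(S¹, ℂᴺ)`. -/
lemma PullTLM.continuous_iff [T2Space M] [CompactSpace M] {X : Type*} [TopologicalSpace X]
    {F : X → PullTLM A} : Continuous F ↔ (Continuous fun x => (F x).pt) ∧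
      Continuous fun x => T.toL2N (F x).pt.loop (F x).vec := by
  constructor
  · intro h
    exact ⟨PullTLM.continuous_pt.comp h, (PullTLM.continuous_toL2N T).comp h⟩
  · rintro ⟨h1, h2⟩
    refine continuous_induced_rng.2 (h1.prodMk ?_)
    refine continuous_iff_continuousAt.2 fun x₀ => ?_
    obtain ⟨Φ₀⟩ := (F x₀).pt.nonempty_frame
    obtain ⟨U, hU, hx, s, hs⟩ := exists_local_section T Φ₀
    have hl : Continuous fun x => (F x).pt.loop := PolLoop.continuous_loop.comp h1
    have hV : IsOpen {x | (F x).pt.loop ∈ U} := hU.preimage hl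
    refine ContinuousOn.continuousAt (s := {x | (F x).pt.loop ∈ U}) ?_ (hV.mem_nhds hx)
    refine continuousOn_iff_continuous_domRestrict.2 ?_
    let V := {x | (F x).pt.loop ∈ U}
    let S : V → FramedLoop A := fun x => ⟨(F x.1).pt.loop, s ⟨(F x.1).pt.loop, x.2⟩⟩
    have hS : Continuous S := hs.comp
      (f := fun x : V => (⟨(F x.1).pt.loop, x.2⟩ : U))
      ((hl.comp continuous_subtype_val).subtype_mk _)
    have h3 : Continuous fun x : V => FramedLoop.op T (S x) :=
      (FramedLoop.continuous_op T).comp hS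
    have h4 : Continuous fun x : V => ContinuousLinearMap.adjoint (FramedLoop.op T (S x)) :=
      (ContinuousLinearMap.adjoint (𝕜 := ℂ) (E := L2 m) (F := L2 T.N)).continuous.comp h3
    have h5 : Continuous fun x : V => (S x, ContinuousLinearMap.adjoint (FramedLoop.op T (S x))
        (T.toL2N (F x.1).pt.loop (F x.1).vec)) :=
      hS.prodMk (h4.clm_apply (h2.comp continuous_subtype_val))
    have h6 : Continuous fun p : FramedLoop A × L2 m =>
        (⟨p.1.loop, frameMap p.1.frame p.2⟩ : TLM A) := continuous_coinduced_rng
    refine (h6.comp h5).congr fun x => ?_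
    exact congrArg (TLM.mk (F x.1).pt.loop) ((S x).frame.frameMap_adjoint T (F x.1).vec)

lemma PullTLM.isInducing [T2Space M] [CompactSpace M] : IsInducing
    fun v : PullTLM A => (v.pt, T.toL2N v.pt.loop v.vec) := by
  refine ⟨le_antisymm ?_ ?_⟩
  · have h := (PullTLM.continuous_iff T).1 (continuous_id (X := PullTLM A))
    exact continuous_iff_le_induced.1 (h.1.prodMk h.2)
  · refine continuous_id_iff_le.1 ?_
    let τ : TopologicalSpace (PullTLM A) := TopologicalSpace.induced
      (fun v : PullTLM A => (v.pt, T.toL2N v.pt.loop v.vec)) inferInstance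
    have h : @Continuous _ _ τ _ fun v : PullTLM A => (v.pt, T.toL2N v.pt.loop v.vec) :=
      continuous_induced_dom
    exact (@PullTLM.continuous_iff m M _ _ _ A T _ _ _ τ id).2
      ⟨continuous_fst.comp h, continuous_snd.comp h⟩

lemma isQuotientMap_pt : IsQuotientMap (FramedPolLoop.pt (A := A)) :=
  ⟨⟨rfl⟩, fun x : PolLoop A => let ⟨Φ⟩ := x.nonempty_frame; ⟨⟨x, Φ⟩, rfl⟩⟩

end PolLoop


/-! ### Rotation of polarizing subspaces -/

lemma fourier_mul_neg (n : ℤ) (t : UnitAddCircle) : (fourier n t : ℂ) * fourier (-n) t = 1 := by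
  rw [← fourier_add, add_neg_cancel, fourier_zero]

lemma norm_fourier_apply (n : ℤ) (t : UnitAddCircle) : ‖(fourier n t : ℂ)‖ = 1 := by
  rw [fourier_apply, Circle.norm_coe]

lemma rotL2_Zp {m : ℕ} (t : UnitAddCircle) (n : ℤ) (f : L2 m) :
    rotL2 t (Zp n f) = (fourier n t : ℂ) • Zp n (rotL2 t f) := by
  refine Lp.ext ?_
  have h1 := (mp_add t).quasiMeasurePreserving.ae_eq_comp (Zp_coe n f)
  filter_upwards [rotL2_coe t (Zp n f), h1, Lp.coeFn_smul (fourier n t : ℂ) (Zp n (rotL2 t f)),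
    Zp_coe n (rotL2 t f), rotL2_coe t f] with θ h2 h3 h4 h5 h6
  rw [h2, h4, Pi.smul_apply, h5, h6]
  refine h3.trans ?_
  simp only [Function.comp]
  rw [smul_smul, fourier_apply_add]

lemma Zp_neg_rotL2 {m : ℕ} (t : UnitAddCircle) (n : ℤ) (f : L2 m) :
    Zp (-n) (rotL2 t f) = (fourier n t : ℂ) • rotL2 t (Zp (-n) f) := by
  rw [rotL2_Zp, smul_smul, fourier_mul_neg, one_smul]

/-- Conjugation by powers of `z` commutes with rotation. -/
lemma conjZ_rotL2 {m : ℕ} {P P' : L2 m →L[ℂ] L2 m} {t : UnitAddCircle}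
    (h : ∀ f, P' (rotL2 t f) = rotL2 t (P f)) (n : ℤ) (f : L2 m) :
    conjZ n P' (rotL2 t f) = rotL2 t (conjZ n P f) := by
  rw [conjZ_apply, conjZ_apply, Zp_neg_rotL2, map_smul, h, map_smul, rotL2_Zp]

lemma rotL2_zero {m : ℕ} (f : L2 m) : rotL2 0 f = f := by
  refine Lp.ext ((rotL2_coe 0 f).trans (Eventually.of_forall fun θ => ?_))
  simp

lemma rotL2_add {m : ℕ} (s t : UnitAddCircle) (f : L2 m) :
    rotL2 (s + t) f = rotL2 s (rotL2 t f) := by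
  refine Lp.ext ?_
  have h1 := (mp_add s).quasiMeasurePreserving.ae_eq_comp (rotL2_coe t f)
  filter_upwards [rotL2_coe (s + t) f, rotL2_coe s (rotL2 t f), h1] with θ h2 h3 h4
  rw [h2, h3]
  refine Eq.trans ?_ h4.symm
  simp only [Function.comp, add_assoc]

/-- The projection onto a rotated subspace. -/
lemma projW_map_rotL2 {m : ℕ} (t : UnitAddCircle) (W : Submodule ℂ (L2 m)) (f : L2 m) :
    projW (W.map ((rotL2 (m := m) t).toLinearEquiv : L2 m →ₗ[ℂ] L2 m)) (rotL2 t f) =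
      rotL2 t (projW W f) := by
  let R : L2 m →L[ℂ] L2 m := (rotL2 (m := m) t).toContinuousLinearEquiv
  have hR : ∀ f, ContinuousLinearMap.adjoint R (R f) = f := by
    intro f
    refine ext_inner_right ℂ fun g => ?_
    rw [ContinuousLinearMap.adjoint_inner_left]
    exact (rotL2 (m := m) t).inner_map_map f g
  have h := congrArg (fun B : L2 m →L[ℂ] L2 m => B (R f)) (projW_map_isometry hR W)
  refine Eq.trans h ?_
  change R (projW W (ContinuousLinearMap.adjoint R (R f))) = _
  rw [hR]
  rfl

/-- Rotation acts on the coordinates of `P_W - P_{H₊}` by isometries. -/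
lemma projDiff_map_rotL2 {m : ℕ} {t : UnitAddCircle} {W : Submodule ℂ (L2 m)} (hW : IsHSDiff W)
    (hW' : IsHSDiff (W.map ((rotL2 (m := m) t).toLinearEquiv : L2 m →ₗ[ℂ] L2 m)))
    (q : ℤ × Fin m) :
    projDiff (W.map ((rotL2 (m := m) t).toLinearEquiv : L2 m →ₗ[ℂ] L2 m)) q =
      (fourier (-q.1) t : ℂ) • rotL2 t (projDiff W q) := by
  rw [projDiff_apply hW', projDiff_apply hW]
  have h1 : mode q = (fourier (-q.1) t : ℂ) • rotL2 t (mode q) := by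
    rw [rotL2_mode, smul_smul, mul_comm, fourier_mul_neg, one_smul]
  have h2 : projH m (rotL2 t (mode q)) = rotL2 t (projH m (mode q)) :=
    starProjection_equiv _ _ (map_rotL2_Hplus t) _
  conv_lhs => rw [h1]
  rw [map_smul, sub_apply, sub_apply, projW_map_rotL2, h2, map_sub]

/-- Rotation, twisted by a character of the circle. -/
def twist {m : ℕ} (n : ℤ) (t : UnitAddCircle) (f : L2 m) : L2 m := (fourier n t : ℂ) • rotL2 t f

lemma norm_twist_sub {m : ℕ} (n : ℤ) (t : UnitAddCircle) (v w : L2 m) :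
    ‖twist n t v - twist n t w‖ = ‖v - w‖ := by
  have h : twist n t v - twist n t w = (fourier n t : ℂ) • rotL2 t (v - w) := by
    rw [map_sub, smul_sub]
    rfl
  rw [h, norm_smul, norm_fourier_apply, one_mul, LinearIsometryEquiv.norm_map]

lemma twist_zero {m : ℕ} (n : ℤ) (t : UnitAddCircle) : twist n t (0 : L2 m) = 0 := by
  rw [twist, map_zero, smul_zero]

lemma continuous_twist {m : ℕ} (n : ℤ) (v : L2 m) : Continuous fun t => twist n t v := by
  have h5 : Continuous fun t : UnitAddCircle => rotL2 t v :=
    continuous_rotL2.comp (f := fun t : UnitAddCircle => (t, v)) (by fun_prop)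
  exact Continuous.smul (f := fun t : UnitAddCircle => (fourier n t : ℂ))
    (g := fun t : UnitAddCircle => rotL2 t v) (fourier n).continuous h5

/-- A family of isometries of the coordinates of `ℓ²`, each depending continuously on a parameter,
acts continuously. -/
lemma continuous_lp_of_isometries {Q S X F : Type*} [NormedAddCommGroup F] [TopologicalSpace S]
    [TopologicalSpace X] {U : S → Q → F → F}
    (hU : ∀ t q v w, ‖U t q v - U t q w‖ = ‖v - w‖) (hU0 : ∀ t q, U t q 0 = 0)
    (hUc : ∀ q v, Continuous fun t => U t q v)
    {D : S × X → lp (fun _ : Q => F) 2} {d : X → lp (fun _ : Q => F) 2} (hd : Continuous d)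
    (hD : ∀ p q, D p q = U p.1 q (d p.2 q)) : Continuous D := by
  have hn : ∀ v : lp (fun _ : Q => F) 2, ‖v‖ ^ 2 = ∑' q, ‖v q‖ ^ 2 := by
    intro v
    have h := lp.norm_rpow_eq_tsum (p := 2) (by norm_num) v
    simpa using h
  have hs : ∀ v : lp (fun _ : Q => F) 2, Summable fun q => ‖v q‖ ^ 2 := by
    intro v
    have h := lp.hasSum_norm (p := 2) (by norm_num) v
    simp only [ENNReal.toReal_ofNat, Real.rpow_ofNat] at h
    exact h.summable
  have hsub : ∀ (v w : lp (fun _ : Q => F) 2) q, (v - w) q = v q - w q := fun v w q => rfl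
  refine continuous_iff_continuousAt.2 fun p₀ => ?_
  -- the two coordinates are varied one after the other
  have h1 : ∀ p, ‖D p - D (p.1, p₀.2)‖ = ‖d p.2 - d p₀.2‖ := by
    intro p
    have e : ‖D p - D (p.1, p₀.2)‖ ^ 2 = ‖d p.2 - d p₀.2‖ ^ 2 := by
      rw [hn, hn]
      refine tsum_congr fun q => ?_
      rw [hsub, hsub, hD, hD, hU]
    exact (sq_eq_sq₀ (norm_nonneg _) (norm_nonneg _)).1 e
  have h2 : Tendsto (fun t => ‖D (t, p₀.2) - D p₀‖) (𝓝 p₀.1) (𝓝 0) := by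
    have h3 : Tendsto (fun t => ∑' q, ‖(D (t, p₀.2) - D p₀) q‖ ^ 2) (𝓝 p₀.1)
        (𝓝 (∑' _ : Q, (0 : ℝ))) := by
      refine tendsto_tsum_of_dominated_convergence (bound := fun q => 2 ^ 2 * ‖d p₀.2 q‖ ^ 2)
        ((hs (d p₀.2)).mul_left _) (fun q => ?_) (Eventually.of_forall fun t q => ?_)
      · have h4 : Continuous fun t => ‖U t q (d p₀.2 q) - D p₀ q‖ ^ 2 :=
          (((hUc q (d p₀.2 q)).sub continuous_const).norm).pow 2
        have h4 := h4.tendsto p₀.1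
        have h5 : U p₀.1 q (d p₀.2 q) - D p₀ q = 0 := by rw [hD, sub_self]
        rw [h5, norm_zero, zero_pow two_ne_zero] at h4
        refine h4.congr fun t => ?_
        rw [hsub, hD (t, p₀.2)]
      · rw [Real.norm_eq_abs, abs_of_nonneg (sq_nonneg _), ← mul_pow]
        refine pow_le_pow_left₀ (norm_nonneg _) ?_ 2
        have h5 : ∀ t, ‖U t q (d p₀.2 q)‖ = ‖d p₀.2 q‖ := by
          intro t
          have := hU t q (d p₀.2 q) 0
          rwa [hU0, sub_zero, sub_zero] at this
        rw [hsub, hD, hD]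
        refine (norm_sub_le _ _).trans_eq ?_
        rw [h5, h5, two_mul]
    rw [tsum_zero] at h3
    have h4 := h3.sqrt
    rw [Real.sqrt_zero] at h4
    refine h4.congr fun t => ?_
    rw [← hn, Real.sqrt_sq (norm_nonneg _)]
  refine tendsto_iff_norm_sub_tendsto_zero.2 ?_
  have h3 : Tendsto (fun p => ‖d p.2 - d p₀.2‖ + ‖D (p.1, p₀.2) - D p₀‖) (𝓝 p₀) (𝓝 (0 + 0)) := by
    refine Tendsto.add ?_ (h2.comp continuous_fst.continuousAt)
    exact tendsto_iff_norm_sub_tendsto_zero.1 ((hd.comp continuous_snd).tendsto p₀)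
  rw [add_zero] at h3
  refine squeeze_zero (fun _ => norm_nonneg _) (fun p => ?_) h3
  rw [← h1]
  exact norm_sub_le_norm_sub_add_norm_sub _ _ _

section PolLoop

variable {m : ℕ} {M : Type u} [TopologicalSpace M]
  [ChartedSpace (EuclideanSpace ℝ (Fin (2 * m))) M] [IsManifold (𝓡 (2 * m)) ∞ M]
  {A : AlmostHermitian m M} (T : A.ParsevalFrame)

lemma map_toL2N_rotPol (t : UnitAddCircle) (x : PolLoop A) :
    (rotPol t x).W.map (T.toL2N (rotPol t x).loop) =
      (x.W.map (T.toL2N x.loop)).map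
        ((rotL2 (m := T.N) t).toLinearEquiv : L2 T.N →ₗ[ℂ] L2 T.N) := by
  change (x.W.map (rot (A := A) t x.loop : TLMfib A x.loop →ₗ[ℂ] _)).map
    (T.toL2N (rotLoop t x.loop)) = _
  rw [← Submodule.map_comp, ← Submodule.map_comp]
  congr 1
  exact LinearMap.ext fun σ => T.toL2N_rot t x.loop σ

lemma polProj_rot (t : UnitAddCircle) (x : PolLoop A) (f : L2 T.N) :
    polProj T (rotPol t x) (rotL2 t f) = rotL2 t (polProj T x f) := by
  rw [polProj, polProj, map_toL2N_rotPol, projW_map_rotL2]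

lemma comap_rotFrame (t : UnitAddCircle) (x : PolLoop A) (Φ : Frame A x.loop) :
    (rotPol t x).W.comap (frameMap (rotFrame t Φ)) = (x.W.comap (frameMap Φ)).map
      ((rotL2 (m := m) t).toLinearEquiv : L2 m →ₗ[ℂ] L2 m) := by
  refine Submodule.ext fun f => ?_
  obtain ⟨f, rfl⟩ := (rotL2 t).surjective f
  have h1 : (∃ σ ∈ x.W, rot t x.loop σ = frameMap (rotFrame t Φ) (rotL2 t f)) ↔
      frameMap Φ f ∈ x.W := by
    rw [frameMap_rot]
    exact ⟨fun ⟨σ, hσ, h⟩ => (rot t x.loop).injective h ▸ hσ, fun h => ⟨_, h, rfl⟩⟩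
  have h2 : (∃ f' ∈ x.W.comap (frameMap Φ), rotL2 t f' = rotL2 t f) ↔ frameMap Φ f ∈ x.W :=
    ⟨fun ⟨f', hf', h⟩ => (rotL2 t).injective h ▸ hf', fun h => ⟨_, h, rfl⟩⟩
  exact h1.trans h2.symm

/-- Rotation of framed points of `LM_±`. -/
def FramedPolLoop.rot (t : UnitAddCircle) (p : FramedPolLoop A) : FramedPolLoop A :=
  ⟨rotPol t p.pt, rotFrame t p.frame⟩

include T in
lemma FramedPolLoop.continuous_rot :
    Continuous fun p : UnitAddCircle × FramedPolLoop A => FramedPolLoop.rot p.1 p.2 := by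
  have h1 : Continuous fun p : UnitAddCircle × FramedPolLoop A =>
      (p.1, (⟨p.2.pt.loop, p.2.frame⟩ : FramedLoop A)) :=
    continuous_fst.prodMk (FramedPolLoop.continuous_frame.comp continuous_snd)
  refine FramedPolLoop.continuous_iff.2 ⟨FramedLoop.continuous_iff.2 ⟨?_, fun k => ?_⟩, ?_⟩
  · exact continuous_rotLoop.comp (f := fun p : UnitAddCircle × FramedPolLoop A =>
      (p.1, p.2.pt.loop)) (h1.fst.prodMk (FramedLoop.continuous_loop.comp h1.snd))
  · exact continuous_rotLoop.comp (f := fun p : UnitAddCircle × FramedPolLoop A =>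
      (p.1, p.2.frame.loopTB k)) (h1.fst.prodMk ((FramedLoop.continuous_loopTB k).comp h1.snd))
  · have h0 : ∀ (p : UnitAddCircle × FramedPolLoop A) q,
        projDiff ((FramedPolLoop.rot p.1 p.2).pt.W.comap
          (frameMap (FramedPolLoop.rot p.1 p.2).frame)) q =
        twist (-q.1) p.1 (projDiff (p.2.pt.W.comap (frameMap p.2.frame)) q) := by
      intro p q
      have e := comap_rotFrame p.1 p.2.pt p.2.frame
      refine (congrArg (fun W => projDiff W q) e).trans ?_
      refine projDiff_map_rotL2 (isHSDiff_comap T p.2.frame) ?_ q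
      exact e ▸ isHSDiff_comap T (x := rotPol p.1 p.2.pt) (rotFrame p.1 p.2.frame)
    exact continuous_lp_of_isometries (U := fun t (q : ℤ × Fin m) f => twist (-q.1) t f)
      (fun t q v w => norm_twist_sub _ t v w) (fun t q => twist_zero _ t)
      (fun q v => continuous_twist _ v) FramedPolLoop.continuous_projDiff h0

include T in
lemma continuous_rotPol : Continuous fun p : UnitAddCircle × PolLoop A => rotPol p.1 p.2 :=
  isQuotientMap_pt.continuous_lift_prod_right
    ((isQuotientMap_pt (A := A)).continuous.comp (FramedPolLoop.continuous_rot T))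

end PolLoop


/-! ### Vector bundles from continuous families of finite rank projections -/

/-- The ranges of a norm continuous family of finite rank projections form a vector bundle. -/
lemma trivialNear_of_projection {B : Type u} [TopologicalSpace B] {F : B → Type}
    [∀ b, AddCommGroup (F b)] [∀ b, Module ℂ (F b)] {H : Type*} [NormedAddCommGroup H]
    [NormedSpace ℂ H] (j : ∀ x, F x →ₗ[ℂ] H) (hj : ∀ x, Function.Injective (j x))
    {P : B → H →L[ℂ] H} (hP : Continuous P) (hrange : ∀ x f, P x f = f ↔ ∃ σ, j x σ = f)
    (hidem : ∀ x f, P x (P x f) = P x f) (hfin : ∀ x, FiniteDimensional ℂ (F x))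
    {τ : TopologicalSpace (Σ x, F x)}
    (hτ : τ = TopologicalSpace.induced (fun v => (v.1, j v.1 v.2)) inferInstance) (x₀ : B) :
    TrivialNear F τ x₀ (Module.finrank ℂ (F x₀)) := by
  let r := Module.finrank ℂ (F x₀)
  have hjP : ∀ x σ, P x (j x σ) = j x σ := fun x σ => (hrange x _).2 ⟨σ, rfl⟩
  -- coordinates on the fibre at `x₀`
  let b : Module.Basis (Fin r) ℂ (F x₀) := Module.finBasis ℂ (F x₀)
  let L : (Fin r → ℂ) →L[ℂ] H := LinearMap.toContinuousLinearMap
    (j x₀ ∘ₗ b.equivFun.symm.toLinearMap)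
  have hproj : ∀ x f, ∃ σ, j x σ = P x f := fun x f => (hrange x _).1 (hidem x f)
  -- the projections, as maps to the fibres
  choose q hq using hproj
  let p : ∀ x, H →ₗ[ℂ] F x := fun x =>
    { toFun := q x
      map_add' := fun f g => hj x (by rw [map_add, hq, hq, hq, map_add])
      map_smul' := fun c f => hj x (by rw [RingHom.id_apply, map_smul, hq, hq, map_smul]) }
  let e₀ : F x₀ ≃ₗ[ℂ] LinearMap.range (j x₀) := LinearEquiv.ofInjective (j x₀) (hj x₀)
  have : FiniteDimensional ℂ (LinearMap.range (j x₀)) := e₀.finiteDimensional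
  let Pr : H →L[ℂ] LinearMap.range (j x₀) := (P x₀).codRestrict _ fun f => ⟨q x₀ f, hq x₀ f⟩
  let K : H →L[ℂ] (Fin r → ℂ) := (LinearMap.toContinuousLinearMap
    (b.equivFun.toLinearMap ∘ₗ e₀.symm.toLinearMap)) ∘L Pr
  have hLK : ∀ f, L (K f) = P x₀ f := by
    intro f
    change j x₀ (b.equivFun.symm (b.equivFun (e₀.symm (Pr f)))) = _
    rw [LinearEquiv.symm_apply_apply]
    exact congrArg Subtype.val (e₀.apply_symm_apply (Pr f))
  have hPL : ∀ c, P x₀ (L c) = L c := fun c => hjP x₀ _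
  have hL0 : ∀ c, L c = 0 → c = 0 := by
    intro c hc
    have h1 : b.equivFun.symm c = 0 := hj x₀ (hc.trans (map_zero _).symm)
    exact b.equivFun.symm.map_eq_zero_iff.1 h1
  have hKL : ∀ c, K (L c) = c := by
    intro c
    refine sub_eq_zero.1 (hL0 _ ?_)
    rw [map_sub, hLK, hPL, sub_self]
  let U : Set B := {x | ‖P x - P x₀‖ < 1}
  have hU : IsOpen U := isOpen_lt (hP.sub continuous_const).norm continuous_const
  have hinj : ∀ x ∈ U, ∀ f, P x₀ f = f → P x f = 0 → f = 0 := by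
    intro x hx f h1 h2
    by_contra h0
    have h3 : ‖f‖ ≤ ‖P x - P x₀‖ * ‖f‖ := by
      have := (P x - P x₀).le_opNorm f
      rwa [sub_apply, h1, h2, zero_sub, norm_neg] at this
    have h4 := norm_pos_iff.2 h0
    have h5 : ‖P x - P x₀‖ < 1 := hx
    nlinarith
  have hinj' : ∀ x ∈ U, ∀ f, P x f = f → P x₀ f = 0 → f = 0 := by
    intro x hx f h1 h2
    by_contra h0
    have h3 : ‖f‖ ≤ ‖P x - P x₀‖ * ‖f‖ := by
      have := (P x - P x₀).le_opNorm f
      rwa [sub_apply, h1, h2, sub_zero] at this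
    have h4 := norm_pos_iff.2 h0
    have h5 : ‖P x - P x₀‖ < 1 := hx
    nlinarith
  -- the trivialization and its inverse
  let e : ∀ x : U, (Fin r → ℂ) →ₗ[ℂ] F x.1 := fun x => p x.1 ∘ₗ L.toLinearMap
  have he : ∀ x c, j x.1 (e x c) = P x.1 (L c) := fun x c => hq x.1 _
  have heinj : ∀ x, Function.Injective (e x) := by
    intro x
    refine (injective_iff_map_eq_zero _).2 fun c hc => ?_
    refine hL0 c (hinj x.1 x.2 _ (hPL c) ?_)
    rw [← he, hc, map_zero]
  have hKinj : ∀ x : U, Function.Injective (K.toLinearMap ∘ₗ j x.1) := by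
    intro x
    refine (injective_iff_map_eq_zero _).2 fun σ hσ => ?_
    have h1 : K (j x.1 σ) = 0 := hσ
    have h2 : P x₀ (j x.1 σ) = 0 := by rw [← hLK, h1, map_zero]
    exact hj x.1 ((hinj' x.1 x.2 _ (hjP x.1 σ) h2).trans (map_zero _).symm)
  have hrank : ∀ x : U, Module.finrank ℂ (F x.1) = r := by
    intro x
    have := hfin x.1
    refine le_antisymm ?_ ?_
    · simpa using LinearMap.finrank_le_finrank_of_injective (hKinj x)
    · simpa using LinearMap.finrank_le_finrank_of_injective (heinj x)
  have hebij : ∀ x, Function.Bijective (e x) := by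
    intro x
    have := hfin x.1
    refine ⟨heinj x, ?_⟩
    exact (LinearMap.injective_iff_surjective_of_finrank_eq_finrank
      (by rw [hrank x]; simp)).1 (heinj x)
  let C : U → (Fin r → ℂ) →L[ℂ] (Fin r → ℂ) := fun x => K ∘L P x.1 ∘L L
  have hCc : Continuous C :=
    continuous_const.clm_comp ((hP.comp continuous_subtype_val).clm_comp continuous_const)
  have hCu : ∀ x, IsUnit (C x) := by
    intro x
    have h1 : Function.Injective (C x).toLinearMap := by
      intro c d hcd
      refine heinj x (hKinj x ?_)
      change K (j x.1 (e x c)) = K (j x.1 (e x d))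
      rw [he, he]
      exact hcd
    rw [ContinuousLinearMap.isUnit_iff_bijective]
    exact ⟨h1, LinearMap.injective_iff_surjective.1 h1⟩
  have hCi : Continuous fun x => Ring.inverse (C x) := by
    refine continuous_iff_continuousAt.2 fun x => ?_
    obtain ⟨u, hu⟩ := hCu x
    have h1 := NormedRing.inverse_continuousAt u
    rw [hu] at h1
    exact h1.comp hCc.continuousAt
  refine ⟨U, hU, by simp [U], fun x => LinearEquiv.ofBijective (e x) (hebij x), ?_⟩
  let g : (Σ x, F x) → B × H := fun v => (v.1, j v.1 v.2)
  have hg : @Continuous _ _ τ _ g := by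
    rw [hτ]
    exact continuous_induced_dom
  let G : U × (Fin r → ℂ) → U × H := fun q => (q.1, P q.1.1 (L q.2))
  have hG : Continuous G := continuous_fst.prodMk
    ((hP.comp (continuous_subtype_val.comp continuous_fst)).clm_apply
      (L.continuous.comp continuous_snd))
  have hemb : IsEmbedding G := by
    refine Function.LeftInverse.isEmbedding
      (f := fun q : U × H => (q.1, Ring.inverse (C q.1) (K q.2))) ?_ ?_ hG
    · rintro ⟨x, c⟩
      refine Prod.ext rfl ?_
      change Ring.inverse (C x) (C x c) = c
      exact congrArg (fun D : (Fin r → ℂ) →L[ℂ] (Fin r → ℂ) => D c)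
        (Ring.inverse_mul_cancel _ (hCu x))
    · exact continuous_fst.prodMk ((hCi.comp continuous_fst).clm_apply
        (K.continuous.comp continuous_snd))
  have hemb2 : IsEmbedding fun q : U × (Fin r → ℂ) => ((q.1.1, P q.1.1 (L q.2)) : B × H) :=
    (IsEmbedding.subtypeVal.prodMap IsEmbedding.id).comp hemb
  have hcomp : (g ∘ fun q : U × (Fin r → ℂ) => (⟨q.1.1, e q.1 q.2⟩ : Σ x, F x)) =
      fun q : U × (Fin r → ℂ) => ((q.1.1, P q.1.1 (L q.2)) : B × H) :=
    funext fun q => Prod.ext rfl (he q.1 q.2)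
  refine IsEmbedding.of_comp (g := g) ?_ hg ?_
  · rw [hτ]
    refine continuous_induced_rng.2 ?_
    exact hcomp ▸ hemb2.continuous
  · exact hcomp ▸ hemb2

section PolLoop

variable {m : ℕ} {M : Type u} [TopologicalSpace M]
  [ChartedSpace (EuclideanSpace ℝ (Fin (2 * m))) M] [IsManifold (𝓡 (2 * m)) ∞ M]
  {A : AlmostHermitian m M} (T : A.ParsevalFrame)

/-! ### The subbundles `zⁱ W ⊖ zʲ W` -/

/-- The projection of `L²(S¹, ℂᴺ)` onto the image of `zⁱ W ⊖ zʲ W`. -/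
def subProj (i j : ℤ) (x : PolLoop A) : L2 T.N →L[ℂ] L2 T.N :=
  conjZ i (polProj T x) - conjZ j (polProj T x)

lemma continuous_conjZ {m : ℕ} (n : ℤ) :
    Continuous (conjZ n : (L2 m →L[ℂ] L2 m) → (L2 m →L[ℂ] L2 m)) :=
  continuous_const.clm_comp (continuous_id.clm_comp continuous_const)

lemma continuous_subProj (i j : ℤ) : Continuous (subProj (A := A) T i j) :=
  ((continuous_conjZ i).comp (continuous_polProj T)).sub
    ((continuous_conjZ j).comp (continuous_polProj T))

lemma subProj_rot (i j : ℤ) (t : UnitAddCircle) (x : PolLoop A) (f : L2 T.N) :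
    subProj T i j (rotPol t x) (rotL2 t f) = rotL2 t (subProj T i j x f) := by
  rw [subProj, subProj, sub_apply, sub_apply, conjZ_rotL2 (polProj_rot T t x),
    conjZ_rotL2 (polProj_rot T t x), map_sub]

/-- The range of the projection consists of vector fields along the loop. -/
lemma exists_toL2N_eq (i j : ℤ) (x : PolLoop A) (f : L2 T.N) :
    ∃ σ, T.toL2N x.loop σ = subProj T i j x f := by
  obtain ⟨Φ⟩ := x.nonempty_frame
  refine ⟨frameMap Φ (conjZ i (projW (x.W.comap (frameMap Φ)))
      (ContinuousLinearMap.adjoint (Φ.op T) f) - conjZ j (projW (x.W.comap (frameMap Φ)))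
      (ContinuousLinearMap.adjoint (Φ.op T) f)), ?_⟩
  rw [Φ.toL2N_frameMap, map_sub, ← conjZ_polProj, ← conjZ_polProj, subProj, sub_apply]

lemma finiteDimensional_range_subProj {i j : ℤ} (h : i ≤ j) (x : PolLoop A) :
    FiniteDimensional ℂ (LinearMap.range (subProj T i j x).toLinearMap) := by
  induction j, h using Int.leInduction with
  | base =>
    have : subProj T i i x = 0 := sub_self _
    rw [this]
    exact Submodule.finiteDimensional_of_le (S₂ := ⊥) (by rintro _ ⟨f, rfl⟩; exact rfl)
  | succ j hj ih =>
    have h1 := (finrank_polProj_le T x).1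
    have hle : LinearMap.range (subProj T i (j + 1) x).toLinearMap ≤
        LinearMap.range (subProj T i j x).toLinearMap ⊔
        (LinearMap.range (conjZ 0 (polProj T x) - conjZ 1 (polProj T x)).toLinearMap).map
          (Zp j : L2 T.N →L[ℂ] L2 T.N).toLinearMap := by
      rintro _ ⟨f, rfl⟩
      refine Submodule.mem_sup.2 ⟨_, ⟨f, rfl⟩, _, ⟨_, ⟨Zp (-j) f, rfl⟩, rfl⟩, ?_⟩
      change subProj T i j x f + Zp j ((conjZ 0 (polProj T x) - conjZ 1 (polProj T x))
        (Zp (-j) f)) = subProj T i (j + 1) x f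
      simp only [subProj, sub_apply, conjZ_apply, map_sub, Zp_apply_apply]
      simp only [neg_zero, zero_add, add_zero, neg_add_rev]
      abel
    exact Submodule.finiteDimensional_of_le hle

/-- The subspace `zⁱ W ⊖ zʲ W` of `T_γ LM`, for `x = (γ, W)`. -/
def subFib (i j : ℤ) (x : PolLoop A) : Submodule ℂ (TLMfib A x.loop) :=
  LinearMap.eqLocus ((subProj T i j x).toLinearMap ∘ₗ T.toL2N x.loop) (T.toL2N x.loop)

lemma mem_subFib {i j : ℤ} {x : PolLoop A} {σ : TLMfib A x.loop} :
    σ ∈ subFib T i j x ↔ subProj T i j x (T.toL2N x.loop σ) = T.toL2N x.loop σ := Iff.rfl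

lemma subProj_idem {i j : ℤ} (h : i ≤ j) (x : PolLoop A) (f : L2 T.N) :
    subProj T i j x (subProj T i j x f) = subProj T i j x f :=
  (isShiftProj_polProj T x).sub_idem h f

/-- The embedding of `zⁱ W ⊖ zʲ W` into `L²(S¹, ℂᴺ)`. -/
def subEmb (i j : ℤ) (x : PolLoop A) : subFib T i j x →ₗ[ℂ] L2 T.N :=
  T.toL2N x.loop ∘ₗ (subFib T i j x).subtype

lemma subEmb_injective (i j : ℤ) (x : PolLoop A) : Function.Injective (subEmb T i j x) :=
  (T.toL2N_injective x.loop).comp Subtype.val_injective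

lemma subProj_eq_self_iff (i j : ℤ) (x : PolLoop A) (f : L2 T.N) :
    subProj T i j x f = f ↔ ∃ σ, subEmb T i j x σ = f := by
  constructor
  · intro hf
    obtain ⟨σ, hσ⟩ := exists_toL2N_eq T i j x f
    rw [hf] at hσ
    exact ⟨⟨σ, by rw [mem_subFib, hσ, hf]⟩, hσ⟩
  · rintro ⟨σ, rfl⟩
    exact σ.2

lemma finiteDimensional_subFib {i j : ℤ} (h : i ≤ j) (x : PolLoop A) :
    FiniteDimensional ℂ (subFib T i j x) := by
  have := finiteDimensional_range_subProj T h x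
  refine FiniteDimensional.of_injective ((subEmb T i j x).codRestrict
    (LinearMap.range (subProj T i j x).toLinearMap) fun σ => ⟨_, σ.2⟩) ?_
  intro σ τ hστ
  exact subEmb_injective T i j x (congrArg Subtype.val hστ)

lemma subFib_mono {i j i' j' : ℤ} (hi : i' ≤ i) (hij : i ≤ j) (hj : j ≤ j') (x : PolLoop A) :
    subFib T i j x ≤ subFib T i' j' x := by
  intro σ hσ
  have hP := isShiftProj_polProj T x
  rw [mem_subFib] at hσ ⊢
  rw [← hσ]
  simp only [subProj, sub_apply, map_sub, hP.conj_le (hi), hP.conj_le (hi.trans hij),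
    hP.conj_le' (hij.trans hj), hP.conj_le' hj]
  abel

lemma continuous_subTopology_fst (E : ∀ x : PolLoop A, Submodule ℂ (TLMfib A x.loop)) :
    @Continuous _ _ (subTopology E) _ (Sigma.fst : (Σ x, E x) → PolLoop A) :=
  let _ : TopologicalSpace (Σ x, E x) := subTopology E
  PullTLM.continuous_pt.comp (f := fun v : Σ x, E x => (⟨v.1, v.2.1⟩ : PullTLM A))
    continuous_induced_dom

lemma continuous_subTopology_toL2N (E : ∀ x : PolLoop A, Submodule ℂ (TLMfib A x.loop)) :
    @Continuous _ _ (subTopology E) _ fun v : Σ x, E x => T.toL2N v.1.loop v.2.1 :=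
  let _ : TopologicalSpace (Σ x, E x) := subTopology E
  (PullTLM.continuous_toL2N T).comp (f := fun v : Σ x, E x => (⟨v.1, v.2.1⟩ : PullTLM A))
    continuous_induced_dom

/-- The circle rotates `z` by a scalar, and so it maps `zⁱ W ⊖ zʲ W` to `zⁱ (t W) ⊖ zʲ (t W)`. -/
lemma subFib_invariant (i j : ℤ) (t : UnitAddCircle) (x : PolLoop A) :
    (subFib T i j x).map (rotFib t x).toLinearMap = subFib T i j (rotPol t x) := by
  have key : ∀ σ, rotFib t x σ ∈ subFib T i j (rotPol t x) ↔ σ ∈ subFib T i j x := by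
    intro σ
    have h : T.toL2N (rotPol t x).loop (rotFib t x σ) = rotL2 t (T.toL2N x.loop σ) :=
      T.toL2N_rot t x.loop σ
    rw [mem_subFib, mem_subFib, h, subProj_rot, (rotL2 t).injective.eq_iff]
  ext τ
  obtain ⟨σ, rfl⟩ := (rotFib t x).surjective τ
  rw [key]
  exact ⟨fun ⟨σ', hσ', h⟩ => (rotFib t x).injective h ▸ hσ', fun h => ⟨σ, h, rfl⟩⟩

section

variable [T2Space M] [CompactSpace M]

lemma subTopology_eq (E : ∀ x : PolLoop A, Submodule ℂ (TLMfib A x.loop)) :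
    subTopology E = TopologicalSpace.induced
      (fun v : Σ x, E x => (v.1, T.toL2N v.1.loop v.2.1)) inferInstance := by
  rw [subTopology, (PullTLM.isInducing T).eq_induced, induced_compose]
  rfl

lemma subTopology_continuous_iff {E : ∀ x : PolLoop A, Submodule ℂ (TLMfib A x.loop)}
    {X : Type*} [TopologicalSpace X] {F : X → Σ x, E x} :
    @Continuous _ _ _ (subTopology E) F ↔ (Continuous fun y => (F y).1) ∧
      Continuous fun y => T.toL2N (F y).1.loop (F y).2.1 := by
  rw [subTopology_eq T, continuous_induced_rng]
  exact continuous_prodMk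

include T in
/-- The circle acts continuously on the total space of an invariant family of subspaces. -/
lemma continuous_rotSub {E : ∀ x : PolLoop A, Submodule ℂ (TLMfib A x.loop)}
    (hE : ∀ t x, (E x).map (rotFib t x).toLinearMap = E (rotPol t x)) :
    @Continuous _ _ (@instTopologicalSpaceProd _ _ _ (subTopology E)) (subTopology E)
      (fun p : UnitAddCircle × (Σ x, E x) =>
        (⟨rotPol p.1 p.2.1, rotSub hE p.1 p.2.1 p.2.2⟩ : Σ x, E x)) := by
  let _ : TopologicalSpace (Σ x, E x) := subTopology E
  refine (subTopology_continuous_iff T).2 ⟨?_, ?_⟩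
  · exact (continuous_rotPol T).comp (f := fun p : UnitAddCircle × (Σ x, E x) => (p.1, p.2.1))
      (continuous_fst.prodMk ((continuous_subTopology_fst E).comp continuous_snd))
  · have h := continuous_rotL2.comp
      (f := fun p : UnitAddCircle × (Σ x, E x) => (p.1, T.toL2N p.2.1.loop p.2.2.1))
      (continuous_fst.prodMk ((continuous_subTopology_toL2N T E).comp continuous_snd))
    refine h.congr fun p => ?_
    exact (T.toL2N_rot p.1 p.2.1.loop p.2.2.1).symm

/-- The subbundle with fibres `zⁱ W ⊖ zʲ W`. -/
def subBundle {i j : ℤ} (h : i ≤ j) : EqSubbundle A where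
  fib := subFib T i j
  invariant := subFib_invariant T i j
  isVectorBundle := ⟨continuous_subTopology_fst _, fun x => ⟨_,
    trivialNear_of_projection (subEmb T i j) (subEmb_injective T i j) (continuous_subProj T i j)
      (subProj_eq_self_iff T i j) (subProj_idem T h) (finiteDimensional_subFib T h)
      (subTopology_eq T _) x⟩⟩
  continuous_act := continuous_rotSub T _

/-- Each vector field along `γ` is approximated by elements of `z⁻ⁿ W ⊖ zⁿ W`. -/
lemma dense_subFib (x : PolLoop A) : @Dense _ (fibTopology x)
    {σ | ∃ n : ℕ, σ ∈ subFib T (-(n + 1 : ℤ)) (n + 1) x} := by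
  have hind : fibTopology x = TopologicalSpace.induced (T.toL2N x.loop) inferInstance := by
    refine le_antisymm ?_ ?_
    · let _ := fibTopology x
      exact continuous_iff_le_induced.1 ((PullTLM.continuous_toL2N T).comp
        (f := fun σ => (⟨x, σ⟩ : PullTLM A)) continuous_induced_dom)
    · refine continuous_iff_le_induced.1 ?_
      let _ := TopologicalSpace.induced (T.toL2N x.loop) inferInstance
      exact (PullTLM.continuous_iff T).2 ⟨continuous_const, continuous_induced_dom⟩
  rw [hind]
  let _ := TopologicalSpace.induced (T.toL2N x.loop) inferInstance
  have hi : IsInducing (T.toL2N x.loop) := ⟨rfl⟩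
  intro σ
  obtain ⟨Φ⟩ := x.nonempty_frame
  choose τ hτ using fun n : ℕ => exists_toL2N_eq T (-(n + 1 : ℤ)) (n + 1) x (T.toL2N x.loop σ)
  refine mem_closure_of_tendsto (f := τ) (b := atTop) ?_ (Eventually.of_forall fun n => ⟨n, ?_⟩)
  · rw [hi.tendsto_nhds_iff]
    have h1 : Tendsto (fun n : ℕ => (n + 1 : ℤ)) atTop atTop :=
      tendsto_atTop_add_const_right _ _ tendsto_natCast_atTop_atTop
    have h2 : Tendsto (fun n : ℕ => -(n + 1 : ℤ)) atTop atBot :=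
      tendsto_neg_atTop_atBot.comp h1
    have hHS := isHSDiff_comap T Φ
    set f := ContinuousLinearMap.adjoint (Φ.op T) (T.toL2N x.loop σ) with hf
    have h3 := ((tendsto_conjZ_atBot hHS f).comp h2).sub ((tendsto_conjZ_atTop hHS f).comp h1)
    have h4 := ((Φ.op T).continuous.tendsto _).comp h3
    rw [sub_zero, hf, Φ.op_adjoint_toL2N T] at h4
    refine h4.congr fun n => ?_
    change Φ.op T (conjZ _ _ _ - conjZ _ _ _) = T.toL2N x.loop (τ n)
    rw [hτ, map_sub, ← conjZ_polProj, ← conjZ_polProj, subProj, sub_apply]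
  · rw [mem_subFib, hτ, subProj_idem T (by omega)]

end

end PolLoop


/-! ### The choice of a radius -/

/-- If `u x s`, for `s ∈ [0, 1]`, is continuous and vanishes at `s = 1`, then `u x s < 1` for some
`s < 1` which depends continuously on `x`. -/
lemma exists_continuous_radius {X : Type*} [TopologicalSpace X] {u : X → ℝ → ℝ}
    (hu : Continuous fun p : X × Icc (0 : ℝ) 1 => u p.1 p.2) (h0 : ∀ x s, 0 ≤ u x s)
    (h1 : ∀ x, u x 1 = 0) :
    ∃ r : X → ℝ, Continuous r ∧ ∀ x, 0 ≤ r x ∧ r x < 1 ∧ u x (r x) < 1 := by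
  -- at a point with `u x s ≥ 1`, the function below has the value `(1 + s) / 2 > s`
  let f : X → Icc (0 : ℝ) 1 → ℝ := fun x s => (1 + s) / 2 * min 1 (u x s)
  have hf : Continuous ↿f := by
    have h2 : Continuous fun p : X × Icc (0 : ℝ) 1 => ((1 + p.2) / 2 : ℝ) := by fun_prop
    exact h2.mul (continuous_const.min hu)
  have hne : (univ : Set (Icc (0 : ℝ) 1)).Nonempty := ⟨⟨0, by simp⟩, mem_univ _⟩
  refine ⟨fun x => sSup (f x '' univ), isCompact_univ.continuous_sSup hf, fun x => ?_⟩
  have hfx : Continuous (f x) := hf.comp (continuous_const.prodMk continuous_id)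
  obtain ⟨s, -, hs, hmax⟩ := isCompact_univ.exists_sSup_image_eq_and_ge hne hfx.continuousOn
  have hnonneg : 0 ≤ f x s :=
    mul_nonneg (by linarith [s.2.1]) (le_min zero_le_one (h0 _ _))
  have hlt : f x s < 1 := by
    rcases lt_or_eq_of_le s.2.2 with h | h
    · refine lt_of_le_of_lt (mul_le_mul_of_nonneg_left (min_le_left _ _) ?_) ?_
      · linarith [s.2.1]
      · linarith
    · have : f x s = 0 := by
        simp only [f, h, h1]
        simp
      rw [this]
      exact one_pos
  change 0 ≤ sSup (f x '' univ) ∧ sSup (f x '' univ) < 1 ∧ u x (sSup (f x '' univ)) < 1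
  rw [hs]
  refine ⟨hnonneg, hlt, ?_⟩
  by_contra hcon
  push Not at hcon
  have h3 := hmax ⟨f x s, hnonneg, hlt.le⟩ (mem_univ _)
  have h4 : f x ⟨f x s, hnonneg, hlt.le⟩ = (1 + f x s) / 2 := by
    change (1 + f x s) / 2 * min 1 (u x (f x s)) = _
    rw [min_eq_left hcon, mul_one]
  rw [h4] at h3
  linarith

/-! ### Comparison of `W ⊖ z W` with the constants -/

/-- The operator `c ↦ (P - b P b* - 1) (k · Q c)` for the Blaschke factor `b` and the normalized
Szegő kernel `k` of a radius `r`. It is small if `P - b P b*` nearly fixes the multiples of `k` by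
vectors in the range of `Q`. -/
def defect {n : ℕ} (P : L2 n →L[ℂ] L2 n) (Q : EHom n n) (r : ℝ) :
    EuclideanSpace ℂ (Fin n) →L[ℂ] L2 n :=
  (P - mulS (blaschke r) ∘L P ∘L mulS (star (blaschke r)) - 1) ∘L mulS (szego r) ∘L
    constL n ∘L Q

lemma defect_apply {n : ℕ} (P : L2 n →L[ℂ] L2 n) (Q : EHom n n) (r : ℝ)
    (c : EuclideanSpace ℂ (Fin n)) : defect P Q r c =
      P (mulS (szego r) (constL n (Q c))) - mulS (blaschke r) (P (mulS (star (blaschke r))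
        (mulS (szego r) (constL n (Q c))))) - mulS (szego r) (constL n (Q c)) := rfl

lemma norm_star_blaschke {r : ℝ} (hr : |r| < 1) (θ : UnitAddCircle) :
    ‖star (blaschke r) θ‖ = 1 := by
  rw [ContinuousMap.star_apply, norm_star, norm_blaschke hr]

lemma norm_sub_conj_le {n : ℕ} {r : ℝ} (hr : |r| < 1) (P : L2 n →L[ℂ] L2 n) (f : L2 n) :
    ‖P f - mulS (blaschke r) (P (mulS (star (blaschke r)) f))‖ ≤ 2 * ‖P‖ * ‖f‖ := by
  have h1 := norm_mulS_apply_of_norm_one (norm_blaschke hr) (P (mulS (star (blaschke r)) f))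
  have h2 := norm_mulS_apply_of_norm_one (norm_star_blaschke hr) f
  have h3 := P.le_opNorm (mulS (star (blaschke r)) f)
  have h4 := P.le_opNorm f
  have h5 := mul_le_mul_of_nonneg_left h2 (norm_nonneg P)
  calc _ ≤ ‖P f‖ + ‖mulS (blaschke r) (P (mulS (star (blaschke r)) f))‖ := norm_sub_le _ _
    _ ≤ ‖P‖ * ‖f‖ + ‖P‖ * ‖f‖ := by linarith
    _ = _ := by ring

/-- The operator `defect P Q r` is Lipschitz in `P` and `Q`, uniformly in the radius. -/
lemma norm_defect_sub_le {n : ℕ} {r : ℝ} (hr : |r| < 1) {P P' : L2 n →L[ℂ] L2 n}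
    (hP' : ‖P'‖ ≤ 1) (Q Q' : EHom n n) : ‖defect P Q r - defect P' Q' r‖ ≤
      2 * ‖P - P'‖ * ‖Q‖ + 3 * ‖Q - Q'‖ := by
  refine ContinuousLinearMap.opNorm_le_bound _ (by positivity) fun c => ?_
  obtain ⟨K, hK⟩ : ∃ K : EuclideanSpace ℂ (Fin n) →L[ℂ] L2 n,
      ∀ v, K v = mulS (szego r) (constL n v) := ⟨mulS (szego r) ∘L constL n, fun _ => rfl⟩
  have hKn : ∀ v, ‖K v‖ = ‖v‖ := fun v => by rw [hK, norm_mulS_szego hr]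
  have h1 := norm_sub_conj_le hr (P - P') (K (Q c))
  have h2 := norm_sub_conj_le hr P' (K ((Q - Q') c))
  have e : (defect P Q r - defect P' Q' r) c =
      ((P - P') (K (Q c)) - mulS (blaschke r) ((P - P') (mulS (star (blaschke r)) (K (Q c))))) +
      ((P' (K ((Q - Q') c)) - mulS (blaschke r) (P' (mulS (star (blaschke r)) (K ((Q - Q') c))))) -
        K ((Q - Q') c)) := by
    rw [sub_apply, defect_apply, defect_apply, ← hK, ← hK]
    simp only [sub_apply, map_sub]
    abel
  rw [e]
  have h3 : ‖Q c‖ ≤ ‖Q‖ * ‖c‖ := Q.le_opNorm c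
  have h4 : ‖(Q - Q') c‖ ≤ ‖Q - Q'‖ * ‖c‖ := (Q - Q').le_opNorm c
  rw [hKn] at h1 h2
  calc _ ≤ _ := (norm_add_le _ _).trans (add_le_add_right (norm_sub_le _ _) _)
    _ ≤ 2 * ‖P - P'‖ * ‖Q c‖ + (2 * ‖P'‖ * ‖(Q - Q') c‖ + ‖(Q - Q') c‖) := by
      rw [hKn]
      exact add_le_add h1 (add_le_add_left h2 _)
    _ ≤ 2 * ‖P - P'‖ * (‖Q‖ * ‖c‖) + (2 * 1 * (‖Q - Q'‖ * ‖c‖) + ‖Q - Q'‖ * ‖c‖) := by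
      gcongr
    _ = _ := by ring

/-- In finite dimensions, pointwise convergence of operators implies convergence in norm. -/
lemma tendsto_zero_of_pointwise {n : ℕ} {F : Type*} [NormedAddCommGroup F] [NormedSpace ℂ F]
    {α : Type*} {l : Filter α} {D : α → EuclideanSpace ℂ (Fin n) →L[ℂ] F}
    (h : ∀ c, Tendsto (fun a => D a c) l (𝓝 0)) : Tendsto (fun a => ‖D a‖) l (𝓝 0) := by
  have h1 : Tendsto (fun a => ∑ k, ‖D a (EuclideanSpace.single k 1)‖) l (𝓝 0) := by
    have h2 := tendsto_finsetSum (Finset.univ : Finset (Fin n))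
      fun k _ => (h (EuclideanSpace.single k 1)).norm
    simpa using h2
  refine squeeze_zero (fun _ => norm_nonneg _) (fun a => ?_) h1
  refine ContinuousLinearMap.opNorm_le_bound _ (Finset.sum_nonneg fun _ _ => norm_nonneg _)
    fun c => ?_
  have e : c = ∑ k, c k • EuclideanSpace.single k (1 : ℂ) := by
    ext l
    simp [Pi.single_apply]
  conv_lhs => rw [e, map_sum]
  refine (norm_sum_le _ _).trans ?_
  rw [Finset.sum_mul]
  refine Finset.sum_le_sum fun k _ => ?_
  rw [map_smul, norm_smul, mul_comm]
  exact mul_le_mul_of_nonneg_left (PiLp.norm_apply_le c k) (norm_nonneg _)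

lemma continuousAt_mulS {n : ℕ} {X : Type*} [TopologicalSpace X] {g : X → C(UnitAddCircle, ℂ)}
    {x : X} (h : ContinuousAt g x) : ContinuousAt (fun y => (mulS (g y) : L2 n →L[ℂ] L2 n)) x :=
  ContinuousAt.comp (g := fun g => (mulS g : L2 n →L[ℂ] L2 n)) mulS.continuous.continuousAt h

lemma continuousAt_defect {n : ℕ} {X : Type*} [TopologicalSpace X] {P : X → L2 n →L[ℂ] L2 n}
    {Q : X → EHom n n} {r : X → ℝ} {x : X} (hP : ContinuousAt P x) (hQ : ContinuousAt Q x)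
    (hr : ContinuousAt r x) (h1 : |r x| < 1) :
    ContinuousAt (fun y => defect (P y) (Q y) (r y)) x := by
  have hb : ContinuousAt (fun y => blaschke (r y)) x :=
    ContinuousAt.comp (g := blaschke) (continuousAt_blaschke h1) hr
  have hk : ContinuousAt (fun y => szego (r y)) x :=
    ContinuousAt.comp (g := szego) (continuousAt_szego h1) hr
  have hb' : ContinuousAt (fun y => star (blaschke (r y))) x := hb.star
  have h2 := (continuousAt_mulS (n := n) hb).clm_comp (hP.clm_comp (continuousAt_mulS (n := n) hb'))
  have h3 : ContinuousAt (fun y => constL n ∘L Q y) x := continuousAt_const.clm_comp hQ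
  exact ((hP.sub h2).sub continuousAt_const).clm_comp ((continuousAt_mulS (n := n) hk).clm_comp h3)

open Classical in
/-- The norm of the defect for radii in `[0, 1]`, where the value at `1` is the limit. -/
def defectNorm {n : ℕ} (P : L2 n →L[ℂ] L2 n) (Q : EHom n n) (s : ℝ) : ℝ :=
  if s < 1 then ‖defect P Q s‖ else 0

/-- The norm of the defect is jointly continuous, also at radius `1`: the convergence to `0` as the
radius tends to `1` is locally uniform in `x`, by the uniform Lipschitz estimate. -/
lemma continuous_defectNorm {n : ℕ} {X : Type*} [TopologicalSpace X] {P : X → L2 n →L[ℂ] L2 n}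
    {Q : X → EHom n n} (hP : Continuous P) (hQ : Continuous Q) (hP1 : ∀ x, ‖P x‖ ≤ 1)
    (h : ∀ x c, Tendsto (fun r => defect (P x) (Q x) r c) (𝓝[<] 1) (𝓝 0)) :
    Continuous fun p : X × Icc (0 : ℝ) 1 => defectNorm (P p.1) (Q p.1) p.2 := by
  refine continuous_iff_continuousAt.2 fun p₀ => ?_
  rcases lt_or_eq_of_le p₀.2.2.2 with h1 | h1
  · have h2 : ContinuousAt (fun p : X × Icc (0 : ℝ) 1 => ‖defect (P p.1) (Q p.1) p.2‖) p₀ :=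
      (continuousAt_defect (r := fun p : X × Icc (0 : ℝ) 1 => p.2) (x := p₀)
        (hP.comp continuous_fst).continuousAt (hQ.comp continuous_fst).continuousAt
        (by fun_prop) (abs_lt_one_of_mem ⟨p₀.2.2.1, h1⟩)).norm
    refine h2.congr ?_
    have h3 : ∀ᶠ p : X × Icc (0 : ℝ) 1 in 𝓝 p₀, (p.2 : ℝ) < 1 :=
      (isOpen_lt (by fun_prop) continuous_const).mem_nhds h1
    filter_upwards [h3] with p hp
    rw [defectNorm, if_pos hp]
  · -- near radius `1`, the point `x` is replaced by `x₀`, by the uniform Lipschitz bound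
    have h2 : Tendsto (fun s => defectNorm (P p₀.1) (Q p₀.1) s) (𝓝[≤] 1) (𝓝 0) := by
      have h3 : Tendsto (fun s => defectNorm (P p₀.1) (Q p₀.1) s) (𝓝[<] 1) (𝓝 0) := by
        refine (tendsto_zero_of_pointwise (h p₀.1)).congr' ?_
        filter_upwards [self_mem_nhdsWithin] with s hs
        rw [defectNorm, if_pos (show s < 1 from hs)]
      have h4 : defectNorm (P p₀.1) (Q p₀.1) 1 = 0 := by simp [defectNorm]
      have h5 : ContinuousWithinAt (fun s => defectNorm (P p₀.1) (Q p₀.1) s) (Iic 1) 1 := by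
        refine continuousWithinAt_Iio_iff_Iic.1 ?_
        rw [ContinuousWithinAt, h4]
        exact h3
      rw [ContinuousWithinAt, h4] at h5
      exact h5
    have h3 : Tendsto (fun p : X × Icc (0 : ℝ) 1 => (p.2 : ℝ)) (𝓝 p₀) (𝓝[≤] 1) := by
      refine tendsto_nhdsWithin_iff.2 ⟨?_, Eventually.of_forall fun p => p.2.2.2⟩
      have h4 : Continuous fun p : X × Icc (0 : ℝ) 1 => (p.2 : ℝ) := by fun_prop
      have h5 := h4.tendsto p₀
      rwa [h1] at h5
    have h4 : Tendsto (fun p : X × Icc (0 : ℝ) 1 => 2 * ‖P p.1 - P p₀.1‖ * ‖Q p.1‖ +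
        3 * ‖Q p.1 - Q p₀.1‖) (𝓝 p₀) (𝓝 0) := by
      have h5 : Continuous fun x => 2 * ‖P x - P p₀.1‖ * ‖Q x‖ + 3 * ‖Q x - Q p₀.1‖ := by
        fun_prop
      have h6 := h5.tendsto p₀.1
      simp only [sub_self, norm_zero, mul_zero, zero_mul, add_zero] at h6
      exact h6.comp (continuous_fst.tendsto p₀)
    have h5 := (h2.comp h3).add h4
    have e0 : defectNorm (P p₀.1) (Q p₀.1) p₀.2 = 0 := by simp [defectNorm, h1]
    rw [ContinuousAt, e0]
    rw [add_zero] at h5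
    refine squeeze_zero (fun p => ?_) (fun p => ?_) h5
    · rw [defectNorm]
      split_ifs
      exacts [norm_nonneg _, le_rfl]
    · change defectNorm (P p.1) (Q p.1) p.2 ≤ defectNorm (P p₀.1) (Q p₀.1) p.2 + _
      rw [defectNorm, defectNorm]
      split_ifs with hp
      · have h6 := norm_defect_sub_le (abs_lt_one_of_mem ⟨p.2.2.1, hp⟩) (P := P p.1)
          (hP1 p₀.1) (Q p.1) (Q p₀.1)
        have h7 := norm_sub_norm_le (defect (P p.1) (Q p.1) p.2) (defect (P p₀.1) (Q p₀.1) p.2)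
        linarith
      · positivity

/-- The operator `Λ |k|² Q` from vectors to `W ⊖ z W`, where `Λ = P - z P z⁻¹`. -/
def compareOp {n : ℕ} (P : L2 n →L[ℂ] L2 n) (Q : EHom n n) (r : ℝ) :
    EuclideanSpace ℂ (Fin n) →L[ℂ] L2 n :=
  (conjZ 0 P - conjZ 1 P) ∘L mulS (star (szego r) * szego r) ∘L constL n ∘L Q

/-- If the defect has norm less than `1`, then the comparison operator is injective on the range of
`Q`: by the identity `k Λ k* = P - b P b*`, multiplication by `k` turns it into the sum of an
isometry and the defect. -/
lemma eq_zero_of_compareOp {n : ℕ} {P : L2 n →L[ℂ] L2 n} {Q : EHom n n} {r : ℝ} (hr : |r| < 1)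
    (h : ‖defect P Q r‖ < 1) {c : EuclideanSpace ℂ (Fin n)} (hc : Q c = c)
    (h0 : compareOp P Q r c = 0) : c = 0 := by
  set f := mulS (szego r) (constL n c) with hf
  have h1 : P f - mulS (blaschke r) (P (mulS (star (blaschke r)) f)) = 0 := by
    rw [← szego_conj hr P f, hf, ← mulS_apply_mul]
    have e : (P - Zp 1 ∘L P ∘L Zp (-1)) (mulS (star (szego r) * szego r) (constL n c)) =
        compareOp P Q r c := by
      change _ = (conjZ 0 P - conjZ 1 P) (mulS (star (szego r) * szego r) (constL n (Q c)))
      rw [hc]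
      simp only [sub_apply, conjZ_apply, neg_zero, Zp_zero]
      rfl
    rw [e, h0, map_zero]
  have h2 : defect P Q r c = -f := by
    rw [defect_apply, hc, ← hf, h1, zero_sub]
  have h3 : ‖f‖ = ‖c‖ := norm_mulS_szego hr c
  have h4 := (defect P Q r).le_opNorm c
  rw [h2, norm_neg, h3] at h4
  by_contra hne
  have h5 := norm_pos_iff.2 hne
  nlinarith

lemma continuous_compareOp {n : ℕ} {X : Type*} [TopologicalSpace X] {P : X → L2 n →L[ℂ] L2 n}
    {Q : X → EHom n n} {r : X → ℝ} (hP : Continuous P) (hQ : Continuous Q)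
    (hr : Continuous r) (h1 : ∀ x, |r x| < 1) :
    Continuous fun y => compareOp (P y) (Q y) (r y) := by
  have hk : Continuous fun y => szego (r y) := continuous_iff_continuousAt.2 fun x =>
    ContinuousAt.comp (g := szego) (continuousAt_szego (h1 x)) hr.continuousAt
  have hk2 : Continuous fun y => star (szego (r y)) * szego (r y) := hk.star.mul hk
  have h2 : Continuous fun y => (mulS (star (szego (r y)) * szego (r y)) : L2 n →L[ℂ] L2 n) :=
    mulS.continuous.comp hk2
  have h3 : Continuous fun y => conjZ 0 (P y) - conjZ 1 (P y) :=
    ((continuous_conjZ 0).comp hP).sub ((continuous_conjZ 1).comp hP)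
  have h4 : Continuous fun y => constL n ∘L Q y := continuous_const.clm_comp hQ
  exact h3.clm_comp (h2.clm_comp h4)


/-! ### The quotients are isomorphic to `p̃*TM` -/

section

variable {m : ℕ} {M : Type u} [TopologicalSpace M]
  [ChartedSpace (EuclideanSpace ℝ (Fin (2 * m))) M] [IsManifold (𝓡 (2 * m)) ∞ M]
  {A : AlmostHermitian m M} (T : A.ParsevalFrame)

lemma mulOp_const {m n : ℕ} (B : EHom m n) (v : EuclideanSpace ℂ (Fin m)) :
    mulOp (ContinuousMap.const _ B) (constL m v) = constL n (B v) := by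
  refine Lp.ext ?_
  filter_upwards [mulOp_coe (ContinuousMap.const _ B) (constL m v), constL_coe v,
    constL_coe (B v)] with θ h1 h2 h3
  rw [h1, h2, h3]
  rfl

lemma mulS_mulOp_apply {m n : ℕ} (g : C(UnitAddCircle, ℂ)) (G : C(UnitAddCircle, EHom m n))
    (f : L2 m) : mulS g (mulOp G f) = mulOp G (mulS g f) :=
  congrArg (fun B : L2 m →L[ℂ] L2 n => B f) (mulS_comm g G)

lemma mulOp_sub_apply {m n : ℕ} (G H : C(UnitAddCircle, EHom m n)) (f : L2 m) :
    mulOp (G - H) f = mulOp G f - mulOp H f := by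
  refine Lp.ext ?_
  filter_upwards [mulOp_coe (G - H) f, mulOp_coe G f, mulOp_coe H f,
    Lp.coeFn_sub (mulOp G f) (mulOp H f)] with θ h1 h2 h3 h4
  rw [h1, h4, Pi.sub_apply, h2, h3]
  rfl

/-- The multiples of the Szegő kernels concentrate at the base point of the circle, so that on them
a multiplication operator behaves as its value at the base point. -/
lemma tendsto_mulOp_szego_sub {m n : ℕ} (G : C(UnitAddCircle, EHom m n))
    (v : EuclideanSpace ℂ (Fin m)) :
    Tendsto (fun r => mulOp G (mulS (szego r) (constL m v)) - mulS (szego r) (constL n (G 0 v)))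
      (𝓝[<] 1) (𝓝 0) := by
  have h := tendsto_szego_mulOp (G - ContinuousMap.const _ (G 0)) v (by simp)
  refine h.congr fun r => ?_
  rw [mulOp_sub_apply, mulOp_const, map_sub, mulS_mulOp_apply]

lemma AlmostHermitian.ParsevalFrame.proj_iota (x : M) (v : A.Fib x) :
    T.proj x (T.iota x v) = T.iota x v := by
  rw [T.proj_apply, T.kappa_iota]

lemma AlmostHermitian.ParsevalFrame.proj_idem (x : M) (c : EuclideanSpace ℂ (Fin T.N)) :
    T.proj x (T.proj x c) = T.proj x c := by
  rw [T.proj_apply x c, T.proj_iota]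

lemma toC_adjoint {γ : LM m M} (Φ : Frame A γ) (θ : UnitAddCircle) (v : A.Fib (γ θ)) :
    Φ.toC T θ (ContinuousLinearMap.adjoint (Φ.toC T θ) (T.iota (γ θ) v)) = T.iota (γ θ) v := by
  rw [Φ.toC_apply]
  congr 1
  simp only [Φ.adjoint_toC_apply]
  exact A.sum_herm_smul (fun k l => Φ.herm_eq k l θ) _

/-- The projection `Π - b Π b*` nearly fixes the multiples of `k` by vectors tangent to `M` at the
base point of the loop, as the radius tends to `1`. -/
lemma tendsto_defect_polProj (x : PolLoop A) (c : EuclideanSpace ℂ (Fin T.N)) :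
    Tendsto (fun r => defect (polProj T x) (T.proj (x.loop 0)) r c) (𝓝[<] 1) (𝓝 0) := by
  obtain ⟨Φ⟩ := x.nonempty_frame
  set P := projW (x.W.comap (frameMap Φ)) with hP
  set v := T.proj (x.loop 0) c with hv
  set w := ContinuousLinearMap.adjoint (Φ.toC T 0) v with hw
  have hvw : Φ.toC T 0 w = v := by rw [hw, hv, T.proj_apply, toC_adjoint]
  have h1 := tendsto_mulOp_szego_sub (adjC (Φ.toC T)) v
  have h2 := tendsto_mulOp_szego_sub (Φ.toC T) w
  have h3 := tendsto_projW_blaschke (isHSDiff_comap T Φ) w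
  rw [hvw] at h2
  obtain ⟨K, hK⟩ : ∃ K : ℝ → L2 T.N, ∀ r, K r = mulS (szego r) (constL T.N v) := ⟨_, fun _ => rfl⟩
  obtain ⟨L, hL⟩ : ∃ L : ℝ → L2 m, ∀ r, L r = mulS (szego r) (constL m w) := ⟨_, fun _ => rfl⟩
  obtain ⟨F, hF⟩ : ∃ F : L2 m →L[ℂ] L2 T.N, F = Φ.op T := ⟨_, rfl⟩
  obtain ⟨F', hF'⟩ : ∃ F' : L2 T.N →L[ℂ] L2 m, F' = mulOp (adjC (Φ.toC T)) := ⟨_, rfl⟩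
  have hPi : ∀ f, polProj T x f = F (P (F' f)) := by
    intro f
    rw [polProj_eq T Φ, Φ.adjoint_op, hF, hF']
    rfl
  have hFS : ∀ g f, mulS g (F f) = F (mulS g f) := by
    intro g f
    rw [hF]
    exact mulS_mulOp_apply g _ f
  have hFS' : ∀ g f, mulS g (F' f) = F' (mulS g f) := by
    intro g f
    rw [hF']
    exact mulS_mulOp_apply g _ f
  have h1 : Tendsto (fun r => F' (K r) - L r) (𝓝[<] 1) (𝓝 0) := by
    refine h1.congr fun r => ?_
    rw [hF', hK, hL]
    rfl
  have h2 : Tendsto (fun r => F (L r) - K r) (𝓝[<] 1) (𝓝 0) := by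
    refine h2.congr fun r => ?_
    rw [hF, hK, hL]
    rfl
  have h3 : Tendsto (fun r => F (P (L r) - mulS (blaschke r) (P (mulS (star (blaschke r)) (L r)))
      - L r)) (𝓝[<] 1) (𝓝 0) := by
    have h4 := (F.continuous.tendsto 0).comp h3
    rw [map_zero] at h4
    refine h4.congr fun r => ?_
    rw [hL]
    rfl
  have h5 : Tendsto (fun r => F (P (F' (K r) - L r) - mulS (blaschke r) (P (mulS (star (blaschke r))
      (F' (K r) - L r))))) (𝓝[<] 1) (𝓝 0) := by
    have h6 : Tendsto (fun r => ‖F‖ * (2 * ‖P‖ * ‖F' (K r) - L r‖)) (𝓝[<] 1) (𝓝 0) := by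
      have := ((h1.norm).const_mul (2 * ‖P‖)).const_mul ‖F‖
      simpa using this
    refine squeeze_zero_norm' ?_ h6
    filter_upwards [eventually_mem_Ico_zero_one] with r hr
    refine (F.le_opNorm _).trans (mul_le_mul_of_nonneg_left ?_ (norm_nonneg F))
    exact norm_sub_conj_le (abs_lt_one_of_mem hr) P _
  have h6 := (h3.add h5).add h2
  rw [add_zero, add_zero] at h6
  refine h6.congr fun r => ?_
  rw [defect_apply, ← hv, ← hK, hPi, hPi, hFS, ← hFS']
  simp only [map_sub]
  abel

lemma PolLoop.continuous_base : Continuous fun x : PolLoop A => x.loop 0 := by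
  have h : Continuous fun γ : LM m M => γ.toMap 0 :=
    (ContinuousEval.continuous_eval (F := C(UnitAddCircle, M))).comp
      (f := fun γ : LM m M => (γ.toMap, (0 : UnitAddCircle)))
      (PSLoop.continuous_toMap.prodMk continuous_const)
  exact h.comp PolLoop.continuous_loop

lemma continuous_baseProj : Continuous fun x : PolLoop A => T.proj (x.loop 0) :=
  T.contMDiff_proj.continuous.comp PolLoop.continuous_base

lemma norm_polProj_le (x : PolLoop A) : ‖polProj T x‖ ≤ 1 :=
  ContinuousLinearMap.opNorm_le_bound _ zero_le_one fun f => by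
    rw [one_mul]
    exact (isShiftProj_polProj T x).norm_apply_le f

lemma defectNorm_nonneg {n : ℕ} (P : L2 n →L[ℂ] L2 n) (Q : EHom n n) (s : ℝ) :
    0 ≤ defectNorm P Q s := by
  rw [defectNorm]
  split_ifs
  exacts [norm_nonneg _, le_rfl]

lemma defectNorm_one {n : ℕ} (P : L2 n →L[ℂ] L2 n) (Q : EHom n n) : defectNorm P Q 1 = 0 := by
  simp [defectNorm]

/-- A continuous family of operators `C x` which restrict to isomorphisms of `T_{γ(0)} M` with
`W ⊖ z W`, for `x = (γ, W)`: the comparison operators, at a radius chosen continuously. -/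
lemma exists_comparison : ∃ C : PolLoop A → EuclideanSpace ℂ (Fin T.N) →L[ℂ] L2 T.N,
    Continuous C ∧ ∀ x, (∀ c, C x c = C x (T.proj (x.loop 0) c)) ∧
      (∀ c, (conjZ 0 (polProj T x) - conjZ 1 (polProj T x)) (C x c) = C x c) ∧
      (∀ c, T.proj (x.loop 0) c = c → C x c = 0 → c = 0) ∧
      ∀ f, (conjZ 0 (polProj T x) - conjZ 1 (polProj T x)) f = f → ∃ c,
        T.proj (x.loop 0) c = c ∧ C x c = f := by
  have hu : Continuous fun p : PolLoop A × Icc (0 : ℝ) 1 =>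
      defectNorm (polProj T p.1) (T.proj (p.1.loop 0)) p.2 :=
    continuous_defectNorm (P := polProj T) (Q := fun x => T.proj (x.loop 0))
      (continuous_polProj T) (continuous_baseProj T) (norm_polProj_le T) (tendsto_defect_polProj T)
  obtain ⟨r, hr, hr1⟩ := exists_continuous_radius
    (u := fun x s => defectNorm (polProj T x) (T.proj (x.loop 0)) s) hu
    (fun x s => defectNorm_nonneg _ _ _) (fun x => defectNorm_one _ _)
  have hr2 : ∀ x, |r x| < 1 := fun x => abs_lt_one_of_mem ⟨(hr1 x).1, (hr1 x).2.1⟩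
  refine ⟨fun x => compareOp (polProj T x) (T.proj (x.loop 0)) (r x),
    continuous_compareOp (P := polProj T) (Q := fun x => T.proj (x.loop 0)) (r := r)
      (continuous_polProj T) (continuous_baseProj T) hr hr2, fun x => ?_⟩
  set Λ := conjZ 0 (polProj T x) - conjZ 1 (polProj T x) with hΛ
  set C := compareOp (polProj T x) (T.proj (x.loop 0)) (r x) with hC
  have h1 : ∀ c, C c = C (T.proj (x.loop 0) c) := by
    intro c
    change Λ (mulS _ (constL _ (T.proj (x.loop 0) c))) =
      Λ (mulS _ (constL _ (T.proj (x.loop 0) (T.proj (x.loop 0) c))))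
    rw [T.proj_idem]
  have h2 : ∀ c, Λ (C c) = C c := fun c =>
    (isShiftProj_polProj T x).sub_idem (by norm_num) _
  have h3 : ∀ c, T.proj (x.loop 0) c = c → C c = 0 → c = 0 := by
    intro c hc h0
    refine eq_zero_of_compareOp (hr2 x) ?_ hc h0
    have h4 : defectNorm (polProj T x) (T.proj (x.loop 0)) (r x) < 1 := (hr1 x).2.2
    rwa [defectNorm, if_pos (hr1 x).2.1] at h4
  refine ⟨h1, h2, h3, fun f hf => ?_⟩
  -- an injective map between spaces of dimensions `m` and at most `m`
  obtain ⟨h5, h6⟩ := finrank_polProj_le T x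
  obtain ⟨h7, h8⟩ := A.finrank_fib (x.loop 0)
  let a : A.Fib (x.loop 0) →ₗ[ℂ] LinearMap.range Λ.toLinearMap :=
    LinearMap.codRestrict _ (C.toLinearMap ∘ₗ T.iota (x.loop 0)) fun v => ⟨_, h2 _⟩
  have ha : Function.Injective a := by
    refine (injective_iff_map_eq_zero a).2 fun v hv => ?_
    have h9 := h3 _ (T.proj_iota _ v) (congrArg Subtype.val hv)
    exact T.iota_injective _ (h9.trans (map_zero _).symm)
  have h9 := LinearMap.finrank_le_finrank_of_injective ha
  have ha2 := (LinearMap.injective_iff_surjective_of_finrank_eq_finrank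
    (le_antisymm h9 (by rw [h8]; exact h6))).1 ha
  obtain ⟨v, hv⟩ := ha2 ⟨f, f, hf⟩
  exact ⟨T.iota _ v, T.proj_iota _ v, congrArg Subtype.val hv⟩

end


section

variable {m : ℕ} {M : Type u} [TopologicalSpace M]
  [ChartedSpace (EuclideanSpace ℝ (Fin (2 * m))) M] [IsManifold (𝓡 (2 * m)) ∞ M]
  {A : AlmostHermitian m M} (T : A.ParsevalFrame)

/-- If `Q` is an orthogonal projection and `C = C Q` is injective on the range of `Q`, then
`(C* C + 1 - Q)⁻¹ C*` is a left inverse of `C` on the range of `Q`. -/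
lemma isUnit_adjoint_comp_add {n : ℕ} {H : Type} [NormedAddCommGroup H] [InnerProductSpace ℂ H]
    [CompleteSpace H] {C : EuclideanSpace ℂ (Fin n) →L[ℂ] H} {Q : EHom n n}
    (hQ : ∀ c, Q (Q c) = Q c) (hQs : ∀ c d, inner ℂ (Q c) d = inner ℂ c (Q d))
    (hC : ∀ c, Q c = c → C c = 0 → c = 0) :
    IsUnit (ContinuousLinearMap.adjoint C ∘L C + (1 - Q)) := by
  set B : EHom n n := ContinuousLinearMap.adjoint C ∘L C + (1 - Q) with hB
  have h1 : Function.Injective B.toLinearMap := by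
    refine (injective_iff_map_eq_zero _).2 fun c hc => ?_
    have hBc : B c = ContinuousLinearMap.adjoint C (C c) + (c - Q c) := rfl
    have h2 : inner ℂ c (B c) = inner ℂ (C c) (C c) + inner ℂ (c - Q c) (c - Q c) := by
      rw [hBc, inner_add_right, ContinuousLinearMap.adjoint_inner_right]
      congr 1
      rw [inner_sub_left c (Q c), hQs c, map_sub, hQ, sub_self, inner_zero_right, sub_zero]
    have h3 : B c = 0 := hc
    rw [h3, inner_zero_right, inner_self_eq_norm_sq_to_K, inner_self_eq_norm_sq_to_K] at h2
    have h4 : ‖C c‖ ^ 2 + ‖c - Q c‖ ^ 2 = 0 := by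
      refine Complex.ofReal_injective ?_
      push_cast
      exact h2.symm
    have h5 : ‖C c‖ = 0 := by nlinarith [sq_nonneg ‖C c‖, sq_nonneg ‖c - Q c‖]
    have h6 : ‖c - Q c‖ = 0 := by nlinarith [sq_nonneg ‖C c‖, sq_nonneg ‖c - Q c‖]
    exact hC c (sub_eq_zero.1 (norm_eq_zero.1 h6)).symm (norm_eq_zero.1 h5)
  rw [ContinuousLinearMap.isUnit_iff_bijective]
  exact ⟨h1, LinearMap.injective_iff_surjective.1 h1⟩

lemma AlmostHermitian.ParsevalFrame.proj_symm (x : M) (c d : EuclideanSpace ℂ (Fin T.N)) :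
    inner ℂ (T.proj x c) d = inner ℂ c (T.proj x d) := by
  rw [T.inner_proj, ← inner_conj_symm, T.inner_proj, A.herm_conj]

/-- A continuous family of operators inducing isomorphisms of `W ⊖ z W` with `T_{γ(0)} M`, together
with the inverse family. -/
lemma exists_comparison_inverse :
    ∃ (C : PolLoop A → EuclideanSpace ℂ (Fin T.N) →L[ℂ] L2 T.N)
      (G : PolLoop A → L2 T.N →L[ℂ] EuclideanSpace ℂ (Fin T.N)), Continuous C ∧ Continuous G ∧
      ∀ x, (∀ c, (conjZ 0 (polProj T x) - conjZ 1 (polProj T x)) (C x c) = C x c) ∧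
        (∀ c, T.proj (x.loop 0) c = c → G x (C x c) = c) ∧
        (∀ f, (conjZ 0 (polProj T x) - conjZ 1 (polProj T x)) f = 0 → G x f = 0) ∧
        ∀ f, (conjZ 0 (polProj T x) - conjZ 1 (polProj T x)) f = f → ∃ c,
          T.proj (x.loop 0) c = c ∧ C x c = f := by
  obtain ⟨C, hC, h⟩ := exists_comparison T
  let B : PolLoop A → EHom T.N T.N := fun x =>
    ContinuousLinearMap.adjoint (C x) ∘L C x + (1 - T.proj (x.loop 0))
  have hBu : ∀ x, IsUnit (B x) := fun x => isUnit_adjoint_comp_add (T.proj_idem _)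
    (T.proj_symm _) (h x).2.2.1
  have hC' : Continuous fun x => ContinuousLinearMap.adjoint (C x) :=
    (ContinuousLinearMap.adjoint (𝕜 := ℂ) (E := EuclideanSpace ℂ (Fin T.N))
      (F := L2 T.N)).continuous.comp hC
  have hB : Continuous B := (hC'.clm_comp hC).add (continuous_const.sub (continuous_baseProj T))
  have hBi : Continuous fun x => Ring.inverse (B x) := by
    refine continuous_iff_continuousAt.2 fun x => ?_
    obtain ⟨u, hu⟩ := hBu x
    have h1 := NormedRing.inverse_continuousAt u
    rw [hu] at h1
    exact ContinuousAt.comp (g := Ring.inverse) h1 hB.continuousAt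
  refine ⟨C, fun x => Ring.inverse (B x) ∘L ContinuousLinearMap.adjoint (C x), hC,
    hBi.clm_comp hC', fun x => ⟨(h x).2.1, fun c hc => ?_, fun f hf => ?_, (h x).2.2.2⟩⟩
  · have h1 : ContinuousLinearMap.adjoint (C x) (C x c) = B x c := by
      change _ = ContinuousLinearMap.adjoint (C x) (C x c) + (c - T.proj (x.loop 0) c)
      rw [hc, sub_self, add_zero]
    change Ring.inverse (B x) (ContinuousLinearMap.adjoint (C x) (C x c)) = c
    rw [h1]
    exact congrArg (fun D : EHom T.N T.N => D c) (Ring.inverse_mul_cancel _ (hBu x))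
  · have h1 : ContinuousLinearMap.adjoint (C x) f = 0 := by
      refine ext_inner_left ℂ fun c => ?_
      rw [ContinuousLinearMap.adjoint_inner_right, ← (h x).2.1 c,
        (isShiftProj_polProj T x).sub_symm, hf, inner_zero_right, inner_zero_right]
    change Ring.inverse (B x) (ContinuousLinearMap.adjoint (C x) f) = 0
    rw [h1, map_zero]

/-! ### The topology of `p̃*TM` -/

lemma evTopology_eq : EqSubbundle.evTopology A = TopologicalSpace.induced
    (fun v : Σ x : PolLoop A, A.Fib (x.loop 0) => (v.1, T.iota (v.1.loop 0) v.2))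
    inferInstance := by
  refine le_antisymm ?_ ?_
  · let _ := EqSubbundle.evTopology A
    have h : Continuous fun v : Σ x : PolLoop A, A.Fib (x.loop 0) => (v.1, A.toTB v.2) :=
      continuous_induced_dom
    exact continuous_iff_le_induced.1 (h.fst.prodMk (T.contMDiff_iotaTB.continuous.comp h.snd))
  · let _ : TopologicalSpace (Σ x : PolLoop A, A.Fib (x.loop 0)) := TopologicalSpace.induced
      (fun v : Σ x : PolLoop A, A.Fib (x.loop 0) => (v.1, T.iota (v.1.loop 0) v.2)) inferInstance
    have h : Continuous fun v : Σ x : PolLoop A, A.Fib (x.loop 0) =>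
        (v.1, T.iota (v.1.loop 0) v.2) := continuous_induced_dom
    refine continuous_iff_le_induced.1 (h.fst.prodMk ?_)
    have h2 := T.contMDiff_kappaTB.continuous.comp
      (h.snd.prodMk (PolLoop.continuous_base.comp h.fst))
    refine h2.congr fun v => ?_
    change A.toTB (T.kappa (v.1.loop 0) (T.iota (v.1.loop 0) v.2)) = A.toTB v.2
    rw [T.kappa_iota]

lemma evTopology_continuous_iff {X : Type*} [TopologicalSpace X]
    {F : X → Σ x : PolLoop A, A.Fib (x.loop 0)} :
    @Continuous _ _ _ (EqSubbundle.evTopology A) F ↔ (Continuous fun y => (F y).1) ∧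
      Continuous fun y => T.iota ((F y).1.loop 0) (F y).2 := by
  rw [evTopology_eq T, continuous_induced_rng]
  exact continuous_prodMk

include T in
/-- The fibres of `p̃*TM` are the ranges of the continuous family of projections `ι κ`. -/
lemma isVectorBundleOfRank_ev :
    IsVectorBundleOfRank (fun x : PolLoop A => A.Fib (x.loop 0)) (EqSubbundle.evTopology A) m := by
  let _ := EqSubbundle.evTopology A
  have h : Continuous fun v : Σ x : PolLoop A, A.Fib (x.loop 0) => (v.1, A.toTB v.2) :=
    continuous_induced_dom
  refine ⟨h.fst, fun x => ?_⟩
  have h1 := trivialNear_of_projection (F := fun x : PolLoop A => A.Fib (x.loop 0))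
    (fun x => T.iota (x.loop 0)) (fun x => T.iota_injective _) (continuous_baseProj T)
    (fun x c => ⟨fun hc => ⟨T.kappa _ c, by rw [← T.proj_apply, hc]⟩, by
      rintro ⟨v, rfl⟩
      exact T.proj_iota _ v⟩) (fun x => T.proj_idem _)
    (fun x => (A.finrank_fib (x.loop 0)).1) (evTopology_eq T) x
  rwa [(A.finrank_fib (x.loop 0)).2] at h1

/-- Isomorphisms transport vector bundles. -/
lemma IsVectorBundleOfRank.of_isHomeomorph {B : Type u} [TopologicalSpace B] {F F' : B → Type}
    [∀ b, AddCommGroup (F b)] [∀ b, Module ℂ (F b)] [∀ b, AddCommGroup (F' b)]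
    [∀ b, Module ℂ (F' b)] {τ : TopologicalSpace (Σ b, F b)} {τ' : TopologicalSpace (Σ b, F' b)}
    {r : ℕ} (h : IsVectorBundleOfRank F' τ' r) (e : ∀ b, F b ≃ₗ[ℂ] F' b)
    (he : IsHomeomorph fun v : Σ b, F b => (⟨v.1, e v.1 v.2⟩ : Σ b, F' b)) :
    IsVectorBundleOfRank F τ r := by
  refine ⟨h.1.comp he.continuous, fun b => ?_⟩
  obtain ⟨U, hU, hb, e', he'⟩ := h.2 b
  refine ⟨U, hU, hb, fun x => (e' x).trans (e x.1).symm, ?_⟩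
  let H := he.homeomorph
  have h1 := H.symm.isEmbedding.comp he'
  convert h1 using 1
  funext p
  refine (H.symm_apply_eq.2 ?_).symm
  change _ = (⟨p.1.1, e p.1.1 ((e p.1.1).symm (e' p.1 p.2))⟩ : Σ b, F' b)
  rw [LinearEquiv.apply_symm_apply]

/-! ### The quotients of the subbundles -/

lemma subProj_succ (n : ℤ) (x : PolLoop A) (f : L2 T.N) : subProj T n (n + 1) x f =
    Zp n ((conjZ 0 (polProj T x) - conjZ 1 (polProj T x)) (Zp (-n) f)) := by
  simp only [subProj, sub_apply, conjZ_apply, map_sub, Zp_apply_apply]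
  simp only [neg_zero, zero_add, add_zero, neg_add_rev]

section

variable [T2Space M] [CompactSpace M]

/-- If `Π' = Π + zⁿ Λ z⁻ⁿ` for the projections `Π'`, `Π` onto the fibres of `E'`, `E`, where `Λ` is
the projection onto `W ⊖ z W`, then `E' / E` is isomorphic to `p̃*TM`. -/
lemma quotientIsPullbackTM {i j i' j' : ℤ} (h : i ≤ j) (h' : i' ≤ j') (n : ℤ)
    (hadd : ∀ (x : PolLoop A) f, subProj T i' j' x f = subProj T i j x f + subProj T n (n + 1) x f)
    (h1 : ∀ (x : PolLoop A) f, subProj T n (n + 1) x (subProj T i j x f) = 0)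
    (h2 : ∀ (x : PolLoop A) f,
      subProj T i' j' x (subProj T n (n + 1) x f) = subProj T n (n + 1) x f) :
    (subBundle T h).QuotientIsPullbackTM (subBundle T h') := by
  obtain ⟨C, G, hC, hG, hCG⟩ := exists_comparison_inverse T
  let E := subBundle T h
  let E' := subBundle T h'
  let q : ∀ x : PolLoop A, E'.fib x →ₗ[ℂ] A.Fib (x.loop 0) := fun x =>
    T.kappa (x.loop 0) ∘ₗ (G x ∘L Zp (-n)).toLinearMap ∘ₗ subEmb T i' j' x
  have hq : ∀ x σ, q x σ = T.kappa (x.loop 0) (G x (Zp (-n) (T.toL2N x.loop σ.1))) :=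
    fun x σ => rfl
  -- a section of `q`
  have hs : ∀ (x : PolLoop A) (v : A.Fib (x.loop 0)), ∃ σ : E'.fib x,
      T.toL2N x.loop σ.1 = Zp n (C x (T.iota _ v)) := by
    intro x v
    have h3 : subProj T n (n + 1) x (Zp n (C x (T.iota _ v))) = Zp n (C x (T.iota _ v)) := by
      rw [subProj_succ, Zp_neg_apply, (hCG x).1]
    have h4 := h2 x (Zp n (C x (T.iota _ v)))
    rw [h3] at h4
    exact (subProj_eq_self_iff T i' j' x _).1 h4
  choose s hs using hs
  have hqs : ∀ x v, q x (s x v) = v := by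
    intro x v
    rw [hq, hs, Zp_neg_apply, (hCG x).2.1 _ (T.proj_iota _ v), T.kappa_iota]
  have hsurj : ∀ x, Function.Surjective (q x) := fun x v => ⟨_, hqs x v⟩
  have hker : ∀ x, (E.fib x).submoduleOf (E'.fib x) = LinearMap.ker (q x) := by
    intro x
    ext σ
    change subProj T i j x (T.toL2N x.loop σ.1) = T.toL2N x.loop σ.1 ↔ q x σ = 0
    set f := T.toL2N x.loop σ.1 with hf
    set Λ := conjZ 0 (polProj T x) - conjZ 1 (polProj T x) with hΛ
    constructor
    · intro h3
      have h4 := h1 x f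
      rw [h3, subProj_succ] at h4
      have h5 : Λ (Zp (-n) f) = 0 := by
        rw [← Zp_neg_apply n (Λ (Zp (-n) f)), h4, map_zero]
      rw [hq, (hCG x).2.2.1 _ h5]
      exact map_zero (T.kappa (x.loop 0))
    · intro h3
      have h4 : Λ (Λ (Zp (-n) f)) = Λ (Zp (-n) f) :=
        (isShiftProj_polProj T x).sub_idem (by norm_num) _
      obtain ⟨c, hc, hc2⟩ := (hCG x).2.2.2 _ h4
      have h5 : G x (Zp (-n) f) = c := by
        have h6 : Λ (Zp (-n) f - Λ (Zp (-n) f)) = 0 := by rw [map_sub, h4, sub_self]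
        have h7 := (hCG x).2.2.1 _ h6
        rw [map_sub, ← hc2, (hCG x).2.1 c hc] at h7
        exact sub_eq_zero.1 h7
      have h6 : c = 0 := by
        rw [hq, ← hf, h5] at h3
        rw [← hc, T.proj_apply, h3, map_zero]
      have h7 := hadd x f
      rw [subProj_succ, ← hΛ, ← hc2, h6, map_zero, map_zero, add_zero] at h7
      rw [← h7]
      exact σ.2
  let e : ∀ x, E.Quo E' x ≃ₗ[ℂ] A.Fib (x.loop 0) := fun x =>
    (Submodule.quotEquivOfEq _ _ (hker x)).trans ((q x).quotKerEquivOfSurjective (hsurj x))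
  have he : ∀ x σ, e x (Submodule.Quotient.mk σ) = q x σ := fun x σ => rfl
  let τ' : TopologicalSpace (Σ x, E'.fib x) := subTopology E'.fib
  let τ : TopologicalSpace (Σ x, E.Quo E' x) := E.quoTopology E'
  let τe : TopologicalSpace (Σ x : PolLoop A, A.Fib (x.loop 0)) := EqSubbundle.evTopology A
  let mk : (Σ x, E'.fib x) → Σ x, E.Quo E' x := fun v => ⟨v.1, Submodule.Quotient.mk v.2⟩
  have hmk : IsQuotientMap mk := by
    refine ⟨⟨rfl⟩, ?_⟩
    rintro ⟨x, v⟩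
    obtain ⟨σ, rfl⟩ := Submodule.Quotient.mk_surjective _ v
    exact ⟨⟨x, σ⟩, rfl⟩
  have hhomeo : IsHomeomorph fun v : Σ x, E.Quo E' x =>
      (⟨v.1, e v.1 v.2⟩ : Σ x : PolLoop A, A.Fib (x.loop 0)) := by
    refine isHomeomorph_iff_exists_inverse.2 ⟨?_, fun v => mk ⟨v.1, s v.1 v.2⟩, ?_, ?_, ?_⟩
    · refine hmk.continuous_iff.2 ((evTopology_continuous_iff T).2 ⟨?_, ?_⟩)
      · exact continuous_subTopology_fst _
      · have hx : Continuous fun v : Σ x, E'.fib x => v.1 := continuous_subTopology_fst _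
        have hJ : Continuous fun v : Σ x, E'.fib x => T.toL2N v.1.loop v.2.1 :=
          continuous_subTopology_toL2N T _
        have h3 : Continuous fun v : Σ x, E'.fib x =>
            T.proj (v.1.loop 0) (G v.1 (Zp (-n) (T.toL2N v.1.loop v.2.1))) :=
          ((continuous_baseProj T).comp hx).clm_apply
            ((hG.comp hx).clm_apply ((Zp (-n)).continuous.comp hJ))
        refine h3.congr fun v => ?_
        exact T.proj_apply _ _
    · rintro ⟨x, v⟩
      obtain ⟨σ, rfl⟩ := Submodule.Quotient.mk_surjective _ v
      change (⟨x, Submodule.Quotient.mk (s x (q x σ))⟩ : Σ x, E.Quo E' x) = _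
      congr 1
      refine (e x).injective ?_
      rw [he, he, hqs]
    · rintro ⟨x, v⟩
      change (⟨x, q x (s x v)⟩ : Σ x : PolLoop A, A.Fib (x.loop 0)) = _
      rw [hqs]
    · refine hmk.continuous.comp ((subTopology_continuous_iff T).2 ?_)
      have h3 := (evTopology_continuous_iff T).1 (@continuous_id _ τe)
      refine ⟨h3.1, ?_⟩
      have h4 : Continuous fun v : Σ x : PolLoop A, A.Fib (x.loop 0) =>
          Zp n (C v.1 (T.iota (v.1.loop 0) v.2)) :=
        (Zp n).continuous.comp ((hC.comp h3.1).clm_apply h3.2)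
      exact h4.congr fun v => (hs v.1 v.2).symm
  refine ⟨(isVectorBundleOfRank_ev T).of_isHomeomorph e hhomeo, ?_, e, hhomeo⟩
  refine hmk.continuous_lift_prod_right ?_
  exact hmk.continuous.comp E'.continuous_act

/-- `zⁱ⁻¹ W ⊖ zʲ W` is the orthogonal sum of `zⁱ W ⊖ zʲ W` and `zⁱ⁻¹ (W ⊖ z W)`. -/
lemma quotientIsPullbackTM_pred {i j : ℤ} (h : i ≤ j) (h' : i - 1 ≤ j) :
    (subBundle T h).QuotientIsPullbackTM (subBundle T h') := by
  refine quotientIsPullbackTM T h h' (i - 1) (fun x f => ?_) (fun x f => ?_) (fun x f => ?_)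
  · simp only [subProj, sub_apply, sub_add_cancel]
    abel
  · have hP := isShiftProj_polProj T x
    simp only [subProj, sub_apply, sub_add_cancel, map_sub, hP.conj_idem, hP.conj_le h,
      hP.conj_le (sub_one_lt i).le, hP.conj_le h']
    abel
  · have hP := isShiftProj_polProj T x
    simp only [subProj, sub_apply, sub_add_cancel, map_sub, hP.conj_idem, hP.conj_le' h,
      hP.conj_le (sub_one_lt i).le, hP.conj_le' h']
    abel

/-- `zⁱ W ⊖ zʲ⁺¹ W` is the orthogonal sum of `zⁱ W ⊖ zʲ W` and `zʲ (W ⊖ z W)`. -/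
lemma quotientIsPullbackTM_succ {i j : ℤ} (h : i ≤ j) (h' : i ≤ j + 1) :
    (subBundle T h).QuotientIsPullbackTM (subBundle T h') := by
  refine quotientIsPullbackTM T h h' j (fun x f => ?_) (fun x f => ?_) (fun x f => ?_)
  · simp only [subProj, sub_apply]
    abel
  · have hP := isShiftProj_polProj T x
    simp only [subProj, sub_apply, map_sub, hP.conj_idem, hP.conj_le' h,
      hP.conj_le' (lt_add_one j).le, hP.conj_le' h']
    abel
  · have hP := isShiftProj_polProj T x
    simp only [subProj, sub_apply, map_sub, hP.conj_idem, hP.conj_le h,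
      hP.conj_le' (lt_add_one j).le, hP.conj_le h']
    abel

end

end


/-! ### Spaces of isometric embeddings -/

section Embeddings

variable {m : ℕ} {M : Type u} [TopologicalSpace M]
  [ChartedSpace (EuclideanSpace ℝ (Fin (2 * m))) M] [IsManifold (𝓡 (2 * m)) ∞ M]
  {A : AlmostHermitian m M} (T : A.ParsevalFrame)

omit [IsManifold (𝓡 (2 * m)) ∞ M] in
lemma PSLoop.ext_apply {γ γ' : LM m M} (h : ∀ θ, γ θ = γ' θ) : γ = γ' := by
  obtain ⟨f, hf⟩ := γ
  obtain ⟨f', hf'⟩ := γ'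
  obtain rfl : f = f' := ContinuousMap.ext h
  rfl

namespace EmbPt

variable {E : EqSubbundle A} {n k : ℕ}

include T in
/-- An isometric embedding preserves inner products, by polarization. -/
lemma inner_φ (s : EmbPt E n) (e e' : E.fib s.x) :
    inner ℝ (s.φ e) (s.φ e') = ip e.1 e'.1 := by
  have h1 := s.isometric (e + e')
  rw [map_add, norm_add_sq_real, s.isometric, s.isometric, T.ip_eq, T.ip_eq, T.ip_eq,
    Submodule.coe_add, map_add, inner_add_left, inner_add_right, inner_add_right, Complex.add_re,
    Complex.add_re, Complex.add_re] at h1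
  have h2 : (inner ℂ (T.toL2N s.x.loop e'.1) (T.toL2N s.x.loop e.1)).re =
      (inner ℂ (T.toL2N s.x.loop e.1) (T.toL2N s.x.loop e'.1)).re := inner_re_symm (𝕜 := ℂ) _ _
  rw [T.ip_eq]
  linarith

include T in
/-- The adjunction formula. The adjoint exists, as each `v` may be replaced by its orthogonal
projection to the range of the embedding. -/
lemma ip_adj (s : EmbPt E n) (v : V n) (e' : E.fib s.x) :
    ip (s.adj v).1 e'.1 = inner ℝ v (s.φ e') := by
  have h : ∃ e : E.fib s.x, ∀ e' : E.fib s.x, ip e.1 e'.1 = inner ℝ v (s.φ e') := by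
    obtain ⟨e, he⟩ := LinearMap.mem_range.1
      (Submodule.starProjection_apply_mem (LinearMap.range s.φ) v)
    refine ⟨e, fun e' => ?_⟩
    rw [← s.inner_φ T, he, ← sub_eq_zero, ← inner_sub_left, ← neg_sub, inner_neg_left,
      Submodule.starProjection_inner_eq_zero v _ (LinearMap.mem_range_self s.φ e'), neg_zero]
  exact Classical.epsilon_spec h e'

include T in
/-- The adjoint of an embedding is characterized by the adjunction formula. -/
lemma adj_eq (s : EmbPt E n) {v : V n} {e : E.fib s.x}
    (h : ∀ e' : E.fib s.x, ip e.1 e'.1 = inner ℝ v (s.φ e')) : s.adj v = e := by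
  refine Subtype.ext (T.toL2N_injective _ (sub_eq_zero.1 ?_))
  have h1 := s.ip_adj T v (s.adj v - e)
  have h2 := h (s.adj v - e)
  rw [← h1, T.ip_eq, T.ip_eq, ← sub_eq_zero, ← Complex.sub_re, ← inner_sub_left, ← neg_sub,
    inner_neg_left, Submodule.coe_sub, map_sub, Complex.neg_re, neg_eq_zero] at h2
  exact inner_self_eq_zero.1 (Complex.ext h2 (inner_self_im (𝕜 := ℂ) _))

/-- The adjoint of an embedding `E_x → ℝⁿ`, followed by the embedding of `E_x` into
`L²(S¹, ℂᴺ)`. -/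
def vec (s : EmbPt E n) (v : V n) : L2 T.N := T.toL2N s.x.loop (s.adj v).1

lemma re_inner_vec (s : EmbPt E n) (v : V n) (e : E.fib s.x) :
    (inner ℂ (s.vec T v) (T.toL2N s.x.loop e.1)).re = inner ℝ v (s.φ e) := by
  rw [vec, ← T.ip_eq, s.ip_adj T]

/-- The adjoint depends linearly on the vector. -/
lemma vec_eq_sum (s : EmbPt E n) (v : V n) :
    s.vec T v = ∑ j, (v j : ℂ) • s.vec T (EuclideanSpace.single j 1) := by
  have h : s.adj v = ∑ j, (v j : ℂ) • s.adj (EuclideanSpace.single j 1) := by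
    refine s.adj_eq T fun e' => ?_
    have hv : v = ∑ j, v j • EuclideanSpace.single j (1 : ℝ) := by
      ext i
      simp [Finset.sum_apply, Pi.single_apply]
    rw [T.ip_eq, Submodule.coe_sum, map_sum, sum_inner, Complex.re_sum]
    conv_rhs => rw [hv, sum_inner]
    refine Finset.sum_congr rfl fun j _ => ?_
    rw [Submodule.coe_smul, map_smul, inner_smul_left, Complex.conj_ofReal, Complex.re_ofReal_mul,
      real_inner_smul_left]
    exact congrArg _ (s.re_inner_vec T _ e')
  rw [vec, h, Submodule.coe_sum, map_sum]
  refine Finset.sum_congr rfl fun j _ => ?_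
  rw [Submodule.coe_smul, map_smul]
  rfl

/-- An embedding is determined by its adjoint. -/
lemma ext_vec {s s' : EmbPt E n} (hx : s.x = s'.x) (h : ∀ v, s.vec T v = s'.vec T v) :
    s = s' := by
  obtain ⟨x, φ, hφ⟩ := s
  obtain ⟨x', φ', hφ'⟩ := s'
  obtain rfl : x = x' := hx
  obtain rfl : φ = φ' := by
    refine LinearMap.ext fun e => ext_inner_left ℝ fun v => ?_
    have h1 := re_inner_vec T ⟨x, φ, hφ⟩ v e
    have h2 := re_inner_vec T ⟨x, φ', hφ'⟩ v e
    rw [h] at h1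
    exact h1.symm.trans h2
  rfl

variable [T2Space M] [CompactSpace M]

/-- The topology of the space of embeddings, in terms of their adjoints. -/
lemma continuous_iff {X : Type*} [TopologicalSpace X] {F : X → EmbPt E n} :
    Continuous F ↔ (Continuous fun y => (F y).x) ∧ ∀ v, Continuous fun y => (F y).vec T v := by
  have h : Continuous F ↔ ∀ v : V n, Continuous fun y =>
      (⟨(F y).x, (F y).adj v⟩ : PullTLM A) := by
    rw [continuous_induced_rng]
    exact continuous_pi_iff
  rw [h]
  constructor
  · intro h'
    exact ⟨((PullTLM.continuous_iff T).1 (h' 0)).1,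
      fun v => ((PullTLM.continuous_iff T).1 (h' v)).2⟩
  · rintro ⟨h1, h2⟩ v
    exact (PullTLM.continuous_iff T).2 ⟨h1, h2 v⟩

include T in
lemma continuous_x : Continuous (EmbPt.x : EmbPt E n → PolLoop A) :=
  ((continuous_iff T).1 continuous_id).1

lemma continuous_vec (v : V n) : Continuous fun s : EmbPt E n => s.vec T v :=
  ((continuous_iff T).1 continuous_id).2 v

omit [T2Space M] [CompactSpace M]

/-- The circle action on embeddings, `t · (x, φ) = (t x, φ t⁻¹)`. -/
def act (t : UnitAddCircle) (s : EmbPt E n) : EmbPt E n where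
  x := rotPol t s.x
  φ := s.φ ∘ₗ ((rotSub E.invariant t s.x).symm.toLinearMap.restrictScalars ℝ)
  isometric v := by
    obtain ⟨v, rfl⟩ := (rotSub E.invariant t s.x).surjective v
    have h : ((rotSub E.invariant t s.x v : E.fib (rotPol t s.x)) :
      TLMfib A (rotPol t s.x).loop) = rot t s.x.loop v.1 := rfl
    rw [h]
    refine Eq.trans ?_ ((s.isometric v).trans (ip_rot t s.x.loop v.1 v.1).symm)
    exact congrArg (fun e => ‖s.φ e‖ ^ 2) ((rotSub E.invariant t s.x).symm_apply_apply v)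

/-- Composition of an embedding `E_x → ℝⁿ` with an embedding `ℝⁿ → ℝᵏ`. -/
def str (a : V n →ₗᵢ[ℝ] V k) (s : EmbPt E n) : EmbPt E k where
  x := s.x
  φ := a.toLinearMap ∘ₗ s.φ
  isometric v := by
    rw [← s.isometric v]
    exact congrArg (· ^ 2) (a.norm_map (s.φ v))

/-- Restriction of an embedding to a subbundle. -/
def restrict {E' : EqSubbundle A} (h : E ≤ E') (s : EmbPt E' n) : EmbPt E n where
  x := s.x
  φ := s.φ ∘ₗ ((Submodule.inclusion (h s.x)).restrictScalars ℝ)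
  isometric v := s.isometric (Submodule.inclusion (h s.x) v)

lemma vec_act (t : UnitAddCircle) (s : EmbPt E n) (v : V n) :
    (s.act t).vec T v = rotL2 t (s.vec T v) := by
  have h : (s.act t).adj v = rotSub E.invariant t s.x (s.adj v) := by
    refine (s.act t).adj_eq T fun e' => ?_
    obtain ⟨e, rfl⟩ := (rotSub E.invariant t s.x).surjective e'
    refine (ip_rot t s.x.loop (s.adj v).1 e.1).trans ((s.ip_adj T v e).trans ?_)
    exact congrArg (fun e => inner ℝ v (s.φ e))
      ((rotSub E.invariant t s.x).symm_apply_apply e).symm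
  rw [vec, h]
  exact T.toL2N_rot t s.x.loop _

lemma vec_str (a : V n →ₗᵢ[ℝ] V k) (s : EmbPt E n) (v : V k) :
    (s.str a).vec T v =
      s.vec T (ContinuousLinearMap.adjoint a.toContinuousLinearMap v) := by
  have h : (s.str a).adj v = s.adj (ContinuousLinearMap.adjoint a.toContinuousLinearMap v) := by
    refine (s.str a).adj_eq T fun e' => ?_
    refine (s.ip_adj T _ e').trans ?_
    rw [ContinuousLinearMap.adjoint_inner_left]
    rfl
  rw [vec, h]
  rfl

/-- The adjoint of the restriction of an embedding to a subbundle is the adjoint of the embedding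
followed by the orthogonal projection `Q` onto the subbundle. -/
lemma vec_restrict {E' : EqSubbundle A} (h : E ≤ E') (s : EmbPt E' n)
    {Q : L2 T.N →L[ℂ] L2 T.N} (hQ : ∀ f g, inner ℂ (Q f) g = inner ℂ f (Q g))
    (hE : ∀ e : E.fib s.x, Q (T.toL2N s.x.loop e.1) = T.toL2N s.x.loop e.1)
    (v : V n) {e : E.fib s.x} (he : T.toL2N s.x.loop e.1 = Q (s.vec T v)) :
    (s.restrict h).vec T v = Q (s.vec T v) := by
  have h1 : (s.restrict h).adj v = e := by
    refine (s.restrict h).adj_eq T fun e' => ?_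
    refine Eq.trans ?_ (s.re_inner_vec T v (Submodule.inclusion (h s.x) e'))
    rw [T.ip_eq]
    refine congrArg Complex.re ?_
    refine (congrArg (fun f => inner ℂ f (T.toL2N s.x.loop e'.1)) he).trans ?_
    refine (hQ _ _).trans ?_
    exact congrArg (inner ℂ (s.vec T v)) (hE e')
  rw [← he, ← h1]
  rfl

end EmbPt

lemma inner_subProj (i j : ℤ) (x : PolLoop A) (f g : L2 T.N) :
    inner ℂ (subProj T i j x f) g = inner ℂ f (subProj T i j x g) := by
  have hP := isShiftProj_polProj T x
  rw [subProj, sub_apply, sub_apply, inner_sub_left, inner_sub_right, hP.conj_symm, hP.conj_symm]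

variable [T2Space M] [CompactSpace M]

lemma vec_restrict_subBundle {n : ℕ} {E : EqSubbundle A} {i j : ℤ} {hij : i ≤ j}
    (h : subBundle T hij ≤ E) (s : EmbPt E n) (v : V n) :
    (s.restrict h).vec T v = subProj T i j s.x (s.vec T v) := by
  obtain ⟨e, he⟩ := (subProj_eq_self_iff T i j s.x (subProj T i j s.x (s.vec T v))).1
    (subProj_idem T hij _ _)
  exact s.vec_restrict T h (inner_subProj T i j s.x) (fun e' => e'.2) v (e := e) he

omit [T2Space M] [CompactSpace M]

/-- A point `(γ, W)` is determined by `γ` and the image of `W` in `L²(S¹, ℂᴺ)`. -/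
lemma PolLoop.ext_map {x y : PolLoop A} (hl : x.loop = y.loop)
    (hW : x.W.map (T.toL2N x.loop) = y.W.map (T.toL2N y.loop)) : x = y := by
  obtain ⟨γ, W, h1, h2⟩ := x
  obtain ⟨γ', W', h1', h2'⟩ := y
  obtain rfl : γ = γ' := hl
  obtain rfl : W = W' := Submodule.map_injective_of_injective (T.toL2N_injective _) hW
  rfl

include T in
lemma rotPol_zero (x : PolLoop A) : rotPol 0 x = x := by
  refine PolLoop.ext_map T ?_ ?_
  · refine PSLoop.ext_apply fun θ => ?_
    exact congrArg x.loop (add_zero θ)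
  · rw [map_toL2N_rotPol]
    convert Submodule.map_id _
    exact LinearMap.ext fun f => rotL2_zero f

include T in
lemma rotPol_add (s t : UnitAddCircle) (x : PolLoop A) :
    rotPol (s + t) x = rotPol s (rotPol t x) := by
  refine PolLoop.ext_map T ?_ ?_
  · refine PSLoop.ext_apply fun θ => ?_
    exact congrArg x.loop (add_assoc θ s t).symm
  · rw [map_toL2N_rotPol, map_toL2N_rotPol, map_toL2N_rotPol]
    have h : ((rotL2 (m := T.N) (s + t)).toLinearEquiv : L2 T.N →ₗ[ℂ] L2 T.N) =
        ((rotL2 (m := T.N) s).toLinearEquiv : L2 T.N →ₗ[ℂ] L2 T.N) ∘ₗ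
          ((rotL2 (m := T.N) t).toLinearEquiv : L2 T.N →ₗ[ℂ] L2 T.N) :=
      LinearMap.ext fun f => rotL2_add s t f
    rw [h, Submodule.map_comp]

end Embeddings


/-! ### One-point compactifications of Euclidean spaces -/

section Sphere

variable {n k l : ℕ}

/-- The function `1 / (1 + ‖w‖²)` on the one-point compactification of `ℝⁿ`, with the value `0`
at infinity. -/
def height : OnePoint (V n) → ℝ
  | none => 0
  | some w => (1 + ‖w‖ ^ 2)⁻¹

/-- The map `w / (1 + ‖w‖²)` on the one-point compactification of `ℝⁿ`, with the value `0`
at infinity. -/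
def shadow : OnePoint (V n) → V n
  | none => 0
  | some w => (1 + ‖w‖ ^ 2)⁻¹ • w

lemma height_infty : height (OnePoint.infty : OnePoint (V n)) = 0 := rfl

lemma height_coe (w : V n) : height (w : OnePoint (V n)) = (1 + ‖w‖ ^ 2)⁻¹ := rfl

lemma shadow_infty : shadow (OnePoint.infty : OnePoint (V n)) = 0 := rfl

lemma shadow_coe (w : V n) : shadow (w : OnePoint (V n)) = (1 + ‖w‖ ^ 2)⁻¹ • w := rfl

lemma height_coe_pos (w : V n) : 0 < height (w : OnePoint (V n)) := by
  rw [height_coe]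
  positivity

lemma height_nonneg (p : OnePoint (V n)) : 0 ≤ height p := by
  induction p using OnePoint.rec with
  | infty => exact le_rfl
  | coe w => exact (height_coe_pos w).le

lemma height_le_one (p : OnePoint (V n)) : height p ≤ 1 := by
  induction p using OnePoint.rec with
  | infty => exact zero_le_one
  | coe w => exact inv_le_one_of_one_le₀ (by nlinarith [sq_nonneg ‖w‖])

lemma norm_shadow_sq_le (p : OnePoint (V n)) : ‖shadow p‖ ^ 2 ≤ height p := by
  induction p using OnePoint.rec with
  | infty => simp [shadow_infty, height_infty]
  | coe w =>
    have h : 0 < 1 + ‖w‖ ^ 2 := by positivity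
    rw [shadow_coe, height_coe, norm_smul, norm_inv, Real.norm_of_nonneg h.le, mul_pow, inv_pow,
      sq (1 + ‖w‖ ^ 2), mul_inv, mul_assoc]
    refine mul_le_of_le_one_right (by positivity) ?_
    rw [inv_mul_le_one₀ h]
    linarith

lemma tendsto_shadow {X : Type*} {l : Filter X} {g : X → OnePoint (V n)}
    (h : Tendsto (fun x => height (g x)) l (𝓝 0)) :
    Tendsto (fun x => shadow (g x)) l (𝓝 0) := by
  have h1 : Tendsto (fun x => √(height (g x))) l (𝓝 0) := by
    simpa using h.sqrt
  exact squeeze_zero_norm (fun x => Real.le_sqrt_of_sq_le (norm_shadow_sq_le _)) h1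

lemma continuous_height : Continuous (height : OnePoint (V n) → ℝ) := by
  refine (OnePoint.continuous_iff _).2 ⟨?_, ?_⟩
  · rw [coclosedCompact_eq_cocompact]
    refine Tendsto.inv_tendsto_atTop (tendsto_atTop_add_const_left _ _ ?_)
    exact (tendsto_pow_atTop two_ne_zero).comp (tendsto_norm_cocompact_atTop (E := V n))
  · exact Continuous.inv₀ (by fun_prop) fun w => by positivity

lemma continuous_shadow : Continuous (shadow : OnePoint (V n) → V n) := by
  refine (OnePoint.continuous_iff _).2 ⟨?_, ?_⟩
  · exact tendsto_shadow ((OnePoint.continuous_iff _).1 continuous_height).1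
  · exact ((OnePoint.continuous_iff _).1 continuous_height).2.smul continuous_id

/-- Stereographic coordinates embed the one-point compactification of `ℝⁿ` as a sphere in
`ℝ × ℝⁿ`. -/
lemma isEmbedding_stereographic :
    IsEmbedding fun p : OnePoint (V n) => (height p, shadow p) := by
  refine (Continuous.isClosedEmbedding (continuous_height.prodMk continuous_shadow) ?_).isEmbedding
  intro p q hpq
  have h1 : height p = height q := congrArg Prod.fst hpq
  have h2 : shadow p = shadow q := congrArg Prod.snd hpq
  induction p using OnePoint.rec with
  | infty =>
    induction q using OnePoint.rec with
    | infty => rfl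
    | coe w => exact absurd h1 (height_coe_pos w).ne
  | coe v =>
    induction q using OnePoint.rec with
    | infty => exact absurd h1 (height_coe_pos v).ne'
    | coe w =>
      rw [shadow_coe, shadow_coe, ← height_coe, ← height_coe, h1] at h2
      rw [smul_right_injective _ (height_coe_pos w).ne' h2]

namespace JMor

/-- The map `w ↦ a w + u` of one-point compactifications defined by a morphism `(a, u)`. -/
def apply (f : JMor n k) (w : OnePoint (V n)) : OnePoint (V k) :=
  Option.map₂ (fun u w => f.iso w + u) f.pt w

lemma continuous_iso : Continuous fun f : JMor n k => f.iso.toContinuousLinearMap :=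
  continuous_fst.comp (f := fun f : JMor n k => (f.iso.toContinuousLinearMap, f.pt))
    continuous_induced_dom

lemma continuous_pt : Continuous fun f : JMor n k => f.pt :=
  continuous_snd.comp (f := fun f : JMor n k => (f.iso.toContinuousLinearMap, f.pt))
    continuous_induced_dom

/-- The vectors `a w` and `u` are orthogonal, so that `1 + ‖a w + u‖² = 1 + ‖w‖² + ‖u‖²`. -/
lemma height_shadow_apply (f : JMor n k) (w : OnePoint (V n)) :
    height (f.apply w) =
        (height w + height f.pt - height w * height f.pt)⁻¹ * (height w * height f.pt) ∧
      shadow (f.apply w) = (height w + height f.pt - height w * height f.pt)⁻¹ •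
        (height f.pt • f.iso (shadow w) + height w • shadow f.pt) := by
  obtain ⟨a, p, hp⟩ := f
  change height (Option.map₂ (fun u w => a w + u) p w) = _ ∧
    shadow (Option.map₂ (fun u w => a w + u) p w) = _
  induction p using OnePoint.rec with
  | infty =>
    change height (OnePoint.infty : OnePoint (V k)) = _ ∧
      shadow (OnePoint.infty : OnePoint (V k)) = _
    simp [height_infty, shadow_infty]
  | coe u =>
    induction w using OnePoint.rec with
    | infty =>
      change height (OnePoint.infty : OnePoint (V k)) = _ ∧
        shadow (OnePoint.infty : OnePoint (V k)) = _
      simp [height_infty, shadow_infty]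
    | coe w =>
      change height ((a w + u : V k) : OnePoint (V k)) = _ ∧
        shadow ((a w + u : V k) : OnePoint (V k)) = _
      have h : ‖a w + u‖ ^ 2 = ‖w‖ ^ 2 + ‖u‖ ^ 2 := by
        rw [norm_add_sq_real, hp u rfl w, a.norm_map]
        ring
      have h1 : (1 + ‖a w + u‖ ^ 2)⁻¹ = ((1 + ‖w‖ ^ 2)⁻¹ + (1 + ‖u‖ ^ 2)⁻¹ -
          (1 + ‖w‖ ^ 2)⁻¹ * (1 + ‖u‖ ^ 2)⁻¹)⁻¹ * ((1 + ‖w‖ ^ 2)⁻¹ * (1 + ‖u‖ ^ 2)⁻¹) := by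
        have h2 : 0 < 1 + ‖w‖ ^ 2 := by positivity
        have h3 : 0 < 1 + ‖u‖ ^ 2 := by positivity
        have h4 : 0 < 1 + (‖w‖ ^ 2 + ‖u‖ ^ 2) := by positivity
        have h5 : (1 + ‖w‖ ^ 2)⁻¹ + (1 + ‖u‖ ^ 2)⁻¹ - (1 + ‖w‖ ^ 2)⁻¹ * (1 + ‖u‖ ^ 2)⁻¹ =
            (1 + (‖w‖ ^ 2 + ‖u‖ ^ 2)) * ((1 + ‖w‖ ^ 2)⁻¹ * (1 + ‖u‖ ^ 2)⁻¹) := by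
          field_simp
          ring
        rw [h, h5, mul_inv, mul_assoc, inv_mul_cancel₀ (by positivity), mul_one]
      refine ⟨h1, ?_⟩
      simp only [shadow_coe, height_coe]
      rw [h1, map_smul, smul_smul, smul_smul, mul_comm (1 + ‖u‖ ^ 2)⁻¹, ← smul_add, smul_smul]

/-- In stereographic coordinates, the map `((a, u), w) ↦ a w + u` is given by the formulas of
`height_shadow_apply`, which are continuous where `w` or `u` is finite. At points with `w = u = ∞` the
coordinates tend to `0`, because the height of `a w + u` is at most that of `w`. -/
lemma continuous_apply : Continuous fun q : JMor n k × OnePoint (V n) => q.1.apply q.2 := by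
  refine isEmbedding_stereographic.continuous_iff.2 ?_
  have hw : Continuous fun q : JMor n k × OnePoint (V n) => height q.2 :=
    continuous_height.comp continuous_snd
  have hu : Continuous fun q : JMor n k × OnePoint (V n) => height q.1.pt :=
    continuous_height.comp (continuous_pt.comp continuous_fst)
  have hw' : Continuous fun q : JMor n k × OnePoint (V n) => q.1.iso (shadow q.2) :=
    Continuous.clm_apply (f := fun q : JMor n k × OnePoint (V n) =>
      q.1.iso.toContinuousLinearMap) (continuous_iso.comp continuous_fst)
      (continuous_shadow.comp continuous_snd)
  have hu' : Continuous fun q : JMor n k × OnePoint (V n) => shadow q.1.pt :=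
    continuous_shadow.comp (continuous_pt.comp continuous_fst)
  refine continuous_iff_continuousAt.2 fun q₀ => ?_
  by_cases h0 : height q₀.2 + height q₀.1.pt - height q₀.2 * height q₀.1.pt = 0
  · have hw0 : height q₀.2 = 0 := by
      nlinarith [height_nonneg q₀.2, height_nonneg q₀.1.pt, height_le_one q₀.2]
    have hle : ∀ q : JMor n k × OnePoint (V n), height (q.1.apply q.2) ≤ height q.2 := by
      intro q
      rw [(q.1.height_shadow_apply q.2).1, ← div_eq_inv_mul]
      refine div_le_of_le_mul₀ ?_ (height_nonneg _) ?_ <;>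
        nlinarith [height_nonneg q.2, height_nonneg q.1.pt, height_le_one q.2, height_le_one q.1.pt,
          mul_nonneg (height_nonneg q.2) (height_nonneg q.1.pt),
          mul_nonneg (sq_nonneg (height q.2)) (sub_nonneg.2 (height_le_one q.1.pt))]
    have h1 : Tendsto (fun q : JMor n k × OnePoint (V n) => height (q.1.apply q.2)) (𝓝 q₀)
        (𝓝 0) :=
      squeeze_zero (fun q => height_nonneg _) hle (hw0 ▸ hw.tendsto q₀)
    have h2 := tendsto_shadow h1
    have e1 : height (q₀.1.apply q₀.2) = 0 :=
      le_antisymm (hw0 ▸ hle q₀) (height_nonneg _)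
    have e2 : shadow (q₀.1.apply q₀.2) = 0 := by
      rw [(q₀.1.height_shadow_apply q₀.2).2, h0, inv_zero, zero_smul]
    refine ContinuousAt.prodMk (f := fun q : JMor n k × OnePoint (V n) => height (q.1.apply q.2))
      ?_ ?_
    · rw [ContinuousAt, e1]
      exact h1
    · rw [ContinuousAt, e2]
      exact h2
  · have hd := ((hw.add hu).sub (hw.mul hu)).continuousAt (x := q₀) |>.inv₀ h0
    refine ContinuousAt.prodMk ?_ ?_
    · refine (hd.mul (hw.mul hu).continuousAt).congr (Eventually.of_forall fun q => ?_)
      exact (q.1.height_shadow_apply q.2).1.symm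
    · refine (hd.smul ((hu.smul hw').add (hw.smul hu')).continuousAt).congr
        (Eventually.of_forall fun q => ?_)
      exact (q.1.height_shadow_apply q.2).2.symm

/-- The space of morphisms is closed in the product of a finite dimensional vector space with a
compact space. -/
instance locallyCompactSpace (n k : ℕ) : LocallyCompactSpace (JMor n k) := by
  have : ProperSpace (V n →L[ℝ] V k) := FiniteDimensional.proper ℝ _
  have hr : range (fun f : JMor n k => (f.iso.toContinuousLinearMap, f.pt)) =
      {q | ∀ v : V n, ‖q.1 v‖ = ‖v‖ ∧ inner ℝ (q.1 v) (shadow q.2) = 0} := by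
    ext q
    constructor
    · rintro ⟨f, rfl⟩ v
      refine ⟨f.iso.norm_map v, ?_⟩
      obtain ⟨a, p, hp⟩ := f
      induction p using OnePoint.rec with
      | infty => exact inner_zero_right _
      | coe u =>
        change inner ℝ (a v) (shadow (u : OnePoint (V k))) = 0
        rw [shadow_coe, inner_smul_right, hp u rfl, mul_zero]
    · intro hq
      obtain ⟨a, p⟩ := q
      refine ⟨⟨⟨a.toLinearMap, fun v => (hq v).1⟩, p, ?_⟩, rfl⟩
      rintro w rfl v
      have h := (hq v).2
      change inner ℝ (a v) (shadow (w : OnePoint (V k))) = 0 at h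
      rw [shadow_coe, inner_smul_right] at h
      exact (mul_eq_zero.1 h).resolve_left (height_coe_pos w).ne'
  refine IsClosedEmbedding.locallyCompactSpace
    (f := fun f : JMor n k => (f.iso.toContinuousLinearMap, f.pt)) ⟨⟨⟨rfl⟩, ?_⟩, ?_⟩
  · rintro ⟨a, p, hp⟩ ⟨b, q, hq⟩ h
    obtain rfl : p = q := congrArg Prod.snd h
    obtain rfl : a = b := LinearIsometry.ext fun v =>
      congrArg (fun r : (V n →L[ℝ] V k) × OnePoint (V k) => r.1 v) h
    rfl
  · rw [hr, ofPred_forall]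
    refine isClosed_iInter fun v => ?_
    have h1 : Continuous fun q : (V n →L[ℝ] V k) × OnePoint (V k) => q.1 v :=
      continuous_fst.clm_apply continuous_const
    exact (isClosed_eq h1.norm continuous_const).inter
      (isClosed_eq (h1.inner (continuous_shadow.comp continuous_snd)) continuous_const)

end JMor

end Sphere


/-! ### Thom spectra -/

section ThomSpectra

variable {m : ℕ} {M : Type u} [TopologicalSpace M]
  [ChartedSpace (EuclideanSpace ℝ (Fin (2 * m))) M] [IsManifold (𝓡 (2 * m)) ∞ M]
  {A : AlmostHermitian m M} (T : A.ParsevalFrame) {E E' : EqSubbundle A} {n k l : ℕ}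

lemma collapse_infty (s : EmbPt E n) (h) : collapse ⟨s, OnePoint.infty, h⟩ = none :=
  dif_neg fun ⟨_, hw⟩ => OnePoint.infty_ne_coe _ hw

lemma collapse_coe (s : EmbPt E n) (w : V n) (h) :
    collapse ⟨s, (w : OnePoint (V n)), h⟩ = some ⟨s, w, h w rfl⟩ := by
  have h1 : ∃ w' : V n, (w : OnePoint (V n)) = ↑w' := ⟨w, rfl⟩
  have h2 : h1.choose = w := (OnePoint.coe_injective h1.choose_spec).symm
  refine (dif_pos h1).trans (congrArg some ?_)
  change (⟨s, h1.choose, _⟩ : ComplPt E n) = _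
  congr 1

/-- If there is no isometric embedding of a fibre of `E` into `ℝⁿ`, then the bundle of spheres is
empty and the base point of the Thom space is not in the image. -/
lemma isQuotientMap_collapse [Nonempty (EmbPt E n)] :
    IsQuotientMap (collapse : SpherePt E n → Thom E n) := by
  refine ⟨⟨rfl⟩, fun p => ?_⟩
  match p with
  | none =>
    exact ⟨⟨Classical.arbitrary _, OnePoint.infty, fun w h => (OnePoint.infty_ne_coe w h).elim⟩,
      collapse_infty _ _⟩
  | some p =>
    exact ⟨⟨p.toEmbPt, (p.w : OnePoint (V n)), fun w h v => by
      rw [← OnePoint.coe_injective h, p.orth]⟩, collapse_coe _ _ _⟩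

lemma Thom.eq_none [IsEmpty (EmbPt E n)] (p : Thom E n) : p = none :=
  match p with
  | none => rfl
  | some p => isEmptyElim p.toEmbPt

lemma ComplPt.ext_w {p q : ComplPt E n} (h : p.toEmbPt = q.toEmbPt) (hw : p.w = q.w) : p = q := by
  obtain ⟨s, w, _⟩ := p
  obtain ⟨s', w', _⟩ := q
  obtain rfl : s = s' := h
  obtain rfl : w = w' := hw
  rfl

/-- A map of Thom spaces, depending on a parameter in a locally compact space, is continuous if it
is covered by a continuous family of maps of bundles of spheres. -/
lemma continuous_thom {Y : Type*} [TopologicalSpace Y] [LocallyCompactSpace Y]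
    {F : Y → Thom E n → Thom E' k} {G : Y → SpherePt E n → SpherePt E' k}
    (hF : ∀ y, F y none = none) (hFG : ∀ y s, F y (collapse s) = collapse (G y s))
    (hG : Continuous fun p : Y × SpherePt E n => G p.1 p.2) :
    Continuous fun p : Y × Thom E n => F p.1 p.2 := by
  rcases isEmpty_or_nonempty (EmbPt E n) with h | h
  · have h1 : ∀ p : Y × Thom E n, F p.1 p.2 = none := fun p => by rw [p.2.eq_none, hF]
    exact continuous_const.congr fun p => (h1 p).symm
  · refine isQuotientMap_collapse.continuous_lift_prod_right ?_
    have h1 : Continuous (collapse : SpherePt E' k → Thom E' k) := continuous_coinduced_rng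
    exact (h1.comp hG).congr fun p => (hFG p.1 p.2).symm

namespace SpherePt

lemma continuous_toEmbPt : Continuous fun s : SpherePt E n => s.toEmbPt :=
  continuous_fst.comp (f := fun s : SpherePt E n => (s.toEmbPt, s.w)) continuous_induced_dom

lemma continuous_w : Continuous fun s : SpherePt E n => s.w :=
  continuous_snd.comp (f := fun s : SpherePt E n => (s.toEmbPt, s.w)) continuous_induced_dom

/-- The circle action on the bundle of spheres. -/
def act (t : UnitAddCircle) (s : SpherePt E n) : SpherePt E n :=
  ⟨s.toEmbPt.act t, s.w, fun w hw _ => s.orth w hw _⟩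

/-- The map `(x, φ, w) ↦ (x, a φ, a w + u)` of bundles of spheres. -/
def str (f : JMor n k) (s : SpherePt E n) : SpherePt E k :=
  ⟨s.toEmbPt.str f.iso, f.apply s.w, fun w hw v => by
    obtain ⟨u, w', hu, hw', rfl⟩ := Option.map₂_eq_some_iff.1 hw
    change inner ℝ (f.iso w' + u) (f.iso (s.φ v)) = 0
    have h := s.orth w' hw' v
    rw [inner_add_left, LinearIsometry.inner_map_map, h, real_inner_comm, f.orth u hu, add_zero]⟩

/-- Restriction of embeddings to a subbundle, on the bundle of spheres. -/
def restrict (h : E ≤ E') (s : SpherePt E' n) : SpherePt E n :=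
  ⟨s.toEmbPt.restrict h, s.w, fun w hw _ => s.orth w hw _⟩

end SpherePt

lemma act_collapse (t : UnitAddCircle) (s : SpherePt E n) :
    Thom.act t (collapse s) = collapse (s.act t) := by
  obtain ⟨s, w, hw⟩ := s
  induction w using OnePoint.rec with
  | infty => exact (congrArg _ (collapse_infty s hw)).trans (collapse_infty _ _).symm
  | coe w => exact (congrArg _ (collapse_coe s w hw)).trans (Eq.symm (collapse_coe _ w _))

lemma str_collapse (f : JMor n k) (s : SpherePt E n) :
    Thom.str f (collapse s) = collapse (s.str f) := by
  obtain ⟨s, w, hw⟩ := s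
  obtain ⟨a, u, hu⟩ := f
  induction w using OnePoint.rec with
  | infty =>
    refine (congrArg _ (collapse_infty s hw)).trans (Eq.symm ?_)
    induction u using OnePoint.rec with
    | infty => exact collapse_infty _ _
    | coe u => exact collapse_infty _ _
  | coe w =>
    refine (congrArg _ (collapse_coe s w hw)).trans (Eq.symm ?_)
    induction u using OnePoint.rec with
    | infty => exact collapse_infty _ _
    | coe u => exact collapse_coe _ (a w + u) _

lemma restrict_collapse (h : E ≤ E') (s : SpherePt E' n) :
    Thom.restrict h n (collapse s) = collapse (s.restrict h) := by
  obtain ⟨s, w, hw⟩ := s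
  induction w using OnePoint.rec with
  | infty => exact (congrArg _ (collapse_infty s hw)).trans (collapse_infty _ _).symm
  | coe w => exact (congrArg _ (collapse_coe s w hw)).trans (Eq.symm (collapse_coe _ w _))

section Laws

include T in
lemma Thom.act_zero (p : Thom E n) : Thom.act 0 p = p := by
  match p with
  | none => rfl
  | some p =>
    refine congrArg some (ComplPt.ext_w (EmbPt.ext_vec T (rotPol_zero T _) fun v => ?_) rfl)
    exact (EmbPt.vec_act T 0 p.toEmbPt v).trans (rotL2_zero _)

include T in
lemma Thom.act_add (s t : UnitAddCircle) (p : Thom E n) :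
    Thom.act (s + t) p = Thom.act s (Thom.act t p) := by
  match p with
  | none => rfl
  | some p =>
    refine congrArg some (ComplPt.ext_w (EmbPt.ext_vec T (rotPol_add T s t _) fun v => ?_) rfl)
    refine (EmbPt.vec_act T (s + t) p.toEmbPt v).trans ((rotL2_add s t _).trans ?_)
    refine Eq.trans ?_ (EmbPt.vec_act T s (p.toEmbPt.act t) v).symm
    rw [EmbPt.vec_act]

lemma Thom.str_infty (f : JMor n k) (p : Thom E n) (hf : f.pt = OnePoint.infty) :
    Thom.str f p = none := by
  obtain ⟨a, u, hu⟩ := f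
  obtain rfl : u = OnePoint.infty := hf
  match p with
  | none => rfl
  | some p => rfl

lemma Thom.str_id (p : Thom E n) : Thom.str (JMor.id n) p = p := by
  match p with
  | none => rfl
  | some p => exact congrArg some (ComplPt.ext_w rfl (add_zero p.w))

lemma Thom.str_comp (g : JMor k l) (f : JMor n k) (p : Thom E n) :
    Thom.str (g.comp f) p = Thom.str g (Thom.str f p) := by
  obtain ⟨a, u, hu⟩ := f
  obtain ⟨b, u', hu'⟩ := g
  match p, u, u' with
  | none, _, _ => rfl
  | some p, none, none => rfl
  | some p, none, some u' => rfl
  | some p, some u, none => rfl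
  | some p, some u, some u' =>
    refine congrArg some (ComplPt.ext_w rfl ?_)
    change b (a p.w) + (b u + u') = b (a p.w + u) + u'
    rw [map_add, add_assoc]

lemma Thom.str_act (f : JMor n k) (t : UnitAddCircle) (p : Thom E n) :
    Thom.str f (Thom.act t p) = Thom.act t (Thom.str f p) := by
  obtain ⟨a, u, hu⟩ := f
  match p, u with
  | none, _ => rfl
  | some p, none => rfl
  | some p, some u => rfl

lemma Thom.restrict_str (h : E ≤ E') (f : JMor n k) (p : Thom E' n) :
    Thom.restrict h k (Thom.str f p) = Thom.str f (Thom.restrict h n p) := by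
  obtain ⟨a, u, hu⟩ := f
  match p, u with
  | none, _ => rfl
  | some p, none => rfl
  | some p, some u => rfl

lemma Thom.restrict_self (h : E ≤ E) (p : Thom E n) : Thom.restrict h n p = p := by
  match p with
  | none => rfl
  | some p => rfl

lemma Thom.restrict_trans {E'' : EqSubbundle A} (h : E ≤ E') (h' : E' ≤ E'') (h'' : E ≤ E'')
    (p : Thom E'' n) : Thom.restrict h'' n p = Thom.restrict h n (Thom.restrict h' n p) := by
  match p with
  | none => rfl
  | some p => rfl

lemma Thom.restrict_act {i j : ℤ} {hij : i ≤ j} [T2Space M] [CompactSpace M]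
    (h : subBundle T hij ≤ E') (t : UnitAddCircle) (p : Thom E' n) :
    Thom.restrict h n (Thom.act t p) = Thom.act t (Thom.restrict h n p) := by
  match p with
  | none => rfl
  | some p =>
    refine congrArg some (ComplPt.ext_w (EmbPt.ext_vec T rfl fun v => ?_) rfl)
    refine (vec_restrict_subBundle T h (p.toEmbPt.act t) v).trans ?_
    refine Eq.trans ?_ (EmbPt.vec_act T t (p.toEmbPt.restrict h) v).symm
    rw [EmbPt.vec_act, vec_restrict_subBundle]
    exact subProj_rot T i j t _ _

end Laws

variable [T2Space M] [CompactSpace M]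

include T in
lemma SpherePt.continuous_act :
    Continuous fun p : UnitAddCircle × SpherePt E n => p.2.act p.1 := by
  refine continuous_induced_rng.2 (Continuous.prodMk ?_ ?_)
  swap
  · exact continuous_w.comp (f := fun p : UnitAddCircle × SpherePt E n => p.2) continuous_snd
  have h : Continuous fun p : UnitAddCircle × SpherePt E n => p.2.toEmbPt :=
    continuous_toEmbPt.comp continuous_snd
  refine (EmbPt.continuous_iff T).2 ⟨?_, fun v => ?_⟩
  · exact (continuous_rotPol T).comp (f := fun p : UnitAddCircle × SpherePt E n =>
      (p.1, p.2.toEmbPt.x)) (continuous_fst.prodMk ((EmbPt.continuous_x T).comp h))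
  · refine (continuous_rotL2.comp (f := fun p : UnitAddCircle × SpherePt E n =>
      (p.1, p.2.toEmbPt.vec T v)) (continuous_fst.prodMk ((EmbPt.continuous_vec T v).comp h))).congr
      fun p => ?_
    exact (EmbPt.vec_act T p.1 p.2.toEmbPt v).symm

include T in
lemma SpherePt.continuous_str :
    Continuous fun p : JMor n k × SpherePt E n => p.2.str p.1 := by
  have h : Continuous fun p : JMor n k × SpherePt E n => p.2.toEmbPt :=
    continuous_toEmbPt.comp continuous_snd
  refine continuous_induced_rng.2 (Continuous.prodMk ?_ ?_)
  · refine (EmbPt.continuous_iff T).2 ⟨(EmbPt.continuous_x T).comp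
      (f := fun p : JMor n k × SpherePt E n => p.2.toEmbPt) h, fun v => ?_⟩
    have h1 : Continuous fun p : JMor n k × SpherePt E n =>
        ContinuousLinearMap.adjoint p.1.iso.toContinuousLinearMap v :=
      (ContinuousLinearMap.adjoint.continuous.comp
        (JMor.continuous_iso.comp continuous_fst)).clm_apply continuous_const
    have h2 : Continuous fun p : JMor n k × SpherePt E n => ∑ j,
        (ContinuousLinearMap.adjoint p.1.iso.toContinuousLinearMap v j : ℂ) •
          p.2.toEmbPt.vec T (EuclideanSpace.single j 1) := by
      refine continuous_finsetSum _ fun j _ => ?_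
      refine Continuous.smul (f := fun p : JMor n k × SpherePt E n =>
        (ContinuousLinearMap.adjoint p.1.iso.toContinuousLinearMap v j : ℂ))
        (g := fun p => p.2.toEmbPt.vec T (EuclideanSpace.single j 1)) ?_
        ((EmbPt.continuous_vec T _).comp h)
      exact Complex.continuous_ofReal.comp
        ((EuclideanSpace.proj (𝕜 := ℝ) j).continuous.comp h1)
    refine h2.congr fun p => ?_
    exact ((EmbPt.vec_str T p.1.iso p.2.toEmbPt v).trans (EmbPt.vec_eq_sum T _ _)).symm
  · exact JMor.continuous_apply.comp (f := fun p : JMor n k × SpherePt E n => (p.1, p.2.w))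
      (continuous_fst.prodMk (continuous_w.comp continuous_snd))

lemma SpherePt.continuous_restrict {i j : ℤ} {hij : i ≤ j} (h : subBundle T hij ≤ E') :
    Continuous fun s : SpherePt E' n => s.restrict h := by
  refine continuous_induced_rng.2 (Continuous.prodMk ?_ continuous_w)
  have hx : Continuous fun s : SpherePt E' n => s.toEmbPt.x :=
    (EmbPt.continuous_x T).comp continuous_toEmbPt
  refine (EmbPt.continuous_iff T).2 ⟨hx, fun v => ?_⟩
  have h1 : Continuous fun s : SpherePt E' n => subProj T i j s.toEmbPt.x (s.toEmbPt.vec T v) :=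
    Continuous.clm_apply (f := fun s : SpherePt E' n => subProj T i j s.toEmbPt.x)
      (g := fun s => s.toEmbPt.vec T v) ((continuous_subProj T i j).comp hx)
      ((EmbPt.continuous_vec T v).comp continuous_toEmbPt)
  exact h1.congr fun s => (vec_restrict_subBundle T h s.toEmbPt v).symm

/-- The Thom spectrum `LM_±^{-E}`. Only the proofs of its properties involve the Parseval frame. -/
def thomSpectrum (E : EqSubbundle A) : S1Spectrum.{u} where
  X := Thom E
  top _ := inferInstance
  base _ := none
  act _ := Thom.act
  str := Thom.str
  continuous_act _ :=
    continuous_thom (fun _ => rfl) act_collapse (SpherePt.continuous_act T)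
  act_zero _ := Thom.act_zero T
  act_add _ := Thom.act_add T
  act_base _ _ := rfl
  continuous_str _ _ :=
    continuous_thom (fun _ => rfl) str_collapse (SpherePt.continuous_str T)
  str_base _ := rfl
  str_infty := Thom.str_infty
  str_id _ := Thom.str_id
  str_comp := Thom.str_comp
  str_act := Thom.str_act

/-- The map of Thom spectra induced by an inclusion of subbundles. -/
def thomRestrict {i j : ℤ} {hij : i ≤ j} (h : subBundle T hij ≤ E') :
    S1Spectrum.Hom (thomSpectrum T E') (thomSpectrum T (subBundle T hij)) where
  toFun := Thom.restrict h
  continuous n := by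
    have h1 : Continuous (collapse : SpherePt (subBundle T hij) n → Thom (subBundle T hij) n) :=
      continuous_coinduced_rng
    exact continuous_coinduced_dom.2 ((h1.comp (SpherePt.continuous_restrict T h)).congr
      fun s => (restrict_collapse h s).symm)
  map_base _ := rfl
  map_act _ := Thom.restrict_act T h
  map_str := Thom.restrict_str h

lemma subBundle_le {a b : Idx} (hab : a ≤ b) :
    subBundle T a.lt.le ≤ subBundle T b.lt.le :=
  subFib_mono T hab.1 a.lt.le hab.2

/-- The inverse system of the Thom spectra of the bundles with fibres `-(zⁱ W ⊖ zʲ W)`. -/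
def thomSystem : CategoryTheory.Functor Idxᵒᵖ S1Spectrum.{u} where
  obj a := thomSpectrum T (subBundle T a.unop.lt.le)
  map f := thomRestrict T (subBundle_le T f.unop.le)
  map_id a := S1Spectrum.Hom.ext (funext fun _ => funext
    (Thom.restrict_self (subBundle_le T (le_refl a.unop))))
  map_comp f g := S1Spectrum.Hom.ext (funext fun _ => funext
    (Thom.restrict_trans (subBundle_le T g.unop.le) (subBundle_le T f.unop.le)
      (subBundle_le T (g.unop.le.trans f.unop.le))))

lemma isPolarizedAtiyahDual_thomSystem :
    IsPolarizedAtiyahDual (fun a => subBundle T a.lt.le) (thomSystem T) :=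
  ⟨fun a => { homeo := fun n => Homeomorph.refl (Thom (subBundle T a.lt.le) n)
              map_base := fun _ => rfl
              map_act := fun _ _ _ => rfl
              map_str := fun _ _ => rfl },
    fun _ _ hab => ⟨subBundle_le T hab, fun _ _ => rfl⟩⟩

end ThomSpectra

end PolarizedLoop

end

theorem mainTheorem6 {m : ℕ} {M : Type*} [TopologicalSpace M]
    [ChartedSpace (EuclideanSpace ℝ (Fin (2 * m))) M] [IsManifold (𝓡 (2 * m)) ∞ M]
    [T2Space M] [CompactSpace M] [SimplyConnectedSpace M]
    (A : PolarizedLoop.AlmostHermitian m M) :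
    ∃ E : PolarizedLoop.Idx → PolarizedLoop.EqSubbundle A,
      (∀ (i j : ℤ) (h : i < j),
        E ⟨i, j, h⟩ ≤ E ⟨i - 1, j, (sub_one_lt i).trans h⟩ ∧
        E ⟨i, j, h⟩ ≤ E ⟨i, j + 1, h.trans (lt_add_one j)⟩) ∧
      (∀ x : PolarizedLoop.PolLoop A,
        @Dense _ (PolarizedLoop.fibTopology x) {σ | ∃ a, σ ∈ (E a).fib x}) ∧
      (∀ (i j : ℤ) (h : i < j),
        (E ⟨i, j, h⟩).QuotientIsPullbackTM (E ⟨i - 1, j, (sub_one_lt i).trans h⟩) ∧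
        (E ⟨i, j, h⟩).QuotientIsPullbackTM (E ⟨i, j + 1, h.trans (lt_add_one j)⟩)) ∧
      ∃ P : CategoryTheory.Functor PolarizedLoop.Idxᵒᵖ PolarizedLoop.S1Spectrum,
        PolarizedLoop.IsPolarizedAtiyahDual E P := by
  obtain ⟨T⟩ := A.nonempty_parsevalFrame
  refine ⟨fun a => PolarizedLoop.subBundle T a.lt.le, fun i j h => ⟨fun x => ?_, fun x => ?_⟩,
    fun x => ?_, fun i j h => ⟨?_, ?_⟩, ?_⟩
  · exact PolarizedLoop.subFib_mono T (sub_one_lt i).le h.le le_rfl x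
  · exact PolarizedLoop.subFib_mono T le_rfl h.le (lt_add_one j).le x
  · refine @Dense.mono _ (PolarizedLoop.fibTopology x) _ _ ?_ (PolarizedLoop.dense_subFib T x)
    rintro σ ⟨n, hn⟩
    exact ⟨⟨-(n + 1 : ℤ), n + 1, by omega⟩, hn⟩
  · exact PolarizedLoop.quotientIsPullbackTM_pred T _ _
  · exact PolarizedLoop.quotientIsPullbackTM_succ T _ _
  · exact ⟨PolarizedLoop.thomSystem T, PolarizedLoop.isPolarizedAtiyahDual_thomSystem T⟩
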